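/- **Threat points in anonymous games.** An anonymous game with $n\ge 2$ players and $k$ strategies consists of payoff functions $u^i_\ell:\Pi^k_{n-1}\to[0,1]$, for $i\in[n]$ and $\ell\in[k]$, where $\Pi^k_{n-1}=\{x\in\mathbb Z_{\ge0}^k:\sum_h x_h=n-1\}$; here $u^i_\ell(x)$ is the payoff of player $i$ when she plays $\ell$ and, for each $h$, exactly $x_h$ of the other players play $h$. A mixed strategy is a probability vector on $[k]$; it is identified with a random vector $X$ with values in the standard basis vectors $e_1,\dots,e_k$ of $\mathbb R^k$ (a $k$-CRV). Let $\mathcal M_{n-1,k}$ be the set of distributions of sums of $n-1$ independent $k$-CRVs. The threat point of the game is the vector $\theta\in\mathbb R^n$ with $$\theta_i=\min_{X\in\mathcal M_{n-1,k}}\ \max_{1\le \ell\le k}\ \mathbb E\big[u^i_\ell(X)\big].$$ There are an algorithm and an absolute constant $C$ such that the following holds for all $n\ge2$, all $k>2$, all real $\epsilon$ with $0<\epsilon<k/e$ (that is, whenever $\log\log(k/\epsilon)>0$; this includes all $\epsilon\in(0,1]$), and all anonymous games with $n$ players and $k$ strategies. Put $m=\lceil 1/\epsilon\rceil$. The algorithm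 is given $n$, $k$, $m$ and, for each payoff $u^i_\ell(x)$, some integer $a\geq 0$ with $|u^i_\ell(x)-a/(4m)|\le 1/(4m)$ (so that every payoff is given to within $\epsilon/4$, using $O(\log (2+1/\epsilon))$ bits). It runs in time at most $$n^{Ck^3}\cdot\left(\frac k\epsilon\right)^{\left(C\,k^3\,\frac{\log(k/\epsilon)}{\log\log(k/\epsilon)}\right)^{k-1}}$$ and outputs 1. a vector $\tilde\theta$ of $n$ rational numbers with $\|\theta-\tilde\theta\|_\infty\le\epsilon$, and 2. for each player $i$, mixed strategies (with rational probabilities) $X_{i,j}$ for all the other players $j\ne i$ such that, when the $X_{i,j}$, $j\neq i$, are independent, $$\max_{1\le\ell\le k}\mathbb E\Big[u^i_\ell\Big(\sum_{j\ne i}X_{i,j}\Big)\Big]\le\theta_i+\epsilon.$$ Algorithms are programs for a random access machine over the natural numbers with addition, truncated subtraction, multiplication and integer division; every operation is charged one plus the bit lengths of the numbers it handles. -/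

import Mathlib

/-! ### Poisson multinomial distributions and anonymous games -/

/-- `Π_N^k`: the vectors of `k` natural numbers with sum `N`. -/
abbrev Partitions (N k : ℕ) : Finset (Fin k → ℕ) :=
  Finset.piAntidiag (Finset.univ : Finset (Fin k)) N

/-- The mass function of `∑ i, X i`, where the `X i` are independent random vectors with
`Pr[X i = e_ℓ] = p i ℓ`; here `s i = ℓ` is the elementary event `X i = e_ℓ`. -/
noncomputable def pmdMass {ι : Type} [Fintype ι] [DecidableEq ι] {k : ℕ}
    (p : ι → Fin k → ℝ) (x : Fin k → ℕ) : ℝ :=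
  ∑ s : ι → Fin k with (∑ i, (Pi.single (s i) 1 : Fin k → ℕ)) = x, ∏ i, p i (s i)

/-- `M_{N,k}`: the set of `(N, k)`-Poisson multinomial distributions, as mass functions. -/
def PMD (N k : ℕ) : Set ((Fin k → ℕ) → ℝ) :=
  {P | ∃ p : Fin N → Fin k → ℝ, (∀ i, p i ∈ stdSimplex ℝ (Fin k)) ∧ P = pmdMass p}

/-- An anonymous game with `n` players and `k` strategies: `payoff i ℓ x` is the payoff of player
`i` when she plays `ℓ` and, for every `h`, exactly `x h` of the other players play `h`. -/
structure AnonymousGame (n k : ℕ) where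
  payoff : Fin n → Fin k → Partitions (n - 1) k → ℝ
  payoff_mem : ∀ i ℓ x, payoff i ℓ x ∈ Set.Icc (0 : ℝ) 1

namespace AnonymousGame

/-- `max_ℓ E[u^i_ℓ(X)]` for `X` with mass function `P`. -/
noncomputable def bestPayoff {n k : ℕ} (G : AnonymousGame n k) (i : Fin n)
    (P : (Fin k → ℕ) → ℝ) : ℝ :=
  ⨆ ℓ : Fin k, ∑ x : Partitions (n - 1) k, P x * G.payoff i ℓ x

/-- The threat point `θ`; the infimum is a minimum by `isLeast_threatPoint`. -/
noncomputable def threatPoint {n k : ℕ} (G : AnonymousGame n k) (i : Fin n) : ℝ :=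
  sInf (G.bestPayoff i '' PMD (n - 1) k)

theorem isLeast_threatPoint {n k : ℕ} (hk : 0 < k) (G : AnonymousGame n k) (i : Fin n) :
    IsLeast (G.bestPayoff i '' PMD (n - 1) k) (G.threatPoint i) := by
  have : Nonempty (Fin k) := ⟨⟨0, hk⟩⟩
  have himage : PMD (n - 1) k =
      pmdMass '' (Set.univ.pi fun _ : Fin (n - 1) => stdSimplex ℝ (Fin k)) := by
    ext P
    constructor
    · rintro ⟨p, hp, rfl⟩
      exact ⟨p, fun i _ => hp i, rfl⟩
    · rintro ⟨p, hp, rfl⟩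
      exact ⟨p, fun i => hp i (Set.mem_univ i), rfl⟩
  have hpmd : Continuous (pmdMass : (Fin (n - 1) → Fin k → ℝ) → (Fin k → ℕ) → ℝ) := by
    unfold pmdMass
    fun_prop
  have hbest : Continuous (G.bestPayoff i) := by
    have : G.bestPayoff i = fun P : (Fin k → ℕ) → ℝ =>
        Finset.univ.sup' Finset.univ_nonempty
          (fun ℓ : Fin k => ∑ x : Partitions (n - 1) k, P x * G.payoff i ℓ x) := by
      funext P
      rw [Finset.sup'_univ_eq_ciSup]
      rfl
    rw [this]
    refine Continuous.finset_sup'_apply _ fun ℓ _ => ?_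
    fun_prop
  have hcpt : IsCompact (G.bestPayoff i '' PMD (n - 1) k) := by
    rw [himage]
    exact ((isCompact_univ_pi fun _ => isCompact_stdSimplex ℝ (Fin k)).image hpmd).image hbest
  refine hcpt.isLeast_sInf ?_
  rw [himage]
  refine Set.Nonempty.image _ (Set.Nonempty.image _ ?_)
  exact ⟨fun _ => Pi.single ⟨0, hk⟩ 1, fun _ _ => single_mem_stdSimplex ℝ _⟩

end AnonymousGame

/-! ### A random access machine with logarithmic (bit) cost

The machine has registers and arrays of unbounded natural numbers; a program is a finite text, so
it names finitely many registers and arrays. Every elementary operation is charged one plus the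
bit lengths of the numbers it handles. -/

namespace RAM

structure State where
  reg : ℕ → ℕ
  arr : ℕ → ℕ → ℕ

inductive Op where
  | add | sub | mul | div

/-- Subtraction is truncated at `0`, division is rounded down (and `x / 0 = 0`). -/
def Op.eval : Op → ℕ → ℕ → ℕ
  | .add, x, y => x + y
  | .sub, x, y => x - y
  | .mul, x, y => x * y
  | .div, x, y => x / y

/-- `load a e` reads the cell of array `a` whose index is the value of `e`. -/
inductive Expr where
  | lit (c : ℕ)
  | reg (r : ℕ)
  | op (o : Op) (e₁ e₂ : Expr)
  | load (a : ℕ) (e : Expr)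

def Expr.eval (σ : State) : Expr → ℕ
  | .lit c => c
  | .reg r => σ.reg r
  | .op o e₁ e₂ => o.eval (e₁.eval σ) (e₂.eval σ)
  | .load a e => σ.arr a (e.eval σ)

def Expr.cost (σ : State) : Expr → ℕ
  | .lit c => 1 + c.size
  | .reg r => 1 + (σ.reg r).size
  | .op o e₁ e₂ =>
      e₁.cost σ + e₂.cost σ +
        (1 + (e₁.eval σ).size + (e₂.eval σ).size + (o.eval (e₁.eval σ) (e₂.eval σ)).size)
  | .load a e => e.cost σ + (1 + (e.eval σ).size + (σ.arr a (e.eval σ)).size)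

/-- `branch e c₁ c₂` runs `c₁` if the value of `e` is nonzero, and `c₂` otherwise; `loop e c` runs
`c` as long as the value of `e` is nonzero. -/
inductive Program where
  | skip
  | assign (r : ℕ) (e : Expr)
  | store (a : ℕ) (e₁ e₂ : Expr)
  | seq (c₁ c₂ : Program)
  | branch (e : Expr) (c₁ c₂ : Program)
  | loop (e : Expr) (c : Program)

def State.setReg (σ : State) (r v : ℕ) : State :=
  { σ with reg := Function.update σ.reg r v }

def State.setArr (σ : State) (a i v : ℕ) : State :=
  { σ with arr := Function.update σ.arr a (Function.update (σ.arr a) i v) }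

/-- `Exec c σ σ' t`: started in state `σ`, the program `c` halts in state `σ'` after time `t`. -/
inductive Exec : Program → State → State → ℕ → Prop where
  | skip (σ : State) : Exec .skip σ σ 1
  | assign (σ : State) (r : ℕ) (e : Expr) :
      Exec (.assign r e) σ (σ.setReg r (e.eval σ)) (e.cost σ + (1 + (e.eval σ).size))
  | store (σ : State) (a : ℕ) (e₁ e₂ : Expr) :
      Exec (.store a e₁ e₂) σ (σ.setArr a (e₁.eval σ) (e₂.eval σ))
        (e₁.cost σ + e₂.cost σ + (1 + (e₁.eval σ).size + (e₂.eval σ).size))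
  | seq {c₁ c₂ : Program} {σ σ' σ'' : State} {t₁ t₂ : ℕ} :
      Exec c₁ σ σ' t₁ → Exec c₂ σ' σ'' t₂ → Exec (.seq c₁ c₂) σ σ'' (t₁ + t₂)
  | branch_true {e : Expr} {c₁ c₂ : Program} {σ σ' : State} {t : ℕ} :
      e.eval σ ≠ 0 → Exec c₁ σ σ' t → Exec (.branch e c₁ c₂) σ σ' (e.cost σ + 1 + t)
  | branch_false {e : Expr} {c₁ c₂ : Program} {σ σ' : State} {t : ℕ} :
      e.eval σ = 0 → Exec c₂ σ σ' t → Exec (.branch e c₁ c₂) σ σ' (e.cost σ + 1 + t)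
  | loop_done {e : Expr} {c : Program} {σ : State} :
      e.eval σ = 0 → Exec (.loop e c) σ σ (e.cost σ + 1)
  | loop_step {e : Expr} {c : Program} {σ σ' σ'' : State} {t₁ t₂ : ℕ} :
      e.eval σ ≠ 0 → Exec c σ σ' t₁ → Exec (.loop e c) σ' σ'' t₂ →
        Exec (.loop e c) σ σ'' (e.cost σ + 1 + t₁ + t₂)

end RAM

/-! ### Input, output and running time -/

/-- The place in the input table of the payoff `u^i_ℓ(x)`: `x` is read as a number in base `n`. -/
def payoffIndex (n k : ℕ) (i : Fin n) (ℓ : Fin k) (x : Fin k → ℕ) : ℕ :=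
  ((i : ℕ) * k + ℓ) * n ^ k + ∑ h : Fin k, x h * n ^ (h : ℕ)

/-- The memory holds `n`, `k`, `m` in registers `0`, `1`, `2`, the table `a` of integers in
array `0`, and zeros everywhere else. -/
structure IsInput {n k : ℕ} (m : ℕ) (a : Fin n → Fin k → Partitions (n - 1) k → ℕ)
    (σ : RAM.State) : Prop where
  players : σ.reg 0 = n
  strategies : σ.reg 1 = k
  accuracy : σ.reg 2 = m
  reg_zero : ∀ r, 3 ≤ r → σ.reg r = 0
  table : ∀ i ℓ (x : Partitions (n - 1) k), σ.arr 0 (payoffIndex n k i ℓ x) = a i ℓ x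
  table_zero : ∀ q, (∀ i ℓ (x : Partitions (n - 1) k), q ≠ payoffIndex n k i ℓ x) → σ.arr 0 q = 0
  arr_zero : ∀ b q, 1 ≤ b → σ.arr b q = 0

/-- The vector that is output in array `1`, with common denominator in register `0`. -/
noncomputable def outThreat (n : ℕ) (σ : RAM.State) (i : Fin n) : ℝ :=
  (σ.arr 1 i : ℝ) / (σ.reg 0 : ℝ)

/-- The mixed strategy of player `j` against player `i` that is output in array `2`, with common
denominator in register `1`. -/
noncomputable def outStrategy (n k : ℕ) (σ : RAM.State) (i j : Fin n) (ℓ : Fin k) : ℝ :=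
  (σ.arr 2 (((i : ℕ) * n + j) * k + ℓ) : ℝ) / (σ.reg 1 : ℝ)

/-- `n^(C k³) · (k/ε)^((C k³ log(k/ε) / log log(k/ε))^(k-1))`. -/
noncomputable def timeBound (C n k : ℕ) (ε : ℝ) : ℝ :=
  (n : ℝ) ^ (C * k ^ 3) *
    ((k : ℝ) / ε) ^
      ((C * (k : ℝ) ^ 3 * Real.log (k / ε) / Real.log (Real.log (k / ε))) ^ (k - 1) : ℝ)

/-! ### Monomials under the complex Gaussian weight -/

section Fock

open MeasureTheory Complex

/-! The payoff of a player depends on the opponents only through the law of their sum, so a threat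
can be found by exhaustive search once every such law is approximated, uniformly in n, by a short
list of profiles. The structural fact behind the list is `exists_few_types_profile`: every profile
is within 1/(4m) of one whose rows have the common denominator D = `gridDenom k m` and take few
distinct values ("types"). Up to a permutation of the players such a profile is given by its types
and their multiplicities.

For the structural fact, each player is assigned to a strategy ℓ of probability at least 1/k, and
the coordinate ℓ is dropped; the remaining vector has mass at most 1 - 1/k. Laws are compared
through generating functions translated to 1 + s_h / m_h, where m_h^2 is essentially the total mass
of coordinate h. In the Gaussian-weighted L² space of entire functions this translation bounds the
ℓ¹ distance of the coefficients (`sq_sum_abs_coeff_le`). Because every vector has mass bounded away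
from 1, the weighted generating function still decays like exp(-|s|²/(4k)) (`norm_genFun_sq_le`).
Hence only a ball |s|² ≤ 64k²l matters, where l is the bit length of km, and on it nearby logarithms
suffice (`pmdClose_of_log_close`).

On that ball a vector is split as b + u + z. Pigeonhole on scales (`exists_gap`) makes every
coordinate either poor or very rich in mass. The part z lives on rich coordinates, and there only
the first two moments count; Carathéodory's theorem provides grid vectors with k + k² + 1 atoms
(`exists_grid_types`). The part u consists of tiny entries, and only its sum counts. The part b
consists of the other poor entries, and its moments are matched up to a degree R. Few points suffice
for that: a minimiser of a penalised moment functional solves polynomial equations with leading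
forms x_h^(R+2), which have at most (R+2)^(k-1) solutions (`exists_few_types`). Players whose entry
dominates a coordinate are first removed by a potential argument (`exists_spread_subset`). The
remaining linear forms are at most 1/q on the ball, with q about l^(1/8), so that R of order k·l/log
l is enough.

The program tries all codes of such profiles. Players with the z-part are arbitrarily many but have
O(k³) types, which gives the power of n; all others number at most D, so that their multiplicities
do not involve n. The law of a profile is computed exactly by Kronecker substitution: the product
over the players of ∑_h d_h Y^(n^h) is one integer, and its base-Y digits are the scaled masses
(`codePayoff_eq`). Code 0 with value 0 is output without a search when m = 1, for then ε ≥ 1. -/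

theorem integrable_monomial_gaussian (a b : ℕ) :
    Integrable (fun z : ℂ => z ^ a * (starRingEnd ℂ z) ^ b * (Real.exp (-‖z‖ ^ 2) : ℂ)) := by
  have h0 : Integrable (fun z : ℂ => ‖z‖ ^ ((a + b : ℕ) : ℝ) * Real.exp (-‖z‖ ^ (2 : ℝ))) := by
    refine Integrable.of_integral_ne_zero ?_
    rw [Complex.integral_rpow_mul_exp_neg_rpow (by norm_num)
      (lt_of_lt_of_le (by norm_num : (-2 : ℝ) < 0) (Nat.cast_nonneg _))]
    have : 0 < Real.Gamma ((((a + b : ℕ) : ℝ) + 2) / 2) := Real.Gamma_pos_of_pos (by positivity)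
    positivity
  refine h0.mono' (by fun_prop) (Filter.Eventually.of_forall fun z => ?_)
  rw [norm_mul, norm_mul, norm_pow, norm_pow, RCLike.norm_conj, Complex.norm_real,
    Real.norm_of_nonneg (Real.exp_pos _).le, Real.rpow_natCast, pow_add, Real.rpow_two]

/-- For a ≠ b, the rotation by the angle θ with (a - b)θ = π preserves measure and weight and
changes the sign of the integrand. -/
theorem integral_monomial_gaussian (a b : ℕ) :
    ∫ z : ℂ, z ^ a * (starRingEnd ℂ z) ^ b * (Real.exp (-‖z‖ ^ 2) : ℂ) =
      if a = b then (Real.pi * a.factorial : ℂ) else 0 := by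
  split_ifs with h
  · subst h
    have h0 : ∀ z : ℂ, z ^ a * (starRingEnd ℂ z) ^ a * (Real.exp (-‖z‖ ^ 2) : ℂ) =
        ((‖z‖ ^ ((2 * a : ℕ) : ℝ) * Real.exp (-‖z‖ ^ (2 : ℝ)) : ℝ) : ℂ) := by
      intro z
      rw [← mul_pow, Complex.mul_conj, Complex.normSq_eq_norm_sq, Real.rpow_natCast, pow_mul]
      push_cast
      norm_num
    simp_rw [h0]
    rw [integral_complex_ofReal, Complex.integral_rpow_mul_exp_neg_rpow (by norm_num)
      (lt_of_lt_of_le (by norm_num : (-2 : ℝ) < 0) (Nat.cast_nonneg _))]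
    have : (((2 * a : ℕ) : ℝ) + 2) / 2 = a + 1 := by push_cast; ring
    rw [this, Real.Gamma_nat_eq_factorial]
    push_cast
    ring
  · have key : ∀ c : ℂ, ‖c‖ = 1 →
        ∫ z : ℂ, z ^ a * (starRingEnd ℂ z) ^ b * (Real.exp (-‖z‖ ^ 2) : ℂ) =
        c ^ a * (starRingEnd ℂ c) ^ b *
          ∫ z : ℂ, z ^ a * (starRingEnd ℂ z) ^ b * (Real.exp (-‖z‖ ^ 2) : ℂ) := by
      intro c hc
      let u : Circle := ⟨c, by simpa [Submonoid.unitSphere] using hc⟩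
      have hm := (rotation u).measurePreserving
      conv_lhs => rw [← hm.integral_comp (rotation u).toHomeomorph.measurableEmbedding]
      rw [← integral_const_mul]
      congr 1
      ext z
      have : rotation u z = c * z := rfl
      rw [this, norm_mul, hc, map_mul]
      ring_nf
    obtain ⟨θ, hθ⟩ : ∃ θ : ℝ, ((a : ℝ) - b) * θ = Real.pi :=
      ⟨Real.pi / ((a : ℝ) - b), by
        have : (a : ℝ) - b ≠ 0 := sub_ne_zero.mpr (by exact_mod_cast h)
        field_simp⟩
    have h1 := key (Complex.exp (θ * I)) (Complex.norm_exp_ofReal_mul_I θ)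
    have h2 : Complex.exp (θ * I) ^ a * (starRingEnd ℂ (Complex.exp (θ * I))) ^ b = -1 := by
      rw [← Complex.exp_conj, ← Complex.exp_nat_mul, ← Complex.exp_nat_mul, ← Complex.exp_add,
        ← Complex.exp_pi_mul_I, ← hθ]
      congr 1
      simp
      ring
    rw [h2] at h1
    linear_combination h1 / 2

variable {κ : Type*} [Fintype κ]

theorem integrable_multi_monomial_gaussian (a b : κ → ℕ) :
    Integrable (fun z : κ → ℂ => (∏ h, z h ^ a h) * (starRingEnd ℂ (∏ h, z h ^ b h)) *
      (Real.exp (-∑ h, ‖z h‖ ^ 2) : ℂ)) := by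
  have h := Integrable.fintype_prod (f := fun (h : κ) (z : ℂ) =>
    z ^ a h * (starRingEnd ℂ z) ^ b h * (Real.exp (-‖z‖ ^ 2) : ℂ))
    (μ := fun _ => volume) (fun h => integrable_monomial_gaussian (a h) (b h))
  refine h.congr (Filter.Eventually.of_forall fun z => ?_)
  simp only [Finset.prod_mul_distrib, map_prod, map_pow, ← Finset.sum_neg_distrib, Real.exp_sum,
    Complex.ofReal_prod]

theorem integral_multi_monomial_gaussian (a b : κ → ℕ) :
    ∫ z : κ → ℂ, (∏ h, z h ^ a h) * (starRingEnd ℂ (∏ h, z h ^ b h)) *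
      (Real.exp (-∑ h, ‖z h‖ ^ 2) : ℂ) =
      if a = b then (Real.pi ^ Fintype.card κ * ∏ h, ((a h).factorial : ℂ)) else 0 := by
  have h := integral_fintype_prod_volume_eq_prod (𝕜 := ℂ) (fun (h : κ) (z : ℂ) =>
    z ^ a h * (starRingEnd ℂ z) ^ b h * (Real.exp (-‖z‖ ^ 2) : ℂ))
  simp only [Finset.prod_mul_distrib, integral_monomial_gaussian] at h
  have e : ∀ z : κ → ℂ, (∏ h, z h ^ a h) * (starRingEnd ℂ (∏ h, z h ^ b h)) *
      (Real.exp (-∑ h, ‖z h‖ ^ 2) : ℂ) =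
      ((∏ h, z h ^ a h) * ∏ h, (starRingEnd ℂ (z h)) ^ b h) *
        ∏ h, (Real.exp (-‖z h‖ ^ 2) : ℂ) := by
    intro z
    simp only [map_prod, map_pow, ← Finset.sum_neg_distrib, Real.exp_sum, Complex.ofReal_prod]
  simp_rw [e]
  rw [h]
  split_ifs with hab
  · subst hab
    simp [Finset.prod_mul_distrib, Finset.card_univ]
  · obtain ⟨i, hi⟩ := Function.ne_iff.mp hab
    exact Finset.prod_eq_zero (Finset.mem_univ i) (if_neg hi)

theorem norm_sq_sum_monomial (Y : Finset (κ → ℕ)) (b : (κ → ℕ) → ℝ) (z : κ → ℂ) (w : ℝ) :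
    ((‖∑ y ∈ Y, (b y : ℂ) * ∏ h, z h ^ y h‖ ^ 2 * w : ℝ) : ℂ) =
      ∑ y ∈ Y, ∑ y' ∈ Y, ((b y : ℂ) * b y') *
        ((∏ h, z h ^ y h) * (starRingEnd ℂ (∏ h, z h ^ y' h)) * (w : ℂ)) := by
  rw [Complex.ofReal_mul, Complex.ofReal_pow, ← Complex.mul_conj', map_sum, Finset.sum_mul_sum,
    Finset.sum_mul]
  refine Finset.sum_congr rfl fun y _ => ?_
  rw [Finset.sum_mul]
  refine Finset.sum_congr rfl fun y' _ => ?_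
  rw [map_mul, Complex.conj_ofReal]
  ring

/-- Parseval: the monomials are orthogonal for the Gaussian weight. The factorials in their norms
are what the Cauchy-Schwarz step of `sq_sum_abs_coeff_le` pairs with Poisson weights. -/
theorem integral_norm_sq_gaussian (Y : Finset (κ → ℕ)) (b : (κ → ℕ) → ℝ) :
    ∫ z : κ → ℂ, ‖∑ y ∈ Y, (b y : ℂ) * ∏ h, z h ^ y h‖ ^ 2 * Real.exp (-∑ h, ‖z h‖ ^ 2) =
      Real.pi ^ Fintype.card κ * ∑ y ∈ Y, b y ^ 2 * ∏ h, ((y h).factorial : ℝ) := by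
  apply Complex.ofReal_injective
  rw [← integral_complex_ofReal]
  simp_rw [norm_sq_sum_monomial]
  rw [integral_finsetSum _ fun y _ => integrable_finsetSum _ fun y' _ =>
    (integrable_multi_monomial_gaussian y y').const_mul _, Complex.ofReal_mul, Complex.ofReal_sum,
    Finset.mul_sum]
  refine Finset.sum_congr rfl fun y hy => ?_
  rw [integral_finsetSum _ fun y' _ => (integrable_multi_monomial_gaussian y y').const_mul _]
  simp_rw [integral_const_mul, integral_multi_monomial_gaussian]
  classical
  rw [Finset.sum_eq_single y]
  · simp
    ring
  · intro y' _ hne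
    rw [if_neg hne.symm, mul_zero]
  · exact fun h => absurd hy h

/-- A translated polynomial controls the total variation of its coefficients. -/
theorem sq_sum_abs_coeff_le (Y : Finset (κ → ℕ)) (b : (κ → ℕ) → ℝ) (m : κ → ℝ)
    (hm : ∀ h, 0 < m h) :
    Real.pi ^ Fintype.card κ * (∑ y ∈ Y, |b y|) ^ 2 ≤
      ∫ s : κ → ℂ, ‖(∑ y ∈ Y, (b y : ℂ) * ∏ h, (1 + s h / m h) ^ y h) *
        Complex.exp (-∑ h, s h * m h)‖ ^ 2 * Real.exp (-∑ h, ‖s h‖ ^ 2) := by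
  classical
  -- Cauchy-Schwarz for |b_y| = (|b_y| m^(-y) √(y!)) · (m^y / √(y!)). The squares of the second
  -- factors are terms of the series of ∏ exp(m_h²).
  have hcs : (∑ y ∈ Y, |b y|) ^ 2 ≤
      (∑ y ∈ Y, (b y / ∏ h, m h ^ y h) ^ 2 * ∏ h, ((y h).factorial : ℝ)) *
        Real.exp (∑ h, m h ^ 2) := by
    have h1 : ∑ y ∈ Y, ∏ h, ((m h ^ 2) ^ y h / (y h).factorial) ≤ Real.exp (∑ h, m h ^ 2) := by
      rw [Real.exp_sum]
      obtain ⟨n, hn⟩ : ∃ n, Y ⊆ Fintype.piFinset fun _ => Finset.range n := by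
        refine ⟨(Y.sup fun y => Finset.univ.sup y) + 1, fun y hy => ?_⟩
        rw [Fintype.mem_piFinset]
        intro h
        rw [Finset.mem_range, Nat.lt_succ_iff]
        exact (Finset.le_sup (f := y) (Finset.mem_univ h)).trans
          (Finset.le_sup (f := fun y => Finset.univ.sup y) hy)
      refine (Finset.sum_le_sum_of_subset_of_nonneg hn fun y _ _ => ?_).trans ?_
      · exact Finset.prod_nonneg fun h _ => by positivity
      · rw [← Finset.prod_univ_sum (fun _ => Finset.range n)
          (fun h j => (m h ^ 2) ^ j / (j.factorial : ℝ))]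
        refine Finset.prod_le_prod (fun h _ => Finset.sum_nonneg fun _ _ => by positivity)
          fun h _ => ?_
        exact Real.sum_le_exp_of_nonneg (sq_nonneg _) n
    have h2 := Finset.sum_mul_sq_le_sq_mul_sq Y
      (fun y => |b y| / (∏ h, m h ^ y h) * √(∏ h, ((y h).factorial : ℝ)))
      (fun y => (∏ h, m h ^ y h) / √(∏ h, ((y h).factorial : ℝ)))
    have h3 : ∀ y : κ → ℕ, 0 < ∏ h, m h ^ y h := fun y => Finset.prod_pos fun h _ => pow_pos (hm h) _
    have h4 : ∀ y : κ → ℕ, 0 < ∏ h, ((y h).factorial : ℝ) :=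
      fun y => Finset.prod_pos fun h _ => by positivity
    have e1 : ∀ y ∈ Y, |b y| / (∏ h, m h ^ y h) * √(∏ h, ((y h).factorial : ℝ)) *
        ((∏ h, m h ^ y h) / √(∏ h, ((y h).factorial : ℝ))) = |b y| := by
      intro y _
      have := h3 y
      have := Real.sqrt_pos.mpr (h4 y)
      field_simp
    have e2 : ∀ y ∈ Y, (|b y| / (∏ h, m h ^ y h) * √(∏ h, ((y h).factorial : ℝ))) ^ 2 =
        (b y / ∏ h, m h ^ y h) ^ 2 * ∏ h, ((y h).factorial : ℝ) := by
      intro y _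
      rw [mul_pow, Real.sq_sqrt (h4 y).le, div_pow, div_pow, sq_abs]
    have e3 : ∀ y ∈ Y, ((∏ h, m h ^ y h) / √(∏ h, ((y h).factorial : ℝ))) ^ 2 =
        ∏ h, ((m h ^ 2) ^ y h / (y h).factorial) := by
      intro y _
      rw [div_pow, Real.sq_sqrt (h4 y).le, Finset.prod_div_distrib, ← Finset.prod_pow]
      congr 1
      exact Finset.prod_congr rfl fun h _ => by ring
    rw [Finset.sum_congr rfl e1, Finset.sum_congr rfl e2, Finset.sum_congr rfl e3] at h2
    refine h2.trans (mul_le_mul_of_nonneg_left h1 ?_)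
    exact Finset.sum_nonneg fun y _ => mul_nonneg (sq_nonneg _) (h4 y).le
  have hI := integral_norm_sq_gaussian Y fun y => b y / ∏ h, m h ^ y h
  -- Lebesgue measure is invariant under the shift by m. Expanding |s_h + m_h|² leaves the cross
  -- term 2 Re(s_h) m_h, which becomes the factor exp(-∑ s_h m_h), and the constant exp(-∑ m_h²),
  -- which cancels the one from Cauchy-Schwarz.
  rw [← integral_add_right_eq_self _ (fun h => (m h : ℂ))] at hI
  have hpt : ∀ s : κ → ℂ, ‖(∑ y ∈ Y, (b y : ℂ) * ∏ h, (1 + s h / m h) ^ y h) *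
        Complex.exp (-∑ h, s h * m h)‖ ^ 2 * Real.exp (-∑ h, ‖s h‖ ^ 2) =
      Real.exp (∑ h, m h ^ 2) * (‖∑ y ∈ Y, ((b y / ∏ h, m h ^ y h : ℝ) : ℂ) *
        ∏ h, (s + fun h => (m h : ℂ)) h ^ y h‖ ^ 2 *
        Real.exp (-∑ h, ‖(s + fun h => (m h : ℂ)) h‖ ^ 2)) := by
    intro s
    have e1 : ∀ y ∈ Y, ((b y / ∏ h, m h ^ y h : ℝ) : ℂ) *
        ∏ h, (s + fun h => (m h : ℂ)) h ^ y h = (b y : ℂ) * ∏ h, (1 + s h / m h) ^ y h := by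
      intro y _
      push_cast
      rw [div_mul_eq_mul_div, mul_div_assoc, ← Finset.prod_div_distrib]
      congr 1
      refine Finset.prod_congr rfl fun h _ => ?_
      have : (m h : ℂ) ≠ 0 := by exact_mod_cast (hm h).ne'
      rw [← div_pow, Pi.add_apply, add_div, div_self this, add_comm]
    rw [Finset.sum_congr rfl e1, norm_mul, mul_pow, Complex.norm_exp, mul_assoc,
      mul_left_comm (Real.exp (∑ h, m h ^ 2)), ← Real.exp_nat_mul, ← Real.exp_add, ← Real.exp_add]
    congr 2
    have e2 : ∀ h, ‖s h + m h‖ ^ 2 = ‖s h‖ ^ 2 + 2 * (s h).re * m h + m h ^ 2 := by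
      intro h
      rw [← Complex.normSq_eq_norm_sq, ← Complex.normSq_eq_norm_sq, Complex.normSq_apply,
        Complex.normSq_apply]
      simp
      ring
    simp only [Pi.add_apply, e2, Finset.sum_add_distrib, Complex.neg_re, Complex.re_sum,
      Complex.re_mul_ofReal]
    have e3 : ∑ h, 2 * (s h).re * m h = 2 * ∑ h, (s h).re * m h := by
      rw [Finset.mul_sum]
      exact Finset.sum_congr rfl fun h _ => by ring
    rw [e3]
    push_cast
    ring
  simp_rw [hpt]
  rw [integral_const_mul, hI, mul_left_comm]
  refine mul_le_mul_of_nonneg_left (hcs.trans_eq (mul_comm _ _)) (by positivity)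

/-- The Gaussian integral in several complex variables. -/
theorem integral_exp_neg_norm_sq_div {a : ℝ} (ha : 0 < a) :
    ∫ s : κ → ℂ, Real.exp (-(∑ h, ‖s h‖ ^ 2) / a) = (Real.pi * a) ^ Fintype.card κ := by
  have h := integral_fintype_prod_volume_eq_prod (𝕜 := ℝ) (fun (_ : κ) (z : ℂ) =>
    Real.exp (-a⁻¹ * ‖z‖ ^ (2 : ℝ)))
  have e : ∀ s : κ → ℂ, Real.exp (-(∑ h, ‖s h‖ ^ 2) / a) =
      ∏ h, Real.exp (-a⁻¹ * ‖s h‖ ^ (2 : ℝ)) := by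
    intro s
    rw [← Real.exp_sum, ← Finset.mul_sum]
    simp only [Real.rpow_two]
    congr 1
    ring
  simp_rw [e]
  rw [h, Complex.integral_exp_neg_mul_rpow (by norm_num) (by positivity)]
  norm_num
  rw [Real.rpow_neg_one, inv_inv]

theorem integrable_exp_neg_norm_sq_div {a : ℝ} (ha : 0 < a) :
    Integrable fun s : κ → ℂ => Real.exp (-(∑ h, ‖s h‖ ^ 2) / a) := by
  refine Integrable.of_integral_ne_zero ?_
  rw [integral_exp_neg_norm_sq_div ha]
  have := Real.pi_pos
  positivity

end Fock

/-! ### Expectations under Poisson multinomial distributions -/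

section Expectation

variable {ι : Type} [Fintype ι] [DecidableEq ι] {k : ℕ}

/-- The expectation of `f` at a sum of independent random basis vectors. -/
noncomputable def pmdExp (p : ι → Fin k → ℝ) (f : (Fin k → ℕ) → ℝ) : ℝ :=
  ∑ c : ι → Fin k, (∏ i, p i (c i)) * f (∑ i, Pi.single (c i) 1)

/-- Two profiles whose sums are within `ε` when tested against functions bounded by `1`. -/
def PMDClose (p q : ι → Fin k → ℝ) (ε : ℝ) : Prop :=
  ∀ f : (Fin k → ℕ) → ℝ, (∀ x, |f x| ≤ 1) → |pmdExp p f - pmdExp q f| ≤ ε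

/-- Complete a sub-probability vector by putting the missing mass on `ℓ`. -/
def fillAt (ℓ : Fin k) (v : Fin k → ℝ) (h : Fin k) : ℝ :=
  v h + if h = ℓ then 1 - ∑ j, v j else 0

theorem sum_fillAt_mul {R : Type*} [CommRing R] [Algebra ℝ R] (ℓ : Fin k) (v : Fin k → ℝ)
    (ζ : Fin k → R) (hζ : ζ ℓ = 1) :
    ∑ h, algebraMap ℝ R (fillAt ℓ v h) * ζ h = 1 + ∑ h, algebraMap ℝ R (v h) * (ζ h - 1) := by
  simp only [fillAt, map_add, add_mul, Finset.sum_add_distrib, mul_sub, Finset.sum_sub_distrib,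
    mul_one]
  have : ∑ h, algebraMap ℝ R (if h = ℓ then 1 - ∑ j, v j else 0) * ζ h =
      1 - ∑ j, algebraMap ℝ R (v j) := by
    rw [Finset.sum_eq_single ℓ]
    · simp [hζ]
    · intro b _ hb
      simp [hb]
    · simp
  rw [this]
  ring

/-- With the variable of ℓ set to 1, the mass that `fillAt` puts on ℓ is absorbed by the constant
term, so the dropped coordinate never appears. -/
theorem prod_one_add_eq_sum (ℓ : Fin k) (v : ι → Fin k → ℝ) (ζ : Fin k → ℂ) (hζ : ζ ℓ = 1) :
    ∏ i, (1 + ∑ h, (v i h : ℂ) * (ζ h - 1)) =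
      ∑ c : ι → Fin k, ((∏ i, fillAt ℓ (v i) (c i) : ℝ) : ℂ) * ∏ i, ζ (c i) := by
  have h1 : ∀ i, (1 + ∑ h, (v i h : ℂ) * (ζ h - 1)) = ∑ h, (fillAt ℓ (v i) h : ℂ) * ζ h :=
    fun i => (sum_fillAt_mul ℓ (v i) ζ hζ).symm
  simp_rw [h1]
  rw [Finset.prod_univ_sum, Fintype.piFinset_univ]
  refine Finset.sum_congr rfl fun c _ => ?_
  rw [Finset.prod_mul_distrib]
  push_cast
  rfl

/-- A pointwise bound for the difference of the translated generating functions bounds the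
distance of the distributions. -/
theorem sq_pmdExp_sub_le (ℓ : Fin k) (v w : ι → Fin k → ℝ) (hv : ∀ i, v i ℓ = 0)
    (hw : ∀ i, w i ℓ = 0) (m : Fin k → ℝ) (hm : ∀ h, 0 < m h) {A B a b : ℝ} (ha : 0 < a)
    (hb : 0 < b)
    (H : ∀ s : Fin k → ℂ, ‖(∏ i, (1 + ∑ h, (v i h : ℂ) * (s h / m h)) -
        ∏ i, (1 + ∑ h, (w i h : ℂ) * (s h / m h))) * Complex.exp (-∑ h, s h * m h)‖ ^ 2 *
          Real.exp (-∑ h, ‖s h‖ ^ 2) ≤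
      A * Real.exp (-(∑ h, ‖s h‖ ^ 2) / a) + B * Real.exp (-(∑ h, ‖s h‖ ^ 2) / b))
    (f : (Fin k → ℕ) → ℝ) (hf : ∀ x, |f x| ≤ 1) :
    (pmdExp (fun i => fillAt ℓ (v i)) f - pmdExp (fun i => fillAt ℓ (w i)) f) ^ 2 ≤
      A * a ^ k + B * b ^ k := by
  classical
  let cnt : (ι → Fin k) → Fin k → ℕ := fun c => ∑ i, Pi.single (c i) 1
  -- The total count is the number of players, so the count at ℓ is redundant: `zr` erases it and
  -- `g` restores it. Thus it is enough to bound the coefficients in the other variables.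
  let zr : (ι → Fin k) → Fin k → ℕ := fun c => Function.update (cnt c) ℓ 0
  let δ : (ι → Fin k) → ℝ := fun c => ∏ i, fillAt ℓ (v i) (c i) - ∏ i, fillAt ℓ (w i) (c i)
  let Y : Finset (Fin k → ℕ) := Finset.univ.image zr
  let β : (Fin k → ℕ) → ℝ := fun y => ∑ c with zr c = y, δ c
  let g : (Fin k → ℕ) → ℝ := fun y => f (Function.update y ℓ (Fintype.card ι - ∑ h, y h))
  have hsum : ∀ c, ∑ h, cnt c h = Fintype.card ι := by
    intro c
    simp only [cnt, Finset.sum_apply]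
    rw [Finset.sum_comm]
    simp
  have hfg : ∀ c, f (cnt c) = g (zr c) := by
    intro c
    simp only [g]
    congr 1
    have : ∑ h, zr c h + cnt c ℓ = Fintype.card ι := by
      rw [← hsum c, ← Finset.add_sum_erase _ (cnt c) (Finset.mem_univ ℓ),
        ← Finset.add_sum_erase _ (zr c) (Finset.mem_univ ℓ)]
      have : ∑ x ∈ Finset.univ.erase ℓ, zr c x = ∑ x ∈ Finset.univ.erase ℓ, cnt c x :=
        Finset.sum_congr rfl fun x hx => by simp [zr, Finset.ne_of_mem_erase hx]
      rw [this]
      simp [zr]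
      ring
    rw [← this]
    ext h
    by_cases hh : h = ℓ
    · subst hh; simp
    · simp [hh, zr]
  have hmap : ∀ c ∈ (Finset.univ : Finset (ι → Fin k)), zr c ∈ Y := fun c hc =>
    Finset.mem_image_of_mem _ hc
  have hdiff : pmdExp (fun i => fillAt ℓ (v i)) f - pmdExp (fun i => fillAt ℓ (w i)) f =
      ∑ y ∈ Y, β y * g y := by
    rw [pmdExp, pmdExp, ← Finset.sum_sub_distrib, ← Finset.sum_fiberwise_of_maps_to hmap]
    refine Finset.sum_congr rfl fun y _ => ?_
    rw [Finset.sum_mul]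
    refine Finset.sum_congr rfl fun c hc => ?_
    rw [← (Finset.mem_filter.mp hc).2, ← hfg, ← sub_mul]
  have habs : |pmdExp (fun i => fillAt ℓ (v i)) f - pmdExp (fun i => fillAt ℓ (w i)) f| ≤
      ∑ y ∈ Y, |β y| := by
    rw [hdiff]
    refine (Finset.abs_sum_le_sum_abs _ _).trans (Finset.sum_le_sum fun y _ => ?_)
    rw [abs_mul]
    exact mul_le_of_le_one_right (abs_nonneg _) (hf _)
  have hpoly : ∀ s : Fin k → ℂ, ∑ y ∈ Y, (β y : ℂ) * ∏ h, (1 + s h / m h) ^ y h =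
      ∏ i, (1 + ∑ h, (v i h : ℂ) * (s h / m h)) -
        ∏ i, (1 + ∑ h, (w i h : ℂ) * (s h / m h)) := by
    intro s
    let ζ : Fin k → ℂ := Function.update (fun h => 1 + s h / m h) ℓ 1
    have hζ : ζ ℓ = 1 := by simp [ζ]
    have e : ∀ u : ι → Fin k → ℝ, (∀ i, u i ℓ = 0) →
        ∏ i, (1 + ∑ h, (u i h : ℂ) * (s h / m h)) = ∏ i, (1 + ∑ h, (u i h : ℂ) * (ζ h - 1)) := by
      intro u hu
      refine Finset.prod_congr rfl fun i _ => ?_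
      congr 1
      refine Finset.sum_congr rfl fun h _ => ?_
      by_cases hh : h = ℓ
      · subst hh; simp [hu]
      · simp [ζ, hh]
    rw [e v hv, e w hw, prod_one_add_eq_sum ℓ v ζ hζ, prod_one_add_eq_sum ℓ w ζ hζ,
      ← Finset.sum_sub_distrib, ← Finset.sum_fiberwise_of_maps_to hmap]
    refine Finset.sum_congr rfl fun y _ => ?_
    simp only [β]
    push_cast
    rw [Finset.sum_mul]
    refine Finset.sum_congr rfl fun c hc => ?_
    have hz : ∏ h, (1 + s h / m h) ^ y h = ∏ i, ζ (c i) := by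
      rw [← (Finset.mem_filter.mp hc).2]
      have h1 : ∏ h, (1 + s h / (m h : ℂ)) ^ zr c h = ∏ h, ζ h ^ cnt c h := by
        refine Finset.prod_congr rfl fun h _ => ?_
        by_cases hh : h = ℓ
        · subst hh; simp [zr, hζ]
        · simp [zr, ζ, hh]
      rw [h1]
      simp only [cnt, Finset.sum_apply, ← Finset.prod_pow_eq_pow_sum]
      rw [Finset.prod_comm]
      refine Finset.prod_congr rfl fun i _ => ?_
      rw [Finset.prod_eq_single (c i)]
      · simp
      · intro h _ hne
        simp [Pi.single_apply, hne]
      · simp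
    rw [hz, ← sub_mul]
    simp only [δ]
    push_cast
    ring
  have hI := sq_sum_abs_coeff_le Y β m hm
  simp_rw [hpoly] at hI
  have hint := (((integrable_exp_neg_norm_sq_div (κ := Fin k) ha).const_mul A).add
    ((integrable_exp_neg_norm_sq_div (κ := Fin k) hb).const_mul B))
  have h2 := hI.trans (MeasureTheory.integral_mono_of_nonneg
    (Filter.Eventually.of_forall fun s => by positivity) hint (Filter.Eventually.of_forall H))
  simp only [Pi.add_apply] at h2
  rw [MeasureTheory.integral_add ((integrable_exp_neg_norm_sq_div ha).const_mul A)
    ((integrable_exp_neg_norm_sq_div hb).const_mul B), MeasureTheory.integral_const_mul,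
    MeasureTheory.integral_const_mul, integral_exp_neg_norm_sq_div ha,
    integral_exp_neg_norm_sq_div hb, Fintype.card_fin, mul_pow, mul_pow] at h2
  have h3 : (∑ y ∈ Y, |β y|) ^ 2 ≤ A * a ^ k + B * b ^ k := by
    have hpi : 0 < Real.pi ^ k := pow_pos Real.pi_pos k
    refine le_of_mul_le_mul_left (h2.trans_eq ?_) hpi
    ring
  calc _ = |pmdExp (fun i => fillAt ℓ (v i)) f - pmdExp (fun i => fillAt ℓ (w i)) f| ^ 2 :=
        (sq_abs _).symm
    _ ≤ (∑ y ∈ Y, |β y|) ^ 2 := pow_le_pow_left₀ (abs_nonneg _) habs 2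
    _ ≤ _ := h3

end Expectation

/-! ### Pointwise bounds for the generating functions -/

section Pointwise

variable {ι : Type} [Fintype ι] {k : ℕ}

theorem norm_prod_one_add_sq_le (x : ι → ℂ) :
    ‖∏ i, (1 + x i)‖ ^ 2 ≤ Real.exp (∑ i, (2 * (x i).re + ‖x i‖ ^ 2)) := by
  rw [norm_prod, ← Finset.prod_pow, Real.exp_sum]
  refine Finset.prod_le_prod (fun _ _ => sq_nonneg _) fun i _ => ?_
  have : ‖1 + x i‖ ^ 2 = (2 * (x i).re + ‖x i‖ ^ 2) + 1 := by
    rw [← Complex.normSq_eq_norm_sq, ← Complex.normSq_eq_norm_sq, Complex.normSq_apply,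
      Complex.normSq_apply]
    simp
    ring
  rw [this]
  exact Real.add_one_le_exp _

/-- Cauchy-Schwarz for a non-negative vector. -/
theorem norm_sum_mul_sq_le (v : Fin k → ℝ) (hv : ∀ h, 0 ≤ v h) (c : Fin k → ℂ) :
    ‖∑ h, (v h : ℂ) * c h‖ ^ 2 ≤ (∑ h, v h) * ∑ h, v h * ‖c h‖ ^ 2 := by
  have h1 : ‖∑ h, (v h : ℂ) * c h‖ ≤ ∑ h, √(v h) * (√(v h) * ‖c h‖) := by
    refine (norm_sum_le _ _).trans_eq (Finset.sum_congr rfl fun h _ => ?_)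
    rw [norm_mul, Complex.norm_real, Real.norm_of_nonneg (hv h), ← mul_assoc,
      Real.mul_self_sqrt (hv h)]
  refine (pow_le_pow_left₀ (norm_nonneg _) h1 2).trans
    ((Finset.sum_mul_sq_le_sq_mul_sq _ _ _).trans_eq ?_)
  congr 1
  · exact Finset.sum_congr rfl fun h _ => Real.sq_sqrt (hv h)
  · exact Finset.sum_congr rfl fun h _ => by rw [mul_pow, Real.sq_sqrt (hv h)]

theorem sum_norm_sq_le (v : ι → Fin k → ℝ) (hv : ∀ i h, 0 ≤ v i h) {g : ℝ}
    (hsum : ∀ i, ∑ h, v i h ≤ g) (c : Fin k → ℂ) :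
    ∑ i, ‖∑ h, (v i h : ℂ) * c h‖ ^ 2 ≤ g * ∑ h, (∑ i, v i h) * ‖c h‖ ^ 2 := by
  have h1 : ∑ i, ‖∑ h, (v i h : ℂ) * c h‖ ^ 2 ≤ ∑ i, g * ∑ h, v i h * ‖c h‖ ^ 2 :=
    Finset.sum_le_sum fun i _ => (norm_sum_mul_sq_le (v i) (hv i) c).trans
      (mul_le_mul_of_nonneg_right (hsum i)
        (Finset.sum_nonneg fun h _ => mul_nonneg (hv i h) (sq_nonneg _)))
  refine h1.trans_eq ?_
  rw [← Finset.mul_sum, Finset.sum_comm]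
  simp_rw [Finset.sum_mul]

/-- By |1 + x|² ≤ exp(2 Re x + |x|²) only first and second moments matter. The factor exp(-∑ s m)
cancels the first-order term up to κ₀. In the second-order term Cauchy-Schwarz gains the mass 1 -
1/(2k) of a single vector; this gain is what leaves exp(-|s|²/(4k)) after multiplication by the
Gaussian weight. -/
theorem norm_genFun_sq_le (hk : 0 < k) (v : ι → Fin k → ℝ) (hv : ∀ i h, 0 ≤ v i h)
    (hsum : ∀ i, ∑ h, v i h ≤ 1 - 1 / (2 * k)) (m : Fin k → ℝ) (hm : ∀ h, 0 < m h) {κ₀ : ℝ}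
    (hκ : 8 * (k : ℝ) ^ 2 * κ₀ ^ 2 ≤ 1)
    (h1 : ∀ h, |∑ i, v i h - m h ^ 2| ≤ κ₀ * m h)
    (h2 : ∀ h, ∑ i, v i h ≤ (1 + 1 / (8 * k)) * m h ^ 2) (s : Fin k → ℂ) :
    ‖(∏ i, (1 + ∑ h, (v i h : ℂ) * (s h / m h))) * Complex.exp (-∑ h, s h * m h)‖ ^ 2 ≤
      Real.exp (1 + (1 - 1 / (4 * k)) * ∑ h, ‖s h‖ ^ 2) := by
  have hk' : (0 : ℝ) < k := by exact_mod_cast hk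
  have hk1 : (1 : ℝ) ≤ k := by exact_mod_cast hk
  rw [norm_mul, mul_pow, Complex.norm_exp, ← Real.exp_nat_mul]
  refine (mul_le_mul_of_nonneg_right (norm_prod_one_add_sq_le _) (Real.exp_pos _).le).trans ?_
  rw [← Real.exp_add, Real.exp_le_exp, Finset.sum_add_distrib]
  have hre : ∑ i, 2 * (∑ h, (v i h : ℂ) * (s h / m h)).re +
      ((2 : ℕ) : ℝ) * (-∑ h, s h * m h).re =
      ∑ h, 2 * ((s h).re * ((∑ i, v i h - m h ^ 2) / m h)) := by
    simp only [Complex.re_sum, Complex.neg_re, Complex.re_ofReal_mul, Complex.re_mul_ofReal,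
      Complex.div_ofReal_re]
    rw [← Finset.mul_sum, Finset.sum_comm, ← Finset.mul_sum]
    push_cast
    rw [mul_neg, ← sub_eq_add_neg, ← mul_sub, ← Finset.sum_sub_distrib]
    congr 1
    refine Finset.sum_congr rfl fun h _ => ?_
    rw [← Finset.sum_mul]
    have := (hm h).ne'
    field_simp
  have hlin : ∑ h, 2 * ((s h).re * ((∑ i, v i h - m h ^ 2) / m h)) ≤
      1 / (8 * k) * ∑ h, ‖s h‖ ^ 2 + 1 := by
    have : ∀ h, 2 * ((s h).re * ((∑ i, v i h - m h ^ 2) / m h)) ≤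
        1 / (8 * k) * ‖s h‖ ^ 2 + 8 * k * κ₀ ^ 2 := by
      intro h
      have e1 : |(∑ i, v i h - m h ^ 2) / m h| ≤ κ₀ := by
        rw [abs_div, abs_of_pos (hm h), div_le_iff₀ (hm h)]
        exact h1 h
      have e2 : (s h).re * ((∑ i, v i h - m h ^ 2) / m h) ≤ ‖s h‖ * κ₀ := by
        refine (le_abs_self _).trans ?_
        rw [abs_mul]
        exact mul_le_mul (Complex.abs_re_le_norm _) e1 (abs_nonneg _) (norm_nonneg _)
      -- Completing the square trades the linear term for a fraction 1/(8k) of |s|²; the constants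
      -- 8kκ₀² sum to at most 1 over the k coordinates.
      have e3 : 0 ≤ 1 / (8 * k) * (‖s h‖ - 8 * k * κ₀) ^ 2 := by positivity
      have e4 : 1 / (8 * k) * (‖s h‖ - 8 * k * κ₀) ^ 2 =
          1 / (8 * k) * ‖s h‖ ^ 2 - 2 * (‖s h‖ * κ₀) + 8 * k * κ₀ ^ 2 := by
        field_simp
        ring
      linarith
    refine (Finset.sum_le_sum fun h _ => this h).trans ?_
    rw [Finset.sum_add_distrib, ← Finset.mul_sum, Finset.sum_const, Finset.card_univ,
      Fintype.card_fin, nsmul_eq_mul]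
    have : (k : ℝ) * (8 * k * κ₀ ^ 2) = 8 * (k : ℝ) ^ 2 * κ₀ ^ 2 := by ring
    linarith
  have hg : (0 : ℝ) ≤ 1 - 1 / (2 * k) := by
    rw [sub_nonneg, div_le_one (by positivity)]
    linarith
  have hquad : ∑ i, ‖∑ h, (v i h : ℂ) * (s h / m h)‖ ^ 2 ≤
      (1 - 3 / (8 * k)) * ∑ h, ‖s h‖ ^ 2 := by
    refine (sum_norm_sq_le v hv hsum _).trans ?_
    have e1 : ∑ h, (∑ i, v i h) * ‖s h / m h‖ ^ 2 ≤ (1 + 1 / (8 * k)) * ∑ h, ‖s h‖ ^ 2 := by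
      rw [Finset.mul_sum]
      refine Finset.sum_le_sum fun h _ => ?_
      rw [norm_div, Complex.norm_real, Real.norm_of_nonneg (hm h).le, div_pow, mul_div_assoc',
        div_le_iff₀ (pow_pos (hm h) 2)]
      nlinarith [h2 h, sq_nonneg ‖s h‖]
    refine (mul_le_mul_of_nonneg_left e1 hg).trans ?_
    rw [← mul_assoc]
    refine mul_le_mul_of_nonneg_right ?_ (Finset.sum_nonneg fun _ _ => sq_nonneg _)
    have : (1 - 1 / (2 * k)) * (1 + 1 / (8 * k)) =
        1 - 3 / (8 * (k : ℝ)) - 1 / (2 * k) * (1 / (8 * k)) := by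
      field_simp
      ring
    rw [this]
    have : (0 : ℝ) ≤ 1 / (2 * k) * (1 / (8 * k)) := by positivity
    linarith
  have e : (1 - 1 / (4 * (k : ℝ))) = (1 - 3 / (8 * k)) + 1 / (8 * k) := by
    field_simp
    ring
  rw [e, add_mul]
  linarith

/-- Two families of sub-probability vectors whose generating functions have nearby logarithms on a
ball have nearby distributions. -/
theorem pmdClose_of_log_close [DecidableEq ι] (hk : 0 < k) (ℓ : Fin k) (v w : ι → Fin k → ℝ)
    (hvℓ : ∀ i, v i ℓ = 0) (hwℓ : ∀ i, w i ℓ = 0) (hv : ∀ i h, 0 ≤ v i h)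
    (hw : ∀ i h, 0 ≤ w i h) (hvs : ∀ i, ∑ h, v i h ≤ 1 - 1 / (2 * k))
    (hws : ∀ i, ∑ h, w i h ≤ 1 - 1 / (2 * k)) (m : Fin k → ℝ) (hm : ∀ h, 0 < m h) {κ₀ : ℝ}
    (hκ : 8 * (k : ℝ) ^ 2 * κ₀ ^ 2 ≤ 1)
    (hv1 : ∀ h, |∑ i, v i h - m h ^ 2| ≤ κ₀ * m h)
    (hv2 : ∀ h, ∑ i, v i h ≤ (1 + 1 / (8 * k)) * m h ^ 2)
    (hw1 : ∀ h, |∑ i, w i h - m h ^ 2| ≤ κ₀ * m h)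
    (hw2 : ∀ h, ∑ i, w i h ≤ (1 + 1 / (8 * k)) * m h ^ 2) {r₀ Δ ε : ℝ} (hΔ : Δ ≤ 1) (hε : 0 ≤ ε)
    (hT : ∀ s : Fin k → ℂ, ∑ h, ‖s h‖ ^ 2 ≤ r₀ → ∃ T T' : ℂ,
      ∏ i, (1 + ∑ h, (v i h : ℂ) * (s h / m h)) = Complex.exp T ∧
      ∏ i, (1 + ∑ h, (w i h : ℂ) * (s h / m h)) = Complex.exp T' ∧ ‖T - T'‖ ≤ Δ)
    (hbound : 4 * Real.exp 1 * Δ ^ 2 * (4 * k) ^ k +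
      4 * Real.exp 1 * Real.exp (-r₀ / (8 * k)) * (8 * k) ^ k ≤ ε ^ 2) :
    PMDClose (fun i => fillAt ℓ (v i)) (fun i => fillAt ℓ (w i)) ε := by
  intro f hf
  have hk' : (0 : ℝ) < k := by exact_mod_cast hk
  refine abs_le_of_sq_le_sq ?_ hε
  refine (sq_pmdExp_sub_le ℓ v w hvℓ hwℓ m hm (a := 4 * k) (b := 8 * k) (by positivity)
    (by positivity) (fun s => ?_) f hf).trans hbound
  have hGv := norm_genFun_sq_le hk v hv hvs m hm hκ hv1 hv2 s
  have hGw := norm_genFun_sq_le hk w hw hws m hm hκ hw1 hw2 s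
  set X := ∏ i, (1 + ∑ h, (v i h : ℂ) * (s h / m h))
  set Y := ∏ i, (1 + ∑ h, (w i h : ℂ) * (s h / m h))
  set E := Complex.exp (-∑ h, s h * m h)
  set S := ∑ h, ‖s h‖ ^ 2
  have hS : 0 ≤ S := Finset.sum_nonneg fun _ _ => sq_nonneg _
  have hexp : Real.exp (1 + (1 - 1 / (4 * k)) * S) * Real.exp (-S) =
      Real.exp 1 * Real.exp (-S / (4 * k)) := by
    rw [← Real.exp_add, ← Real.exp_add]
    congr 1
    field_simp
    ring
  rcases le_or_gt S r₀ with hr | hr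
  -- Inside the ball, X - Y = (exp(T - T') - 1) Y, and the first factor is at most 2Δ.
  · obtain ⟨T, T', hX, hY, hTT⟩ := hT s hr
    have h1 : ‖(X - Y) * E‖ ≤ 2 * Δ * ‖Y * E‖ := by
      have : (X - Y) * E = (Complex.exp (T - T') - 1) * (Y * E) := by
        rw [show X = _ from hX, show Y = _ from hY, Complex.exp_sub]
        field_simp
      rw [this, norm_mul]
      refine mul_le_mul_of_nonneg_right ?_ (norm_nonneg _)
      exact (Complex.norm_exp_sub_one_le (hTT.trans hΔ)).trans (by linarith)
    have hΔ0 : 0 ≤ Δ := (norm_nonneg _).trans hTT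
    have h2 : ‖(X - Y) * E‖ ^ 2 ≤ 4 * Δ ^ 2 * Real.exp (1 + (1 - 1 / (4 * k)) * S) := by
      refine (pow_le_pow_left₀ (norm_nonneg _) h1 2).trans ?_
      rw [mul_pow]
      calc _ ≤ (2 * Δ) ^ 2 * Real.exp (1 + (1 - 1 / (4 * k)) * S) :=
            mul_le_mul_of_nonneg_left hGw (by positivity)
        _ = _ := by ring
    calc _ ≤ 4 * Δ ^ 2 * Real.exp (1 + (1 - 1 / (4 * k)) * S) * Real.exp (-S) :=
          mul_le_mul_of_nonneg_right h2 (Real.exp_pos _).le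
      _ = 4 * Real.exp 1 * Δ ^ 2 * Real.exp (-S / (4 * k)) := by
          rw [mul_assoc, hexp]; ring
      _ ≤ _ := le_add_of_nonneg_right (by positivity)
  -- Outside the ball no cancellation is needed. Half of the decay exp(-S/(4k)) pays for the factor
  -- exp(-r₀/(8k)), the other half keeps the bound integrable.
  · have h2 : ‖(X - Y) * E‖ ^ 2 ≤ 4 * Real.exp (1 + (1 - 1 / (4 * k)) * S) := by
      rw [sub_mul]
      have := pow_le_pow_left₀ (norm_nonneg _) (norm_sub_le (X * E) (Y * E)) 2
      nlinarith [sq_nonneg (‖X * E‖ - ‖Y * E‖)]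
    have h3 : Real.exp (-S / (4 * k)) ≤ Real.exp (-r₀ / (8 * k)) * Real.exp (-S / (8 * k)) := by
      rw [← Real.exp_add, Real.exp_le_exp]
      have : -S / (4 * k) = -S / (8 * k) + -S / (8 * k) := by
        field_simp
        ring
      rw [this]
      gcongr
    calc _ ≤ 4 * Real.exp (1 + (1 - 1 / (4 * k)) * S) * Real.exp (-S) :=
          mul_le_mul_of_nonneg_right h2 (Real.exp_pos _).le
      _ = 4 * Real.exp 1 * Real.exp (-S / (4 * k)) := by rw [mul_assoc, hexp]; ring
      _ ≤ 4 * Real.exp 1 * (Real.exp (-r₀ / (8 * k)) * Real.exp (-S / (8 * k))) := by gcongr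
      _ = 4 * Real.exp 1 * Real.exp (-r₀ / (8 * k)) * Real.exp (-S / (8 * k)) := by ring
      _ ≤ _ := le_add_of_nonneg_left (by positivity)

/-! ### Logarithms -/

/-- Up to a factor 1 + ρ with ρ bilinear in the three parts, 1 + b + u + z is the product (1 + b)(1
+ u)(1 + z). The logarithm of 1 + b is kept whole, u is expanded to first and z to second order,
according to what is matched later for each part. Any logarithm T is good enough, so the sum of the
principal ones is taken. -/
theorem exists_log_split {b u z : ℂ} (hb : ‖b‖ ≤ 1 / 8) (hu : ‖u‖ ≤ 1 / 8) (hz : ‖z‖ ≤ 1 / 8) :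
    ∃ T : ℂ, Complex.exp T = 1 + (b + u + z) ∧
      ‖T - (Complex.log (1 + b) + u + (z - z ^ 2 / 2))‖ ≤
        4 * (‖b‖ * ‖u‖ + ‖b‖ * ‖z‖ + ‖u‖ * ‖z‖ + ‖u‖ ^ 2 + ‖z‖ ^ 3) := by
  have hlow : ∀ x : ℂ, ‖x‖ ≤ 1 / 8 → 7 / 8 ≤ ‖1 + x‖ := by
    intro x hx
    have := norm_sub_norm_le (1 : ℂ) (-x)
    rw [norm_one, norm_neg, sub_neg_eq_add] at this
    linarith
  have hne : ∀ x : ℂ, ‖x‖ ≤ 1 / 8 → 1 + x ≠ 0 := fun x hx h0 => by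
    have := hlow x hx
    rw [h0, norm_zero] at this
    linarith
  set ρ : ℂ := -(b * u + b * z + u * z + b * u * z) / ((1 + b) * (1 + u) * (1 + z)) with hρ
  have hprod : (1 + ρ) * ((1 + b) * (1 + u) * (1 + z)) = 1 + (b + u + z) := by
    have h1 := hne b hb
    have h2 := hne u hu
    have h3 := hne z hz
    rw [hρ]
    field_simp
    ring
  have hnum : ‖-(b * u + b * z + u * z + b * u * z)‖ ≤
      9 / 8 * (‖b‖ * ‖u‖ + ‖b‖ * ‖z‖ + ‖u‖ * ‖z‖) := by
    rw [norm_neg]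
    have h1 : ‖b * u + b * z + u * z + b * u * z‖ ≤
        ‖b‖ * ‖u‖ + ‖b‖ * ‖z‖ + ‖u‖ * ‖z‖ + ‖b‖ * ‖u‖ * ‖z‖ := by
      refine (norm_add_le _ _).trans (add_le_add ((norm_add₃_le).trans_eq ?_) (le_of_eq ?_)) <;>
        simp only [norm_mul]
    have h2 : ‖b‖ * ‖u‖ * ‖z‖ ≤ ‖b‖ * ‖u‖ * (1 / 8) :=
      mul_le_mul_of_nonneg_left hz (by positivity)
    have h3 : 0 ≤ ‖b‖ * ‖z‖ := by positivity
    have h4 : 0 ≤ ‖u‖ * ‖z‖ := by positivity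
    linarith
  have hden : 343 / 512 ≤ ‖(1 + b) * (1 + u) * (1 + z)‖ := by
    rw [norm_mul, norm_mul]
    calc (343 / 512 : ℝ) = 7 / 8 * (7 / 8) * (7 / 8) := by norm_num
      _ ≤ _ := by
        have := hlow b hb
        have := hlow u hu
        have := hlow z hz
        gcongr
  have hρn : ‖ρ‖ ≤ 7 / 4 * (‖b‖ * ‖u‖ + ‖b‖ * ‖z‖ + ‖u‖ * ‖z‖) := by
    rw [hρ, norm_div, div_le_iff₀ (by linarith)]
    refine hnum.trans ?_
    have : 0 ≤ ‖b‖ * ‖u‖ + ‖b‖ * ‖z‖ + ‖u‖ * ‖z‖ := by positivity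
    nlinarith
  have hρ2 : ‖ρ‖ ≤ 1 / 2 := by
    have h1 : ‖b‖ * ‖u‖ ≤ 1 / 8 * (1 / 8) := by gcongr
    have h2 : ‖b‖ * ‖z‖ ≤ 1 / 8 * (1 / 8) := by gcongr
    have h3 : ‖u‖ * ‖z‖ ≤ 1 / 8 * (1 / 8) := by gcongr
    linarith
  have hlogρ := Complex.norm_log_one_add_half_le_self hρ2
  have hρ1 : 1 + ρ ≠ 0 := by
    intro h0
    have := norm_sub_norm_le (1 : ℂ) (-ρ)
    rw [norm_one, norm_neg, sub_neg_eq_add, h0, norm_zero] at this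
    linarith
  refine ⟨Complex.log (1 + ρ) + (Complex.log (1 + b) + Complex.log (1 + u) + Complex.log (1 + z)),
    ?_, ?_⟩
  · rw [Complex.exp_add, Complex.exp_add, Complex.exp_add, Complex.exp_log hρ1,
      Complex.exp_log (hne b hb), Complex.exp_log (hne u hu), Complex.exp_log (hne z hz), hprod]
  · have hU := Complex.norm_log_sub_logTaylor_le 1 (z := u) (by linarith)
    have hZ := Complex.norm_log_sub_logTaylor_le 2 (z := z) (by linarith)
    have tU : Complex.logTaylor (1 + 1) u = u := by
      simp [Complex.logTaylor, Finset.sum_range_succ]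
    have tZ : Complex.logTaylor (2 + 1) z = z - z ^ 2 / 2 := by
      simp [Complex.logTaylor, Finset.sum_range_succ]
      ring
    rw [tU] at hU
    rw [tZ] at hZ
    have inv_le : ∀ x : ℂ, ‖x‖ ≤ 1 / 8 → (1 - ‖x‖)⁻¹ ≤ 8 / 7 := by
      intro x hx
      rw [inv_le_comm₀ (by linarith) (by norm_num)]
      linarith
    have hU' : ‖Complex.log (1 + u) - u‖ ≤ ‖u‖ ^ 2 := by
      refine hU.trans ?_
      have := inv_le u hu
      norm_num
      nlinarith [sq_nonneg ‖u‖]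
    have hZ' : ‖Complex.log (1 + z) - (z - z ^ 2 / 2)‖ ≤ ‖z‖ ^ 3 := by
      refine hZ.trans ?_
      have := inv_le z hz
      have h3 : 0 ≤ ‖z‖ ^ 3 := by positivity
      norm_num
      nlinarith
    have e : Complex.log (1 + ρ) + (Complex.log (1 + b) + Complex.log (1 + u) +
        Complex.log (1 + z)) - (Complex.log (1 + b) + u + (z - z ^ 2 / 2)) =
        Complex.log (1 + ρ) + (Complex.log (1 + u) - u) +
          (Complex.log (1 + z) - (z - z ^ 2 / 2)) := by ring
    rw [e]
    refine (norm_add₃_le).trans ?_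
    have h2 : 0 ≤ ‖u‖ ^ 2 := by positivity
    have h3 : 0 ≤ ‖z‖ ^ 3 := by positivity
    have h4 : 0 ≤ ‖b‖ * ‖u‖ + ‖b‖ * ‖z‖ + ‖u‖ * ‖z‖ := by positivity
    linarith

theorem norm_log_sub_logTaylor_le_pow (R : ℕ) {b : ℂ} (hb : ‖b‖ ≤ 1 / 2) :
    ‖Complex.log (1 + b) - Complex.logTaylor (R + 1) b‖ ≤ 2 * ‖b‖ ^ (R + 1) := by
  refine (Complex.norm_log_sub_logTaylor_le R (by linarith)).trans ?_
  have h1 : (1 - ‖b‖)⁻¹ ≤ 2 := by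
    rw [inv_le_comm₀ (by linarith) (by norm_num)]
    linarith
  have h2 : 0 ≤ ‖b‖ ^ (R + 1) := by positivity
  have h3 : (1 : ℝ) ≤ R + 1 := by linarith [(Nat.cast_nonneg R : (0 : ℝ) ≤ R)]
  refine (div_le_self (mul_nonneg h2 (inv_nonneg.mpr (by linarith))) h3).trans ?_
  rw [mul_comm]
  exact mul_le_mul_of_nonneg_right h1 h2

end Pointwise

/-! ### Replacing a family of points by one with few distinct points and the same moments -/

section FewTypes

variable {κ : Type*} [Fintype κ]

theorem exists_mvPolynomial_interpolation (X : Finset (κ → ℝ)) (g : (κ → ℝ) → ℝ) :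
    ∃ P : MvPolynomial κ ℝ, ∀ x ∈ X, MvPolynomial.eval x P = g x := by
  classical
  have hsep : ∀ x₀ x : κ → ℝ, ∃ P : MvPolynomial κ ℝ, x ≠ x₀ →
      MvPolynomial.eval x₀ P = 1 ∧ MvPolynomial.eval x P = 0 := by
    intro x₀ x
    by_cases hx : x = x₀
    · exact ⟨0, fun h => absurd hx h⟩
    · obtain ⟨h, hh⟩ := Function.ne_iff.mp hx
      have hne : x₀ h - x h ≠ 0 := sub_ne_zero.mpr hh.symm
      refine ⟨MvPolynomial.C (x₀ h - x h)⁻¹ * (MvPolynomial.X h - MvPolynomial.C (x h)), fun _ => ?_⟩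
      constructor <;> simp [hne]
  choose S hS using hsep
  refine ⟨∑ x₀ ∈ X, MvPolynomial.C (g x₀) * ∏ x ∈ X.erase x₀, S x₀ x, fun x hx => ?_⟩
  rw [map_sum, Finset.sum_eq_single_of_mem x hx]
  · rw [map_mul, MvPolynomial.eval_C, map_prod, Finset.prod_eq_one, mul_one]
    exact fun y hy => (hS x y (Finset.ne_of_mem_erase hy)).1
  · intro y hy hne
    rw [map_mul, map_prod, Finset.prod_eq_zero (Finset.mem_erase.mpr ⟨hne.symm, hx⟩)
      (hS y x hne.symm).2, mul_zero]

/-- On a finite set where every `x_h ^ n` is a polynomial of lower degree, there are at most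
`n ^ d` points. -/
theorem card_le_pow_of_leading_forms (X : Finset (κ → ℝ)) (n : ℕ)
    (H : ∀ h, ∃ P : MvPolynomial κ ℝ, P.totalDegree < n ∧ ∀ x ∈ X, x h ^ n = MvPolynomial.eval x P) :
    X.card ≤ n ^ Fintype.card κ := by
  classical
  -- By interpolation every function on X is a polynomial, and the leading forms reduce every
  -- polynomial to monomials with all exponents below n. So the dimension |X| of the space of
  -- functions on X is at most n^d.
  let mon : (κ → Fin n) → X → ℝ := fun α x => ∏ h, x.1 h ^ (α h : ℕ)
  let V := Submodule.span ℝ (Set.range mon)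
  choose L hLdeg hL using H
  -- Strong induction on the degree: a factor x_h^n of a monomial is exchanged for a polynomial of
  -- smaller degree, which lowers the total degree.
  have key : ∀ d : ℕ, ∀ P : MvPolynomial κ ℝ, P.totalDegree ≤ d →
      (fun x : X => MvPolynomial.eval x.1 P) ∈ V := by
    intro d
    induction d using Nat.strong_induction_on with
    | _ d ih =>
      intro P hP
      have hmon : ∀ a ∈ P.support, (fun x : X => ∏ h, x.1 h ^ a h) ∈ V := by
        intro a ha
        by_cases hall : ∀ h, a h < n
        · exact Submodule.subset_span ⟨fun h => ⟨a h, hall h⟩, rfl⟩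
        · push Not at hall
          obtain ⟨h, hh⟩ := hall
          have hle : Finsupp.single h n ≤ a := by
            rw [Finsupp.single_le_iff]
            exact hh
          let Q : MvPolynomial κ ℝ := MvPolynomial.monomial (a - Finsupp.single h n) 1 * L h
          have hdegree : (a.sum fun _ e => e) ≤ d := (MvPolynomial.le_totalDegree ha).trans hP
          have hsplit : ((a - Finsupp.single h n).sum fun _ e => e) + n = a.sum fun _ e => e := by
            have h1 : (a - Finsupp.single h n) + Finsupp.single h n = a := tsub_add_cancel_of_le hle
            conv_rhs => rw [← h1]
            rw [Finsupp.sum_add_index' (fun _ => rfl) (fun _ _ _ => rfl)]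
            simp
          have hQ : Q.totalDegree < d := by
            refine (MvPolynomial.totalDegree_mul _ _).trans_lt ?_
            have h1 := MvPolynomial.totalDegree_monomial_le (R := ℝ) (a - Finsupp.single h n) (1 : ℝ)
            have h2 := hLdeg h
            change _ ≤ (a - Finsupp.single h n).sum fun _ e => e at h1
            omega
          have := ih Q.totalDegree hQ Q le_rfl
          convert this using 2 with x
          rw [map_mul, ← hL h x.1 x.2, MvPolynomial.eval_monomial, one_mul,
            Finsupp.prod_fintype _ _ (fun _ => pow_zero _)]
          rw [← Finset.mul_prod_erase _ _ (Finset.mem_univ h),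
            ← Finset.mul_prod_erase _ _ (Finset.mem_univ h)]
          have h1 : ∏ j ∈ Finset.univ.erase h, x.1 j ^ (a - Finsupp.single h n) j =
              ∏ j ∈ Finset.univ.erase h, x.1 j ^ a j := by
            refine Finset.prod_congr rfl fun j hj => ?_
            rw [Finsupp.tsub_apply, Finsupp.single_eq_of_ne (Finset.ne_of_mem_erase hj), tsub_zero]
          rw [h1, Finsupp.tsub_apply, Finsupp.single_eq_same, mul_right_comm, ← pow_add,
            Nat.sub_add_cancel hh]
      have hP' : (fun x : X => MvPolynomial.eval x.1 P) =
          ∑ a ∈ P.support, P.coeff a • fun x : X => ∏ h, x.1 h ^ a h := by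
        ext x
        rw [MvPolynomial.eval_eq', Finset.sum_apply]
        rfl
      rw [hP']
      exact Submodule.sum_mem _ fun a ha => Submodule.smul_mem _ _ (hmon a ha)
  have htop : V = ⊤ := by
    rw [eq_top_iff]
    intro g _
    obtain ⟨P, hP⟩ := exists_mvPolynomial_interpolation X
      fun x => if hx : x ∈ X then g ⟨x, hx⟩ else 0
    have := key P.totalDegree P le_rfl
    convert this using 1
    ext x
    rw [hP x.1 x.2, dif_pos x.2]
  have h1 : Module.finrank ℝ V ≤ Fintype.card (κ → Fin n) := finrank_range_le_card mon
  rw [htop, finrank_top, Module.finrank_fintype_fun_eq_card] at h1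
  simpa using h1

theorem hasDerivAt_monomial_update [DecidableEq κ] (α : κ → ℕ) (p : κ → ℝ) (h : κ) (t : ℝ) :
    HasDerivAt (fun t : ℝ => ∏ j, Function.update p h t j ^ α j)
      ((α h : ℝ) * t ^ (α h - 1) * ∏ j ∈ Finset.univ.erase h, p j ^ α j) t := by
  have e : (fun t : ℝ => ∏ j, Function.update p h t j ^ α j) =
      fun t => t ^ α h * ∏ j ∈ Finset.univ.erase h, p j ^ α j := by
    ext t
    rw [← Finset.mul_prod_erase _ _ (Finset.mem_univ h), Function.update_self]
    congr 1
    exact Finset.prod_congr rfl fun j hj => by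
      rw [Function.update_of_ne (Finset.ne_of_mem_erase hj)]
  rw [e]
  exact (hasDerivAt_pow (α h) t).mul_const _

variable {ι : Type*} [Fintype ι]

/-- The penalised moment functional. -/
noncomputable def momentPenalty (A : Finset (κ → ℕ)) (R : ℕ) (μ : (κ → ℕ) → ℝ) (η : ℝ)
    (y : ι → κ → ℝ) : ℝ :=
  ∑ α ∈ A, (∑ i, ∏ h, y i h ^ α h - μ α) ^ 2 + η * ∑ i, ∑ h, y i h ^ (R + 1)

theorem continuous_momentPenalty (A : Finset (κ → ℕ)) (R : ℕ) (μ : (κ → ℕ) → ℝ) (η : ℝ) :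
    Continuous (momentPenalty A R μ η : (ι → κ → ℝ) → ℝ) := by
  unfold momentPenalty
  fun_prop

theorem hasDerivAt_momentPenalty [DecidableEq κ] [DecidableEq ι] (A : Finset (κ → ℕ)) (R : ℕ)
    (μ : (κ → ℕ) → ℝ) (η : ℝ) (y : ι → κ → ℝ) (i : ι) (h : κ) :
    HasDerivAt (fun t => momentPenalty A R μ η
      (Function.update y i (Function.update (y i) h t)))
      (∑ α ∈ A, 2 * (∑ i, ∏ h, y i h ^ α h - μ α) *
        ((α h : ℝ) * y i h ^ (α h - 1) * ∏ j ∈ Finset.univ.erase h, y i j ^ α j) +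
        η * ((R + 1 : ℕ) * y i h ^ R)) (y i h) := by
  have hself : Function.update y i (Function.update (y i) h (y i h)) = y := by simp
  have hm : ∀ α : κ → ℕ, HasDerivAt (fun t => ∑ i', ∏ j,
      Function.update y i (Function.update (y i) h t) i' j ^ α j)
      ((α h : ℝ) * y i h ^ (α h - 1) * ∏ j ∈ Finset.univ.erase h, y i j ^ α j) (y i h) := by
    intro α
    have e : (fun t => ∑ i', ∏ j, Function.update y i (Function.update (y i) h t) i' j ^ α j) =
        fun t => ∏ j, Function.update (y i) h t j ^ α j +
          ∑ i' ∈ Finset.univ.erase i, ∏ j, y i' j ^ α j := by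
      ext t
      rw [← Finset.add_sum_erase _ _ (Finset.mem_univ i), Function.update_self]
      congr 1
      exact Finset.sum_congr rfl fun i' hi' => by
        rw [Function.update_of_ne (Finset.ne_of_mem_erase hi')]
    rw [e]
    exact (hasDerivAt_monomial_update α (y i) h (y i h)).add_const _
  have hs : HasDerivAt (fun t => ∑ i', ∑ j,
      Function.update y i (Function.update (y i) h t) i' j ^ (R + 1))
      ((R + 1 : ℕ) * y i h ^ R) (y i h) := by
    have e : (fun t => ∑ i', ∑ j,
        Function.update y i (Function.update (y i) h t) i' j ^ (R + 1)) =
        fun t => t ^ (R + 1) + (∑ j ∈ Finset.univ.erase h, y i j ^ (R + 1) +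
          ∑ i' ∈ Finset.univ.erase i, ∑ j, y i' j ^ (R + 1)) := by
      ext t
      rw [← Finset.add_sum_erase _ _ (Finset.mem_univ i), Function.update_self,
        ← Finset.add_sum_erase _ _ (Finset.mem_univ h), Function.update_self, add_assoc]
      congr 2
      · exact Finset.sum_congr rfl fun j hj => by
          rw [Function.update_of_ne (Finset.ne_of_mem_erase hj)]
      · exact Finset.sum_congr rfl fun i' hi' => by
          rw [Function.update_of_ne (Finset.ne_of_mem_erase hi')]
    rw [e]
    exact (hasDerivAt_pow (R + 1) (y i h)).add_const _
  have h1 : HasDerivAt (fun t => ∑ α ∈ A, (∑ i', ∏ j,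
      Function.update y i (Function.update (y i) h t) i' j ^ α j - μ α) ^ 2)
      (∑ α ∈ A, 2 * (∑ i, ∏ h, y i h ^ α h - μ α) *
        ((α h : ℝ) * y i h ^ (α h - 1) * ∏ j ∈ Finset.univ.erase h, y i j ^ α j)) (y i h) := by
    refine HasDerivAt.fun_sum fun α _ => ?_
    have := ((hm α).sub_const (μ α)).fun_pow 2
    simp only [hself] at this
    simpa using this
  exact h1.add (hs.const_mul η)

theorem totalDegree_sum_le {κ : Type*} {A : Finset (κ → ℕ)} {d : ℕ}
    (f : (κ → ℕ) → MvPolynomial κ ℝ)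
    (hf : ∀ α ∈ A, (f α).totalDegree ≤ d) : (∑ α ∈ A, f α).totalDegree ≤ d :=
  (MvPolynomial.totalDegree_finsetSum _ _).trans (Finset.sup_le hf)

/-- At a minimiser each coordinate of each point is at an end of its interval or has vanishing
derivative. The derivative is Q + η(R+1)x_h^R with one polynomial Q, of degree at most R - 1, for
all points. Multiplied by (x_h - lo)(x_h - hi) the alternatives become one equation with leading
form x_h^(R+2). The penalty is there to provide this leading form. -/
theorem card_image_le_of_isMinOn (A : Finset (κ → ℕ)) (R : ℕ) (hA : ∀ α ∈ A, ∑ h, α h ≤ R)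
    (μ : (κ → ℕ) → ℝ) {η : ℝ} (hη : 0 < η) (lo hi : κ → ℝ) (y : ι → κ → ℝ)
    (hy : ∀ i h, lo h ≤ y i h ∧ y i h ≤ hi h)
    (hmin : ∀ z : ι → κ → ℝ, (∀ i h, lo h ≤ z i h ∧ z i h ≤ hi h) →
      momentPenalty A R μ η y ≤ momentPenalty A R μ η z) :
    ∀ X : Finset (κ → ℝ), (∀ x ∈ X, ∃ i, y i = x) → X.card ≤ (R + 2) ^ Fintype.card κ := by
  classical
  intro X hX
  refine card_le_pow_of_leading_forms X (R + 2) fun h => ?_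
  let c : (κ → ℕ) → ℝ := fun α => 2 * (∑ i, ∏ h, y i h ^ α h - μ α) * α h
  let Q : MvPolynomial κ ℝ := ∑ α ∈ A, if α h = 0 then 0 else
    MvPolynomial.monomial (Finsupp.equivFunOnFinite.symm (Function.update α h (α h - 1))) (c α)
  have hQdeg : Q.totalDegree ≤ R - 1 := by
    refine totalDegree_sum_le _ fun α hα => ?_
    split_ifs with h0
    · simp
    · refine (MvPolynomial.totalDegree_monomial_le _ _).trans ?_
      have h1 : ((Finsupp.equivFunOnFinite.symm (Function.update α h (α h - 1))).sum
          fun _ => id) = ∑ j, Function.update α h (α h - 1) j := by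
        rw [Finsupp.sum_fintype _ _ (fun _ => rfl)]
        rfl
      rw [h1, ← Finset.add_sum_erase _ _ (Finset.mem_univ h), Function.update_self]
      have h2 : ∑ j ∈ Finset.univ.erase h, Function.update α h (α h - 1) j =
          ∑ j ∈ Finset.univ.erase h, α j := Finset.sum_congr rfl fun j hj => by
        rw [Function.update_of_ne (Finset.ne_of_mem_erase hj)]
      have h3 := hA α hα
      rw [← Finset.add_sum_erase _ _ (Finset.mem_univ h)] at h3
      omega
  have hQeval : ∀ i, MvPolynomial.eval (y i) Q = ∑ α ∈ A, 2 * (∑ i, ∏ h, y i h ^ α h - μ α) *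
        ((α h : ℝ) * y i h ^ (α h - 1) * ∏ j ∈ Finset.univ.erase h, y i j ^ α j) := by
    intro i
    rw [map_sum]
    refine Finset.sum_congr rfl fun α _ => ?_
    split_ifs with h0
    · simp [h0]
    · rw [MvPolynomial.eval_monomial, Finsupp.prod_fintype _ _ (fun _ => pow_zero _),
        ← Finset.mul_prod_erase _ _ (Finset.mem_univ h)]
      have h2 : ∏ j ∈ Finset.univ.erase h, y i j ^
          (Finsupp.equivFunOnFinite.symm (Function.update α h (α h - 1))) j =
          ∏ j ∈ Finset.univ.erase h, y i j ^ α j := Finset.prod_congr rfl fun j hj => by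
        rw [Finsupp.equivFunOnFinite_symm_apply_apply,
          Function.update_of_ne (Finset.ne_of_mem_erase hj)]
      rw [h2, Finsupp.equivFunOnFinite_symm_apply_apply, Function.update_self]
      ring
  have hstat : ∀ i, (y i h - lo h) * (y i h - hi h) *
      (MvPolynomial.eval (y i) Q + η * ((R + 1 : ℕ) * y i h ^ R)) = 0 := by
    intro i
    rcases eq_or_lt_of_le (hy i h).1 with h1 | h1
    · rw [h1]; ring
    rcases eq_or_lt_of_le (hy i h).2 with h2 | h2
    · rw [h2]; ring
    have hd := hasDerivAt_momentPenalty A R μ η y i h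
    rw [← hQeval] at hd
    have hloc : IsLocalMin (fun t => momentPenalty A R μ η
        (Function.update y i (Function.update (y i) h t))) (y i h) := by
      filter_upwards [Ioo_mem_nhds h1 h2] with t ht
      have hself : Function.update y i (Function.update (y i) h (y i h)) = y := by simp
      rw [hself]
      refine hmin _ fun i' j => ?_
      by_cases hi' : i' = i
      · subst hi'
        rw [Function.update_self]
        by_cases hj : j = h
        · subst hj
          rw [Function.update_self]
          exact ⟨ht.1.le, ht.2.le⟩
        · rw [Function.update_of_ne hj]
          exact hy i' j
      · rw [Function.update_of_ne hi']
        exact hy i' j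
    rw [hloc.hasDerivAt_eq_zero hd, mul_zero]
  let a : ℝ := η * (R + 1 : ℕ)
  have ha : a ≠ 0 := by positivity
  let W : MvPolynomial κ ℝ := MvPolynomial.X h
  let B : MvPolynomial κ ℝ := MvPolynomial.C (-(lo h + hi h)) * W + MvPolynomial.C (lo h * hi h)
  -- Here (x_h - lo)(x_h - hi) is W² + B with B of degree at most 1, and the stationarity equation
  -- is solved for W^(R+2).
  refine ⟨-(MvPolynomial.C a⁻¹ * ((W ^ 2 + B) * Q) + B * W ^ R), ?_, ?_⟩
  · have hW : ∀ e : ℕ, (W ^ e).totalDegree ≤ e := fun e => by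
      simp [W]
    have hW1 : W.totalDegree ≤ 1 := by simpa using hW 1
    have hB : B.totalDegree ≤ 1 := by
      refine (MvPolynomial.totalDegree_add _ _).trans (max_le ?_ (by rw [MvPolynomial.totalDegree_C]; exact Nat.zero_le _))
      refine (MvPolynomial.totalDegree_mul _ _).trans ?_
      rw [MvPolynomial.totalDegree_C, zero_add]
      exact hW1
    have hWB : (W ^ 2 + B).totalDegree ≤ 2 :=
      (MvPolynomial.totalDegree_add _ _).trans (max_le (hW 2) (hB.trans one_le_two))
    rw [MvPolynomial.totalDegree_neg, Nat.lt_succ_iff]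
    refine (MvPolynomial.totalDegree_add _ _).trans (max_le ?_ ?_)
    · refine (MvPolynomial.totalDegree_mul _ _).trans ?_
      rw [MvPolynomial.totalDegree_C, zero_add]
      -- The bound R - 1 for the degree of Q is truncated, so R = 0 is separate: then only constant
      -- moments occur and Q vanishes.
      rcases Nat.eq_zero_or_pos R with hR | hR
      · have hQ0 : Q = 0 := by
          refine Finset.sum_eq_zero fun α hα => if_pos ?_
          have := hA α hα
          rw [hR, Nat.le_zero, Finset.sum_eq_zero_iff] at this
          exact this h (Finset.mem_univ h)
        rw [hQ0, mul_zero, MvPolynomial.totalDegree_zero]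
        exact Nat.zero_le _
      · refine (MvPolynomial.totalDegree_mul _ _).trans ?_
        omega
    · refine (MvPolynomial.totalDegree_mul _ _).trans ?_
      have := hW R
      omega
  · intro x hx
    obtain ⟨i, rfl⟩ := hX x hx
    have h1 := hstat i
    simp only [map_neg, map_add, map_mul, map_pow, MvPolynomial.eval_C, MvPolynomial.eval_X, B, W]
    have h2 : η * (((R + 1 : ℕ) : ℝ) * y i h ^ R) = a * y i h ^ R := by simp only [a]; ring
    rw [h2] at h1
    field_simp
    linear_combination h1

theorem isCompact_box {γ κ : Type*} (lo hi : κ → ℝ) :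
    IsCompact {y : γ → κ → ℝ | ∀ i h, lo h ≤ y i h ∧ y i h ≤ hi h} := by
  have : {y : γ → κ → ℝ | ∀ i h, lo h ≤ y i h ∧ y i h ≤ hi h} =
      Set.Icc (fun _ => lo) (fun _ => hi) := by
    ext y
    simp [Pi.le_def, forall_and]
  rw [this]
  exact isCompact_Icc

/-- A family of points of a box can be replaced by one with the same moments up to degree `R` and
at most `(R + 2) ^ d` distinct points. -/
theorem exists_few_types (R : ℕ) (lo hi : κ → ℝ) (hlo : ∀ h, 0 ≤ lo h) (x : ι → κ → ℝ)
    (hx : ∀ i h, lo h ≤ x i h ∧ x i h ≤ hi h) :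
    ∃ y : ι → κ → ℝ, (∀ i h, lo h ≤ y i h ∧ y i h ≤ hi h) ∧
      (∀ α : κ → ℕ, ∑ h, α h ≤ R → ∑ i, ∏ h, y i h ^ α h = ∑ i, ∏ h, x i h ^ α h) ∧
      (Set.range y).ncard ≤ (R + 2) ^ Fintype.card κ := by
  classical
  rcases isEmpty_or_nonempty ι with hι | ⟨⟨i₀⟩⟩
  · exact ⟨x, hx, fun _ _ => rfl, by simp [Set.range_eq_empty]⟩
  let T := (R + 2) ^ Fintype.card κ
  let A : Finset (κ → ℕ) :=
    (Fintype.piFinset fun _ => Finset.range (R + 1)).filter fun α => ∑ h, α h ≤ R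
  have hA : ∀ α, α ∈ A ↔ ∑ h, α h ≤ R := by
    intro α
    rw [Finset.mem_filter, Fintype.mem_piFinset, and_iff_right_iff_imp]
    intro hα h
    rw [Finset.mem_range, Nat.lt_succ_iff]
    exact (Finset.single_le_sum (fun _ _ => Nat.zero_le _) (Finset.mem_univ h)).trans hα
  let μ : (κ → ℕ) → ℝ := fun α => ∑ i, ∏ h, x i h ^ α h
  -- A minimiser of the penalised functional has at most T distinct points. Since the given family
  -- has moment error 0, comparison with it bounds the moment error by η times its penalty.
  have hfew : ∀ η : ℝ, 0 < η → ∃ (γ : ι → Fin T) (u : Fin T → κ → ℝ),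
      (∀ i h, lo h ≤ u i h ∧ u i h ≤ hi h) ∧
      ∑ α ∈ A, (∑ i, ∏ h, u (γ i) h ^ α h - μ α) ^ 2 ≤ η * ∑ i, ∑ h, x i h ^ (R + 1) := by
    intro η hη
    obtain ⟨y, hy, hmin⟩ := (isCompact_box (γ := ι) lo hi).exists_isMinOn ⟨x, hx⟩
      (continuous_momentPenalty A R μ η).continuousOn
    have hcard := card_image_le_of_isMinOn A R (fun α hα => (hA α).mp hα) μ hη lo hi y hy
      (fun z hz => hmin hz) (Finset.univ.image y) (by simp)
    let e := (Finset.univ.image y).equivFin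
    have hmem : ∀ i, y i ∈ Finset.univ.image y := fun i =>
      Finset.mem_image_of_mem _ (Finset.mem_univ i)
    refine ⟨fun i => Fin.castLE hcard (e ⟨y i, hmem i⟩), fun t =>
      -- If there are fewer than T points, the list is padded with one that lies in the box.
      if ht : (t : ℕ) < (Finset.univ.image y).card then (e.symm ⟨t, ht⟩).1 else y i₀, ?_, ?_⟩
    · intro t h
      dsimp only
      split_ifs with ht
      · obtain ⟨i, -, hi⟩ := Finset.mem_image.mp (e.symm ⟨t, ht⟩).2
        rw [← hi]
        exact hy i h
      · exact hy i₀ h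
    · have h1 := hmin hx
      have h2 : ∑ α ∈ A, (∑ i, ∏ h, x i h ^ α h - μ α) ^ 2 = 0 :=
        Finset.sum_eq_zero fun α _ => by simp [μ]
      have h3 : 0 ≤ η * ∑ i, ∑ h, y i h ^ (R + 1) :=
        mul_nonneg hη.le (Finset.sum_nonneg fun i _ => Finset.sum_nonneg fun h _ =>
          pow_nonneg ((hlo h).trans (hy i h).1) _)
      simp only [Set.mem_ofPred_eq, momentPenalty, h2, zero_add] at h1
      simp only [Fin.val_castLE, Fin.is_lt, dif_pos, Fin.eta, Equiv.symm_apply_apply]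
      linarith
  have hmin : ∀ γ : ι → Fin T, ∃ u : Fin T → κ → ℝ, (∀ i h, lo h ≤ u i h ∧ u i h ≤ hi h) ∧
      ∀ u' : Fin T → κ → ℝ, (∀ i h, lo h ≤ u' i h ∧ u' i h ≤ hi h) →
        ∑ α ∈ A, (∑ i, ∏ h, u (γ i) h ^ α h - μ α) ^ 2 ≤
          ∑ α ∈ A, (∑ i, ∏ h, u' (γ i) h ^ α h - μ α) ^ 2 := by
    intro γ
    obtain ⟨u, hu, hu'⟩ := (isCompact_box (γ := Fin T) lo hi).exists_isMinOn ⟨fun _ => x i₀, fun _ => hx i₀⟩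
      (f := fun u => ∑ α ∈ A, (∑ i, ∏ h, u (γ i) h ^ α h - μ α) ^ 2)
      (Continuous.continuousOn (by fun_prop))
    exact ⟨u, hu, fun u' h => hu' h⟩
  choose U hU hUmin using hmin
  have hT : 0 < T := pow_pos (by omega) _
  obtain ⟨γ, -, hγ⟩ := Finset.exists_min_image (Finset.univ : Finset (ι → Fin T))
    (fun γ => ∑ α ∈ A, (∑ i, ∏ h, U γ (γ i) h ^ α h - μ α) ^ 2)
    ⟨fun _ => ⟨0, hT⟩, Finset.mem_univ _⟩
  -- There are finitely many assignments γ of players to T points, and for each the error attains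
  -- its minimum by compactness. The least of these minima is below η times a constant for every η >
  -- 0, hence zero. This replaces a limit η → 0.
  have hzero : ∑ α ∈ A, (∑ i, ∏ h, U γ (γ i) h ^ α h - μ α) ^ 2 ≤ 0 := by
    by_contra! hpos
    set w := ∑ α ∈ A, (∑ i, ∏ h, U γ (γ i) h ^ α h - μ α) ^ 2 with hw
    have hC : 0 ≤ ∑ i, ∑ h, x i h ^ (R + 1) := Finset.sum_nonneg fun i _ =>
      Finset.sum_nonneg fun h _ => pow_nonneg ((hlo h).trans (hx i h).1) _
    set C := ∑ i, ∑ h, x i h ^ (R + 1)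
    obtain ⟨γ', u, hu, hle⟩ := hfew (w / (C + 1)) (by positivity)
    have h1 := (hγ γ' (Finset.mem_univ _)).trans ((hUmin γ' u hu).trans hle)
    rw [div_mul_eq_mul_div, le_div_iff₀ (by positivity)] at h1
    linarith
  refine ⟨fun i => U γ (γ i), fun i => hU γ (γ i), fun α hα => ?_, ?_⟩
  · have h1 := (Finset.sum_eq_zero_iff_of_nonneg fun α _ => sq_nonneg _).mp
      (le_antisymm hzero (Finset.sum_nonneg fun α _ => sq_nonneg _)) α ((hA α).mpr hα)
    exact sub_eq_zero.mp (pow_eq_zero_iff two_ne_zero |>.mp h1)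
  · calc _ ≤ (Set.range (U γ)).ncard :=
          Set.ncard_le_ncard (Set.range_comp_subset_range γ (U γ)) (Set.finite_range _)
      _ ≤ T := by
          rw [← Set.image_univ]
          refine (Set.ncard_image_le Set.finite_univ).trans ?_
          rw [Set.ncard_univ, Nat.card_eq_fintype_card, Fintype.card_fin]

end FewTypes

/-! ### Replacing a family of vectors by few grid vectors with nearby first and second moments -/

section GridTypes

variable {k : ℕ}

/-- A vector together with its matrix of second moments. -/
def momentPoint (g : Fin k → ℝ) : (Fin k → ℝ) × (Fin k → Fin k → ℝ) :=
  (g, fun h h' => g h * g h')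

theorem sum_prod_bool (F : Fin k → Bool → ℝ) :
    ∑ b : Fin k → Bool, ∏ j, F j (b j) = ∏ j, (F j true + F j false) := by
  have := Finset.prod_univ_sum (fun _ : Fin k => (Finset.univ : Finset Bool)) F
  rw [Fintype.piFinset_univ] at this
  rw [← this]
  exact Finset.prod_congr rfl fun j _ => by rw [Fintype.sum_bool]

/-- Unbiased rounding to a grid. -/
theorem exists_rounding_mem_convexHull {D : ℕ} (hD : 0 < D) (z : Fin k → ℝ) (hz0 : ∀ h, 0 ≤ z h)
    (hz1 : ∀ h, z h ≤ 1) (S : Set (Fin k → ℝ))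
    (hS : ∀ n : Fin k → ℕ, (∀ h, (n h : ℝ) / D ≤ z h + 1 / D) → (∀ h, n h ≤ D) →
      (∀ h, z h = 0 → n h = 0) → (fun h => (n h : ℝ) / D) ∈ S) :
    ∃ e : Fin k → ℝ, (∀ h, 0 ≤ e h ∧ e h ≤ z h / D) ∧
      ((z, fun h h' => z h * z h' + if h = h' then e h else 0) :
        (Fin k → ℝ) × (Fin k → Fin k → ℝ)) ∈ convexHull ℝ (momentPoint '' S) := by
  have hD' : (0 : ℝ) < D := by exact_mod_cast hD
  -- Independently, coordinate h is rounded up with probability f h and down otherwise. Means and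
  -- mixed second moments are preserved, and a diagonal second moment grows by the variance f(1 -
  -- f)/D² ≤ z/D.
  let f : Fin k → ℝ := fun h => D * z h - ⌊D * z h⌋₊
  have hDz : ∀ h, 0 ≤ D * z h := fun h => mul_nonneg hD'.le (hz0 h)
  have hf0 : ∀ h, 0 ≤ f h := fun h => sub_nonneg.mpr (Nat.floor_le (hDz h))
  have hf1 : ∀ h, f h ≤ 1 := fun h => by
    have := (Nat.lt_floor_add_one (D * z h)).le
    simp only [f]
    linarith
  let N : Fin k → Bool → ℕ := fun h b => if b then ⌈D * z h⌉₊ else ⌊D * z h⌋₊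
  let w : Fin k → Bool → ℝ := fun h b => if b then f h else 1 - f h
  have hw0 : ∀ h b, 0 ≤ w h b := by
    intro h b
    cases b
    · simpa [w] using hf1 h
    · simpa [w] using hf0 h
  have hw1 : ∀ h, w h true + w h false = 1 := fun h => by simp [w]
  -- The ceiling is the floor plus one unless f h = 0, where the factor f h makes both sides vanish.
  have hceil : ∀ h, f h * ⌈D * z h⌉₊ = f h * (⌊D * z h⌋₊ + 1) := by
    intro h
    rcases eq_or_lt_of_le (hf0 h) with h0 | h0
    · rw [← h0, zero_mul, zero_mul]
    · have h1 : (⌊D * z h⌋₊ : ℝ) < D * z h := sub_pos.mp h0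
      have h2 : ⌈D * z h⌉₊ = ⌊D * z h⌋₊ + 1 := by
        refine le_antisymm (Nat.ceil_le_floor_add_one _) ?_
        exact Nat.succ_le_of_lt (Nat.lt_ceil.mpr h1)
      rw [h2]
      push_cast
      ring
  have hmean : ∀ h, w h true * ((N h true : ℝ) / D) + w h false * ((N h false : ℝ) / D) = z h := by
    intro h
    have h1 := hceil h
    simp only [w, N, if_true, Bool.false_eq_true, if_false]
    rw [← mul_div_assoc, ← mul_div_assoc, ← add_div, h1, div_eq_iff hD'.ne']
    simp only [f]
    ring
  let e : Fin k → ℝ := fun h => f h * (1 - f h) / D ^ 2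
  have hsq : ∀ h, w h true * ((N h true : ℝ) / D * ((N h true : ℝ) / D)) +
      w h false * ((N h false : ℝ) / D * ((N h false : ℝ) / D)) = z h * z h + e h := by
    intro h
    have h1 := hceil h
    have h2 : f h * ((⌈D * z h⌉₊ : ℝ) * ⌈D * z h⌉₊) =
        f h * ((⌊D * z h⌋₊ + 1) * (⌊D * z h⌋₊ + 1)) := by
      rw [← mul_assoc, h1, mul_right_comm, h1]
      ring
    simp only [w, N, if_true, Bool.false_eq_true, if_false, e]
    field_simp
    have h3 : (⌊D * z h⌋₊ : ℝ) = D * z h - f h := by simp only [f]; ring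
    have h4 : f h * (⌈D * z h⌉₊ : ℝ) ^ 2 = f h * (⌊D * z h⌋₊ + 1) ^ 2 := by
      rw [sq, sq, h2]
    rw [h4, h3]
    ring
  refine ⟨e, fun h => ⟨?_, ?_⟩, ?_⟩
  · exact div_nonneg (mul_nonneg (hf0 h) (sub_nonneg.mpr (hf1 h))) (by positivity)
  · simp only [e]
    rw [div_le_div_iff₀ (by positivity) hD']
    have h1 : f h ≤ D * z h := sub_le_self _ (Nat.cast_nonneg _)
    have h2 : f h * (1 - f h) ≤ D * z h := by nlinarith [hf0 h]
    calc f h * (1 - f h) * D ≤ D * z h * D := mul_le_mul_of_nonneg_right h2 hD'.le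
      _ = z h * D ^ 2 := by ring
  · let W : (Fin k → Bool) → ℝ := fun b => ∏ j, w j (b j)
    let g : (Fin k → Bool) → Fin k → ℝ := fun b h => (N h (b h) : ℝ) / D
    have hW0 : ∀ b, 0 ≤ W b := fun b => Finset.prod_nonneg fun j _ => hw0 j _
    have hW1 : ∑ b, W b = 1 := by
      simp only [W]
      rw [sum_prod_bool]
      exact Finset.prod_eq_one fun j _ => hw1 j
    have hWg : ∀ h, ∑ b, W b * g b h = z h := by
      intro h
      have e1 : ∀ b, W b * g b h = ∏ j, (w j (b j) * if j = h then (N j (b j) : ℝ) / D else 1) := by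
        intro b
        rw [Finset.prod_mul_distrib, Finset.prod_ite_eq' Finset.univ h, if_pos (Finset.mem_univ h)]
      simp_rw [e1]
      rw [sum_prod_bool fun j b => w j b * if j = h then (N j b : ℝ) / D else 1,
        Fintype.prod_eq_single h]
      · simpa using hmean h
      · intro j hj
        simp [hj, hw1]
    have hWgg : ∀ h h', ∑ b, W b * (g b h * g b h') = z h * z h' + if h = h' then e h else 0 := by
      intro h h'
      by_cases hh : h = h'
      · subst hh
        have e1 : ∀ b, W b * (g b h * g b h) =
            ∏ j, (w j (b j) * if j = h then (N j (b j) : ℝ) / D * ((N j (b j) : ℝ) / D) else 1) := by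
          intro b
          rw [Finset.prod_mul_distrib, Finset.prod_ite_eq' Finset.univ h,
            if_pos (Finset.mem_univ h)]
        simp_rw [e1]
        rw [sum_prod_bool fun j b => w j b *
            if j = h then (N j b : ℝ) / D * ((N j b : ℝ) / D) else 1, Fintype.prod_eq_single h]
        · simpa using hsq h
        · intro j hj
          simp [hj, hw1]
      · have e1 : ∀ b, W b * (g b h * g b h') = ∏ j, (w j (b j) *
            ((if j = h then (N j (b j) : ℝ) / D else 1) *
              if j = h' then (N j (b j) : ℝ) / D else 1)) := by
          intro b
          rw [Finset.prod_mul_distrib, Finset.prod_mul_distrib,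
            Finset.prod_ite_eq' Finset.univ h, Finset.prod_ite_eq' Finset.univ h',
            if_pos (Finset.mem_univ h), if_pos (Finset.mem_univ h')]
        simp_rw [e1]
        rw [sum_prod_bool fun j b => w j b * ((if j = h then (N j b : ℝ) / D else 1) *
              if j = h' then (N j b : ℝ) / D else 1), Fintype.prod_eq_mul h h' hh]
        · have h1 := hmean h
          have h2 := hmean h'
          simp only [if_true, if_neg hh, if_neg (Ne.symm hh), mul_one, one_mul, add_zero]
          rw [h1, h2]
        · intro j hj
          simp [hj.1, hj.2, hw1]
    have hmem := (convex_convexHull ℝ (momentPoint '' S)).sum_mem (t := Finset.univ)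
      (fun b _ => hW0 b) hW1 (z := fun b => momentPoint (g b)) fun b _ =>
        subset_convexHull ℝ _ (Set.mem_image_of_mem _ (hS (fun h => N h (b h)) ?_ ?_ ?_))
    · convert hmem using 1
      refine Prod.ext ?_ ?_
      · ext h
        simp only [Prod.fst_sum, Prod.smul_fst, Finset.sum_apply, Pi.smul_apply, smul_eq_mul,
          momentPoint]
        exact (hWg h).symm
      · ext h h'
        simp only [Prod.snd_sum, Prod.smul_snd, Finset.sum_apply, Pi.smul_apply, smul_eq_mul,
          momentPoint]
        exact (hWgg h h').symm
    · intro h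
      rw [div_le_iff₀ hD', add_mul, div_mul_cancel₀ _ hD'.ne', mul_comm (z h)]
      simp only [N]
      split_ifs
      · exact (Nat.ceil_lt_add_one (hDz h)).le
      · exact (Nat.floor_le (hDz h)).trans (by linarith)
    · intro h
      have h1 : D * z h ≤ (D : ℕ) := mul_le_of_le_one_right hD'.le (hz1 h)
      simp only [N]
      split_ifs
      · exact Nat.ceil_le.mpr h1
      · exact Nat.floor_le_of_le h1
    · intro h hh
      simp [N, hh]

/-- The number of atoms in `exists_grid_types`. -/
def gridTypeCount (k : ℕ) : ℕ := k + k ^ 2 + 1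

/-- After unbiased rounding, the average of the pairs (vector, second moments) lies in the convex
hull of the pairs of grid vectors, in dimension k + k². Carathéodory's theorem leaves k + k² + 1
atoms. Rounding the multiplicities down costs at most one player per atom; players left over get the
zero vector, which is the extra type. -/
theorem exists_grid_types {ι : Type*} [Fintype ι] {D : ℕ} (hD : 0 < D) (z : ι → Fin k → ℝ)
    (hz0 : ∀ i h, 0 ≤ z i h) (hz1 : ∀ i h, z i h ≤ 1) {g : ℝ} (hg : ∀ i, ∑ h, z i h ≤ g) :
    ∃ z' : ι → Fin k → ℝ, (∀ i, ∃ n : Fin k → ℕ, z' i = fun h => (n h : ℝ) / D) ∧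
      (∀ i h, z' i h ≤ 1) ∧ (∀ h, (∀ i, z i h = 0) → ∀ i, z' i h = 0) ∧
      (∀ i, (z' i = 0 ∨ ∑ h, z' i h ≤ g + k / D)) ∧
      (Set.range z').ncard ≤ gridTypeCount k + 1 ∧
      (∀ h, |∑ i, z' i h - ∑ i, z i h| ≤ gridTypeCount k) ∧
      (∀ h h', |∑ i, z' i h * z' i h' - ∑ i, z i h * z i h'| ≤
        gridTypeCount k + if h = h' then (∑ i, z i h) / D else 0) := by
  classical
  rcases isEmpty_or_nonempty ι with hι | hι
  · refine ⟨z, isEmptyElim, isEmptyElim, fun _ _ => isEmptyElim, isEmptyElim, ?_, ?_, ?_⟩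
    · simp [Set.range_eq_empty]
    · simp
    · simp
  have hD' : (0 : ℝ) < D := by exact_mod_cast hD
  let S : Set (Fin k → ℝ) := {x | (∃ n : Fin k → ℕ, x = fun h => (n h : ℝ) / D) ∧
    (∀ h, x h ≤ 1) ∧ (∀ h, (∀ i, z i h = 0) → x h = 0) ∧ ∑ h, x h ≤ g + k / D}
  have hround := fun i => exists_rounding_mem_convexHull hD (z i) (hz0 i) (hz1 i) S (by
    intro n h1 h2 h3
    refine ⟨⟨n, rfl⟩, fun h => ?_, fun h hh => ?_, ?_⟩
    · rw [div_le_one hD']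
      exact_mod_cast h2 h
    · simp [h3 h (hh i)]
    · refine (Finset.sum_le_sum fun h _ => h1 h).trans ?_
      rw [Finset.sum_add_distrib, Finset.sum_const, Finset.card_univ, Fintype.card_fin,
        nsmul_eq_mul, mul_one_div]
      exact add_le_add_left (hg i) _)
  choose e he hmem using hround
  let N : ℝ := Fintype.card ι
  have hN : 0 < N := by simp only [N]; exact_mod_cast Fintype.card_pos
  have havg := (convex_convexHull ℝ (momentPoint '' S)).sum_mem (t := Finset.univ)
    (w := fun _ : ι => N⁻¹) (fun i _ => by positivity) (by simp [N]) fun i _ => hmem i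
  obtain ⟨α, hα, P, w, hPS, hP, hw0, hw1, hwP⟩ := eq_pos_convex_span_of_mem_convexHull havg
  have hcard : Fintype.card α ≤ gridTypeCount k := by
    refine hP.card_le_finrank_succ.trans ?_
    refine Nat.succ_le_succ ((Submodule.finrank_le _).trans ?_)
    rw [Module.finrank_prod, Module.finrank_pi_fintype]
    simp [Module.finrank_pi_fintype, sq]
  choose p hp using fun a => (hPS ⟨a, rfl⟩ : P a ∈ momentPoint '' S)
  have hmean : ∀ h, ∑ a, N * w a * p a h = ∑ i, z i h := by
    intro h
    have := congrFun (congrArg Prod.fst hwP) h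
    simp only [Prod.fst_sum, Prod.smul_fst, Finset.sum_apply, Pi.smul_apply, smul_eq_mul,
      ← (hp _).2, momentPoint] at this
    rw [← Finset.mul_sum] at this
    simp_rw [mul_assoc]
    rw [← Finset.mul_sum, this, mul_inv_cancel_left₀ hN.ne']
  have hsec : ∀ h h', ∑ a, N * w a * (p a h * p a h') =
      ∑ i, z i h * z i h' + if h = h' then ∑ i, e i h else 0 := by
    intro h h'
    have := congrFun (congrFun (congrArg Prod.snd hwP) h) h'
    simp only [Prod.snd_sum, Prod.smul_snd, Finset.sum_apply, Pi.smul_apply, smul_eq_mul,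
      ← (hp _).2, momentPoint] at this
    rw [← Finset.mul_sum] at this
    simp_rw [mul_assoc (N)]
    rw [← Finset.mul_sum, this, mul_inv_cancel_left₀ hN.ne', Finset.sum_add_distrib]
    congr 1
    split_ifs <;> simp
  -- The multiplicity of an atom. Rounding down keeps the total at most the number of players, so
  -- disjoint sets of players can be chosen by an embedding.
  let c : α → ℕ := fun a => ⌊N * w a⌋₊
  have hNw : ∀ a, 0 ≤ N * w a := fun a => mul_nonneg hN.le (hw0 a).le
  have hcsum : Fintype.card (Σ a, Fin (c a)) ≤ Fintype.card ι := by
    rw [Fintype.card_sigma]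
    simp only [Fintype.card_fin]
    have : ((∑ a, c a : ℕ) : ℝ) ≤ N := by
      push_cast
      refine (Finset.sum_le_sum fun a _ => Nat.floor_le (hNw a)).trans_eq ?_
      rw [← Finset.mul_sum, hw1, mul_one]
    simp only [N] at this
    exact_mod_cast this
  obtain ⟨emb⟩ := Function.Embedding.nonempty_of_card_le hcsum
  let z' : ι → Fin k → ℝ := fun i =>
    if hi : ∃ s, emb s = i then p hi.choose.1 else 0
  have hz'emb : ∀ s, z' (emb s) = p s.1 := by
    intro s
    have hi : ∃ s', emb s' = emb s := ⟨s, rfl⟩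
    simp only [z']
    rw [dif_pos hi, emb.injective hi.choose_spec]
  have hz'not : ∀ i, (¬∃ s, emb s = i) → z' i = 0 := fun i hi => dif_neg hi
  have hz'cases : ∀ i, z' i = 0 ∨ ∃ a, z' i = p a := by
    intro i
    by_cases hi : ∃ s, emb s = i
    · obtain ⟨s, rfl⟩ := hi
      exact Or.inr ⟨s.1, hz'emb s⟩
    · exact Or.inl (hz'not i hi)
  have hsum : ∀ F : (Fin k → ℝ) → ℝ, F 0 = 0 → ∑ i, F (z' i) = ∑ a, c a * F (p a) := by
    intro F hF
    have h1 : ∑ i, F (z' i) = ∑ i ∈ Finset.univ.map emb, F (z' i) := by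
      refine (Finset.sum_subset (Finset.subset_univ _) fun i _ hi => ?_).symm
      rw [hz'not i fun ⟨s, hs⟩ => hi (Finset.mem_map.mpr ⟨s, Finset.mem_univ _, hs⟩), hF]
    rw [h1, Finset.sum_map]
    simp only [hz'emb]
    rw [Fintype.sum_sigma]
    simp
  have hdiff : ∀ F : (Fin k → ℝ) → ℝ, F 0 = 0 → (∀ a, 0 ≤ F (p a) ∧ F (p a) ≤ 1) →
      |∑ i, F (z' i) - ∑ a, N * w a * F (p a)| ≤ gridTypeCount k := by
    intro F hF hF1
    rw [hsum F hF, ← Finset.sum_sub_distrib]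
    refine (Finset.abs_sum_le_sum_abs _ _).trans ?_
    have : ∀ a, |(c a : ℝ) * F (p a) - N * w a * F (p a)| ≤ 1 := by
      intro a
      rw [← sub_mul, abs_mul, abs_of_nonneg (hF1 a).1]
      refine mul_le_one₀ ?_ (hF1 a).1 (hF1 a).2
      rw [abs_sub_comm, abs_of_nonneg (sub_nonneg.mpr (Nat.floor_le (hNw a)))]
      have := (Nat.lt_floor_add_one (N * w a)).le
      linarith
    refine (Finset.sum_le_sum fun a _ => this a).trans ?_
    rw [Finset.sum_const, Finset.card_univ, nsmul_eq_mul, mul_one]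
    exact_mod_cast hcard
  have hp0 : ∀ a h, 0 ≤ p a h := by
    intro a h
    obtain ⟨n, hn⟩ := (hp a).1.1
    rw [hn]
    positivity
  have hp1 : ∀ a h, p a h ≤ 1 := fun a => (hp a).1.2.1
  refine ⟨z', fun i => ?_, fun i h => ?_, fun h hh i => ?_, fun i => ?_, ?_, fun h => ?_,
    fun h h' => ?_⟩
  · rcases hz'cases i with h0 | ⟨a, ha⟩
    · exact ⟨0, by rw [h0]; ext; simp⟩
    · rw [ha]
      exact (hp a).1.1
  · rcases hz'cases i with h0 | ⟨a, ha⟩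
    · rw [h0]; exact zero_le_one
    · rw [ha]; exact hp1 a h
  · rcases hz'cases i with h0 | ⟨a, ha⟩
    · rw [h0]; rfl
    · rw [ha]; exact (hp a).1.2.2.1 h hh
  · rcases hz'cases i with h0 | ⟨a, ha⟩
    · exact Or.inl h0
    · rw [ha]; exact Or.inr (hp a).1.2.2.2
  · have : Set.range z' ⊆ insert 0 (Set.range p) := by
      rintro _ ⟨i, rfl⟩
      rcases hz'cases i with h0 | ⟨a, ha⟩
      · exact Or.inl h0
      · exact Or.inr ⟨a, ha.symm⟩
    refine (Set.ncard_le_ncard this ((Set.finite_range p).insert 0)).trans ?_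
    refine (Set.ncard_insert_le _ _).trans (Nat.succ_le_succ ?_)
    rw [← Set.image_univ]
    refine (Set.ncard_image_le Set.finite_univ).trans ?_
    rwa [Set.ncard_univ, Nat.card_eq_fintype_card]
  · rw [← hmean h]
    exact hdiff (fun x => x h) rfl fun a => ⟨hp0 a h, hp1 a h⟩
  · have h1 := hdiff (fun x => x h * x h') (by simp) fun a =>
      ⟨mul_nonneg (hp0 a h) (hp0 a h'), mul_le_one₀ (hp1 a h) (hp0 a h') (hp1 a h')⟩
    rw [hsec] at h1
    have h2 : |if h = h' then ∑ i, e i h else 0| ≤ if h = h' then (∑ i, z i h) / D else 0 := by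
      split_ifs
      · rw [abs_of_nonneg (Finset.sum_nonneg fun i _ => (he i h).1), Finset.sum_div]
        exact Finset.sum_le_sum fun i _ => (he i h).2
      · rw [abs_zero]
    have h3 := abs_add_le (∑ i, z' i h * z' i h' - (∑ i, z i h * z i h' +
      if h = h' then ∑ i, e i h else 0)) (if h = h' then ∑ i, e i h else 0)
    rw [← sub_sub, sub_add_cancel] at h3
    rw [← sub_sub] at h1
    linarith

end GridTypes

/-! ### Comparing two families through their moments -/

section Compare

variable {ι : Type} [Fintype ι] {k : ℕ}

theorem norm_linear_le (c : Fin k → ℂ) (w : Fin k → ℝ) (hw : ∀ h, 0 ≤ w h) {a : ℝ}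
    (hc : ∀ h, w h ≠ 0 → ‖c h‖ ≤ a) : ‖∑ h, (w h : ℂ) * c h‖ ≤ a * ∑ h, w h := by
  rw [Finset.mul_sum]
  refine (norm_sum_le _ _).trans (Finset.sum_le_sum fun h _ => ?_)
  rw [norm_mul, Complex.norm_real, Real.norm_of_nonneg (hw h), mul_comm]
  by_cases h0 : w h = 0
  · simp [h0]
  · exact mul_le_mul_of_nonneg_right (hc h h0) (hw h)

/-- The j-th power of a linear form expands over words of length j in the coordinates; a word
contributes the monomial of its letter counts, which has degree j. -/
theorem sum_linear_pow_eq (c : Fin k → ℂ) (b b' : ι → Fin k → ℝ) {R j : ℕ} (hj : j ≤ R)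
    (hmom : ∀ α : Fin k → ℕ, ∑ h, α h ≤ R → ∑ i, ∏ h, b' i h ^ α h = ∑ i, ∏ h, b i h ^ α h) :
    ∑ i, (∑ h, (b' i h : ℂ) * c h) ^ j = ∑ i, (∑ h, (b i h : ℂ) * c h) ^ j := by
  simp_rw [Fintype.sum_pow, Finset.prod_mul_distrib]
  rw [Finset.sum_comm, Finset.sum_comm (s := Finset.univ (α := ι))]
  refine Finset.sum_congr rfl fun f _ => ?_
  rw [← Finset.sum_mul, ← Finset.sum_mul]
  congr 1
  let α : Fin k → ℕ := fun h => (Finset.univ.filter fun t => f t = h).card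
  have hα : ∑ h, α h ≤ R := by
    have : ∑ h, α h = j := by
      simp only [α]
      rw [← Finset.card_eq_sum_card_fiberwise (f := f) (s := Finset.univ) (t := Finset.univ)
        (fun _ _ => Finset.mem_coe.mpr (Finset.mem_univ _)), Finset.card_univ, Fintype.card_fin]
    omega
  have e : ∀ w : Fin k → ℝ, ∏ t, (w (f t) : ℂ) = ((∏ h, w h ^ α h : ℝ) : ℂ) := by
    intro w
    rw [← Finset.prod_fiberwise_of_maps_to (s := Finset.univ) (t := Finset.univ) (g := f)
      (fun _ _ => Finset.mem_univ _), Complex.ofReal_prod]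
    refine Finset.prod_congr rfl fun h _ => ?_
    rw [Finset.prod_congr rfl fun t ht => by rw [(Finset.mem_filter.mp ht).2], Finset.prod_const,
      Complex.ofReal_pow]
  simp_rw [e]
  exact_mod_cast hmom α hα

/-- Equal power sums up to R make the Taylor polynomials cancel. In the remainder |x|^(R+1) two
factors are kept for the sum of squares, so that the number of players does not enter. -/
theorem norm_sum_log_sub_le (x y : ι → ℂ) {R : ℕ} (hR : 1 ≤ R) {q r : ℝ} (hq : 2 ≤ q)
    (hx : ∀ i, ‖x i‖ ≤ 1 / q) (hy : ∀ i, ‖y i‖ ≤ 1 / q) (hxr : ∑ i, ‖x i‖ ^ 2 ≤ r)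
    (hyr : ∑ i, ‖y i‖ ^ 2 ≤ r) (hxy : ∀ j ≤ R, ∑ i, y i ^ j = ∑ i, x i ^ j) :
    ‖∑ i, Complex.log (1 + x i) - ∑ i, Complex.log (1 + y i)‖ ≤ 4 * r * (1 / q) ^ (R - 1) := by
  have hq' : 1 / q ≤ 1 / 2 := one_div_le_one_div_of_le two_pos hq
  have hq0 : 0 ≤ 1 / q := by positivity
  have h1 : ∀ x : ι → ℂ, (∀ i, ‖x i‖ ≤ 1 / q) → ∑ i, ‖x i‖ ^ 2 ≤ r →
      ‖∑ i, Complex.log (1 + x i) - ∑ i, Complex.logTaylor (R + 1) (x i)‖ ≤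
        2 * r * (1 / q) ^ (R - 1) := by
    intro x hx hxr
    rw [← Finset.sum_sub_distrib]
    refine (norm_sum_le _ _).trans ?_
    have : ∀ i, ‖Complex.log (1 + x i) - Complex.logTaylor (R + 1) (x i)‖ ≤
        ‖x i‖ ^ 2 * (2 * (1 / q) ^ (R - 1)) := by
      intro i
      refine (norm_log_sub_logTaylor_le_pow R ((hx i).trans hq')).trans ?_
      have : R + 1 = 2 + (R - 1) := by omega
      rw [this, pow_add]
      have := pow_le_pow_left₀ (norm_nonneg (x i)) (hx i) (R - 1)
      have h0 : 0 ≤ ‖x i‖ ^ 2 := by positivity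
      nlinarith [mul_le_mul_of_nonneg_left this h0]
    refine (Finset.sum_le_sum fun i _ => this i).trans ?_
    rw [← Finset.sum_mul]
    have h0 : 0 ≤ 2 * (1 / q) ^ (R - 1) := by positivity
    nlinarith [mul_le_mul_of_nonneg_right hxr h0]
  have h2 : ∑ i, Complex.logTaylor (R + 1) (x i) = ∑ i, Complex.logTaylor (R + 1) (y i) := by
    simp only [Complex.logTaylor]
    rw [Finset.sum_comm, Finset.sum_comm (s := Finset.univ (α := ι))]
    refine Finset.sum_congr rfl fun j hj => ?_
    rw [← Finset.sum_div, ← Finset.sum_div, ← Finset.mul_sum, ← Finset.mul_sum,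
      hxy j (Nat.lt_succ_iff.mp (Finset.mem_range.mp hj))]
  have e : ∑ i, Complex.log (1 + x i) - ∑ i, Complex.log (1 + y i) =
      (∑ i, Complex.log (1 + x i) - ∑ i, Complex.logTaylor (R + 1) (x i)) -
      (∑ i, Complex.log (1 + y i) - ∑ i, Complex.logTaylor (R + 1) (y i)) := by
    rw [h2]
    ring
  rw [e]
  refine (norm_sub_le _ _).trans ?_
  linarith [h1 x hx hxr, h1 y hy hyr]

/-- After expansion only first and second moments appear. The error β is multiplied by |c| ≤ a. The
diagonal error grows with the mass `lam h` and is therefore paired with |c_h|², whose sum against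
`lam` is bounded by r. -/
theorem norm_quadratic_sub_le (c : Fin k → ℂ) (z z' : ι → Fin k → ℝ) {a β δ r : ℝ} (ha : 0 ≤ a)
    (hβ : 0 ≤ β) (P : Fin k → Prop) (hc : ∀ h, P h → ‖c h‖ ≤ a) (hz : ∀ h, ¬P h → ∀ i, z i h = 0)
    (hz' : ∀ h, ¬P h → ∀ i, z' i h = 0) (lam : Fin k → ℝ) (hlam : ∀ h, 0 ≤ lam h) (hδ : 0 ≤ δ)
    (hr : ∑ h, lam h * ‖c h‖ ^ 2 ≤ r) (h1 : ∀ h, |∑ i, z' i h - ∑ i, z i h| ≤ β)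
    (h2 : ∀ h h', |∑ i, z' i h * z' i h' - ∑ i, z i h * z i h'| ≤
      β + if h = h' then lam h * δ else 0) :
    ‖∑ i, ((∑ h, (z i h : ℂ) * c h) - (∑ h, (z i h : ℂ) * c h) ^ 2 / 2) -
      ∑ i, ((∑ h, (z' i h : ℂ) * c h) - (∑ h, (z' i h : ℂ) * c h) ^ 2 / 2)‖ ≤
      k * a * β + (k * a) ^ 2 * β + r * δ := by
  have e1 : ∀ z : ι → Fin k → ℝ, ∑ i, ∑ h, (z i h : ℂ) * c h =
      ∑ h, ((∑ i, z i h : ℝ) : ℂ) * c h := by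
    intro z
    rw [Finset.sum_comm]
    refine Finset.sum_congr rfl fun h _ => ?_
    rw [← Finset.sum_mul]
    push_cast
    rfl
  have e2 : ∀ z : ι → Fin k → ℝ, ∑ i, (∑ h, (z i h : ℂ) * c h) ^ 2 =
      ∑ h, ∑ h', ((∑ i, z i h * z i h' : ℝ) : ℂ) * (c h * c h') := by
    intro z
    simp_rw [sq, Finset.sum_mul_sum]
    rw [Finset.sum_comm]
    refine Finset.sum_congr rfl fun h _ => ?_
    rw [Finset.sum_comm]
    refine Finset.sum_congr rfl fun h' _ => ?_
    push_cast
    rw [Finset.sum_mul]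
    exact Finset.sum_congr rfl fun i _ => by ring
  have e : ∑ i, ((∑ h, (z i h : ℂ) * c h) - (∑ h, (z i h : ℂ) * c h) ^ 2 / 2) -
      ∑ i, ((∑ h, (z' i h : ℂ) * c h) - (∑ h, (z' i h : ℂ) * c h) ^ 2 / 2) =
      (∑ h, ((∑ i, z i h - ∑ i, z' i h : ℝ) : ℂ) * c h) -
      (∑ h, ∑ h', ((∑ i, z i h * z i h' - ∑ i, z' i h * z' i h' : ℝ) : ℂ) * (c h * c h')) / 2 := by
    rw [Finset.sum_sub_distrib, Finset.sum_sub_distrib, ← Finset.sum_div, ← Finset.sum_div, e1, e1,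
      e2, e2]
    simp only [Complex.ofReal_sub, sub_mul, Finset.sum_sub_distrib]
    ring
  rw [e]
  refine (norm_sub_le _ _).trans ?_
  have hA : ‖∑ h, ((∑ i, z i h - ∑ i, z' i h : ℝ) : ℂ) * c h‖ ≤ k * a * β := by
    have hsum : (k : ℝ) * a * β = ∑ _h : Fin k, a * β := by simp [mul_assoc]
    rw [hsum]
    refine norm_sum_le_of_le _ fun h _ => ?_
    by_cases hP : P h
    · rw [norm_mul, Complex.norm_real, Real.norm_eq_abs, abs_sub_comm, mul_comm]
      exact mul_le_mul (hc h hP) (h1 h) (abs_nonneg _) ha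
    · simp only [hz h hP, hz' h hP]
      simp
      positivity
  have hB : ‖∑ h, ∑ h', ((∑ i, z i h * z i h' - ∑ i, z' i h * z' i h' : ℝ) : ℂ) * (c h * c h')‖ ≤
      (k * a) ^ 2 * β + r * δ := by
    have hterm : ∀ h h', ‖((∑ i, z i h * z i h' - ∑ i, z' i h * z' i h' : ℝ) : ℂ) *
        (c h * c h')‖ ≤ a * a * β + if h = h' then lam h * ‖c h‖ ^ 2 * δ else 0 := by
      intro h h'
      have hif : 0 ≤ if h = h' then lam h * ‖c h‖ ^ 2 * δ else 0 := by
        split_ifs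
        · exact mul_nonneg (mul_nonneg (hlam h) (sq_nonneg _)) hδ
        · exact le_rfl
      by_cases hP : P h ∧ P h'
      · rw [norm_mul, Complex.norm_real, Real.norm_eq_abs, abs_sub_comm, norm_mul]
        refine (mul_le_mul_of_nonneg_right (h2 h h') (by positivity)).trans ?_
        rw [add_mul]
        refine add_le_add ?_ ?_
        · rw [mul_comm]
          exact mul_le_mul_of_nonneg_right (mul_le_mul (hc h hP.1) (hc h' hP.2) (norm_nonneg _) ha)
            hβ
        · split_ifs with hh
          · subst hh
            exact le_of_eq (by ring)
          · rw [zero_mul]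
      · have h0 : ∑ i, z i h * z i h' - ∑ i, z' i h * z' i h' = 0 := by
          rcases not_and_or.mp hP with hP | hP
          · simp [hz h hP, hz' h hP]
          · simp [hz h' hP, hz' h' hP]
        rw [h0, Complex.ofReal_zero, zero_mul, norm_zero]
        positivity
    refine (norm_sum_le_of_le _ fun h _ => norm_sum_le_of_le _ fun h' _ => hterm h h').trans ?_
    simp only [Finset.sum_add_distrib, Finset.sum_const, Finset.card_univ, Fintype.card_fin,
      nsmul_eq_mul, Finset.sum_ite_eq, Finset.mem_univ, if_true]
    rw [← Finset.sum_mul]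
    have := mul_le_mul_of_nonneg_right hr hδ
    refine add_le_add (le_of_eq (by ring)) this
  rw [norm_div, Complex.norm_ofNat]
  have : 0 ≤ (k * a) ^ 2 * β + r * δ := (norm_nonneg _).trans hB
  linarith

theorem exists_log_sum_split (b u z : ι → ℂ) (hb : ∀ i, ‖b i‖ ≤ 1 / 8) (hu : ∀ i, ‖u i‖ ≤ 1 / 8)
    (hz : ∀ i, ‖z i‖ ≤ 1 / 8) :
    ∃ T : ℂ, ∏ i, (1 + (b i + u i + z i)) = Complex.exp T ∧
      ‖T - (∑ i, Complex.log (1 + b i) + ∑ i, u i + ∑ i, (z i - z i ^ 2 / 2))‖ ≤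
        4 * ∑ i, (‖b i‖ * ‖u i‖ + ‖b i‖ * ‖z i‖ + ‖u i‖ * ‖z i‖ + ‖u i‖ ^ 2 + ‖z i‖ ^ 3) := by
  choose T hT hT' using fun i => exists_log_split (hb i) (hu i) (hz i)
  refine ⟨∑ i, T i, ?_, ?_⟩
  · rw [Complex.exp_sum]
    exact Finset.prod_congr rfl fun i _ => (hT i).symm
  · rw [← Finset.sum_add_distrib, ← Finset.sum_add_distrib, ← Finset.sum_sub_distrib,
      Finset.mul_sum]
    exact norm_sum_le_of_le _ fun i _ => hT' i

end Compare

/-! ### Comparing two families of sub-probability vectors -/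

section Core

variable {ι : Type} [Fintype ι] {k : ℕ}

theorem sum_mul_le_mul_sum {f g : ι → ℝ} {c : ℝ} (hf : ∀ i, f i ≤ c) (hg : ∀ i, 0 ≤ g i) :
    ∑ i, f i * g i ≤ c * ∑ i, g i := by
  rw [Finset.mul_sum]
  exact Finset.sum_le_sum fun i _ => mul_le_mul_of_nonneg_right (hf i) (hg i)

theorem sum_mul_norm_le {x y : ι → ℂ} {c A : ℝ} (hc : 0 ≤ c) (hy : ∀ i, ‖y i‖ ≤ c)
    (hx : ∑ i, ‖x i‖ ≤ A) : ∑ i, ‖x i‖ * ‖y i‖ ≤ c * A := by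
  calc ∑ i, ‖x i‖ * ‖y i‖ = ∑ i, ‖y i‖ * ‖x i‖ := Finset.sum_congr rfl fun i _ => mul_comm _ _
    _ ≤ c * ∑ i, ‖x i‖ := sum_mul_le_mul_sum hy fun i => norm_nonneg _
    _ ≤ c * A := mul_le_mul_of_nonneg_left hx hc

theorem sum_norm_cube_le {x : ι → ℂ} {c r : ℝ} (hc : 0 ≤ c) (hx : ∀ i, ‖x i‖ ≤ c)
    (hr : ∑ i, ‖x i‖ ^ 2 ≤ r) : ∑ i, ‖x i‖ ^ 3 ≤ c * r := by
  calc ∑ i, ‖x i‖ ^ 3 = ∑ i, ‖x i‖ * ‖x i‖ ^ 2 := Finset.sum_congr rfl fun i _ => by ring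
    _ ≤ c * ∑ i, ‖x i‖ ^ 2 := sum_mul_le_mul_sum hx fun i => sq_nonneg _
    _ ≤ c * r := mul_le_mul_of_nonneg_left hr hc

/-- The three main terms of `exists_log_sum_split` are compared separately: the logarithms of b by
matched power sums, the sums of u exactly, the quadratic part of z by `hquad`. The error terms use
that u and z are uniformly small while b and u have ℓ¹ norm at most A. -/
theorem exists_log_pair (b u z b' u' z' : ι → ℂ) {q υ ζ A r Q : ℝ} {R : ℕ} (hR : 1 ≤ R)
    (hq : 8 ≤ q) (hυ0 : 0 ≤ υ) (hυ : υ ≤ 1 / 8) (hζ0 : 0 ≤ ζ) (hζ : ζ ≤ 1 / 8)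
    (hb : ∀ i, ‖b i‖ ≤ 1 / q) (hb' : ∀ i, ‖b' i‖ ≤ 1 / q) (hu : ∀ i, ‖u i‖ ≤ υ)
    (hu' : ∀ i, ‖u' i‖ ≤ υ) (hz : ∀ i, ‖z i‖ ≤ ζ) (hz' : ∀ i, ‖z' i‖ ≤ ζ)
    (hb2 : ∑ i, ‖b i‖ ^ 2 ≤ 2 * r) (hb2' : ∑ i, ‖b' i‖ ^ 2 ≤ 2 * r)
    (hz2 : ∑ i, ‖z i‖ ^ 2 ≤ 2 * r) (hz2' : ∑ i, ‖z' i‖ ^ 2 ≤ 2 * r)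
    (hbA : ∑ i, ‖b i‖ ≤ A) (huA : ∑ i, ‖u i‖ ≤ A) (huA' : ∑ i, ‖u' i‖ ≤ A)
    (hdisj : ∀ i, (b' i = 0 ∧ u' i = 0) ∨ (b' i = 0 ∧ z' i = 0) ∨ (u' i = 0 ∧ z' i = 0))
    (huu : ∑ i, u i = ∑ i, u' i) (hmom : ∀ j ≤ R, ∑ i, b' i ^ j = ∑ i, b i ^ j)
    (hquad : ‖∑ i, (z i - z i ^ 2 / 2) - ∑ i, (z' i - z' i ^ 2 / 2)‖ ≤ Q) :
    ∃ T T' : ℂ, ∏ i, (1 + (b i + u i + z i)) = Complex.exp T ∧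
      ∏ i, (1 + (b' i + u' i + z' i)) = Complex.exp T' ∧
      ‖T - T'‖ ≤ 12 * (υ * A) + 8 * (ζ * A) + 16 * (ζ * r) + 8 * r * (1 / q) ^ (R - 1) + Q := by
  have hq8 : 1 / q ≤ 1 / 8 := one_div_le_one_div_of_le (by norm_num) hq
  obtain ⟨T, hT, hTe⟩ := exists_log_sum_split b u z (fun i => (hb i).trans hq8)
    (fun i => (hu i).trans hυ) (fun i => (hz i).trans hζ)
  obtain ⟨T', hT', hTe'⟩ := exists_log_sum_split b' u' z' (fun i => (hb' i).trans hq8)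
    (fun i => (hu' i).trans hυ) (fun i => (hz' i).trans hζ)
  refine ⟨T, T', hT, hT', ?_⟩
  have hlogs := norm_sum_log_sub_le b b' hR (by linarith : (2 : ℝ) ≤ q) hb hb' hb2 hb2' hmom
  have hsq : ∀ u : ι → ℂ, (∀ i, ‖u i‖ ≤ υ) → ∑ i, ‖u i‖ ≤ A → ∑ i, ‖u i‖ ^ 2 ≤ υ * A := by
    intro u hu huA
    have := sum_mul_norm_le hυ0 hu huA
    simpa only [← pow_two] using this
  have hE : ∑ i, (‖b i‖ * ‖u i‖ + ‖b i‖ * ‖z i‖ + ‖u i‖ * ‖z i‖ + ‖u i‖ ^ 2 + ‖z i‖ ^ 3) ≤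
      2 * (υ * A) + 2 * (ζ * A) + 2 * (ζ * r) := by
    simp only [Finset.sum_add_distrib]
    have h1 := sum_mul_norm_le hυ0 hu hbA
    have h2 := sum_mul_norm_le hζ0 hz hbA
    have h3 := sum_mul_norm_le hζ0 hz huA
    have h4 := hsq u hu huA
    have h5 := sum_norm_cube_le hζ0 hz hz2
    linarith
  have hE' : ∑ i, (‖b' i‖ * ‖u' i‖ + ‖b' i‖ * ‖z' i‖ + ‖u' i‖ * ‖z' i‖ + ‖u' i‖ ^ 2 +
      ‖z' i‖ ^ 3) ≤ υ * A + 2 * (ζ * r) := by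
    -- In the new family each player carries only one of the three parts, so there are no cross
    -- terms.
    have h0 : ∀ i, ‖b' i‖ * ‖u' i‖ + ‖b' i‖ * ‖z' i‖ + ‖u' i‖ * ‖z' i‖ + ‖u' i‖ ^ 2 +
        ‖z' i‖ ^ 3 = ‖u' i‖ ^ 2 + ‖z' i‖ ^ 3 := by
      intro i
      rcases hdisj i with ⟨h1, h2⟩ | ⟨h1, h2⟩ | ⟨h1, h2⟩ <;> simp [h1, h2]
    simp only [h0, Finset.sum_add_distrib]
    have h4 := hsq u' hu' huA'
    have h5 := sum_norm_cube_le hζ0 hz' hz2'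
    linarith
  have htri : ‖T - T'‖ ≤
      ‖T - (∑ i, Complex.log (1 + b i) + ∑ i, u i + ∑ i, (z i - z i ^ 2 / 2))‖ +
      ‖T' - (∑ i, Complex.log (1 + b' i) + ∑ i, u' i + ∑ i, (z' i - z' i ^ 2 / 2))‖ +
      ‖∑ i, Complex.log (1 + b i) - ∑ i, Complex.log (1 + b' i)‖ +
      ‖∑ i, (z i - z i ^ 2 / 2) - ∑ i, (z' i - z' i ^ 2 / 2)‖ := by
    rw [huu]
    generalize ∑ i, (z i - z i ^ 2 / 2) = Z
    generalize ∑ i, (z' i - z' i ^ 2 / 2) = Z'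
    generalize ∑ i, Complex.log (1 + b i) = B
    generalize ∑ i, Complex.log (1 + b' i) = B'
    generalize ∑ i, u' i = V
    rw [show T - T' = (T - (B + V + Z)) - (T' - (B' + V + Z')) + (B - B') + (Z - Z') by ring]
    exact norm_add_le_of_le (norm_add_le_of_le (norm_sub_le _ _) le_rfl) le_rfl
  linarith

/-- The comparison for one test vector `c`. -/
theorem exists_log_pair_linear (b u z b' u' z' : ι → Fin k → ℝ)
    (hb : ∀ i h, 0 ≤ b i h) (hu : ∀ i h, 0 ≤ u i h) (hz : ∀ i h, 0 ≤ z i h)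
    (hb' : ∀ i h, 0 ≤ b' i h) (hu' : ∀ i h, 0 ≤ u' i h) (hz' : ∀ i h, 0 ≤ z' i h)
    (hvs : ∀ i, ∑ h, (b i h + u i h + z i h) ≤ 1) (hws : ∀ i, ∑ h, (b' i h + u' i h + z' i h) ≤ 1)
    (m : Fin k → ℝ) (hv2 : ∀ h, ∑ i, (b i h + u i h + z i h) ≤ m h ^ 2)
    (hw2 : ∀ h, ∑ i, (b' i h + u' i h + z' i h) ≤ 2 * m h ^ 2) (c : Fin k → ℂ)
    {r₀ a ζ q τ L β δ : ℝ} {R : ℕ} (hR : 1 ≤ R) (ha0 : 0 ≤ a) (ha : ∀ h, ‖c h‖ ≤ a)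
    (hζ0 : 0 ≤ ζ) (hζ : ζ ≤ 1 / 8) (P : Fin k → Prop) (hP : ∀ h, P h → ‖c h‖ ≤ ζ)
    (hzP : ∀ h, ¬P h → ∀ i, z i h = 0) (hzP' : ∀ h, ¬P h → ∀ i, z' i h = 0)
    {θ : ℝ} (hq : 8 ≤ q) (hcr : ∑ h, (m h * ‖c h‖) ^ 2 ≤ r₀)
    (hθ : k * r₀ * θ ^ 2 ≤ (1 / q) ^ 2) (hbθ : ∀ i h, b i h ≤ θ * m h)
    (hbθ' : ∀ i h, b' i h ≤ θ * m h) (hτ0 : 0 ≤ τ) (hτ : ∀ i, ∑ h, u i h ≤ τ)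
    (hτ' : ∀ i, ∑ h, u' i h ≤ τ) (hτ8 : a * τ ≤ 1 / 8) (hLb : ∑ i, ∑ h, b i h ≤ L)
    (hLu : ∑ i, ∑ h, u i h ≤ L)
    (hdisj : ∀ i, (b' i = 0 ∧ u' i = 0) ∨ (b' i = 0 ∧ z' i = 0) ∨ (u' i = 0 ∧ z' i = 0))
    (huu : ∀ h, ∑ i, u i h = ∑ i, u' i h)
    (hmom : ∀ α : Fin k → ℕ, ∑ h, α h ≤ R → ∑ i, ∏ h, b' i h ^ α h = ∑ i, ∏ h, b i h ^ α h)
    (hβ : 0 ≤ β) (hδ : 0 ≤ δ) (hz1 : ∀ h, |∑ i, z' i h - ∑ i, z i h| ≤ β)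
    (hz2 : ∀ h h', |∑ i, z' i h * z' i h' - ∑ i, z i h * z i h'| ≤
      β + if h = h' then (∑ i, z i h) * δ else 0) :
    ∃ T T' : ℂ, ∏ i, (1 + ∑ h, ((b i h + u i h + z i h : ℝ) : ℂ) * c h) = Complex.exp T ∧
      ∏ i, (1 + ∑ h, ((b' i h + u' i h + z' i h : ℝ) : ℂ) * c h) = Complex.exp T' ∧
      ‖T - T'‖ ≤ 12 * (a * τ * (a * L)) + 8 * (ζ * (a * L)) + 16 * (ζ * r₀) +
        8 * r₀ * (1 / q) ^ (R - 1) + (k * ζ * β + (k * ζ) ^ 2 * β + r₀ * δ) := by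
  have hlam1 : ∀ (C : ℝ) (w : ι → Fin k → ℝ), 0 ≤ C → (∀ h, ∑ i, w i h ≤ C * m h ^ 2) →
      ∑ h, (∑ i, w i h) * ‖c h‖ ^ 2 ≤ C * r₀ := by
    intro C w hC hw
    refine le_trans ?_ (mul_le_mul_of_nonneg_left hcr hC)
    rw [Finset.mul_sum]
    refine Finset.sum_le_sum fun h _ => ?_
    rw [mul_pow, ← mul_assoc]
    exact mul_le_mul_of_nonneg_right (hw h) (sq_nonneg _)
  have hsq : ∀ w : ι → Fin k → ℝ, (∀ i h, 0 ≤ w i h) → (∀ i, ∑ h, w i h ≤ 1) →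
      (∀ h, ∑ i, w i h ≤ 2 * m h ^ 2) → ∑ i, ‖∑ h, (w i h : ℂ) * c h‖ ^ 2 ≤ 2 * r₀ := by
    intro w hw hw1 hw2
    have := sum_norm_sq_le w hw hw1 c
    rw [one_mul] at this
    exact this.trans (hlam1 2 w zero_le_two hw2)
  -- The entries are at most θ m_h, and ∑ m_h |c_h| ≤ √(k r₀) by Cauchy-Schwarz on the ball. This is
  -- where the spread condition on the vectors becomes smallness of the linear forms.
  have hXb : ∀ w : Fin k → ℝ, (∀ h, 0 ≤ w h) → (∀ h, w h ≤ θ * m h) →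
      ‖∑ h, (w h : ℂ) * c h‖ ≤ 1 / q := by
    intro w hw0 hw
    have h1 : ‖∑ h, (w h : ℂ) * c h‖ ≤ θ * ∑ h, m h * ‖c h‖ := by
      rw [Finset.mul_sum]
      refine norm_sum_le_of_le _ fun h _ => ?_
      rw [norm_mul, Complex.norm_real, Real.norm_of_nonneg (hw0 h), ← mul_assoc]
      exact mul_le_mul_of_nonneg_right (hw h) (norm_nonneg _)
    refine h1.trans (abs_le_of_sq_le_sq' ?_ (by positivity)).2
    rw [mul_pow]
    have h2 : (∑ h, m h * ‖c h‖) ^ 2 ≤ k * r₀ := by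
      have := sq_sum_le_card_mul_sum_sq (s := (Finset.univ : Finset (Fin k)))
        (f := fun h => m h * ‖c h‖)
      rw [Finset.card_univ, Fintype.card_fin] at this
      exact this.trans (mul_le_mul_of_nonneg_left hcr k.cast_nonneg)
    calc θ ^ 2 * (∑ h, m h * ‖c h‖) ^ 2 ≤ θ ^ 2 * (k * r₀) :=
          mul_le_mul_of_nonneg_left h2 (sq_nonneg _)
      _ ≤ (1 / q) ^ 2 := by linarith
  have hXa : ∀ w : Fin k → ℝ, (∀ h, 0 ≤ w h) → ‖∑ h, (w h : ℂ) * c h‖ ≤ a * ∑ h, w h :=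
    fun w hw => norm_linear_le c w hw fun h _ => ha h
  have hXz : ∀ z : ι → Fin k → ℝ, (∀ i h, 0 ≤ z i h) → (∀ h, ¬P h → ∀ i, z i h = 0) →
      (∀ i, ∑ h, z i h ≤ 1) → ∀ i, ‖∑ h, (z i h : ℂ) * c h‖ ≤ ζ := fun z hz hzP hz1 i =>
    (norm_linear_le c _ (hz i) fun h hh => hP h (not_imp_comm.mp (fun h' => hzP h h' i) hh)).trans
      (mul_le_of_le_one_right hζ0 (hz1 i))
  have hsuma : ∀ u : ι → Fin k → ℝ, (∀ i h, 0 ≤ u i h) → ∑ i, ∑ h, u i h ≤ L →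
      ∑ i, ‖∑ h, (u i h : ℂ) * c h‖ ≤ a * L := by
    intro u hu hL
    refine (Finset.sum_le_sum fun i _ => hXa (u i) (hu i)).trans ?_
    rw [← Finset.mul_sum]
    exact mul_le_mul_of_nonneg_left hL ha0
  have p1 : ∀ {x y w : ℝ}, 0 ≤ y → 0 ≤ w → x ≤ x + y + w := fun h1 h2 =>
    (le_add_of_nonneg_right h1).trans (le_add_of_nonneg_right h2)
  have p3 : ∀ {x y w : ℝ}, 0 ≤ x → 0 ≤ y → w ≤ x + y + w := fun h1 h2 =>
    le_add_of_nonneg_left (add_nonneg h1 h2)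
  have hbs : ∀ i, ∑ h, b i h ≤ 1 := fun i =>
    (Finset.sum_le_sum fun h _ => p1 (hu i h) (hz i h)).trans (hvs i)
  have hbs' : ∀ i, ∑ h, b' i h ≤ 1 := fun i =>
    (Finset.sum_le_sum fun h _ => p1 (hu' i h) (hz' i h)).trans (hws i)
  have hzs : ∀ i, ∑ h, z i h ≤ 1 := fun i =>
    (Finset.sum_le_sum fun h _ => p3 (hb i h) (hu i h)).trans (hvs i)
  have hzs' : ∀ i, ∑ h, z' i h ≤ 1 := fun i =>
    (Finset.sum_le_sum fun h _ => p3 (hb' i h) (hu' i h)).trans (hws i)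
  have hv22 : ∀ h, m h ^ 2 ≤ 2 * m h ^ 2 := fun h =>
    le_mul_of_one_le_left (sq_nonneg _) one_le_two
  have hbm : ∀ h, ∑ i, b i h ≤ 2 * m h ^ 2 := fun h =>
    ((Finset.sum_le_sum fun i _ => p1 (hu i h) (hz i h)).trans (hv2 h)).trans (hv22 h)
  have hbm' : ∀ h, ∑ i, b' i h ≤ 2 * m h ^ 2 := fun h =>
    (Finset.sum_le_sum fun i _ => p1 (hu' i h) (hz' i h)).trans (hw2 h)
  have hzm : ∀ h, ∑ i, z i h ≤ m h ^ 2 := fun h =>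
    (Finset.sum_le_sum fun i _ => p3 (hb i h) (hu i h)).trans (hv2 h)
  have hzm' : ∀ h, ∑ i, z' i h ≤ 2 * m h ^ 2 := fun h =>
    (Finset.sum_le_sum fun i _ => p3 (hb' i h) (hu' i h)).trans (hw2 h)
  have hLu' : ∑ i, ∑ h, u' i h ≤ L := by
    rw [Finset.sum_comm, ← Finset.sum_congr rfl fun h _ => huu h, Finset.sum_comm]
    exact hLu
  have hXadd : ∀ x y w : Fin k → ℝ, ∑ h, ((x h + y h + w h : ℝ) : ℂ) * c h =
      ∑ h, (x h : ℂ) * c h + ∑ h, (y h : ℂ) * c h + ∑ h, (w h : ℂ) * c h := by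
    intro x y w
    simp only [Complex.ofReal_add, add_mul, Finset.sum_add_distrib]
  have hzero : ∀ x : Fin k → ℝ, x = 0 → ∑ h, (x h : ℂ) * c h = 0 := by
    rintro x rfl
    simp
  have hquad := norm_quadratic_sub_le c z z' hζ0 hβ P hP hzP hzP' (fun h => ∑ i, z i h)
    (fun h => Finset.sum_nonneg fun i _ => hz i h) hδ
    ((hlam1 1 z zero_le_one fun h => by rw [one_mul]; exact hzm h).trans (one_mul r₀).le) hz1 hz2
  have huX : ∑ i, ∑ h, (u i h : ℂ) * c h = ∑ i, ∑ h, (u' i h : ℂ) * c h := by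
    rw [Finset.sum_comm, Finset.sum_comm (s := Finset.univ (α := ι))]
    refine Finset.sum_congr rfl fun h _ => ?_
    rw [← Finset.sum_mul, ← Finset.sum_mul]
    congr 1
    exact_mod_cast huu h
  simp only [hXadd]
  exact exists_log_pair (fun i => ∑ h, (b i h : ℂ) * c h) (fun i => ∑ h, (u i h : ℂ) * c h)
    (fun i => ∑ h, (z i h : ℂ) * c h) (fun i => ∑ h, (b' i h : ℂ) * c h)
    (fun i => ∑ h, (u' i h : ℂ) * c h) (fun i => ∑ h, (z' i h : ℂ) * c h) hR hq
    (mul_nonneg ha0 hτ0) hτ8 hζ0 hζ (fun i => hXb _ (hb i) (hbθ i))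
    (fun i => hXb _ (hb' i) (hbθ' i))
    (fun i => (hXa _ (hu i)).trans (mul_le_mul_of_nonneg_left (hτ i) ha0))
    (fun i => (hXa _ (hu' i)).trans (mul_le_mul_of_nonneg_left (hτ' i) ha0))
    (hXz z hz hzP hzs) (hXz z' hz' hzP' hzs') (hsq b hb hbs hbm) (hsq b' hb' hbs' hbm')
    (hsq z hz hzs fun h => (hzm h).trans (hv22 h)) (hsq z' hz' hzs' hzm') (hsuma b hb hLb)
    (hsuma u hu hLu) (hsuma u' hu' hLu')
    (fun i => (hdisj i).imp (And.imp (hzero _) (hzero _))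
      (Or.imp (And.imp (hzero _) (hzero _)) (And.imp (hzero _) (hzero _))))
    huX (fun j hj => sum_linear_pow_eq c b b' hj hmom) hquad

/-- The comparison theorem: the vectors are split into a part `b` whose moments are matched up to
degree `R`, a tiny part `u` whose sum is matched, and a part `z` on coordinates of large total mass
whose first two moments are nearly matched. -/
theorem pmdClose_of_parts [DecidableEq ι] (hk : 0 < k) (ℓ : Fin k)
    (b u z b' u' z' : ι → Fin k → ℝ)
    (hb : ∀ i h, 0 ≤ b i h) (hu : ∀ i h, 0 ≤ u i h) (hz : ∀ i h, 0 ≤ z i h)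
    (hb' : ∀ i h, 0 ≤ b' i h) (hu' : ∀ i h, 0 ≤ u' i h) (hz' : ∀ i h, 0 ≤ z' i h)
    (hvℓ : ∀ i, b i ℓ + u i ℓ + z i ℓ = 0) (hwℓ : ∀ i, b' i ℓ + u' i ℓ + z' i ℓ = 0)
    (hvs : ∀ i, ∑ h, (b i h + u i h + z i h) ≤ 1 - 1 / (2 * k))
    (hws : ∀ i, ∑ h, (b' i h + u' i h + z' i h) ≤ 1 - 1 / (2 * k))
    (m : Fin k → ℝ) (hm : ∀ h, 0 < m h) {κ₀ : ℝ} (hκ : 8 * (k : ℝ) ^ 2 * κ₀ ^ 2 ≤ 1)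
    (hv1 : ∀ h, |∑ i, (b i h + u i h + z i h) - m h ^ 2| ≤ κ₀ * m h)
    (hv2 : ∀ h, ∑ i, (b i h + u i h + z i h) ≤ m h ^ 2)
    (hw1 : ∀ h, |∑ i, (b' i h + u' i h + z' i h) - m h ^ 2| ≤ κ₀ * m h)
    (hw2 : ∀ h, ∑ i, (b' i h + u' i h + z' i h) ≤ (1 + 1 / (8 * k)) * m h ^ 2)
    {r₀ σ γ₀ γ₁ q τ L β δ Δ ε : ℝ} {R : ℕ} (hR : 1 ≤ R) (hσ0 : 0 ≤ σ)
    (hσ : r₀ ≤ σ ^ 2) (hγ₀0 : 0 ≤ γ₀) (hγ₀ : ∀ h, 1 ≤ γ₀ * m h) (hγ₁0 : 0 ≤ γ₁)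
    (hγ₁ : σ * γ₁ ≤ 1 / 8)
    (P : Fin k → Prop) (hP : ∀ h, P h → 1 ≤ γ₁ * m h) (hzP : ∀ h, ¬P h → ∀ i, z i h = 0)
    (hzP' : ∀ h, ¬P h → ∀ i, z' i h = 0) {θ : ℝ} (hq : 8 ≤ q)
    (hθ : k * r₀ * θ ^ 2 ≤ (1 / q) ^ 2) (hbθ : ∀ i h, b i h ≤ θ * m h)
    (hbθ' : ∀ i h, b' i h ≤ θ * m h) (hτ0 : 0 ≤ τ) (hτ : ∀ i, ∑ h, u i h ≤ τ)
    (hτ' : ∀ i, ∑ h, u' i h ≤ τ)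
    (hτ8 : σ * γ₀ * τ ≤ 1 / 8) (hLb : ∑ i, ∑ h, b i h ≤ L) (hLu : ∑ i, ∑ h, u i h ≤ L)
    (hdisj : ∀ i, (b' i = 0 ∧ u' i = 0) ∨ (b' i = 0 ∧ z' i = 0) ∨ (u' i = 0 ∧ z' i = 0))
    (huu : ∀ h, ∑ i, u i h = ∑ i, u' i h)
    (hmom : ∀ α : Fin k → ℕ, ∑ h, α h ≤ R → ∑ i, ∏ h, b' i h ^ α h = ∑ i, ∏ h, b i h ^ α h)
    (hβ : 0 ≤ β) (hδ : 0 ≤ δ) (hz1 : ∀ h, |∑ i, z' i h - ∑ i, z i h| ≤ β)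
    (hz2 : ∀ h h', |∑ i, z' i h * z' i h' - ∑ i, z i h * z i h'| ≤
      β + if h = h' then (∑ i, z i h) * δ else 0)
    (hΔ1 : Δ ≤ 1) (hε : 0 ≤ ε)
    (hΔ : 12 * (σ * γ₀ * τ * (σ * γ₀ * L)) + 8 * (σ * γ₁ * (σ * γ₀ * L)) + 16 * (σ * γ₁ * r₀) +
      8 * r₀ * (1 / q) ^ (R - 1) + (k * (σ * γ₁) * β + (k * (σ * γ₁)) ^ 2 * β + r₀ * δ) ≤ Δ)
    (hbound : 4 * Real.exp 1 * Δ ^ 2 * (4 * k) ^ k +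
      4 * Real.exp 1 * Real.exp (-r₀ / (8 * k)) * (8 * k) ^ k ≤ ε ^ 2) :
    PMDClose (fun i => fillAt ℓ fun h => b i h + u i h + z i h)
      (fun i => fillAt ℓ fun h => b' i h + u' i h + z' i h) ε := by
  have hk' : (0 : ℝ) < k := by exact_mod_cast hk
  have hk1 : (1 : ℝ) ≤ k := by exact_mod_cast hk
  refine pmdClose_of_log_close hk ℓ _ _ hvℓ hwℓ
    (fun i h => add_nonneg (add_nonneg (hb i h) (hu i h)) (hz i h))
    (fun i h => add_nonneg (add_nonneg (hb' i h) (hu' i h)) (hz' i h)) hvs hws m hm hκ hv1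
    (fun h => (hv2 h).trans (le_mul_of_one_le_left (sq_nonneg _)
      (le_add_of_nonneg_right (by positivity)))) hw1 hw2 hΔ1 hε (r₀ := r₀) (fun s hs => ?_) hbound
  have hs1 : ∀ h, ‖s h‖ ≤ σ := fun h => (abs_le_of_sq_le_sq'
    (((Finset.single_le_sum (f := fun h => ‖s h‖ ^ 2) (fun _ _ => sq_nonneg _)
      (Finset.mem_univ h)).trans hs).trans hσ) hσ0).2
  have hcn : ∀ h, ‖s h / m h‖ = ‖s h‖ / m h := by
    intro h
    rw [norm_div, Complex.norm_real, Real.norm_of_nonneg (hm h).le]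
  have hle1 : (1 : ℝ) - 1 / (2 * k) ≤ 1 := sub_le_self _ (by positivity)
  have hcγ : ∀ (γ : ℝ) h, 1 ≤ γ * m h → ‖s h / m h‖ ≤ σ * γ := by
    intro γ h hγ
    rw [hcn, div_le_iff₀ (hm h), mul_assoc]
    exact (hs1 h).trans (le_mul_of_one_le_right hσ0 hγ)
  have h2 : ∀ h, ∑ i, (b' i h + u' i h + z' i h) ≤ 2 * m h ^ 2 := by
    intro h
    refine (hw2 h).trans (mul_le_mul_of_nonneg_right ?_ (sq_nonneg _))
    have : 1 / (8 * (k : ℝ)) ≤ 1 := by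
      rw [div_le_one (by positivity)]
      linarith
    linarith
  obtain ⟨T, T', hT, hT', hTT⟩ := exists_log_pair_linear b u z b' u' z' hb hu hz hb' hu' hz'
    (fun i => (hvs i).trans hle1) (fun i => (hws i).trans hle1) m hv2 h2 (fun h => s h / m h)
    hR (mul_nonneg hσ0 hγ₀0) (fun h => hcγ γ₀ h (hγ₀ h)) (mul_nonneg hσ0 hγ₁0) hγ₁ P
    (fun h hh => hcγ γ₁ h (hP h hh)) hzP hzP' hq
    (le_trans (Finset.sum_le_sum fun h _ => by
      rw [hcn, mul_div_cancel₀ _ (hm h).ne']) hs) hθ hbθ hbθ' hτ0 hτ hτ' hτ8 hLb hLu hdisj huu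
    hmom hβ hδ hz1 hz2
  exact ⟨T, T', hT, hT', hTT.trans hΔ⟩

end Core

/-! ### Few types in every cell of a partition of the cube -/

section Cells

/-- Moments add up over cells, so `exists_few_types` is applied to the players of each cell. -/
theorem exists_few_types_boxes {ι κ C : Type*} [Fintype ι] [Fintype κ] [Fintype C] (R : ℕ)
    (cell : ι → C) (lo hi : C → κ → ℝ) (hlo : ∀ c h, 0 ≤ lo c h) (x : ι → κ → ℝ)
    (hx : ∀ i h, lo (cell i) h ≤ x i h ∧ x i h ≤ hi (cell i) h) :
    ∃ y : ι → κ → ℝ, (∀ i h, lo (cell i) h ≤ y i h ∧ y i h ≤ hi (cell i) h) ∧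
      (∀ α : κ → ℕ, ∑ h, α h ≤ R → ∑ i, ∏ h, y i h ^ α h = ∑ i, ∏ h, x i h ^ α h) ∧
      (Set.range y).ncard ≤ Fintype.card C * (R + 2) ^ Fintype.card κ := by
  classical
  have key := fun c : C => exists_few_types (ι := {i // cell i = c}) R (lo c) (hi c) (hlo c)
    (fun i => x i) (fun i h => by
      have := hx i h
      rwa [i.2] at this)
  choose y hy hm hc using key
  refine ⟨fun i => y (cell i) ⟨i, rfl⟩, fun i h => hy _ _ h, fun α hα => ?_, ?_⟩
  · rw [← Finset.sum_fiberwise (s := Finset.univ) (g := cell),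
      ← Finset.sum_fiberwise (s := Finset.univ) (g := cell) (f := fun i => ∏ h, x i h ^ α h)]
    refine Finset.sum_congr rfl fun c _ => ?_
    have := hm c α hα
    rw [← Finset.sum_subtype_eq_sum_filter, ← Finset.sum_subtype_eq_sum_filter,
      Finset.subtype_univ]
    refine Eq.trans (Finset.sum_congr rfl fun i _ => ?_) this
    obtain ⟨i, rfl⟩ := i
    rfl
  · have hsub : Set.range (fun i => y (cell i) ⟨i, rfl⟩) ⊆
        ⋃ c ∈ (Finset.univ : Finset C), Set.range (y c) := by
      rintro _ ⟨i, rfl⟩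
      simp only [Finset.mem_univ, Set.iUnion_true, Set.mem_iUnion]
      exact ⟨cell i, ⟨i, rfl⟩, rfl⟩
    refine (Set.ncard_le_ncard hsub ?_).trans ((Finset.set_ncard_biUnion_le _ _).trans ?_)
    · exact Set.Finite.biUnion (Finset.finite_toSet _) fun c _ => Set.finite_range _
    · exact (Finset.sum_le_sum fun c _ => hc c).trans (by simp [Finset.card_univ])

variable {ι : Type} [Fintype ι] {k : ℕ}

/-- Matching moments on the whole cube would give no control over the mass of a single vector. Cells
of side 1/N let it grow by at most k/N. The coordinate ℓ is removed before and restored as 0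
afterwards, whence the exponent k - 1. -/
theorem exists_matched_types (ℓ : Fin k) (b : ι → Fin k → ℝ) (hb : ∀ i h, 0 ≤ b i h)
    (hbℓ : ∀ i, b i ℓ = 0) (hb1 : ∀ i h, b i h ≤ 1) (cap : Fin k → ℝ)
    (hcap : ∀ i h, b i h ≤ cap h) (hcap0 : 0 ≤ cap ℓ) (R : ℕ) {N : ℕ} (hN : 0 < N) (hk : 2 ≤ k) :
    ∃ b' : ι → Fin k → ℝ, (∀ i h, 0 ≤ b' i h) ∧ (∀ i, b' i ℓ = 0) ∧ (∀ i h, b' i h ≤ cap h) ∧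
      (∀ i, b i = 0 → b' i = 0) ∧ (∀ i, ∑ h, b' i h ≤ ∑ h, b i h + k / N) ∧
      (∀ α : Fin k → ℕ, ∑ h, α h ≤ R → ∑ i, ∏ h, b' i h ^ α h = ∑ i, ∏ h, b i h ^ α h) ∧
      (Set.range b').ncard ≤ ((N + 2) * (R + 2)) ^ (k - 1) := by
  classical
  have hN' : (0 : ℝ) < N := by exact_mod_cast hN
  let κ := {h : Fin k // h ≠ ℓ}
  have hfl : ∀ i h, ⌊b i h * N⌋₊ < N + 1 := fun i h => by
    rw [Nat.lt_succ_iff]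
    exact Nat.floor_le_of_le (by nlinarith [hb1 i h])
  -- The extra cell `none` is the single point 0, so that zero vectors remain zero. The (N+1)^(k-1)
  -- + 1 cells are bounded by (N+2)^(k-1) in the end.
  let cell : ι → Option (κ → Fin (N + 1)) := fun i =>
    if b i = 0 then none else some fun h => ⟨⌊b i h * N⌋₊, hfl i h⟩
  let lo : Option (κ → Fin (N + 1)) → κ → ℝ := fun c h => c.elim 0 fun j => ((j h : ℕ) : ℝ) / N
  let hi : Option (κ → Fin (N + 1)) → κ → ℝ := fun c h =>
    c.elim 0 fun j => min (cap h) ((((j h : ℕ) : ℝ) + 1) / N)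
  have hlo : ∀ c h, 0 ≤ lo c h := by
    intro c h
    cases c with
    | none => exact le_rfl
    | some j => exact div_nonneg (Nat.cast_nonneg _) hN'.le
  have hx : ∀ i (h : κ), lo (cell i) h ≤ b i h ∧ b i h ≤ hi (cell i) h := by
    intro i h
    by_cases h0 : b i = 0
    · simp [cell, h0, lo, hi]
    · simp only [cell, h0, if_false, lo, hi, Option.elim_some]
      refine ⟨?_, le_min (hcap i h) ?_⟩
      · rw [div_le_iff₀ hN']
        exact Nat.floor_le (mul_nonneg (hb i h) hN'.le)
      · rw [le_div_iff₀ hN']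
        exact (Nat.lt_floor_add_one _).le
  obtain ⟨y, hy, hm, hc⟩ := exists_few_types_boxes R cell lo hi hlo (fun i (h : κ) => b i h) hx
  let ext : (κ → ℝ) → Fin k → ℝ := fun g h => if hh : h ≠ ℓ then g ⟨h, hh⟩ else 0
  have hextℓ : ∀ g, ext g ℓ = 0 := fun g => by simp [ext]
  have hext : ∀ g (h : κ), ext g h = g h := fun g h => dif_pos h.2
  have hprod : ∀ (g : Fin k → ℝ) (α : Fin k → ℕ), g ℓ = 0 →
      ∏ h, g h ^ α h = 0 ^ α ℓ * ∏ h : κ, g h ^ α h := by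
    intro g α hg
    rw [Fintype.prod_eq_mul_prod_subtype_ne _ ℓ, hg]
  have hsum : ∀ (g : Fin k → ℝ), g ℓ = 0 → ∑ h, g h = ∑ h : κ, g h := by
    intro g hg
    rw [Fintype.sum_eq_add_sum_subtype_ne _ ℓ, hg, zero_add]
  have hhi : ∀ i (h : κ), hi (cell i) h ≤ b i h + 1 / N := by
    intro i h
    by_cases h0 : b i = 0
    · simp [cell, h0, hi]
    · simp only [cell, h0, if_false, hi, Option.elim_some]
      refine (min_le_right _ _).trans ?_
      rw [add_div]
      gcongr
      rw [div_le_iff₀ hN']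
      exact Nat.floor_le (mul_nonneg (hb i h) hN'.le)
  have hκ : Fintype.card κ = k - 1 := by
    simp [κ, Fintype.card_subtype_compl]
  refine ⟨fun i => ext (y i), fun i h => ?_, fun i => hextℓ _, fun i h => ?_, fun i h0 => ?_,
    fun i => ?_, fun α hα => ?_, ?_⟩
  · change 0 ≤ ext (y i) h
    by_cases hh : h = ℓ
    · rw [hh, hextℓ]
    · rw [hext (y i) ⟨h, hh⟩]
      exact (hlo _ _).trans (hy i _).1
  · change ext (y i) h ≤ cap h
    by_cases hh : h = ℓ
    · rw [hh, hextℓ]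
      exact hcap0
    · rw [hext (y i) ⟨h, hh⟩]
      refine (hy i _).2.trans ?_
      by_cases h0 : b i = 0
      · simp only [cell, h0, if_true, hi, Option.elim_none]
        exact (hb i h).trans (hcap i h)
      · simp only [cell, h0, if_false, hi, Option.elim_some]
        exact min_le_left _ _
  · funext h
    change ext (y i) h = 0
    by_cases hh : h = ℓ
    · rw [hh, hextℓ]
    · rw [hext (y i) ⟨h, hh⟩]
      have := hy i ⟨h, hh⟩
      simp only [cell, h0, if_true, hi, lo, Option.elim_none] at this
      exact le_antisymm this.2 this.1
  · rw [hsum _ (hextℓ _), hsum _ (hbℓ i)]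
    have : ∀ h : κ, ext (y i) h ≤ b i h + 1 / N := fun h => by
      rw [hext]
      exact (hy i h).2.trans (hhi i h)
    refine (Finset.sum_le_sum fun h _ => this h).trans ?_
    rw [Finset.sum_add_distrib, Finset.sum_const, Finset.card_univ, hκ, nsmul_eq_mul]
    gcongr
    rw [mul_one_div]
    gcongr
    exact Nat.sub_le _ _
  · simp only [hprod _ α (hextℓ _), hprod _ α (hbℓ _), hext, ← Finset.mul_sum]
    congr 1
    refine hm (fun h => α h) (le_trans ?_ hα)
    rw [Fintype.sum_eq_add_sum_subtype_ne α ℓ]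
    exact Nat.le_add_left _ _
  · have : Set.range (fun i => ext (y i)) = ext '' Set.range y := by
      rw [← Set.range_comp]
      rfl
    rw [this]
    refine (Set.ncard_image_le (Set.finite_range _)).trans (hc.trans ?_)
    rw [hκ, mul_pow]
    gcongr
    rw [Fintype.card_option, Fintype.card_fun, Fintype.card_fin, hκ]
    obtain ⟨d, hd⟩ : ∃ d, k - 1 = d + 1 := ⟨k - 2, by omega⟩
    rw [hd, show N + 2 = (N + 1) + 1 by ring, pow_succ (N + 1 + 1), pow_succ (N + 1)]
    have h1 : (N + 1) ^ d ≤ (N + 1 + 1) ^ d := Nat.pow_le_pow_left (Nat.le_succ _) _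
    have h2 : 1 ≤ (N + 1 + 1) ^ d := Nat.one_le_pow _ _ (by omega)
    nlinarith [Nat.mul_le_mul_right (N + 1) h1]

end Cells

/-! ### A group of players with a common dominating strategy -/

section Group

variable {ι : Type} [Fintype ι] {k : ℕ}

theorem sum_extend_zero (A : Finset ι) [DecidableEq ι] {M : Type*} [AddCommMonoid M] (f : A → M) :
    ∑ i, (if h : i ∈ A then f ⟨i, h⟩ else 0) = ∑ a, f a := by
  rw [Finset.univ_eq_attach, ← Finset.sum_subset (Finset.subset_univ A), ← Finset.sum_attach]
  · exact Finset.sum_congr rfl fun a _ => dif_pos a.2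
  · intro i _ hi
    exact dif_neg hi

/-- `exists_grid_types` for the vectors indexed by the complement of `E`. -/
theorem exists_grid_types_compl [DecidableEq ι] {D : ℕ} (hD : 0 < D) (z : ι → Fin k → ℝ)
    (hz0 : ∀ i h, 0 ≤ z i h) (hz1 : ∀ i h, z i h ≤ 1) {g : ℝ} (hg0 : 0 ≤ g)
    (hg : ∀ i, ∑ h, z i h ≤ g) (E : Finset ι) {B : ℕ} (hB : E.card ≤ B) :
    ∃ z' : ι → Fin k → ℝ, (∀ i, ∃ n : Fin k → ℕ, z' i = fun h => (n h : ℝ) / D) ∧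
      (∀ i ∈ E, z' i = 0) ∧ (∀ h, (∀ i, z i h = 0) → ∀ i, z' i h = 0) ∧
      (∀ i, ∑ h, z' i h ≤ g + k / D) ∧ (z' '' ((E : Set ι)ᶜ)).ncard ≤ gridTypeCount k + 1 ∧
      (∀ h, |∑ i, z' i h - ∑ i, z i h| ≤ (B : ℝ) + gridTypeCount k) ∧
      (∀ h h', |∑ i, z' i h * z' i h' - ∑ i, z i h * z i h'| ≤
        ((B : ℝ) + gridTypeCount k) + if h = h' then (∑ i, z i h) * (1 / D) else 0) := by
  obtain ⟨y, hy, -, hy0, hyg, hyc, hy1, hy2⟩ := exists_grid_types (ι := ↥Eᶜ) hD (fun i => z i)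
    (fun i => hz0 i) (fun i => hz1 i) (fun i => hg i)
  have hk0 : (0 : ℝ) ≤ k / D := by positivity
  have hBr : (E.card : ℝ) ≤ B := by exact_mod_cast hB
  let z' : ι → Fin k → ℝ := fun i => if h : i ∈ Eᶜ then y ⟨i, h⟩ else 0
  have hz'mem : ∀ i (h : i ∈ Eᶜ), z' i = y ⟨i, h⟩ := fun i h => dif_pos h
  have hz'E : ∀ i ∈ E, z' i = 0 := fun i h => dif_neg (by simpa using h)
  have hsumz : ∀ φ : (Fin k → ℝ) → ℝ, φ 0 = 0 → ∑ i, φ (z' i) = ∑ i, φ (y i) := by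
    intro φ hφ
    rw [← sum_extend_zero Eᶜ fun a => φ (y a)]
    refine Finset.sum_congr rfl fun i _ => ?_
    by_cases h : i ∈ Eᶜ
    · rw [hz'mem i h, dif_pos h]
    · rw [dif_neg h, hz'E i (by simpa using h), hφ]
  have hsplit : ∀ f : ι → ℝ, ∑ i, f i = ∑ i ∈ E, f i + ∑ i : ↥Eᶜ, f i := by
    intro f
    rw [← Finset.sum_add_sum_compl E f, Finset.sum_coe_sort Eᶜ f]
  have hE : ∀ f : ι → ℝ, (∀ i, 0 ≤ f i) → (∀ i, f i ≤ 1) →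
      0 ≤ ∑ i ∈ E, f i ∧ ∑ i ∈ E, f i ≤ B := by
    intro f h0 h1
    refine ⟨Finset.sum_nonneg fun i _ => h0 i, (Finset.sum_le_sum fun i _ => h1 i).trans ?_⟩
    rw [Finset.sum_const, nsmul_eq_mul, mul_one]
    exact hBr
  refine ⟨z', fun i => ?_, hz'E, fun h hh i => ?_, fun i => ?_, ?_, fun h => ?_, fun h h' => ?_⟩
  · by_cases h : i ∈ Eᶜ
    · rw [hz'mem i h]
      exact hy _
    · exact ⟨0, by rw [hz'E i (by simpa using h)]; funext; simp⟩
  · by_cases hi : i ∈ Eᶜ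
    · rw [hz'mem i hi]
      exact hy0 h (fun i => hh i) _
    · rw [hz'E i (by simpa using hi), Pi.zero_apply]
  · by_cases hi : i ∈ Eᶜ
    · rw [hz'mem i hi]
      rcases hyg ⟨i, hi⟩ with h0 | h0
      · rw [h0]
        simpa using add_nonneg hg0 hk0
      · exact h0
    · rw [hz'E i (by simpa using hi)]
      simpa using add_nonneg hg0 hk0
  · refine (Set.ncard_le_ncard ?_ (Set.finite_range y)).trans hyc
    rintro _ ⟨i, hi, rfl⟩
    have hi' : i ∈ Eᶜ := by simpa using hi
    rw [hz'mem i hi']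
    exact ⟨_, rfl⟩
  · have h1 := hy1 h
    rw [hsumz (fun x => x h) rfl, hsplit fun i => z i h]
    obtain ⟨h2, h3⟩ := hE (fun i => z i h) (fun i => hz0 i h) (fun i => hz1 i h)
    rw [abs_le] at h1 ⊢
    constructor <;> linarith [h1.1, h1.2]
  · have h1 := hy2 h h'
    rw [hsumz (fun x => x h * x h') (by simp), hsplit fun i => z i h * z i h']
    obtain ⟨h2, h3⟩ := hE (fun i => z i h * z i h') (fun i => mul_nonneg (hz0 i h) (hz0 i h'))
      (fun i => mul_le_one₀ (hz1 i h) (hz0 i h') (hz1 i h'))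
    have h4 : (if h = h' then (∑ i : ↥Eᶜ, z i h) / (D : ℝ) else 0) ≤
        if h = h' then (∑ i, z i h) * (1 / (D : ℝ)) else 0 := by
      split_ifs
      · rw [hsplit fun i => z i h, div_eq_mul_one_div]
        gcongr
        exact le_add_of_nonneg_left (hE (fun i => z i h) (fun i => hz0 i h) (fun i => hz1 i h)).1
      · exact le_rfl
    rw [abs_le] at h1 ⊢
    constructor <;> linarith [h1.1, h1.2]

/-- The parts are redistributed over disjoint sets of players: A carries the matched part b', F
carries equal shares of the tiny part, everyone else carries the grid part z'. The players of A ∪ F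
give up their rich entries. This changes the moments of z by at most B, which is negligible since
rich coordinates have mass at least Λ^8. -/
theorem exists_group_types_of_gap [DecidableEq ι] (hk : 2 ≤ k) (ℓ : Fin k) (v : ι → Fin k → ℝ)
    (hv : ∀ i h, 0 ≤ v i h) (hvℓ : ∀ i, v i ℓ = 0) (hvs : ∀ i, ∑ h, v i h ≤ 1 - 1 / k)
    {θ : ℝ} (hθ0 : 0 ≤ θ) (hvθ : ∀ i h, v i h ^ 2 ≤ θ ^ 2 * ∑ j, v j h)
    {r₀ σ Γ Λ τ₀ q Δ ε : ℝ} {R B D : ℕ} (hR : 1 ≤ R) (hσ0 : 0 ≤ σ) (hσ : r₀ ≤ σ ^ 2)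
    (hΓ : 1 ≤ Γ) (hΛ : 1 ≤ Λ) (hτ₀ : 0 ≤ τ₀) (hq : 8 ≤ q) (hθ : k * r₀ * θ ^ 2 ≤ (1 / q) ^ 2)
    (P : Fin k → Prop) (hpoor : ∀ h, ¬P h → ∑ i, v i h ≤ Λ)
    (hrich : ∀ h, P h → Λ ^ 8 ≤ ∑ i, v i h) (A F : Finset ι) (hAF : Disjoint A F)
    (hA : ∀ i ∉ A, ∀ h, ¬P h → v i h < τ₀ ∨ v i h = 0)
    (hF : 0 < τ₀ → Λ ≤ τ₀ * F.card) (hB : (A ∪ F).card ≤ B) (hκ : 8 * (k : ℝ) ^ 2 ≤ Γ ^ 2)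
    (hB1 : ((B : ℝ) + gridTypeCount k + 1) * Γ ≤ Λ ^ 4)
    (hB2 : 8 * k * ((B : ℝ) + gridTypeCount k) ≤ Λ ^ 8) (hD : 2 * k ^ 2 ≤ D)
    (hτ2 : k * τ₀ ≤ 1 / 2) (hτ8 : σ * Γ * (k * τ₀) ≤ 1 / 8) (hγ₁ : σ * (1 / Λ ^ 4) ≤ 1 / 8)
    (hΔ1 : Δ ≤ 1) (hε : 0 ≤ ε)
    (hΔ : 12 * (σ * Γ * (k * τ₀) * (σ * Γ * (k * Λ))) +
      8 * (σ * (1 / Λ ^ 4) * (σ * Γ * (k * Λ))) + 16 * (σ * (1 / Λ ^ 4) * r₀) +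
      8 * r₀ * (1 / q) ^ (R - 1) + (k * (σ * (1 / Λ ^ 4)) * ((B : ℝ) + gridTypeCount k) +
      (k * (σ * (1 / Λ ^ 4))) ^ 2 * ((B : ℝ) + gridTypeCount k) + r₀ * (1 / D)) ≤ Δ)
    (hbound : 4 * Real.exp 1 * Δ ^ 2 * (4 * k) ^ k +
      4 * Real.exp 1 * Real.exp (-r₀ / (8 * k)) * (8 * k) ^ k ≤ ε ^ 2) :
    ∃ v' : ι → Fin k → ℝ, (∀ i h, 0 ≤ v' i h) ∧ (∀ i, v' i ℓ = 0) ∧ (∀ i, ∑ h, v' i h ≤ 1) ∧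
      (v' '' (A ∪ F : Finset ι)).ncard ≤ ((4 * k ^ 2 + 2) * (R + 2)) ^ (k - 1) + 1 ∧
      (v' '' ((A ∪ F : Finset ι) : Set ι)ᶜ).ncard ≤ gridTypeCount k + 1 ∧
      (∀ i ∉ A ∪ F, ∃ n : Fin k → ℕ, v' i = fun h => (n h : ℝ) / D) ∧
      PMDClose (fun i => fillAt ℓ (v i)) (fun i => fillAt ℓ (v' i)) ε := by
  classical
  have hk0 : 0 < k := by omega
  have hk' : (0 : ℝ) < k := by exact_mod_cast hk0
  have hk1 : (1 : ℝ) ≤ k := by exact_mod_cast hk0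
  have hD0 : 0 < D := lt_of_lt_of_le (by positivity) hD
  have hD' : (0 : ℝ) < D := by exact_mod_cast hD0
  have hΓ0 : 0 < Γ := by linarith
  have hv1 : ∀ i h, v i h ≤ 1 := fun i h =>
    (Finset.single_le_sum (f := v i) (fun h _ => hv i h) (Finset.mem_univ h)).trans
      ((hvs i).trans (sub_le_self _ (by positivity)))
  set lam : Fin k → ℝ := fun h => ∑ i, v i h with hlam
  have hlam0 : ∀ h, 0 ≤ lam h := fun h => Finset.sum_nonneg fun i _ => hv i h
  -- The entry is split by type: b for poor coordinates and entries of at least τ₀, u for poor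
  -- coordinates and smaller entries, z for rich coordinates.
  let b : ι → Fin k → ℝ := fun i h => if ¬P h ∧ τ₀ ≤ v i h then v i h else 0
  let u : ι → Fin k → ℝ := fun i h => if ¬P h ∧ v i h < τ₀ then v i h else 0
  let z : ι → Fin k → ℝ := fun i h => if P h then v i h else 0
  have hbuz : ∀ i h, b i h + u i h + z i h = v i h := by
    intro i h
    simp only [b, u, z]
    by_cases hh : P h
    · simp [hh]
    · rcases le_or_gt τ₀ (v i h) with h' | h'
      · simp [hh, h', not_lt.mpr h']
      · simp [hh, h', not_le.mpr h']
  have hb : ∀ i h, 0 ≤ b i h := fun i h => by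
    simp only [b]; split_ifs; exacts [hv i h, le_rfl]
  have hu : ∀ i h, 0 ≤ u i h := fun i h => by
    simp only [u]; split_ifs; exacts [hv i h, le_rfl]
  have hz : ∀ i h, 0 ≤ z i h := fun i h => by
    simp only [z]; split_ifs; exacts [hv i h, le_rfl]
  have hbv : ∀ i h, b i h ≤ v i h := fun i h => by linarith [hbuz i h, hu i h, hz i h]
  have huv : ∀ i h, u i h ≤ v i h := fun i h => by linarith [hbuz i h, hb i h, hz i h]
  have hzv : ∀ i h, z i h ≤ v i h := fun i h => by linarith [hbuz i h, hb i h, hu i h]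
  -- The shift keeps the centre at least 1/Γ even on coordinates without mass, and it displaces the
  -- mean by at most m_h / Γ.
  let m : Fin k → ℝ := fun h => Real.sqrt (lam h + (1 / Γ) ^ 2)
  have hm2 : ∀ h, m h ^ 2 = lam h + (1 / Γ) ^ 2 := fun h =>
    Real.sq_sqrt (add_nonneg (hlam0 h) (sq_nonneg _))
  have hΓi : 0 < 1 / Γ := by positivity
  have hmΓ : ∀ h, 1 / Γ ≤ m h := fun h => Real.le_sqrt_of_sq_le (by linarith [hlam0 h])
  have hm : ∀ h, 0 < m h := fun h => hΓi.trans_le (hmΓ h)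
  have hmP : ∀ h, P h → Λ ^ 4 ≤ m h := fun h hh => Real.le_sqrt_of_sq_le (by
    have := hrich h hh
    have e : (Λ ^ 4) ^ 2 = Λ ^ 8 := by ring
    rw [e]
    linarith [sq_nonneg (1 / Γ)])
  have hvm : ∀ i h, v i h ≤ θ * m h := fun i h => by
    refine (abs_le_of_sq_le_sq' ?_ (mul_nonneg hθ0 (hm h).le)).2
    rw [mul_pow, hm2]
    exact (hvθ i h).trans (mul_le_mul_of_nonneg_left (le_add_of_nonneg_right (sq_nonneg _))
      (sq_nonneg _))
  -- the new vectors
  obtain ⟨b', hb'0, hb'ℓ, hb'cap, hb'z, hb's, hb'm, hb'c⟩ := exists_matched_types ℓ b hb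
    (fun i => le_antisymm ((hbv i ℓ).trans (hvℓ i).le) (hb i ℓ)) (fun i h => (hbv i h).trans (hv1 i h))
    (fun h => θ * m h) (fun i h => (hbv i h).trans (hvm i h)) (mul_nonneg hθ0 (hm ℓ).le) R
    (N := 4 * k ^ 2) (by positivity) hk
  obtain ⟨z', hz'n, hz'E, hz'0, hz's, hz'c, hz'1, hz'2⟩ := exists_grid_types_compl hD0 z hz
    (fun i h => (hzv i h).trans (hv1 i h)) (g := 1 - 1 / k)
    (by rw [sub_nonneg, div_le_one hk']; exact hk1)
    (fun i => (Finset.sum_le_sum fun h _ => hzv i h).trans (hvs i)) (A ∪ F) hB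
  have hz'nn : ∀ i h, 0 ≤ z' i h := fun i h => by
    obtain ⟨n, hn⟩ := hz'n i
    rw [hn]
    positivity
  have hbA : ∀ i ∉ A, b i = 0 := by
    intro i hi
    funext h
    simp only [b, Pi.zero_apply, ite_eq_right_iff, and_imp]
    intro hh h1
    rcases hA i hi h hh with h2 | h2
    · exact absurd h1 (not_le.mpr h2)
    · exact h2
  have hb'A : ∀ i ∉ A, b' i = 0 := fun i hi => hb'z i (hbA i hi)
  -- The common share of the players in F. As Λ ≤ τ₀ |F|, it is again at most τ₀ in every
  -- coordinate. If τ₀ = 0 then u vanishes, and F may be empty.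
  let U : Fin k → ℝ := fun h => (∑ i, u i h) / F.card
  have huP : ∀ h, P h → ∀ i, u i h = 0 := fun h hh i => by simp [u, hh]
  have hUτ : ∀ h, U h ≤ τ₀ := by
    intro h
    by_cases hh : P h
    · simp only [U, huP h hh, Finset.sum_const_zero, zero_div]
      exact hτ₀
    · refine div_le_of_le_mul₀ (Nat.cast_nonneg _) hτ₀ ?_
      rcases hτ₀.eq_or_lt with h0 | h0
      · refine le_trans (le_of_eq (Finset.sum_eq_zero fun i _ => ?_)) (by positivity)
        simp only [u, ← h0, ite_eq_right_iff, and_imp]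
        exact fun _ h1 => absurd (hv i h) (not_le.mpr h1)
      · exact ((Finset.sum_le_sum fun i _ => huv i h).trans (hpoor h hh)).trans (hF h0)
  have hU0 : ∀ h, 0 ≤ U h := fun h =>
    div_nonneg (Finset.sum_nonneg fun i _ => hu i h) (Nat.cast_nonneg _)
  let u' : ι → Fin k → ℝ := fun i => if i ∈ F then U else 0
  have hu'F : ∀ i ∈ F, u' i = U := fun i hi => if_pos hi
  have hu'0 : ∀ i ∉ F, u' i = 0 := fun i hi => if_neg hi
  have hu'nn : ∀ i h, 0 ≤ u' i h := fun i h => by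
    by_cases hi : i ∈ F
    · rw [hu'F i hi]
      exact hU0 h
    · rw [hu'0 i hi, Pi.zero_apply]
  have huu : ∀ h, ∑ i, u i h = ∑ i, u' i h := by
    intro h
    have e : ∀ i, u' i h = if i ∈ F then U h else 0 := fun i => by
      simp only [u']
      split_ifs <;> rfl
    simp only [e, Finset.sum_ite_mem, Finset.univ_inter, Finset.sum_const, nsmul_eq_mul]
    rcases F.card.eq_zero_or_pos with h0 | h0
    · rw [h0, Nat.cast_zero, zero_mul]
      refine Finset.sum_eq_zero fun i _ => ?_
      simp only [u, ite_eq_right_iff, and_imp]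
      intro hh h1
      have hpos : 0 < τ₀ := (hv i h).trans_lt h1
      have := hF hpos
      rw [h0, Nat.cast_zero, mul_zero] at this
      linarith
    · have : (F.card : ℝ) ≠ 0 := by exact_mod_cast h0.ne'
      simp only [U]
      rw [mul_div_cancel₀ _ this]
  have hdisj : ∀ i, (b' i = 0 ∧ u' i = 0) ∨ (b' i = 0 ∧ z' i = 0) ∨ (u' i = 0 ∧ z' i = 0) := by
    intro i
    by_cases hiA : i ∈ A
    · exact Or.inr (Or.inr ⟨hu'0 i (Finset.disjoint_left.mp hAF hiA),
        hz'E i (Finset.mem_union_left _ hiA)⟩)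
    · by_cases hiF : i ∈ F
      · exact Or.inr (Or.inl ⟨hb'A i hiA, hz'E i (Finset.mem_union_right _ hiF)⟩)
      · exact Or.inl ⟨hb'A i hiA, hu'0 i hiF⟩
  have hsumτ : ∀ w : Fin k → ℝ, (∀ h, w h ≤ τ₀) → ∑ h, w h ≤ k * τ₀ := by
    intro w hw
    refine (Finset.sum_le_sum fun h _ => hw h).trans ?_
    rw [Finset.sum_const, Finset.card_univ, Fintype.card_fin, nsmul_eq_mul]
  have hk2 : (2 : ℝ) ≤ k := by exact_mod_cast hk
  have hhalf : (1 : ℝ) / 2 ≤ 1 - 1 / (2 * k) := by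
    have : 1 / (2 * (k : ℝ)) ≤ 1 / 2 := one_div_le_one_div_of_le (by norm_num) (by linarith)
    linarith
  have hk12 : 1 / (2 * (k : ℝ)) = 1 / k / 2 := by field_simp
  have hki : 0 < 1 / (k : ℝ) := by positivity
  have hws : ∀ i, ∑ h, (b' i h + u' i h + z' i h) ≤ 1 - 1 / (2 * k) := by
    intro i
    simp only [Finset.sum_add_distrib]
    have hb1 : ∑ h, b' i h ≤ 1 - 1 / (2 * k) := by
      refine (hb's i).trans ?_
      have h1 : ∑ h, b i h ≤ 1 - 1 / k := (Finset.sum_le_sum fun h _ => hbv i h).trans (hvs i)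
      have h2 : (k : ℝ) / ((4 * k ^ 2 : ℕ) : ℝ) = 1 / k / 4 := by
        push_cast
        field_simp
      rw [h2, hk12]
      linarith
    have hu1 : ∑ h, u' i h ≤ 1 - 1 / (2 * k) := by
      refine le_trans (hsumτ _ fun h => ?_) (hτ2.trans hhalf)
      by_cases hi : i ∈ F
      · rw [hu'F i hi]
        exact hUτ h
      · rw [hu'0 i hi]
        exact hτ₀
    have hz1 : ∑ h, z' i h ≤ 1 - 1 / (2 * k) := by
      refine (hz's i).trans ?_
      have h2 : (k : ℝ) / D ≤ 1 / k / 2 := by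
        rw [div_div, div_le_div_iff₀ hD' (by positivity)]
        have : (2 * (k : ℝ) ^ 2) ≤ D := by exact_mod_cast hD
        nlinarith
      rw [hk12]
      linarith
    rcases hdisj i with ⟨h1, h2⟩ | ⟨h1, h2⟩ | ⟨h1, h2⟩ <;> simp only [h1, h2, Pi.zero_apply,
      Finset.sum_const_zero, zero_add, add_zero] <;> assumption
  have hb'1 : ∀ h, ∑ i, b' i h = ∑ i, b i h := by
    intro h
    have := hb'm (Pi.single h 1) (by simpa using hR)
    simpa [Pi.single_apply, Finset.prod_ite_eq', pow_ite] using this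
  have hzpoor : ∀ h, ¬P h → ∀ i, z i h = 0 := fun h hh i => if_neg hh
  have hz'poor : ∀ h, ¬P h → ∀ i, z' i h = 0 := fun h hh => hz'0 h (hzpoor h hh)
  have hbrich : ∀ h, P h → ∀ i, b i h = 0 := fun h hh i => if_neg (by simp [hh])
  have hsumw : ∀ h, |∑ i, (b' i h + u' i h + z' i h) - lam h| ≤
      if P h then (B : ℝ) + gridTypeCount k else 0 := by
    intro h
    have e : ∑ i, (b' i h + u' i h + z' i h) - lam h = ∑ i, z' i h - ∑ i, z i h := by
      simp only [hlam, ← hbuz, Finset.sum_add_distrib, hb'1, ← huu]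
      ring
    rw [e]
    split_ifs with hh
    · exact hz'1 h
    · simp [hzpoor h hh, hz'poor h hh]
  -- On a rich coordinate m_h ≥ Λ^4, so the change of the mass caused by the replacement stays
  -- within the tolerance m_h / Γ for the mean.
  have hgap : ∀ h, P h → ((B : ℝ) + gridTypeCount k) + (1 / Γ) ^ 2 ≤ 1 / Γ * m h := by
    intro h hh
    have h1 : (B : ℝ) + gridTypeCount k + 1 ≤ 1 / Γ * m h := by
      rw [one_div_mul_eq_div, le_div_iff₀ hΓ0]
      exact hB1.trans (hmP h hh)
    have h2 : (1 / Γ) ^ 2 ≤ 1 := pow_le_one₀ hΓi.le (div_le_one_of_le₀ hΓ hΓ0.le)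
    linarith
  have hηm : ∀ h, (1 / Γ) ^ 2 ≤ 1 / Γ * m h := fun h => by
    rw [pow_two]
    exact mul_le_mul_of_nonneg_left (hmΓ h) hΓi.le
  have hLL : ∀ w : ι → Fin k → ℝ, (∀ i h, w i h ≤ v i h) → (∀ h, P h → ∀ i, w i h = 0) →
      ∑ i, ∑ h, w i h ≤ k * Λ := by
    intro w hw hwP
    rw [Finset.sum_comm]
    have : ∀ h, ∑ i, w i h ≤ Λ := fun h => by
      by_cases hh : P h
      · simp only [hwP h hh, Finset.sum_const_zero]
        linarith
      · exact (Finset.sum_le_sum fun i _ => hw i h).trans (hpoor h hh)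
    refine (Finset.sum_le_sum fun h _ => this h).trans ?_
    rw [Finset.sum_const, Finset.card_univ, Fintype.card_fin, nsmul_eq_mul]
  have hw0 : ∀ i h, 0 ≤ b' i h + u' i h + z' i h := fun i h =>
    add_nonneg (add_nonneg (hb'0 i h) (hu'nn i h)) (hz'nn i h)
  have hzℓ : ∀ i, z i ℓ = 0 := fun i => le_antisymm ((hzv i ℓ).trans (hvℓ i).le) (hz i ℓ)
  have huℓ : ∀ i, u i ℓ = 0 := fun i => le_antisymm ((huv i ℓ).trans (hvℓ i).le) (hu i ℓ)
  have hwℓ : ∀ i, b' i ℓ + u' i ℓ + z' i ℓ = 0 := by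
    intro i
    have h1 : u' i ℓ = 0 := by
      by_cases hi : i ∈ F
      · rw [hu'F i hi]
        simp [U, huℓ]
      · rw [hu'0 i hi, Pi.zero_apply]
    rw [hb'ℓ, h1, hz'0 ℓ hzℓ, add_zero, add_zero]
  refine ⟨fun i h => b' i h + u' i h + z' i h, hw0, hwℓ,
    fun i => (hws i).trans (sub_le_self _ (by positivity)), ?_, ?_, ?_, ?_⟩
  · have hsub : (fun i h => b' i h + u' i h + z' i h) '' (A ∪ F : Finset ι) ⊆
        insert U (Set.range b') := by
      rintro _ ⟨i, hi, rfl⟩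
      have hzi := hz'E i hi
      by_cases hiF : i ∈ F
      · left
        have hiA : i ∉ A := fun h => Finset.disjoint_left.mp hAF h hiF
        funext h
        simp [hb'A i hiA, hzi, hu'F i hiF]
      · right
        refine ⟨i, ?_⟩
        funext h
        simp [hu'0 i hiF, hzi]
    refine (Set.ncard_le_ncard hsub ((Set.finite_range _).insert _)).trans ?_
    exact (Set.ncard_insert_le _ _).trans (Nat.add_le_add_right hb'c 1)
  · have e : (fun i h => b' i h + u' i h + z' i h) '' ((A ∪ F : Finset ι) : Set ι)ᶜ =
        z' '' ((A ∪ F : Finset ι) : Set ι)ᶜ := by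
      refine Set.image_congr fun i hi => ?_
      have hi' : i ∉ A ∧ i ∉ F := by simpa [not_or] using hi
      funext h
      simp [hb'A i hi'.1, hu'0 i hi'.2]
    rw [e]
    exact hz'c
  · intro i hi
    have hi' : i ∉ A ∧ i ∉ F := by simpa [not_or] using hi
    obtain ⟨n, hn⟩ := hz'n i
    refine ⟨n, ?_⟩
    funext h
    simp [hb'A i hi'.1, hu'0 i hi'.2, hn]
  · have e : (fun i => fillAt ℓ (v i)) = fun i => fillAt ℓ fun h => b i h + u i h + z i h := by
      simp only [hbuz]
    rw [e]
    refine pmdClose_of_parts hk0 ℓ b u z b' u' z' hb hu hz hb'0 hu'nn hz'nn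
      (fun i => by rw [hbuz, hvℓ]) hwℓ ?_ hws m hm (κ₀ := 1 / Γ) ?_ ?_ ?_ ?_ ?_ hR hσ0 hσ
      (γ₀ := Γ) hΓ0.le ?_ (γ₁ := 1 / Λ ^ 4) (by positivity) hγ₁ P ?_ hzpoor hz'poor
      (θ := θ) hq hθ (fun i h => (hbv i h).trans (hvm i h)) hb'cap (τ := k * τ₀) (by positivity)
      ?_ ?_ hτ8 (L := k * Λ) ?_ ?_ hdisj huu hb'm (β := (B : ℝ) + gridTypeCount k)
      (δ := 1 / D) (by positivity) (by positivity) hz'1 hz'2 hΔ1 hε hΔ hbound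
    · intro i
      simp only [hbuz]
      refine (hvs i).trans ?_
      rw [hk12]
      linarith
    · rw [div_pow, one_pow, mul_one_div, div_le_one (by positivity)]
      exact hκ
    · intro h
      simp only [hbuz]
      rw [hm2, show ∑ i, v i h - (lam h + (1 / Γ) ^ 2) = -(1 / Γ) ^ 2 by simp only [hlam]; ring,
        abs_neg, abs_of_nonneg (sq_nonneg _)]
      exact hηm h
    · intro h
      simp only [hbuz]
      rw [hm2]
      exact le_add_of_nonneg_right (sq_nonneg _)
    · intro h
      have h1 := hsumw h
      rw [hm2]
      have h2 := sq_nonneg (1 / Γ)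
      split_ifs at h1 with hh
      · have h3 := hgap h hh
        rw [abs_le] at h1 ⊢
        constructor <;> linarith [h1.1, h1.2]
      · have h3 := hηm h
        rw [abs_le] at h1 ⊢
        constructor <;> linarith [h1.1, h1.2]
    · intro h
      have h1 := (abs_le.mp (hsumw h)).2
      have h2 : lam h ≤ m h ^ 2 := by
        rw [hm2]
        exact le_add_of_nonneg_right (sq_nonneg _)
      rw [add_mul, one_mul, one_div_mul_eq_div]
      split_ifs at h1 with hh
      · have h3 : (B : ℝ) + gridTypeCount k ≤ m h ^ 2 / (8 * k) := by
          rw [le_div_iff₀ (by positivity), mul_comm]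
          exact hB2.trans ((hrich h hh).trans h2)
        linarith
      · have : 0 ≤ m h ^ 2 / (8 * k) := by positivity
        linarith
    · intro h
      have := hmΓ h
      rwa [div_le_iff₀ hΓ0, mul_comm] at this
    · intro h hh
      rw [one_div_mul_eq_div, one_le_div (by positivity)]
      exact hmP h hh
    · intro i
      refine hsumτ _ fun h => ?_
      simp only [u]
      split_ifs with h1
      · exact h1.2.le
      · exact hτ₀
    · intro i
      refine hsumτ _ fun h => ?_
      by_cases hi : i ∈ F
      · rw [hu'F i hi]
        exact hUτ h
      · rw [hu'0 i hi]
        exact hτ₀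
    · exact hLL b hbv hbrich
    · exact hLL u huv huP

end Group

/-! ### The parameters of the group theorem -/

section Parameters

/-- Pigeonhole: there are k + 1 disjoint intervals between consecutive scales but only k masses, so
one interval is free. -/
theorem exists_gap {k : ℕ} (lam : Fin k → ℝ) {a : ℕ → ℝ} (ha : Monotone a) :
    ∃ j ≤ k, ∀ h, lam h < a j ∨ a (j + 1) ≤ lam h := by
  by_contra! hcon
  choose f hf1 hf2 using fun j : Fin (k + 1) => hcon j (Nat.lt_succ_iff.mp j.2)
  have hinj : Function.Injective f := by
    have hlt : ∀ i j : Fin (k + 1), i < j → f i ≠ f j := by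
      intro i j hij heq
      have h1 := hf2 i
      have h2 := hf1 j
      rw [← heq] at h2
      have h3 : a (i + 1) ≤ a j := ha hij
      linarith
    intro i j heq
    rcases lt_trichotomy i j with h | h | h
    · exact absurd heq (hlt i j h)
    · exact h
    · exact absurd heq.symm (hlt j i h)
  have := Fintype.card_le_of_injective f hinj
  simp at this

/-- The powers of Γ and Λ make each of the six error terms other than t at most W^4/Γ ≤ 1/(64W³).
Their coefficients add up to 39, so together they take at most half of 1/W², and t takes the other
half. -/
theorem group_error_le {k r₀ σ W Γ Λ τ₀ β d t : ℝ} (hk0 : 0 ≤ k) (hr0 : 0 ≤ r₀) (hσ0 : 0 ≤ σ)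
    (hW : 64 ≤ W) (hk : k ≤ W) (hσ : σ ≤ W) (hr : r₀ ≤ W) (hΓ : Γ = W ^ 8) (hΛ : Γ ^ 8 ≤ Λ)
    (hτ0 : 0 ≤ τ₀) (hτ : τ₀ * (Λ * Γ ^ 3) ≤ 1) (hβ0 : 0 ≤ β) (hβ : β ≤ Λ ^ 2 * Γ ^ 4)
    (hd0 : 0 ≤ d) (hd : d * Γ ≤ 1) (ht : t ≤ 1 / (2 * W ^ 2)) :
    k * τ₀ ≤ 1 / 2 ∧ σ * Γ * (k * τ₀) ≤ 1 / 8 ∧ σ * (1 / Λ ^ 4) ≤ 1 / 8 ∧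
    12 * (σ * Γ * (k * τ₀) * (σ * Γ * (k * Λ))) +
      8 * (σ * (1 / Λ ^ 4) * (σ * Γ * (k * Λ))) + 16 * (σ * (1 / Λ ^ 4) * r₀) + t +
      (k * (σ * (1 / Λ ^ 4)) * β + (k * (σ * (1 / Λ ^ 4))) ^ 2 * β + r₀ * d) ≤ 1 / W ^ 2 := by
  have hW1 : 1 ≤ W := by linarith
  have hW0 : 0 < W := by linarith
  have hΓ1 : 1 ≤ Γ := hΓ ▸ one_le_pow₀ hW1
  have hΓ0 : 0 < Γ := by linarith
  have hΓΛ : Γ ≤ Λ := (le_self_pow₀ hΓ1 (by norm_num)).trans hΛ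
  have hΛ1 : 1 ≤ Λ := hΓ1.trans hΓΛ
  have hΛ0 : 0 < Λ := by linarith
  have hΓ4 : Γ ^ 6 ≤ Λ := (pow_le_pow_right₀ hΓ1 (by norm_num)).trans hΛ
  have hWΓ : 64 * W ^ 7 ≤ Γ := by
    rw [hΓ, pow_succ W 7, mul_comm]
    exact mul_le_mul_of_nonneg_left hW (by positivity)
  have hτ' : τ₀ ≤ 1 / (Λ * Γ ^ 3) := (le_div_iff₀ (by positivity)).mpr hτ
  have hd' : d ≤ 1 / Γ := (le_div_iff₀ hΓ0).mpr hd
  have hx : 1 / Λ ^ 4 ≤ 1 / (Λ ^ 3 * Γ ^ 6) := by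
    apply one_div_le_one_div_of_le (by positivity)
    rw [pow_succ Λ 3]
    gcongr
  have hx' : 1 / Λ ^ 4 ≤ 1 / Γ := by
    refine hx.trans (one_div_le_one_div_of_le hΓ0 ?_)
    calc Γ ≤ Γ ^ 6 := le_self_pow₀ hΓ1 (by norm_num)
      _ ≤ Λ ^ 3 * Γ ^ 6 := le_mul_of_one_le_left (by positivity) (one_le_pow₀ hΛ1)
  have hσx : σ * (1 / Λ ^ 4) ≤ W * (1 / Γ) := by gcongr
  have hWp : ∀ n, 1 ≤ W ^ n := fun n => one_le_pow₀ hW1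
  have hbase : W ^ 4 * (1 / Γ) ≤ 1 / (64 * W ^ 3) := by
    rw [mul_one_div, div_le_div_iff₀ hΓ0 (by positivity)]
    nlinarith
  have hsmall : W ^ 4 * (1 / Γ) ≤ 1 / 8 := by
    refine hbase.trans (one_div_le_one_div_of_le (by norm_num) ?_)
    nlinarith [hWp 3]
  have hg0 : 0 < 1 / Γ := by positivity
  have hmono : ∀ n ≤ 4, W ^ n * (1 / Γ) ≤ W ^ 4 * (1 / Γ) := fun n hn =>
    mul_le_mul_of_nonneg_right (pow_le_pow_right₀ hW1 hn) hg0.le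
  have hτ1 : σ * Γ * (k * τ₀) ≤ W ^ 2 * (1 / (Λ * Γ ^ 2)) := by
    calc σ * Γ * (k * τ₀) ≤ W * Γ * (W * (1 / (Λ * Γ ^ 3))) := by gcongr
      _ = _ := by field_simp
  have hΛg : 1 / (Λ * Γ ^ 2) ≤ 1 / Γ := by
    apply one_div_le_one_div_of_le hΓ0
    nlinarith [mul_le_mul hΛ1 (le_self_pow₀ hΓ1 (two_ne_zero)) hΓ0.le hΛ0.le]
  have hΛg3 : 1 / (Λ * Γ ^ 3) ≤ 1 / Γ := by
    apply one_div_le_one_div_of_le hΓ0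
    nlinarith [mul_le_mul hΛ1 (le_self_pow₀ hΓ1 (three_ne_zero)) hΓ0.le hΛ0.le]
  have t1 : σ * Γ * (k * τ₀) * (σ * Γ * (k * Λ)) ≤ W ^ 4 * (1 / Γ) := by
    calc σ * Γ * (k * τ₀) * (σ * Γ * (k * Λ)) ≤
        W ^ 2 * (1 / (Λ * Γ ^ 2)) * (W * Γ * (W * Λ)) := by gcongr
      _ = _ := by field_simp
  have t2 : σ * (1 / Λ ^ 4) * (σ * Γ * (k * Λ)) ≤ W ^ 4 * (1 / Γ) := by
    calc σ * (1 / Λ ^ 4) * (σ * Γ * (k * Λ)) ≤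
        W * (1 / (Λ ^ 3 * Γ ^ 6)) * (W * Γ * (W * Λ)) := by gcongr
      _ = W ^ 3 * (1 / (Λ ^ 2 * Γ ^ 5)) := by field_simp
      _ ≤ W ^ 3 * (1 / Γ) := by
        refine mul_le_mul_of_nonneg_left (one_div_le_one_div_of_le hΓ0 ?_) (by positivity)
        exact (le_self_pow₀ hΓ1 (by norm_num)).trans
          (le_mul_of_one_le_left (by positivity) (one_le_pow₀ hΛ1))
      _ ≤ W ^ 4 * (1 / Γ) := hmono 3 (by norm_num)
  have t3 : σ * (1 / Λ ^ 4) * r₀ ≤ W ^ 4 * (1 / Γ) := by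
    calc σ * (1 / Λ ^ 4) * r₀ ≤ W * (1 / Γ) * W := by gcongr
      _ = W ^ 2 * (1 / Γ) := by ring
      _ ≤ _ := hmono 2 (by norm_num)
  have hxβ : (1 / Λ ^ 4) * β ≤ 1 / Γ := by
    calc (1 / Λ ^ 4) * β ≤ 1 / (Λ ^ 3 * Γ ^ 6) * (Λ ^ 2 * Γ ^ 4) := by gcongr
      _ = 1 / (Λ * Γ ^ 2) := by field_simp
      _ ≤ _ := hΛg
  have t5 : k * (σ * (1 / Λ ^ 4)) * β ≤ W ^ 4 * (1 / Γ) := by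
    calc k * (σ * (1 / Λ ^ 4)) * β = k * σ * ((1 / Λ ^ 4) * β) := by ring
      _ ≤ W * W * (1 / Γ) := by gcongr
      _ = W ^ 2 * (1 / Γ) := by ring
      _ ≤ _ := hmono 2 (by norm_num)
  have t6 : (k * (σ * (1 / Λ ^ 4))) ^ 2 * β ≤ W ^ 4 * (1 / Γ) := by
    have h1 : 1 / Λ ^ 4 ≤ 1 := div_le_one_of_le₀ (one_le_pow₀ hΛ1) (by positivity)
    calc (k * (σ * (1 / Λ ^ 4))) ^ 2 * β = (k * σ) ^ 2 * (1 / Λ ^ 4) * ((1 / Λ ^ 4) * β) := by ring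
      _ ≤ (W * W) ^ 2 * 1 * (1 / Γ) := by gcongr
      _ = _ := by ring
  have t7 : r₀ * d ≤ W ^ 4 * (1 / Γ) := by
    calc r₀ * d ≤ W * (1 / Γ) := by gcongr
      _ = W ^ 1 * (1 / Γ) := by ring
      _ ≤ _ := hmono 1 (by norm_num)
  refine ⟨?_, ?_, ?_, ?_⟩
  · calc k * τ₀ ≤ W * (1 / Γ) := by
          gcongr
          exact hτ'.trans hΛg3
      _ = W ^ 1 * (1 / Γ) := by ring
      _ ≤ W ^ 4 * (1 / Γ) := hmono 1 (by norm_num)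
      _ ≤ 1 / 2 := by linarith
  · calc σ * Γ * (k * τ₀) ≤ W ^ 2 * (1 / Γ) := hτ1.trans (by gcongr)
      _ ≤ W ^ 4 * (1 / Γ) := hmono 2 (by norm_num)
      _ ≤ 1 / 8 := hsmall
  · calc σ * (1 / Λ ^ 4) ≤ W ^ 1 * (1 / Γ) := by rw [pow_one]; exact hσx
      _ ≤ W ^ 4 * (1 / Γ) := hmono 1 (by norm_num)
      _ ≤ 1 / 8 := hsmall
  · have h64 : 40 * (1 / (64 * W ^ 3)) ≤ 1 / (2 * W ^ 2) := by
      rw [mul_one_div, div_le_div_iff₀ (by positivity) (by positivity)]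
      have : 64 * W ^ 2 ≤ W ^ 3 := by
        rw [pow_succ W 2, mul_comm]
        exact mul_le_mul_of_nonneg_left hW (by positivity)
      linarith [hWp 2]
    have e : 1 / W ^ 2 = 1 / (2 * W ^ 2) + 1 / (2 * W ^ 2) := by field_simp; norm_num
    rw [e]
    have hY : 0 ≤ 1 / (64 * W ^ 3) := by positivity
    generalize σ * Γ * (k * τ₀) * (σ * Γ * (k * Λ)) = a₁ at t1 ⊢
    generalize σ * (1 / Λ ^ 4) * (σ * Γ * (k * Λ)) = a₂ at t2 ⊢
    generalize σ * (1 / Λ ^ 4) * r₀ = a₃ at t3 ⊢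
    generalize k * (σ * (1 / Λ ^ 4)) * β = a₅ at t5 ⊢
    generalize (k * (σ * (1 / Λ ^ 4))) ^ 2 * β = a₆ at t6 ⊢
    generalize r₀ * d = a₇ at t7 ⊢
    generalize W ^ 4 * (1 / Γ) = X at *
    generalize 1 / (64 * W ^ 3) = Y at *
    generalize 1 / (2 * W ^ 2) = Z at *
    clear hτ hβ hd hτ' hd' hx hx' hσx hτ1 hmono
    linarith

variable {ι : Type} [Fintype ι] {k : ℕ}

theorem exists_group_types_of_threshold [DecidableEq ι] (hk : 2 ≤ k) (ℓ : Fin k)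
    (v : ι → Fin k → ℝ)
    (hv : ∀ i h, 0 ≤ v i h) (hvℓ : ∀ i, v i ℓ = 0) (hvs : ∀ i, ∑ h, v i h ≤ 1 - 1 / k)
    {θ : ℝ} (hθ0 : 0 ≤ θ) (hvθ : ∀ i h, v i h ^ 2 ≤ θ ^ 2 * ∑ j, v j h)
    {r₀ σ q ε : ℝ} {R D W Γ Λ B : ℕ} (hR : 1 ≤ R) (hr0 : 0 ≤ r₀) (hσ0 : 0 ≤ σ) (hσ : r₀ ≤ σ ^ 2)
    (hq : 8 ≤ q) (hθ : k * r₀ * θ ^ 2 ≤ (1 / q) ^ 2) (hWr : (64 : ℝ) ≤ W)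
    (hkWr : (k : ℝ) + 1 ≤ W) (hσW : σ ≤ W) (hrW : r₀ ≤ W) (hD : W ^ 16 ≤ D)
    (hRq : 8 * r₀ * (1 / q) ^ (R - 1) ≤ 1 / (2 * (W : ℝ) ^ 2)) (hε : 0 ≤ ε)
    (hbound : 4 * Real.exp 1 * (1 / (W : ℝ) ^ 2) ^ 2 * (4 * k) ^ k +
      4 * Real.exp 1 * Real.exp (-r₀ / (8 * k)) * (8 * k) ^ k ≤ ε ^ 2)
    (hΓr : (Γ : ℝ) = (W : ℝ) ^ 8) (hΓΛ : (Γ : ℝ) ^ 8 ≤ Λ) (P : Fin k → Prop)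
    (hpoor : ∀ h, ¬P h → ∑ i, v i h ≤ Λ) (hrich : ∀ h, P h → (Λ : ℝ) ^ 8 ≤ ∑ i, v i h)
    (hβ : (B : ℝ) + gridTypeCount k + 1 ≤ (Λ : ℝ) ^ 2 * (Γ : ℝ) ^ 4)
    (τ₀ : ℝ) (A F : Finset ι) (hτ0 : 0 ≤ τ₀) (hτ : τ₀ * (Λ * Γ ^ 3) ≤ 1) (hAF : Disjoint A F)
    (hA : ∀ i ∉ A, ∀ h, ¬P h → v i h < τ₀ ∨ v i h = 0)
    (hF : 0 < τ₀ → (Λ : ℝ) ≤ τ₀ * F.card) (hAB : (A ∪ F).card ≤ B) :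
    ∃ (v' : ι → Fin k → ℝ) (E : Finset ι), (∀ i h, 0 ≤ v' i h) ∧
      (∀ i, v' i ℓ = 0) ∧ (∀ i, ∑ h, v' i h ≤ 1) ∧ E.card ≤ B ∧
      (v' '' E).ncard ≤ ((4 * k ^ 2 + 2) * (R + 2)) ^ (k - 1) + 1 ∧
      (v' '' (E : Set ι)ᶜ).ncard ≤ gridTypeCount k + 1 ∧
      (∀ i ∉ E, ∃ n : Fin k → ℕ, v' i = fun h => (n h : ℝ) / D) ∧
      PMDClose (fun i => fillAt ℓ (v i)) (fun i => fillAt ℓ (v' i)) ε := by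
  have hW1 : (1 : ℝ) ≤ W := by linarith
  have hΓ1 : (1 : ℝ) ≤ Γ := hΓr ▸ one_le_pow₀ hW1
  have hΓ0 : (0 : ℝ) < Γ := by linarith
  have hΛΓ : (Γ : ℝ) ≤ Λ := (le_self_pow₀ hΓ1 (by norm_num)).trans hΓΛ
  have hΛ1 : (1 : ℝ) ≤ Λ := hΓ1.trans hΛΓ
  have hWΓ2 : (W : ℝ) * 64 ≤ Γ := by
    rw [hΓr, pow_succ (W : ℝ) 7, mul_comm]
    exact mul_le_mul (hWr.trans (le_self_pow₀ hW1 (by norm_num))) le_rfl (by linarith)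
      (by positivity)
  have hD1 : (Γ : ℝ) ^ 2 ≤ D := by
    rw [hΓr, ← pow_mul]
    exact_mod_cast hD
  have hD0 : (0 : ℝ) < D := lt_of_lt_of_le (by positivity) hD1
  obtain ⟨n1, n2, n3, n4⟩ := group_error_le (k := (k : ℝ)) (d := 1 / (D : ℝ)) k.cast_nonneg hr0
    hσ0 hWr (by linarith) hσW hrW hΓr hΓΛ hτ0 hτ (β := (B : ℝ) + gridTypeCount k)
    (by positivity) (by linarith) (by positivity)
    (by
      rw [one_div_mul_eq_div, div_le_one hD0]
      exact (le_self_pow₀ hΓ1 two_ne_zero).trans hD1) hRq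
  have hk0 : (0 : ℝ) ≤ k := k.cast_nonneg
  have hkΓ8 : 8 * (k : ℝ) ≤ Γ := by linarith
  have hkΓ : 8 * (k : ℝ) ^ 2 ≤ (Γ : ℝ) ^ 2 := by
    have := mul_self_le_mul_self (by positivity) hkΓ8
    linarith [sq_nonneg (k : ℝ)]
  obtain ⟨v', h1, h2, h3, h4, h5, h6, h7⟩ := exists_group_types_of_gap hk ℓ v hv hvℓ hvs hθ0 hvθ
    (B := B) (D := D) (Δ := 1 / (W : ℝ) ^ 2) (ε := ε) hR hσ0 hσ hΓ1 hΛ1 hτ0 hq hθ P hpoor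
    hrich A F hAF hA hF hAB hkΓ
    (by
      calc ((B : ℝ) + gridTypeCount k + 1) * Γ ≤ (Λ : ℝ) ^ 2 * (Γ : ℝ) ^ 4 * Γ := by gcongr
        _ = (Λ : ℝ) ^ 2 * (Γ : ℝ) ^ 5 := by ring
        _ ≤ (Λ : ℝ) ^ 2 * (Γ : ℝ) ^ 8 :=
            mul_le_mul_of_nonneg_left (pow_le_pow_right₀ hΓ1 (by norm_num)) (by positivity)
        _ ≤ (Λ : ℝ) ^ 2 * Λ := by gcongr
        _ = (Λ : ℝ) ^ 3 := by ring
        _ ≤ (Λ : ℝ) ^ 4 := pow_le_pow_right₀ hΛ1 (by norm_num))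
    (by
      calc 8 * (k : ℝ) * ((B : ℝ) + gridTypeCount k) ≤ Γ * ((Λ : ℝ) ^ 2 * (Γ : ℝ) ^ 4) := by
            gcongr
            linarith
        _ = (Λ : ℝ) ^ 2 * (Γ : ℝ) ^ 5 := by ring
        _ ≤ (Λ : ℝ) ^ 2 * (Γ : ℝ) ^ 8 :=
            mul_le_mul_of_nonneg_left (pow_le_pow_right₀ hΓ1 (by norm_num)) (by positivity)
        _ ≤ (Λ : ℝ) ^ 2 * Λ := by gcongr
        _ = (Λ : ℝ) ^ 3 := by ring
        _ ≤ (Λ : ℝ) ^ 8 := pow_le_pow_right₀ hΛ1 (by norm_num))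
    (by
      have : (2 : ℝ) * k ^ 2 ≤ D := by nlinarith [sq_nonneg (k : ℝ)]
      exact_mod_cast this)
    n1 n2 n3 (div_le_one_of_le₀ (one_le_pow₀ hW1) (by positivity)) hε n4 hbound
  exact ⟨v', A ∪ F, h1, h2, h3, hAB, h4, h5, h6, h7⟩

/-- The scales for `exists_gap` are W^(8·8^(j+1)): each is the eighth power of the one before, so
the free interval is [Λ, Λ^8). Even the largest scale admitted keeps the exceptional set below
W^(8^(k+3)), independently of the number of players. -/
theorem exists_group_types_of_params [DecidableEq ι] (hk : 2 ≤ k) (ℓ : Fin k) (v : ι → Fin k → ℝ)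
    (hv : ∀ i h, 0 ≤ v i h) (hvℓ : ∀ i, v i ℓ = 0) (hvs : ∀ i, ∑ h, v i h ≤ 1 - 1 / k)
    {θ : ℝ} (hθ0 : 0 ≤ θ) (hvθ : ∀ i h, v i h ^ 2 ≤ θ ^ 2 * ∑ j, v j h)
    {r₀ σ q ε : ℝ} {R D W : ℕ} (hR : 1 ≤ R) (hr0 : 0 ≤ r₀) (hσ0 : 0 ≤ σ) (hσ : r₀ ≤ σ ^ 2)
    (hq : 8 ≤ q) (hθ : k * r₀ * θ ^ 2 ≤ (1 / q) ^ 2) (hW : 64 ≤ W) (hkW : gridTypeCount k + 1 ≤ W)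
    (hσW : σ ≤ W) (hrW : r₀ ≤ W) (hD : W ^ 16 ≤ D)
    (hRq : 8 * r₀ * (1 / q) ^ (R - 1) ≤ 1 / (2 * (W : ℝ) ^ 2)) (hε : 0 ≤ ε)
    (hbound : 4 * Real.exp 1 * (1 / (W : ℝ) ^ 2) ^ 2 * (4 * k) ^ k +
      4 * Real.exp 1 * Real.exp (-r₀ / (8 * k)) * (8 * k) ^ k ≤ ε ^ 2) :
    ∃ (v' : ι → Fin k → ℝ) (E : Finset ι), (∀ i h, 0 ≤ v' i h) ∧ (∀ i, v' i ℓ = 0) ∧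
      (∀ i, ∑ h, v' i h ≤ 1) ∧ E.card ≤ W ^ 8 ^ (k + 3) ∧
      (v' '' E).ncard ≤ ((4 * k ^ 2 + 2) * (R + 2)) ^ (k - 1) + 1 ∧
      (v' '' (E : Set ι)ᶜ).ncard ≤ gridTypeCount k + 1 ∧
      (∀ i ∉ E, ∃ n : Fin k → ℕ, v' i = fun h => (n h : ℝ) / D) ∧
      PMDClose (fun i => fillAt ℓ (v i)) (fun i => fillAt ℓ (v' i)) ε := by
  classical
  have hkW' : k + 1 ≤ W := by
    have : k ≤ gridTypeCount k := by unfold gridTypeCount; omega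
    omega
  have hWr : (64 : ℝ) ≤ W := by exact_mod_cast hW
  have hW1 : (1 : ℝ) ≤ W := by linarith
  have hkWr : ((k : ℝ) + 1) ≤ W := by exact_mod_cast hkW'
  have hgW : ((gridTypeCount k : ℝ) + 1) ≤ W := by exact_mod_cast hkW
  have ha : Monotone fun j : ℕ => (W : ℝ) ^ (8 * 8 ^ (j + 1)) := by
    intro i j hij
    exact pow_le_pow_right₀ hW1 (Nat.mul_le_mul_left _ (Nat.pow_le_pow_right (by norm_num)
      (by omega)))
  obtain ⟨j, hjk, hj⟩ := exists_gap (fun h => ∑ i, v i h) ha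
  obtain ⟨Γ, hΓ⟩ : ∃ Γ : ℕ, Γ = W ^ 8 := ⟨_, rfl⟩
  obtain ⟨Λ, hΛ⟩ : ∃ Λ : ℕ, Λ = W ^ (8 * 8 ^ (j + 1)) := ⟨_, rfl⟩
  have hΓr : (Γ : ℝ) = (W : ℝ) ^ 8 := by rw [hΓ]; push_cast; rfl
  have hΛr : (Λ : ℝ) = (W : ℝ) ^ (8 * 8 ^ (j + 1)) := by rw [hΛ]; push_cast; rfl
  have hΛ8 : (Λ : ℝ) ^ 8 = (W : ℝ) ^ (8 * 8 ^ (j + 1 + 1)) := by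
    rw [hΛr, ← pow_mul, pow_succ 8 (j + 1), mul_assoc]
  have hΓΛ : (Γ : ℝ) ^ 8 ≤ Λ := by
    rw [hΓr, hΛr, ← pow_mul]
    refine pow_le_pow_right₀ hW1 (Nat.mul_le_mul_left 8 ?_)
    exact Nat.le_self_pow (by omega) 8
  have hΓ1 : (1 : ℝ) ≤ Γ := hΓr ▸ one_le_pow₀ hW1
  have hΓ0 : (0 : ℝ) < Γ := by linarith
  have hΛΓ : (Γ : ℝ) ≤ Λ := (le_self_pow₀ hΓ1 (by norm_num)).trans hΓΛ
  have hΛ1 : (1 : ℝ) ≤ Λ := hΓ1.trans hΛΓ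
  have hΛ0 : (0 : ℝ) < Λ := by linarith
  have hWΓ : 64 * (W : ℝ) ^ 7 ≤ Γ := by
    rw [hΓr, pow_succ (W : ℝ) 7, mul_comm]
    exact mul_le_mul_of_nonneg_left hWr (by positivity)
  have hWΓ2 : (W : ℝ) * 64 ≤ Γ := by
    have := le_self_pow₀ hW1 (show 7 ≠ 0 by norm_num)
    linarith
  let P : Fin k → Prop := fun h => (Λ : ℝ) ^ 8 ≤ ∑ i, v i h
  have hpoor : ∀ h, ¬P h → ∑ i, v i h ≤ Λ := by
    intro h hh
    rcases hj h with h1 | h1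
    · rw [hΛr]
      exact h1.le
    · exact absurd (hΛ8.trans_le h1) hh
  obtain ⟨B, hB⟩ : ∃ B : ℕ, B = (k + 1) * (Λ ^ 2 * Γ ^ 3) := ⟨_, rfl⟩
  have hBr : (B : ℝ) = ((k : ℝ) + 1) * ((Λ : ℝ) ^ 2 * (Γ : ℝ) ^ 3) := by rw [hB]; push_cast; rfl
  have hβ : (B : ℝ) + gridTypeCount k + 1 ≤ (Λ : ℝ) ^ 2 * (Γ : ℝ) ^ 4 := by
    have h1 : (1 : ℝ) ≤ (Λ : ℝ) ^ 2 * (Γ : ℝ) ^ 3 :=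
      one_le_mul_of_one_le_of_one_le (one_le_pow₀ hΛ1) (one_le_pow₀ hΓ1)
    rw [hBr, pow_succ (Γ : ℝ) 3, ← mul_assoc ((Λ : ℝ) ^ 2)]
    nlinarith
  have hBmax : B ≤ W ^ 8 ^ (k + 3) := by
    have h1 : B ≤ W * (Λ ^ 2 * Γ ^ 3) := hB ▸ Nat.mul_le_mul_right _ hkW'
    refine h1.trans ?_
    rw [hΛ, hΓ, ← pow_mul, ← pow_mul, ← pow_add, ← pow_succ']
    refine Nat.pow_le_pow_right (by omega) ?_
    have h2 : 8 ^ (j + 1) ≤ 8 ^ (k + 1) := Nat.pow_le_pow_right (by norm_num) (by omega)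
    have h3 : 8 ≤ 8 ^ (k + 1) := Nat.le_self_pow (by omega) 8
    have h4 : 8 ^ (k + 3) = 64 * 8 ^ (k + 1) := by ring
    omega
  obtain ⟨τ₀, A, F, hτ0, hτ, hAF, hA, hF, hAB⟩ : ∃ (τ₀ : ℝ) (A F : Finset ι), 0 ≤ τ₀ ∧
      τ₀ * (Λ * Γ ^ 3) ≤ 1 ∧ Disjoint A F ∧
      (∀ i ∉ A, ∀ h, ¬P h → v i h < τ₀ ∨ v i h = 0) ∧ (0 < τ₀ → (Λ : ℝ) ≤ τ₀ * F.card) ∧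
      (A ∪ F).card ≤ B := by
    -- The poor coordinates have total mass at most kΛ, so at most kΛ/τ₀ = kΛ²Γ³ players have a poor
    -- entry of size τ₀. These form A. A further Λ²Γ³ players suffice to carry the tiny entries.
    let τ₀ : ℝ := 1 / (Λ * Γ ^ 3)
    have hτpos : 0 < τ₀ := by positivity
    have hτeq : τ₀ * (Λ * (Γ : ℝ) ^ 3) = 1 := by simp only [τ₀]; field_simp
    let A : Finset ι := Finset.univ.filter fun i => ∃ h, ¬P h ∧ τ₀ ≤ v i h
    have hAcard : (A.card : ℝ) ≤ k * ((Λ : ℝ) ^ 2 * (Γ : ℝ) ^ 3) := by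
      have h1 : ∀ i ∈ A, τ₀ ≤ ∑ h, if P h then 0 else v i h := by
        intro i hi
        obtain ⟨h, hh, hτ⟩ := (Finset.mem_filter.mp hi).2
        refine hτ.trans ?_
        have := Finset.single_le_sum (f := fun h => if P h then 0 else v i h)
          (fun h _ => by split_ifs; exacts [le_rfl, hv i h]) (Finset.mem_univ h)
        simpa only [if_neg hh] using this
      have h2 : A.card * τ₀ ≤ k * (Λ : ℝ) := by
        calc A.card * τ₀ = ∑ i ∈ A, τ₀ := by rw [Finset.sum_const, nsmul_eq_mul]
          _ ≤ ∑ i ∈ A, ∑ h, (if P h then 0 else v i h) := Finset.sum_le_sum h1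
          _ ≤ ∑ i, ∑ h, (if P h then 0 else v i h) :=
            Finset.sum_le_univ_sum_of_nonneg fun i => Finset.sum_nonneg fun h _ => by
              split_ifs; exacts [le_rfl, hv i h]
          _ = ∑ h, ∑ i, (if P h then 0 else v i h) := Finset.sum_comm
          _ ≤ ∑ _h : Fin k, (Λ : ℝ) := by
            refine Finset.sum_le_sum fun h _ => ?_
            by_cases hh : P h
            · simp only [if_pos hh, Finset.sum_const_zero]
              exact hΛ0.le
            · simp only [if_neg hh]
              exact hpoor h hh
          _ = k * (Λ : ℝ) := by simp
      calc (A.card : ℝ) = A.card * τ₀ * (Λ * (Γ : ℝ) ^ 3) := by rw [mul_assoc, hτeq, mul_one]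
        _ ≤ k * (Λ : ℝ) * (Λ * (Γ : ℝ) ^ 3) := by gcongr
        _ = _ := by ring
    by_cases hJ : Λ ^ 2 * Γ ^ 3 ≤ Aᶜ.card
    · obtain ⟨F, hFA, hFc⟩ := Finset.exists_subset_card_eq hJ
      have hdis : Disjoint A F := Finset.disjoint_of_subset_right hFA disjoint_compl_right
      refine ⟨τ₀, A, F, hτpos.le, hτeq.le, hdis, ?_, fun _ => ?_, ?_⟩
      · intro i hi h hh
        left
        by_contra hcon
        exact hi (Finset.mem_filter.mpr ⟨Finset.mem_univ _, h, hh, not_lt.mp hcon⟩)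
      · rw [hFc]
        push_cast
        rw [show τ₀ * ((Λ : ℝ) ^ 2 * (Γ : ℝ) ^ 3) = Λ * (τ₀ * (Λ * (Γ : ℝ) ^ 3)) by ring, hτeq,
          mul_one]
      · rw [Finset.card_union_of_disjoint hdis, hFc, hB, add_mul, one_mul]
        refine Nat.add_le_add_right ?_ _
        exact_mod_cast hAcard
    -- Too few players are left outside A to form F. Then the group has at most B players in all,
    -- and every one is put into A, with threshold 0.
    · refine ⟨0, Finset.univ, ∅, le_rfl, by simp, Finset.disjoint_empty_right _,
        fun i hi => absurd (Finset.mem_univ i) hi, fun h => absurd h (lt_irrefl _), ?_⟩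
      rw [Finset.union_empty, Finset.card_univ, ← Finset.card_add_card_compl A, hB, add_mul, one_mul]
      refine Nat.add_le_add ?_ (not_le.mp hJ).le
      exact_mod_cast hAcard
  obtain ⟨v', E, h1, h2, h3, h4, h5⟩ := exists_group_types_of_threshold hk ℓ v hv hvℓ hvs hθ0 hvθ
    hR hr0 hσ0 hσ hq hθ hWr hkWr hσW hrW hD hRq hε hbound hΓr hΓΛ P hpoor (fun h hh => hh) hβ
    τ₀ A F hτ0 hτ hAF hA hF hAB
  exact ⟨v', E, h1, h2, h3, h4.trans hBmax, h5⟩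

end Parameters

/-! ### The concrete parameters -/

section Concrete

/-- The bit length of `k * m`. -/
def paramSize (k m : ℕ) : ℕ := Nat.size (k * m)

/-- The degree up to which moments are matched. -/
def momentOrder (k m : ℕ) : ℕ := 64 * k * (paramSize k m / Nat.size (paramSize k m) + 1) + 1

/-- In a group, no squared entry exceeds the total mass of its coordinate divided by this number. -/
def spreadFactor (k m : ℕ) : ℕ :=
  k * (64 * k ^ 2 * paramSize k m) * (2 ^ (Nat.size (paramSize k m) / 8 + 3)) ^ 2

variable {k m : ℕ}

theorem lt_two_pow_paramSize : k * m < 2 ^ paramSize k m := Nat.lt_size_self _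

theorem three_le_paramSize (hk : 3 ≤ k) (hm : 2 ≤ m) : 3 ≤ paramSize k m :=
  Nat.lt_size.mpr (by nlinarith)

theorem le_two_pow_paramSize (hm : 2 ≤ m) : k ≤ 2 ^ paramSize k m :=
  (Nat.le_mul_of_pos_right k (by omega)).trans lt_two_pow_paramSize.le

theorem spreadFactor_pos (hk : 3 ≤ k) (hm : 2 ≤ m) : 0 < spreadFactor k m := by
  have := three_le_paramSize hk hm
  unfold spreadFactor
  positivity

/-- The base is q, of order l^(1/8), and the exponent is about 64kl/log l. Raising q thus gains the
logarithm that makes the moment order l/log l rather than l. -/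
theorem two_pow_le_momentOrder (hk : 3 ≤ k) (hm : 2 ≤ m) :
    2 ^ (8 * k * paramSize k m) ≤
      (2 ^ (Nat.size (paramSize k m) / 8 + 3)) ^ (momentOrder k m - 1) := by
  have h3 := three_le_paramSize hk hm
  unfold momentOrder
  set l := paramSize k m
  set s := Nat.size l
  have hs : 0 < s := Nat.size_pos.mpr (by omega)
  rw [← pow_mul, Nat.add_sub_cancel]
  refine Nat.pow_le_pow_right (by norm_num) ?_
  have h1 : s ≤ 8 * (s / 8 + 3) := by omega
  have h2 : l ≤ s * (l / s + 1) := (Nat.lt_mul_div_succ l hs).le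
  calc 8 * k * l ≤ 8 * k * (s * (l / s + 1)) := Nat.mul_le_mul_left _ h2
    _ ≤ 8 * k * (8 * (s / 8 + 3) * (l / s + 1)) := by gcongr
    _ = _ := by ring

/-- With W = 2^(2kl) the error of the logarithms contributes 2^(-8kl), and r₀/(8k) = 8kl gives the
same bound for the Gaussian tail. As k ≤ 2^l, this absorbs the factors (4k)^k and (8k)^k. -/
theorem close_bound (hk : 3 ≤ k) (hm : 2 ≤ m) {r₀ : ℝ} (hr : r₀ = 64 * (k : ℝ) ^ 2 * paramSize k m) :
    4 * Real.exp 1 * (1 / ((2 : ℝ) ^ (2 * k * paramSize k m)) ^ 2) ^ 2 * (4 * k) ^ k +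
      4 * Real.exp 1 * Real.exp (-r₀ / (8 * k)) * (8 * k) ^ k ≤ (1 / (8 * m * k)) ^ 2 := by
  have h3 := three_le_paramSize hk hm
  have hkm := lt_two_pow_paramSize (k := k) (m := m)
  have hkl := le_two_pow_paramSize (k := k) hm
  set l := paramSize k m
  have hk0 : (0 : ℝ) < k := by exact_mod_cast (by omega : 0 < k)
  have hm0 : (0 : ℝ) < m := by exact_mod_cast (by omega : 0 < m)
  have hkl' : (k : ℝ) ≤ 2 ^ l := by exact_mod_cast hkl
  have hkm' : (k : ℝ) * m ≤ 2 ^ l := by exact_mod_cast hkm.le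
  have e1 : Real.exp 1 ≤ 4 := (Real.exp_one_lt_d9.trans (by norm_num)).le
  have e2 : Real.exp (-r₀ / (8 * k)) ≤ 1 / 2 ^ (8 * k * l) := by
    have : -r₀ / (8 * k) = -((8 * k * l : ℕ) : ℝ) := by
      rw [hr]
      push_cast
      field_simp
      ring
    rw [this, Real.exp_neg, ← one_div]
    apply one_div_le_one_div_of_le (by positivity)
    have h2 : (2 : ℝ) ≤ Real.exp 1 := by
      have := Real.add_one_le_exp 1
      linarith
    calc (2 : ℝ) ^ (8 * k * l) ≤ Real.exp 1 ^ (8 * k * l) := pow_le_pow_left₀ (by norm_num) h2 _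
      _ = _ := by rw [← Real.exp_nat_mul, mul_one]
  have e3 : (1 / ((2 : ℝ) ^ (2 * k * l)) ^ 2) ^ 2 = 1 / 2 ^ (8 * k * l) := by
    rw [div_pow, one_pow, ← pow_mul, ← pow_mul]
    congr 2
    ring
  have e4 : (8 * (k : ℝ)) ^ k ≤ 2 ^ ((3 + l) * k) := by
    rw [pow_mul, pow_add]
    gcongr
    norm_num
  have e5 : (4 * (k : ℝ)) ^ k ≤ 2 ^ ((3 + l) * k) := le_trans (by gcongr; norm_num) e4
  have e6 : 1 / (2 : ℝ) ^ (2 * (3 + l)) ≤ (1 / (8 * m * k)) ^ 2 := by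
    rw [div_pow, one_pow, mul_comm 2, pow_mul]
    apply one_div_le_one_div_of_le (by positivity)
    gcongr
    rw [pow_add]
    nlinarith
  refine le_trans ?_ e6
  rw [e3]
  calc 4 * Real.exp 1 * (1 / 2 ^ (8 * k * l)) * (4 * (k : ℝ)) ^ k +
      4 * Real.exp 1 * Real.exp (-r₀ / (8 * k)) * (8 * (k : ℝ)) ^ k ≤
      4 * 4 * (1 / 2 ^ (8 * k * l)) * 2 ^ ((3 + l) * k) +
      4 * 4 * (1 / 2 ^ (8 * k * l)) * 2 ^ ((3 + l) * k) := by gcongr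
    _ = 2 ^ (5 + (3 + l) * k) / 2 ^ (8 * k * l) := by rw [pow_add]; ring
    _ ≤ 1 / (2 : ℝ) ^ (2 * (3 + l)) := by
      rw [div_le_div_iff₀ (by positivity) (by positivity), one_mul, ← pow_add]
      apply pow_le_pow_right₀ (by norm_num)
      have h1 : 3 * l ≤ k * l := Nat.mul_le_mul_right _ hk
      have h2 : k * 3 ≤ k * l := Nat.mul_le_mul_left _ h3
      have h5 : 8 * k * l = 8 * (k * l) := by ring
      have h6 : (3 + l) * k = k * 3 + k * l := by ring
      omega

variable {ι : Type} [Fintype ι]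

/-- The values are r₀ = 64k²l, σ = 8kl, W = 2^(2kl) and θ² = 1/K. Here K = k r₀ q² is exactly what
makes the linear forms of the b-part at most 1/q. The accuracy 1/(8mk) is the share of one of k
groups. -/
theorem exists_group_types [DecidableEq ι] (hk : 3 ≤ k) (hm : 2 ≤ m) (ℓ : Fin k)
    (v : ι → Fin k → ℝ)
    (hv : ∀ i h, 0 ≤ v i h) (hvℓ : ∀ i, v i ℓ = 0) (hvs : ∀ i, ∑ h, v i h ≤ 1 - 1 / k)
    (hvK : ∀ i h, v i h ^ 2 * spreadFactor k m ≤ ∑ j, v j h) {D : ℕ}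
    (hD : 2 ^ (32 * k * paramSize k m) ≤ D) :
    ∃ (v' : ι → Fin k → ℝ) (E : Finset ι), (∀ i h, 0 ≤ v' i h) ∧ (∀ i, v' i ℓ = 0) ∧
      (∀ i, ∑ h, v' i h ≤ 1) ∧ E.card ≤ 2 ^ (2 * k * paramSize k m * 8 ^ (k + 3)) ∧
      (v' '' E).ncard ≤ ((4 * k ^ 2 + 2) * (momentOrder k m + 2)) ^ (k - 1) + 1 ∧
      (v' '' (E : Set ι)ᶜ).ncard ≤ gridTypeCount k + 1 ∧
      (∀ i ∉ E, ∃ n : Fin k → ℕ, v' i = fun h => (n h : ℝ) / D) ∧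
      PMDClose (fun i => fillAt ℓ (v i)) (fun i => fillAt ℓ (v' i)) (1 / (8 * m * k)) := by
  have h3 := three_le_paramSize hk hm
  have hkl := le_two_pow_paramSize (k := k) hm
  have hK := spreadFactor_pos hk hm
  have hmom := two_pow_le_momentOrder hk hm
  have hcb := close_bound hk hm (r₀ := 64 * (k : ℝ) ^ 2 * paramSize k m) rfl
  have hKdef : (spreadFactor k m : ℝ) = k * (64 * (k : ℝ) ^ 2 * paramSize k m) *
      (2 ^ (Nat.size (paramSize k m) / 8 + 3)) ^ 2 := by
    unfold spreadFactor
    push_cast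
    ring
  set l := paramSize k m
  set q : ℝ := 2 ^ (Nat.size l / 8 + 3) with hq
  have hl2 : l ≤ 2 ^ l := Nat.lt_two_pow_self.le
  have hk0 : (0 : ℝ) < k := by exact_mod_cast (by omega : 0 < k)
  have hl0 : (0 : ℝ) < l := by exact_mod_cast (by omega : 0 < l)
  have hl1 : (1 : ℝ) ≤ l := by exact_mod_cast (by omega : 1 ≤ l)
  have hkl6 : 6 * l ≤ 2 * k * l := Nat.mul_le_mul_right _ (by omega)
  have hr : 64 * k ^ 2 * l ≤ 2 ^ (2 * k * l) := by
    calc 64 * k ^ 2 * l ≤ 2 ^ 6 * (2 ^ l) ^ 2 * 2 ^ l := by gcongr; norm_num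
      _ = 2 ^ (6 + 3 * l) := by rw [pow_add, ← pow_mul, mul_assoc, ← pow_add]; congr 2; ring
      _ ≤ _ := Nat.pow_le_pow_right (by norm_num) (by omega)
  have hσ : 8 * k * l ≤ 2 ^ (2 * k * l) := by
    refine le_trans ?_ hr
    gcongr
    · norm_num
    · exact Nat.le_self_pow two_ne_zero k
  have hqpos : 0 < q := by positivity
  have hK0 : (0 : ℝ) < spreadFactor k m := by exact_mod_cast hK
  refine (exists_group_types_of_params (r₀ := 64 * (k : ℝ) ^ 2 * l) (σ := 8 * k * l) (q := q)
    (ε := 1 / (8 * m * k)) (W := 2 ^ (2 * k * l)) (R := momentOrder k m) (D := D)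
    (θ := Real.sqrt (1 / spreadFactor k m)) (by omega) ℓ v hv hvℓ hvs
    (Real.sqrt_nonneg _) (fun i h => ?_) (Nat.le_add_left 1 _) (by positivity) (by positivity) ?_ ?_ ?_ ?_ ?_ ?_ ?_ ?_ ?_
    (by positivity) ?_).imp fun v' => Exists.imp fun E h => ?_
  · rw [Real.sq_sqrt (by positivity), one_div_mul_eq_div, le_div_iff₀ hK0]
    exact hvK i h
  · nlinarith [mul_pos hk0 hl0, mul_le_mul_of_nonneg_left hl1 (by positivity : 0 ≤ (k : ℝ) ^ 2 * l)]
  · rw [hq, pow_add]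
    have : (1 : ℝ) ≤ 2 ^ (Nat.size l / 8) := one_le_pow₀ (by norm_num)
    linarith
  · rw [Real.sq_sqrt (by positivity), hKdef]
    apply le_of_eq
    field_simp
  · calc 64 = 2 ^ 6 := by norm_num
      _ ≤ _ := Nat.pow_le_pow_right (by norm_num) (by omega)
  · refine le_trans ?_ hr
    unfold gridTypeCount
    nlinarith
  · exact_mod_cast hσ
  · exact_mod_cast hr
  · rw [← pow_mul]
    refine le_trans (le_of_eq ?_) hD
    congr 1
    ring
  · have h1 : (2 : ℝ) ^ (8 * k * l) ≤ q ^ (momentOrder k m - 1) := by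
      rw [hq]
      exact_mod_cast hmom
    have h2 : 16 * (64 * (k : ℝ) ^ 2 * l) * (2 ^ (2 * k * l)) ^ 2 ≤ 2 ^ (8 * k * l) := by
      have hr' : (64 : ℝ) * k ^ 2 * l ≤ 2 ^ (2 * k * l) := by exact_mod_cast hr
      calc 16 * (64 * (k : ℝ) ^ 2 * l) * (2 ^ (2 * k * l)) ^ 2 ≤
          2 ^ 4 * 2 ^ (2 * k * l) * (2 ^ (2 * k * l)) ^ 2 := by gcongr; norm_num
        _ = 2 ^ (4 + 3 * (2 * k * l)) := by rw [pow_add, mul_assoc, ← pow_succ', ← pow_mul]; ring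
        _ ≤ _ := pow_le_pow_right₀ (by norm_num) (by
          have : 8 * k * l = 4 * (2 * k * l) := by ring
          omega)
    push_cast
    rw [one_div, inv_pow, ← div_eq_mul_inv, div_le_div_iff₀ (by positivity) (by positivity)]
    calc 8 * (64 * (k : ℝ) ^ 2 * l) * (2 * (2 ^ (2 * k * l)) ^ 2) =
        16 * (64 * (k : ℝ) ^ 2 * l) * (2 ^ (2 * k * l)) ^ 2 := by ring
      _ ≤ _ := h2.trans (h1.trans (one_mul _).ge)
  · push_cast
    exact hcb
  · rw [← pow_mul] at h
    exact h

end Concrete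

/-! ### Removing the vectors with a dominating share of a coordinate -/

section Violators

variable {ι : Type} [Fintype ι] {k : ℕ}

/-- Here √x - √(x - y) = y/(√x + √(x - y)) > y/(2√x), while √x < y√K by assumption. So the removal
of a dominating entry lowers 2√K·√(mass) by more than 1. -/
theorem sqrt_sub_lt {x y K : ℝ} (hK : 0 < K) (hy0 : 0 ≤ y) (hyx : y ≤ x) (hv : x < y ^ 2 * K) :
    2 * Real.sqrt K * Real.sqrt (x - y) + 1 < 2 * Real.sqrt K * Real.sqrt x := by
  have hy : 0 < y := by
    rcases hy0.eq_or_lt with h | h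
    · subst h
      norm_num at hv
      linarith
    · exact h
  have hx : 0 < x := hy.trans_le hyx
  set a := Real.sqrt x
  set b := Real.sqrt (x - y)
  set c := Real.sqrt K
  have ha : a ^ 2 = x := Real.sq_sqrt hx.le
  have hb : b ^ 2 = x - y := Real.sq_sqrt (sub_nonneg.mpr hyx)
  have hc : c ^ 2 = K := Real.sq_sqrt hK.le
  have ha0 : 0 < a := Real.sqrt_pos.mpr hx
  have hb0 : 0 ≤ b := Real.sqrt_nonneg _
  have hc0 : 0 < c := Real.sqrt_pos.mpr hK
  have hba : b < a := Real.sqrt_lt_sqrt (sub_nonneg.mpr hyx) (by linarith)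
  have h1 : a < c * y := by
    refine lt_of_pow_lt_pow_left₀ 2 (by positivity) ?_
    rw [mul_pow, ha, hc]
    linarith
  have h2 : (a - b) * (a + b) = y := by ring_nf; rw [ha, hb]; ring
  have h3 : a < c * ((a - b) * (2 * a)) := by
    have : y < (a - b) * (2 * a) := by
      rw [← h2]
      exact mul_lt_mul_of_pos_left (by linarith) (by linarith)
    exact h1.trans (mul_lt_mul_of_pos_left this hc0)
  have h4 : a * 1 < a * (2 * c * (a - b)) := by
    calc a * 1 = a := mul_one a
      _ < c * ((a - b) * (2 * a)) := h3
      _ = _ := by ring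
  have h5 := lt_of_mul_lt_mul_left h4 ha0.le
  linarith

theorem exists_spread_subset [DecidableEq ι] (S : Finset ι) (v : ι → Fin k → ℝ)
    (hv : ∀ i h, 0 ≤ v i h) (hv1 : ∀ i h, v i h ≤ 1) {K : ℕ} (hK : 0 < K) :
    ∃ A ⊆ S, (S \ A).card ≤ 2 * k * K ∧ ∀ i ∈ A, ∀ h, v i h ^ 2 * K ≤ ∑ j ∈ A, v j h := by
  have hK' : (0 : ℝ) < K := by exact_mod_cast hK
  -- The number of removed players plus a capped potential of the masses. Removing a violator costs
  -- 1 but lowers the potential by more than 1, so a minimiser of Φ has no violators. A violated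
  -- coordinate has mass at most K, so the cap is not active there. The cap bounds Φ S, and hence
  -- the number of removed players, by 2kK.
  let Φ : Finset ι → ℝ := fun A =>
    (S \ A).card + ∑ h, 2 * Real.sqrt K * min (Real.sqrt (∑ j ∈ A, v j h)) (Real.sqrt K)
  obtain ⟨A, hA, hmin⟩ := Finset.exists_min_image S.powerset Φ ⟨S, Finset.mem_powerset_self S⟩
  have hAS := Finset.mem_powerset.mp hA
  refine ⟨A, hAS, ?_, fun i hi h => ?_⟩
  · have h1 : Φ A ≤ Φ S := hmin S (Finset.mem_powerset_self S)
    have h2 : Φ S ≤ ((2 * k * K : ℕ) : ℝ) := by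
      simp only [Φ, Finset.sdiff_self, Finset.card_empty, Nat.cast_zero, zero_add]
      calc _ ≤ ∑ _h : Fin k, 2 * Real.sqrt K * Real.sqrt K := by
            gcongr
            exact min_le_right _ _
        _ = _ := by
          simp only [mul_assoc, Real.mul_self_sqrt hK'.le, Finset.sum_const, Finset.card_univ,
            Fintype.card_fin, nsmul_eq_mul]
          push_cast
          ring
    have h3 : ((S \ A).card : ℝ) ≤ Φ A :=
      le_add_of_nonneg_right (Finset.sum_nonneg fun h _ => by positivity)
    exact_mod_cast h3.trans (h1.trans h2)
  · by_contra! hcon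
    have h1 : Φ A ≤ Φ (A.erase i) :=
      hmin _ (Finset.mem_powerset.mpr ((Finset.erase_subset i A).trans hAS))
    have hcard : ((S \ A.erase i).card : ℝ) = (S \ A).card + 1 := by
      rw [Finset.sdiff_erase (hAS hi), Finset.card_insert_of_notMem (by simp [hi])]
      push_cast
      rfl
    have hsum : ∀ h, ∑ j ∈ A.erase i, v j h = ∑ j ∈ A, v j h - v i h := fun h =>
      Finset.sum_erase_eq_sub hi
    have hle : ∀ h, v i h ≤ ∑ j ∈ A, v j h := fun h =>
      Finset.single_le_sum (f := fun j => v j h) (fun j _ => hv j h) hi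
    have hterm : ∀ h', 2 * Real.sqrt K * min (Real.sqrt (∑ j ∈ A.erase i, v j h')) (Real.sqrt K) +
        (if h' = h then 1 else 0) ≤
        2 * Real.sqrt K * min (Real.sqrt (∑ j ∈ A, v j h')) (Real.sqrt K) := by
      intro h'
      split_ifs with hh
      · subst hh
        have hxK : ∑ j ∈ A, v j h' ≤ K := by
          refine hcon.le.trans (mul_le_of_le_one_left hK'.le (pow_le_one₀ (hv i h') (hv1 i h')))
        rw [min_eq_left (Real.sqrt_le_sqrt hxK), hsum, min_eq_left (Real.sqrt_le_sqrt
          ((sub_le_self _ (hv i h')).trans hxK))]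
        exact (sqrt_sub_lt hK' (hv i h') (hle h') hcon).le
      · rw [add_zero, hsum]
        gcongr
        exact sub_le_self _ (hv i h')
    have hstrict : 2 * Real.sqrt K * min (Real.sqrt (∑ j ∈ A.erase i, v j h)) (Real.sqrt K) +
        (if h = h then 1 else 0) <
        2 * Real.sqrt K * min (Real.sqrt (∑ j ∈ A, v j h)) (Real.sqrt K) := by
      rw [if_pos rfl]
      have hxK : ∑ j ∈ A, v j h ≤ K := by
        refine hcon.le.trans (mul_le_of_le_one_left hK'.le (pow_le_one₀ (hv i h) (hv1 i h)))
      rw [min_eq_left (Real.sqrt_le_sqrt hxK), hsum, min_eq_left (Real.sqrt_le_sqrt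
        ((sub_le_self _ (hv i h)).trans hxK))]
      exact sqrt_sub_lt hK' (hv i h) (hle h) hcon
    have h2 := Finset.sum_lt_sum (fun h' _ => hterm h') ⟨h, Finset.mem_univ h, hstrict⟩
    rw [Finset.sum_add_distrib, Finset.sum_ite_eq' Finset.univ h, if_pos (Finset.mem_univ h)] at h2
    simp only [Φ] at h1
    rw [hcard] at h1
    linarith

end Violators

/-! ### Closeness of product distributions -/

section Closeness

variable {ι : Type} [Fintype ι] [DecidableEq ι] {k : ℕ}

theorem PMDClose.trans {p q r : ι → Fin k → ℝ} {a b : ℝ} (h₁ : PMDClose p q a)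
    (h₂ : PMDClose q r b) : PMDClose p r (a + b) := fun f hf =>
  (abs_sub_le _ _ _).trans (add_le_add (h₁ f hf) (h₂ f hf))

theorem PMDClose.refl (p : ι → Fin k → ℝ) : PMDClose p p 0 := fun f _ => by simp

/-- Conditioning on the strategies of the players outside `S`. -/
theorem pmdExp_eq_sum_compl (p : ι → Fin k → ℝ) (S : ι → Prop) [DecidablePred S]
    (f : (Fin k → ℕ) → ℝ) :
    pmdExp p f = ∑ c : {i // ¬S i} → Fin k, (∏ i : {i // ¬S i}, p i (c i)) *
      pmdExp (fun i : {i // S i} => p i) (fun x => f (x + ∑ i : {i // ¬S i}, Pi.single (c i) 1)) := by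
  unfold pmdExp
  simp only [Finset.mul_sum]
  rw [Finset.sum_comm, ← Fintype.sum_prod_type']
  refine Fintype.sum_equiv (Equiv.piEquivPiSubtypeProd S fun _ => Fin k) _ _ fun c => ?_
  simp only [Equiv.piEquivPiSubtypeProd_apply]
  rw [← Fintype.prod_subtype_mul_prod_subtype S, ← Fintype.sum_subtype_add_sum_subtype S]
  ring

theorem sum_prod_eq_one {κ : Type} [Fintype κ] [DecidableEq κ] (p : κ → Fin k → ℝ)
    (hp1 : ∀ i, ∑ h, p i h = 1) : ∑ c : κ → Fin k, ∏ i, p i (c i) = 1 := by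
  rw [← Fintype.piFinset_univ, ← Finset.prod_univ_sum]
  exact Finset.prod_eq_one fun i _ => hp1 i

/-- Given the strategies of the players outside S, the test function is merely translated, so
closeness on S is averaged. -/
theorem pmdClose_of_subtype {p q : ι → Fin k → ℝ} (S : ι → Prop) [DecidablePred S] {ε : ℝ}
    (hp0 : ∀ i h, 0 ≤ p i h) (hp1 : ∀ i, ∑ h, p i h = 1) (hpq : ∀ i, ¬S i → q i = p i)
    (h : PMDClose (fun i : {i // S i} => p i) (fun i : {i // S i} => q i) ε) : PMDClose p q ε := by
  intro f hf
  rw [pmdExp_eq_sum_compl p S, pmdExp_eq_sum_compl q S, ← Finset.sum_sub_distrib]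
  have hw : ∑ c : {i // ¬S i} → Fin k, ∏ i : {i // ¬S i}, p i (c i) = 1 :=
    sum_prod_eq_one (fun i : {i // ¬S i} => p i) fun i => hp1 i
  calc _ ≤ ∑ c : {i // ¬S i} → Fin k, (∏ i : {i // ¬S i}, p i (c i)) * ε := by
        refine (Finset.abs_sum_le_sum_abs _ _).trans (Finset.sum_le_sum fun c _ => ?_)
        have e : ∏ i : {i // ¬S i}, q i (c i) = ∏ i : {i // ¬S i}, p i (c i) :=
          Finset.prod_congr rfl fun i _ => by rw [hpq i i.2]
        rw [e, ← mul_sub, abs_mul, abs_of_nonneg (Finset.prod_nonneg fun i _ => hp0 _ _)]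
        exact mul_le_mul_of_nonneg_left (h _ fun x => hf _) (Finset.prod_nonneg fun i _ => hp0 _ _)
    _ = ε := by rw [← Finset.sum_mul, hw, one_mul]

/-- Hybrid argument: the players are exchanged one at a time, and each exchange costs the ℓ¹
distance of the two rows because the other factors sum to 1. -/
theorem sum_abs_prod_sub_prod_le (p q : ι → Fin k → ℝ) (hp0 : ∀ i h, 0 ≤ p i h)
    (hp1 : ∀ i, ∑ h, p i h = 1) (hq0 : ∀ i h, 0 ≤ q i h) (hq1 : ∀ i, ∑ h, q i h = 1) :
    ∑ c : ι → Fin k, |∏ i, p i (c i) - ∏ i, q i (c i)| ≤ ∑ i, ∑ h, |p i h - q i h| := by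
  suffices H : ∀ S : Finset ι, ∑ c : ι → Fin k, |∏ i, p i (c i) - ∏ i, S.piecewise q p i (c i)| ≤
      ∑ i ∈ S, ∑ h, |p i h - q i h| by
    simpa using H Finset.univ
  intro S
  induction S using Finset.induction_on with
  | empty => simp
  | insert a S ha ih =>
    rw [Finset.sum_insert ha, add_comm]
    have hstep : ∑ c : ι → Fin k, |∏ i, S.piecewise q p i (c i) -
        ∏ i, (insert a S).piecewise q p i (c i)| = ∑ h, |p a h - q a h| := by
      have e : ∀ c : ι → Fin k, |∏ i, S.piecewise q p i (c i) -
          ∏ i, (insert a S).piecewise q p i (c i)| =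
          ∏ i, (if i = a then |p a (c i) - q a (c i)| else S.piecewise q p i (c i)) := by
        intro c
        rw [Finset.piecewise_insert, ← Finset.mul_prod_erase Finset.univ _ (Finset.mem_univ a),
          ← Finset.mul_prod_erase Finset.univ
            (fun i => Function.update (S.piecewise q p) a (q a) i (c i)) (Finset.mem_univ a),
          ← Finset.mul_prod_erase Finset.univ (fun i => if i = a then |p a (c i) - q a (c i)| else
            S.piecewise q p i (c i)) (Finset.mem_univ a)]
        have e1 : ∏ i ∈ Finset.univ.erase a, Function.update (S.piecewise q p) a (q a) i (c i) =
            ∏ i ∈ Finset.univ.erase a, S.piecewise q p i (c i) :=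
          Finset.prod_congr rfl fun i hi => by
            rw [Function.update_of_ne (Finset.ne_of_mem_erase hi)]
        have e2 : ∏ i ∈ Finset.univ.erase a,
            (if i = a then |p a (c i) - q a (c i)| else S.piecewise q p i (c i)) =
            ∏ i ∈ Finset.univ.erase a, S.piecewise q p i (c i) :=
          Finset.prod_congr rfl fun i hi => if_neg (Finset.ne_of_mem_erase hi)
        rw [e1, e2, Function.update_self, if_pos rfl, ← sub_mul, abs_mul,
          Finset.piecewise_eq_of_notMem _ _ _ ha]
        congr 1
        refine abs_of_nonneg (Finset.prod_nonneg fun i _ => ?_)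
        by_cases hi : i ∈ S
        · rw [Finset.piecewise_eq_of_mem _ _ _ hi]
          exact hq0 _ _
        · rw [Finset.piecewise_eq_of_notMem _ _ _ hi]
          exact hp0 _ _
      simp only [e]
      have := (Finset.prod_univ_sum (fun _ : ι => (Finset.univ : Finset (Fin k)))
        (fun i h => if i = a then |p a h - q a h| else S.piecewise q p i h))
      rw [Fintype.piFinset_univ] at this
      rw [← this, ← Finset.mul_prod_erase Finset.univ _ (Finset.mem_univ a)]
      simp only [if_true]
      rw [Finset.prod_eq_one, mul_one]
      intro i hi
      simp only [if_neg (Finset.ne_of_mem_erase hi)]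
      by_cases hi : i ∈ S
      · rw [Finset.piecewise_eq_of_mem _ _ _ hi]
        exact hq1 _
      · rw [Finset.piecewise_eq_of_notMem _ _ _ hi]
        exact hp1 _
    refine le_trans ?_ (add_le_add ih hstep.le)
    rw [← Finset.sum_add_distrib]
    exact Finset.sum_le_sum fun c _ => abs_sub_le _ _ _

theorem pmdClose_of_sum_abs_sub_le (p q : ι → Fin k → ℝ) (hp0 : ∀ i h, 0 ≤ p i h)
    (hp1 : ∀ i, ∑ h, p i h = 1) (hq0 : ∀ i h, 0 ≤ q i h) (hq1 : ∀ i, ∑ h, q i h = 1) {ε : ℝ}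
    (hε : ∑ i, ∑ h, |p i h - q i h| ≤ ε) : PMDClose p q ε := by
  intro f hf
  unfold pmdExp
  rw [← Finset.sum_sub_distrib]
  refine (Finset.abs_sum_le_sum_abs _ _).trans
    (le_trans (Finset.sum_le_sum fun c _ => ?_) ((sum_abs_prod_sub_prod_le p q hp0 hp1 hq0 hq1).trans hε))
  rw [← sub_mul, abs_mul]
  exact mul_le_of_le_one_right (abs_nonneg _) (hf _)

end Closeness

/-! ### Profiles with few types -/

section Rounding

variable {k : ℕ}

/-- Round a probability vector to a multiple of `1 / D`, correcting the sum at `o`. -/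
noncomputable def roundGrid (D : ℕ) (o : Fin k) (x : Fin k → ℝ) (h : Fin k) : ℕ :=
  ⌊D * x h⌋₊ + if h = o then D - ∑ j, ⌊D * x j⌋₊ else 0

theorem sum_floor_le {D : ℕ} {x : Fin k → ℝ} (hx0 : ∀ h, 0 ≤ x h) (hx1 : ∑ h, x h = 1) :
    ∑ j, ⌊D * x j⌋₊ ≤ D := by
  have h : ((∑ j, ⌊D * x j⌋₊ : ℕ) : ℝ) ≤ D := by
    push_cast
    calc ∑ j, (⌊D * x j⌋₊ : ℝ) ≤ ∑ j, D * x j := Finset.sum_le_sum fun j _ =>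
          Nat.floor_le (mul_nonneg D.cast_nonneg (hx0 j))
      _ = D := by rw [← Finset.mul_sum, hx1, mul_one]
  exact_mod_cast h

theorem sum_roundGrid {D : ℕ} (o : Fin k) {x : Fin k → ℝ} (hx0 : ∀ h, 0 ≤ x h)
    (hx1 : ∑ h, x h = 1) : ∑ h, roundGrid D o x h = D := by
  have := sum_floor_le (D := D) hx0 hx1
  simp only [roundGrid, Finset.sum_add_distrib, Finset.sum_ite_eq', Finset.mem_univ, if_true]
  omega

/-- The unboundedly many players with grid vectors incur no rounding error; only the light players
do. -/
theorem roundGrid_of_grid {D : ℕ} (hD : 0 < D) (o : Fin k) {x : Fin k → ℝ} (hx1 : ∑ h, x h = 1)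
    {n : Fin k → ℕ} (hn : ∀ h, x h = n h / D) : roundGrid D o x = n := by
  have hD' : (D : ℝ) ≠ 0 := by exact_mod_cast hD.ne'
  have hfl : ∀ h, ⌊D * x h⌋₊ = n h := fun h => by
    rw [hn, mul_div_cancel₀ _ hD', Nat.floor_natCast]
  have hs : ∑ h, n h = D := by
    have : ((∑ h, n h : ℕ) : ℝ) / D = 1 := by
      rw [← hx1]
      push_cast
      rw [Finset.sum_div]
      exact Finset.sum_congr rfl fun h _ => (hn h).symm
    rw [div_eq_one_iff_eq hD'] at this
    exact_mod_cast this
  funext h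
  simp only [roundGrid, hfl, hs, Nat.sub_self, ite_self, add_zero]

theorem sum_abs_sub_roundGrid_le {D : ℕ} (hD : 0 < D) (o : Fin k) {x : Fin k → ℝ}
    (hx0 : ∀ h, 0 ≤ x h) (hx1 : ∑ h, x h = 1) :
    ∑ h, |x h - roundGrid D o x h / D| ≤ 2 * k / D := by
  have hD' : (0 : ℝ) < D := by exact_mod_cast hD
  have hfl : ∀ h, |x h - ⌊D * x h⌋₊ / D| ≤ 1 / D := by
    intro h
    have h1 := Nat.floor_le (mul_nonneg D.cast_nonneg (hx0 h))
    have h2 := Nat.lt_floor_add_one (D * x h)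
    have e : x h - ⌊D * x h⌋₊ / D = (D * x h - ⌊D * x h⌋₊) / D := by field_simp
    rw [e, abs_div, abs_of_pos hD', abs_of_nonneg (by linarith)]
    gcongr
    linarith
  have hrest : ((D - ∑ j, ⌊D * x j⌋₊ : ℕ) : ℝ) ≤ k := by
    rw [Nat.cast_sub (sum_floor_le hx0 hx1)]
    push_cast
    have : (D : ℝ) = ∑ j, D * x j := by rw [← Finset.mul_sum, hx1, mul_one]
    nth_rw 1 [this]
    rw [← Finset.sum_sub_distrib]
    calc ∑ j, ((D : ℝ) * x j - ⌊D * x j⌋₊) ≤ ∑ _j : Fin k, (1 : ℝ) :=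
          Finset.sum_le_sum fun j _ => by linarith [Nat.lt_floor_add_one (D * x j)]
      _ = k := by simp
  calc ∑ h, |x h - roundGrid D o x h / D| ≤
      ∑ h, (1 / (D : ℝ) + if h = o then (k : ℝ) / D else 0) := by
        refine Finset.sum_le_sum fun h _ => ?_
        simp only [roundGrid]
        push_cast
        rw [add_div, ← sub_sub]
        refine (abs_sub _ _).trans (add_le_add (hfl h) ?_)
        split_ifs
        · rw [abs_of_nonneg (by positivity)]
          gcongr
        · simp
    _ = 2 * k / D := by
      rw [Finset.sum_add_distrib, Finset.sum_ite_eq', if_pos (Finset.mem_univ o), Finset.sum_const,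
        Finset.card_univ, Fintype.card_fin, nsmul_eq_mul]
      ring

end Rounding

/-! ### Assembling the groups into a profile with few types -/

section Assembly

variable {ι : Type} [Fintype ι] [DecidableEq ι] {k m : ℕ}

theorem fillAt_nonneg {ℓ : Fin k} {v : Fin k → ℝ} (hv : ∀ h, 0 ≤ v h) (hs : ∑ h, v h ≤ 1)
    (h : Fin k) : 0 ≤ fillAt ℓ v h := by
  unfold fillAt
  split_ifs
  · linarith [hv h]
  · linarith [hv h]

theorem sum_fillAt (ℓ : Fin k) (v : Fin k → ℝ) : ∑ h, fillAt ℓ v h = 1 := by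
  simp [fillAt, Finset.sum_add_distrib]

theorem exists_group_types_on (hk : 3 ≤ k) (hm : 2 ≤ m) (ℓ : Fin k) (A : Finset ι)
    (v : ι → Fin k → ℝ) (hv : ∀ i h, 0 ≤ v i h) (hvℓ : ∀ i ∈ A, v i ℓ = 0)
    (hvs : ∀ i ∈ A, ∑ h, v i h ≤ 1 - 1 / k)
    (hvK : ∀ i ∈ A, ∀ h, v i h ^ 2 * spreadFactor k m ≤ ∑ j ∈ A, v j h) {D : ℕ}
    (hD : 2 ^ (32 * k * paramSize k m) ≤ D) :
    ∃ (v' : ι → Fin k → ℝ) (E : Finset ι), (∀ i h, 0 ≤ v' i h) ∧ (∀ i, v' i ℓ = 0) ∧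
      (∀ i, ∑ h, v' i h ≤ 1) ∧ E.card ≤ 2 ^ (2 * k * paramSize k m * 8 ^ (k + 3)) ∧
      (v' '' E).ncard ≤ ((4 * k ^ 2 + 2) * (momentOrder k m + 2)) ^ (k - 1) + 1 ∧
      (v' '' (A \ E : Finset ι)).ncard ≤ gridTypeCount k + 1 ∧
      (∀ i ∈ A \ E, ∃ n : Fin k → ℕ, v' i = fun h => (n h : ℝ) / D) ∧
      PMDClose (fun i : {i // i ∈ A} => fillAt ℓ (v i)) (fun i : {i // i ∈ A} => fillAt ℓ (v' i))
        (1 / (8 * m * k)) := by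
  obtain ⟨w, E, h1, h2, h3, h4, h5, h6, h7, h8⟩ := exists_group_types (ι := {i // i ∈ A}) hk hm ℓ
    (fun i => v i) (fun i => hv i) (fun i => hvℓ i i.2) (fun i => hvs i i.2)
    (fun i h => by
      rw [Finset.sum_coe_sort A fun j => v j h]
      exact hvK i i.2 h) hD
  let v' : ι → Fin k → ℝ := fun i => if h : i ∈ A then w ⟨i, h⟩ else 0
  have hv' : ∀ i : {i // i ∈ A}, v' i = w i := fun i => dif_pos i.2
  have hv'0 : ∀ i ∉ A, v' i = 0 := fun i hi => dif_neg hi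
  have hall : ∀ Q : (Fin k → ℝ) → Prop, (∀ i, Q (w i)) → Q 0 → ∀ i, Q (v' i) := by
    intro Q hw h0 i
    by_cases hi : i ∈ A
    · rw [hv' ⟨i, hi⟩]
      exact hw _
    · rw [hv'0 i hi]
      exact h0
  have hEmem : ∀ i : {i // i ∈ A}, (i : ι) ∈ E.map (Function.Embedding.subtype _) ↔ i ∈ E := by
    intro i
    simp
  refine ⟨v', E.map (Function.Embedding.subtype _),
    hall (fun x => ∀ h, 0 ≤ x h) h1 fun _ => le_rfl, hall (fun x => x ℓ = 0) h2 rfl,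
    hall (fun x => ∑ h, x h ≤ 1) h3 (by simp), by rwa [Finset.card_map], ?_, ?_, ?_, ?_⟩
  · refine (Set.ncard_le_ncard ?_ (Set.toFinite _)).trans h5
    rintro _ ⟨i, hi, rfl⟩
    obtain ⟨j, hj, rfl⟩ := Finset.mem_map.mp (Finset.mem_coe.mp hi)
    exact ⟨j, hj, (hv' j).symm⟩
  · refine (Set.ncard_le_ncard ?_ (Set.toFinite _)).trans h6
    rintro _ ⟨i, hi, rfl⟩
    obtain ⟨hiA, hiE⟩ := Finset.mem_sdiff.mp (Finset.mem_coe.mp hi)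
    exact ⟨⟨i, hiA⟩, fun h => hiE ((hEmem ⟨i, hiA⟩).mpr h), (hv' ⟨i, hiA⟩).symm⟩
  · intro i hi
    obtain ⟨hiA, hiE⟩ := Finset.mem_sdiff.mp hi
    rw [hv' ⟨i, hiA⟩]
    exact h7 _ fun h => hiE ((hEmem ⟨i, hiA⟩).mpr h)
  · simp only [hv']
    exact h8

/-- The number of types of the players that play a grid strategy chosen in advance. -/
def heavyTypes (k : ℕ) : ℕ := k * (gridTypeCount k + 1)

/-- The number of types of the other players. -/
def lightTypes (k m : ℕ) : ℕ :=
  k * (2 * k * spreadFactor k m + (((4 * k ^ 2 + 2) * (momentOrder k m + 2)) ^ (k - 1) + 1))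

/-- The common denominator of all probabilities, and a bound for the number of light players. -/
def gridDenom (k m : ℕ) : ℕ := 2 ^ (k * paramSize k m * 8 ^ (k + 5))

/-- The left-hand side of the first bound counts removed and exceptional players over all groups.
The second bound makes their rounding errors, 2k/D each, sum to at most 1/(8m). -/
theorem light_card_bounds (hk : 3 ≤ k) (hm : 2 ≤ m) :
    k * (2 * k * spreadFactor k m + 2 ^ (2 * k * paramSize k m * 8 ^ (k + 3))) ≤ gridDenom k m ∧
    k * (2 * k * spreadFactor k m + 2 ^ (2 * k * paramSize k m * 8 ^ (k + 3))) * (16 * m * k) ≤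
      gridDenom k m := by
  have h3 := three_le_paramSize hk hm
  have hkl := le_two_pow_paramSize (k := k) hm
  have hkm := lt_two_pow_paramSize (k := k) (m := m)
  unfold spreadFactor gridDenom
  set l := paramSize k m
  have hl : l ≤ 2 ^ l := Nat.lt_two_pow_self.le
  have hsl : Nat.size l ≤ l := Nat.size_le.mpr Nat.lt_two_pow_self
  have h1 : 2 * k * (k * (64 * k ^ 2 * l) * (2 ^ (Nat.size l / 8 + 3)) ^ 2) ≤ 2 ^ (13 + 7 * l) := by
    calc 2 * k * (k * (64 * k ^ 2 * l) * (2 ^ (Nat.size l / 8 + 3)) ^ 2) ≤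
        2 * 2 ^ l * (2 ^ l * (64 * (2 ^ l) ^ 2 * 2 ^ l) * (2 ^ (l + 3)) ^ 2) := by
          gcongr
          · norm_num
          · omega
      _ = 2 ^ (13 + 7 * l) := by
        rw [show (64 : ℕ) = 2 ^ 6 by norm_num]
        ring
  set e := 2 * k * l * 8 ^ (k + 3) with he
  have h8 : 8 ^ 6 ≤ 8 ^ (k + 3) := Nat.pow_le_pow_right (by norm_num) (by omega)
  have hle : 100 * l ≤ e := by
    have : 2 * 3 * l * 8 ^ 6 ≤ 2 * k * l * 8 ^ (k + 3) := by gcongr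
    omega
  have h2 : k * (2 * k * (k * (64 * k ^ 2 * l) * (2 ^ (Nat.size l / 8 + 3)) ^ 2) + 2 ^ e) ≤
      2 ^ (l + 1 + e) := by
    calc _ ≤ 2 ^ l * (2 ^ e + 2 ^ e) := by
          gcongr
          exact h1.trans (Nat.pow_le_pow_right (by norm_num) (by omega))
      _ = _ := by ring
  have hE : k * l * 8 ^ (k + 5) = 32 * e := by rw [he]; ring
  rw [hE]
  constructor
  · exact h2.trans (Nat.pow_le_pow_right (by norm_num) (by omega))
  · calc _ ≤ 2 ^ (l + 1 + e) * (2 ^ 4 * 2 ^ l) := by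
          refine Nat.mul_le_mul h2 ?_
          nlinarith
      _ = 2 ^ (2 * l + 5 + e) := by ring
      _ ≤ _ := Nat.pow_le_pow_right (by norm_num) (by omega)

/-- The k groups cost 1/(8mk) each and the rounding to denominator D costs 1/(8m). The set E
collects the removed players, each with a type of its own, and the exceptional sets of the groups;
its size does not depend on the number of players. -/
theorem exists_few_types_profile (hk : 3 ≤ k) (hm : 2 ≤ m) (p : ι → Fin k → ℝ)
    (hp0 : ∀ i h, 0 ≤ p i h) (hp1 : ∀ i, ∑ h, p i h = 1) :
    ∃ (d : ι → Fin k → ℕ) (E : Finset ι), (∀ i, ∑ h, d i h = gridDenom k m) ∧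
      (d '' (E : Set ι)ᶜ).ncard ≤ heavyTypes k ∧ (d '' E).ncard ≤ lightTypes k m ∧
      E.card ≤ gridDenom k m ∧
      PMDClose p (fun i h => (d i h : ℝ) / gridDenom k m) (1 / (4 * m)) := by
  classical
  obtain ⟨hc1, hc2⟩ := light_card_bounds hk hm
  have hk0 : (0 : ℝ) < k := by exact_mod_cast (by omega : 0 < k)
  have hm0 : (0 : ℝ) < m := by exact_mod_cast (by omega : 0 < m)
  set D := gridDenom k m with hDdef
  have hD : 2 ^ (32 * k * paramSize k m) ≤ D := by
    refine Nat.pow_le_pow_right (by norm_num) ?_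
    have : 32 ≤ 8 ^ (k + 5) := le_trans (by norm_num : 32 ≤ 8 ^ 2)
      (Nat.pow_le_pow_right (by norm_num) (by omega))
    calc 32 * k * paramSize k m = k * paramSize k m * 32 := by ring
      _ ≤ _ := Nat.mul_le_mul_left _ this
  have hD0 : 0 < D := lt_of_lt_of_le (by positivity) hD
  have hDr : (0 : ℝ) < D := by exact_mod_cast hD0
  have hdom : ∀ i, ∃ ℓ, 1 / (k : ℝ) ≤ p i ℓ := by
    intro i
    by_contra! hcon
    have : Nonempty (Fin k) := ⟨⟨0, by omega⟩⟩
    have h1 : ∑ h, p i h < ∑ _h : Fin k, 1 / (k : ℝ) :=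
      Finset.sum_lt_sum_of_nonempty Finset.univ_nonempty fun h _ => hcon h
    rw [hp1, Finset.sum_const, Finset.card_univ, Fintype.card_fin, nsmul_eq_mul,
      mul_one_div_cancel hk0.ne'] at h1
    exact lt_irrefl _ h1
  choose L hL using hdom
  let w : ι → Fin k → ℝ := fun i h => if h = L i then 0 else p i h
  have hw0 : ∀ i h, 0 ≤ w i h := fun i h => by simp only [w]; split_ifs; exacts [le_rfl, hp0 i h]
  have hws : ∀ i, ∑ h, w i h = 1 - p i (L i) := by
    intro i
    have e : ∀ h, w i h = p i h - if h = L i then p i h else 0 := fun h => by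
      simp only [w]
      split_ifs <;> simp
    simp only [e, Finset.sum_sub_distrib, hp1, Finset.sum_ite_eq', Finset.mem_univ, if_true]
  have hfill : ∀ i, fillAt (L i) (w i) = p i := by
    intro i
    funext h
    simp only [fillAt, hws]
    by_cases hh : h = L i
    · simp [w, hh]
    · simp [w, hh]
  have hw1 : ∀ i h, w i h ≤ 1 := fun i h =>
    (Finset.single_le_sum (f := w i) (fun h _ => hw0 i h) (Finset.mem_univ h)).trans
      (by rw [hws]; linarith [hp0 i (L i)])
  let S : Fin k → Finset ι := fun ℓ => Finset.univ.filter fun i => L i = ℓ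
  choose A hAS hAc hAv using fun ℓ =>
    exists_spread_subset (S ℓ) w hw0 hw1 (spreadFactor_pos hk hm)
  have hAL : ∀ ℓ, ∀ i ∈ A ℓ, L i = ℓ := fun ℓ i hi => (Finset.mem_filter.mp (hAS ℓ hi)).2
  choose v' E hv'0 hv'ℓ hv's hEc hEt hHt hHg hcl using fun ℓ =>
    exists_group_types_on hk hm ℓ (A ℓ) w hw0 (fun i hi => by simp [w, hAL ℓ i hi])
      (fun i _ => by rw [hws]; linarith [hL i]) (hAv ℓ) hD
  let p' : ι → Fin k → ℝ := fun i => if i ∈ A (L i) then fillAt (L i) (v' (L i) i) else p i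
  have hp'A : ∀ ℓ, ∀ i ∈ A ℓ, p' i = fillAt ℓ (v' ℓ i) := by
    intro ℓ i hi
    have := hAL ℓ i hi
    subst this
    exact if_pos hi
  have hp'0 : ∀ i h, 0 ≤ p' i h := fun i h => by
    simp only [p']
    split_ifs
    · exact fillAt_nonneg (hv'0 _ i) (hv's _ i) h
    · exact hp0 i h
  have hp'1 : ∀ i, ∑ h, p' i h = 1 := fun i => by
    simp only [p']
    split_ifs
    · exact sum_fillAt _ _
    · exact hp1 i
  -- The groups are replaced one after the other, with all other players fixed.
  have hclose : ∀ T : Finset (Fin k), PMDClose p (fun i => if L i ∈ T then p' i else p i)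
      (T.card * (1 / (8 * m * k))) := by
    intro T
    induction T using Finset.induction_on with
    | empty =>
      simp only [Finset.notMem_empty, if_false, Finset.card_empty, Nat.cast_zero, zero_mul]
      exact PMDClose.refl p
    | insert ℓ T hℓ ih =>
      rw [Finset.card_insert_of_notMem hℓ, Nat.cast_succ, add_mul, one_mul]
      refine ih.trans (pmdClose_of_subtype (fun i => i ∈ A ℓ) (fun i h => ?_) (fun i => ?_)
        (fun i hi => ?_) ?_)
      · split_ifs
        exacts [hp'0 i h, hp0 i h]
      · split_ifs
        exacts [hp'1 i, hp1 i]
      · by_cases hi' : L i = ℓ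
        · have : i ∉ A (L i) := by rwa [hi']
          simp [hi', hℓ, p', hi]
        · simp [Finset.mem_insert, hi']
      · have e1 : (fun i : {i // i ∈ A ℓ} => if L i ∈ T then p' i else p i) =
            fun i : {i // i ∈ A ℓ} => fillAt ℓ (w i) := by
          funext i
          have hi := hAL ℓ i i.2
          rw [if_neg (by rwa [hi]), ← hfill i, hi]
        have e2 : (fun i : {i // i ∈ A ℓ} => if L i ∈ insert ℓ T then p' i else p i) =
            fun i : {i // i ∈ A ℓ} => fillAt ℓ (v' ℓ i) := by
          funext i
          rw [if_pos (by rw [hAL ℓ i i.2]; exact Finset.mem_insert_self _ _), hp'A ℓ i i.2]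
        rw [e1, e2]
        convert hcl ℓ
  have hpp' : PMDClose p p' (1 / (8 * m)) := by
    have h := hclose Finset.univ
    simp only [Finset.mem_univ, if_true, Finset.card_univ, Fintype.card_fin] at h
    rwa [show (k : ℝ) * (1 / (8 * m * k)) = 1 / (8 * m) by field_simp] at h
  let o : Fin k := ⟨0, by omega⟩
  let d : ι → Fin k → ℕ := fun i => roundGrid D o (p' i)
  let F : Finset ι := Finset.univ.filter fun i => i ∉ A (L i) ∨ i ∈ E (L i)
  have hF : ∀ i ∉ F, i ∈ A (L i) ∧ i ∉ E (L i) := by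
    intro i hi
    simpa [F, not_or] using hi
  have hFmem : ∀ i ∈ F, i ∈ S (L i) \ A (L i) ∨ (i ∈ A (L i) ∧ i ∈ E (L i)) := by
    intro i hi
    by_cases hiA : i ∈ A (L i)
    · exact Or.inr ⟨hiA, (Finset.mem_filter.mp hi).2.resolve_left (not_not.mpr hiA)⟩
    · exact Or.inl (Finset.mem_sdiff.mpr ⟨Finset.mem_filter.mpr ⟨Finset.mem_univ _, rfl⟩, hiA⟩)
  have hFc : F.card ≤
      k * (2 * k * spreadFactor k m + 2 ^ (2 * k * paramSize k m * 8 ^ (k + 3))) := by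
    have hsub : F ⊆ Finset.univ.biUnion fun ℓ => (S ℓ \ A ℓ) ∪ E ℓ := by
      intro i hi
      refine Finset.mem_biUnion.mpr ⟨L i, Finset.mem_univ _, Finset.mem_union.mpr ?_⟩
      exact (hFmem i hi).imp id And.right
    refine (Finset.card_le_card hsub).trans (Finset.card_biUnion_le.trans ?_)
    calc ∑ ℓ, ((S ℓ \ A ℓ) ∪ E ℓ).card ≤ ∑ _ℓ : Fin k,
        (2 * k * spreadFactor k m + 2 ^ (2 * k * paramSize k m * 8 ^ (k + 3))) :=
          Finset.sum_le_sum fun ℓ _ =>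
            (Finset.card_union_le _ _).trans (Nat.add_le_add (hAc ℓ) (hEc ℓ))
      _ = _ := by simp
  have hiU : ∀ (T : Fin k → Set (Fin k → ℕ)) (X : Set ι) (c : ℕ), (∀ ℓ, (T ℓ).Finite) →
      (∀ ℓ, (T ℓ).ncard ≤ c) → (∀ i ∈ X, d i ∈ T (L i)) → (d '' X).ncard ≤ k * c := by
    intro T X c hfin hT hX
    have hsub : d '' X ⊆ ⋃ ℓ ∈ (Finset.univ : Finset (Fin k)), T ℓ := by
      rintro _ ⟨i, hi, rfl⟩
      simp only [Finset.mem_univ, Set.iUnion_true, Set.mem_iUnion]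
      exact ⟨L i, hX i hi⟩
    refine (Set.ncard_le_ncard hsub (Set.Finite.biUnion (Finset.finite_toSet _)
      fun ℓ _ => hfin ℓ)).trans ((Finset.set_ncard_biUnion_le _ _).trans ?_)
    exact (Finset.sum_le_sum fun ℓ _ => hT ℓ).trans (by simp)
  refine ⟨d, F, fun i => sum_roundGrid o (hp'0 i) (hp'1 i), ?_, ?_, hFc.trans hc1, ?_⟩
  · refine hiU (fun ℓ => (fun x => roundGrid D o (fillAt ℓ x)) '' (v' ℓ '' (A ℓ \ E ℓ : Finset ι)))
      _ _ (fun ℓ => Set.toFinite _)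
      (fun ℓ => (Set.ncard_image_le (Set.toFinite _)).trans (hHt ℓ)) fun i hi => ?_
    obtain ⟨h1, h2⟩ := hF i hi
    refine ⟨_, ⟨i, Finset.mem_coe.mpr (Finset.mem_sdiff.mpr ⟨h1, h2⟩), rfl⟩, ?_⟩
    simp only [d, hp'A _ i h1]
  · refine hiU (fun ℓ => d '' (S ℓ \ A ℓ : Finset ι) ∪
      (fun x => roundGrid D o (fillAt ℓ x)) '' (v' ℓ '' (E ℓ))) _ _ (fun ℓ => Set.toFinite _)
      (fun ℓ => (Set.ncard_union_le _ _).trans (Nat.add_le_add ?_ ?_)) fun i hi => ?_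
    · refine (Set.ncard_image_le (Set.toFinite _)).trans ?_
      rw [Set.ncard_coe_finset]
      exact hAc ℓ
    · exact (Set.ncard_image_le (Set.toFinite _)).trans (hEt ℓ)
    · rcases hFmem i hi with h | ⟨h1, h2⟩
      · exact Or.inl ⟨i, h, rfl⟩
      · refine Or.inr ⟨_, ⟨i, h2, rfl⟩, ?_⟩
        simp only [d, hp'A _ i h1]
  · have hround : PMDClose p' (fun i h => (d i h : ℝ) / D) (1 / (8 * m)) := by
      have hd1 : ∀ i, ∑ h, (d i h : ℝ) / D = 1 := fun i => by
        rw [← Finset.sum_div, div_eq_one_iff_eq hDr.ne']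
        exact_mod_cast sum_roundGrid o (hp'0 i) (hp'1 i)
      refine pmdClose_of_sum_abs_sub_le p' _ hp'0 hp'1 (fun i h => by positivity) hd1 ?_
      -- Players outside F already have grid rows: filling in the missing mass at ℓ preserves the
      -- denominator D.
      have h1 : ∀ i, ∑ h, |p' i h - (d i h : ℝ) / D| ≤ if i ∈ F then 2 * (k : ℝ) / D else 0 := by
        intro i
        split_ifs with hi
        · exact sum_abs_sub_roundGrid_le hD0 o (hp'0 i) (hp'1 i)
        · obtain ⟨h1, h2⟩ := hF i hi
          obtain ⟨n, hn⟩ := hHg (L i) i (Finset.mem_sdiff.mpr ⟨h1, h2⟩)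
          have hns : ∑ j, n j ≤ D := by
            have := hv's (L i) i
            simp only [hn] at this
            rw [← Finset.sum_div, div_le_one hDr] at this
            exact_mod_cast this
          have hgrid : ∀ h, p' i h =
              ((n h + if h = L i then D - ∑ j, n j else 0 : ℕ) : ℝ) / D := by
            intro h
            rw [hp'A _ i h1, fillAt, hn]
            push_cast
            rw [add_div]
            congr 1
            split_ifs
            · rw [Nat.cast_sub hns, ← Finset.sum_div]
              push_cast
              field_simp
            · simp
          refine (Finset.sum_eq_zero fun h _ => ?_).le
          have e : d i = fun h => n h + if h = L i then D - ∑ j, n j else 0 :=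
            roundGrid_of_grid hD0 o (hp'1 i) hgrid
          rw [hgrid h, e, sub_self, abs_zero]
      refine (Finset.sum_le_sum fun i _ => h1 i).trans ?_
      rw [Finset.sum_ite_mem, Finset.univ_inter, Finset.sum_const, nsmul_eq_mul, mul_div_assoc',
        div_le_div_iff₀ hDr (by positivity)]
      have h2 : F.card * (16 * m * k) ≤ D := (Nat.mul_le_mul_right _ hFc).trans hc2
      have h3 : (F.card : ℝ) * (16 * m * k) ≤ D := by exact_mod_cast h2
      linarith
    have h := hpp'.trans hround
    have e : 1 / (8 * (m : ℝ)) + 1 / (8 * m) = 1 / (4 * m) := by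
      field_simp
      norm_num
    rwa [e] at h

end Assembly

/-! ### Reasoning about programs of the random access machine -/

namespace RAM

instance : Add Expr := ⟨.op .add⟩
instance : Sub Expr := ⟨.op .sub⟩
instance : Mul Expr := ⟨.op .mul⟩
instance : Div Expr := ⟨.op .div⟩

section Framework

variable {X : ℕ} {σ : State}

@[simp] theorem Expr.eval_lit (c : ℕ) : (Expr.lit c).eval σ = c := rfl
@[simp] theorem Expr.eval_reg (r : ℕ) : (Expr.reg r).eval σ = σ.reg r := rfl
@[simp] theorem Expr.eval_add (a b : Expr) : (a + b).eval σ = a.eval σ + b.eval σ := rfl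
@[simp] theorem Expr.eval_sub (a b : Expr) : (a - b).eval σ = a.eval σ - b.eval σ := rfl
@[simp] theorem Expr.eval_mul (a b : Expr) : (a * b).eval σ = a.eval σ * b.eval σ := rfl
@[simp] theorem Expr.eval_div (a b : Expr) : (a / b).eval σ = a.eval σ / b.eval σ := rfl
@[simp] theorem Expr.eval_load (a : ℕ) (e : Expr) : (Expr.load a e).eval σ = σ.arr a (e.eval σ) :=
  rfl

@[simp] theorem State.reg_setReg (σ : State) (r v r' : ℕ) :
    (σ.setReg r v).reg r' = if r' = r then v else σ.reg r' := by
  simp [State.setReg, Function.update_apply]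

@[simp] theorem State.arr_setReg (σ : State) (r v a i : ℕ) :
    (σ.setReg r v).arr a i = σ.arr a i := rfl

@[simp] theorem State.reg_setArr (σ : State) (a i v r : ℕ) :
    (σ.setArr a i v).reg r = σ.reg r := rfl

@[simp] theorem State.arr_setArr (σ : State) (a i v a' i' : ℕ) :
    (σ.setArr a i v).arr a' i' = if a' = a ∧ i' = i then v else σ.arr a' i' := by
  by_cases h : a' = a
  · subst h
    simp [State.setArr, Function.update_apply]
  · simp [State.setArr, Function.update_apply, h]

/-- All numbers in the memory are at most `X`. -/
def Bounded (X : ℕ) (σ : State) : Prop := (∀ r, σ.reg r ≤ X) ∧ ∀ a i, σ.arr a i ≤ X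

/-- The literals, sums and products in an expression are at most `X`. -/
def Expr.Small (X : ℕ) (σ : State) : Expr → Prop
  | .lit c => c ≤ X
  | .reg _ => True
  | .op .add a b => a.Small X σ ∧ b.Small X σ ∧ a.eval σ + b.eval σ ≤ X
  | .op .sub a b => a.Small X σ ∧ b.Small X σ
  | .op .mul a b => a.Small X σ ∧ b.Small X σ ∧ a.eval σ * b.eval σ ≤ X
  | .op .div a b => a.Small X σ ∧ b.Small X σ
  | .load _ e => e.Small X σ

@[simp] theorem Expr.small_lit (c : ℕ) : (Expr.lit c).Small X σ ↔ c ≤ X := Iff.rfl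
@[simp] theorem Expr.small_reg (r : ℕ) : (Expr.reg r).Small X σ ↔ True := Iff.rfl
@[simp] theorem Expr.small_add (a b : Expr) :
    (a + b).Small X σ ↔ a.Small X σ ∧ b.Small X σ ∧ a.eval σ + b.eval σ ≤ X := Iff.rfl
@[simp] theorem Expr.small_sub (a b : Expr) :
    (a - b).Small X σ ↔ a.Small X σ ∧ b.Small X σ := Iff.rfl
@[simp] theorem Expr.small_mul (a b : Expr) :
    (a * b).Small X σ ↔ a.Small X σ ∧ b.Small X σ ∧ a.eval σ * b.eval σ ≤ X := Iff.rfl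
@[simp] theorem Expr.small_div (a b : Expr) :
    (a / b).Small X σ ↔ a.Small X σ ∧ b.Small X σ := Iff.rfl
@[simp] theorem Expr.small_load (a : ℕ) (e : Expr) :
    (Expr.load a e).Small X σ ↔ e.Small X σ := Iff.rfl

/-- The number of nodes of an expression. -/
def Expr.nodes : Expr → ℕ
  | .lit _ => 1
  | .reg _ => 1
  | .op _ a b => a.nodes + b.nodes + 1
  | .load _ e => e.nodes + 1

@[simp] theorem Expr.nodes_lit (c : ℕ) : (Expr.lit c).nodes = 1 := rfl
@[simp] theorem Expr.nodes_reg (r : ℕ) : (Expr.reg r).nodes = 1 := rfl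
@[simp] theorem Expr.nodes_add (a b : Expr) : (a + b).nodes = a.nodes + b.nodes + 1 := rfl
@[simp] theorem Expr.nodes_sub (a b : Expr) : (a - b).nodes = a.nodes + b.nodes + 1 := rfl
@[simp] theorem Expr.nodes_mul (a b : Expr) : (a * b).nodes = a.nodes + b.nodes + 1 := rfl
@[simp] theorem Expr.nodes_div (a b : Expr) : (a / b).nodes = a.nodes + b.nodes + 1 := rfl
@[simp] theorem Expr.nodes_load (a : ℕ) (e : Expr) : (Expr.load a e).nodes = e.nodes + 1 := rfl

/-- A bound for the cost of handling up to three numbers that are at most `X`. -/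
def unitCost (X : ℕ) : ℕ := 3 * X.size + 1

theorem Expr.eval_le (hσ : Bounded X σ) : ∀ e : Expr, e.Small X σ → e.eval σ ≤ X
  | .lit _, h => h
  | .reg r, _ => hσ.1 r
  | .op .add _ _, h => h.2.2
  | .op .sub a _, h => (Nat.sub_le _ _).trans (a.eval_le hσ h.1)
  | .op .mul _ _, h => h.2.2
  | .op .div a _, h => (Nat.div_le_self _ _).trans (a.eval_le hσ h.1)
  | .load a e, _ => hσ.2 a (e.eval σ)

theorem Expr.small_operands {o : Op} {a b : Expr} (h : (Expr.op o a b).Small X σ) :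
    a.Small X σ ∧ b.Small X σ := by
  cases o
  exacts [⟨h.1, h.2.1⟩, h, ⟨h.1, h.2.1⟩, h]

/-- A uniform bound X for all numbers reduces bit cost to counting nodes; each node handles at most
three numbers. -/
theorem Expr.cost_le (hσ : Bounded X σ) : ∀ e : Expr, e.Small X σ →
    e.cost σ ≤ e.nodes * unitCost X
  | .lit c, h => by
    have := Nat.size_le_size (show c ≤ X from h)
    simp only [Expr.cost, Expr.nodes, unitCost]
    omega
  | .reg r, _ => by
    have := Nat.size_le_size (hσ.1 r)
    simp only [Expr.cost, Expr.nodes, unitCost]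
    omega
  | .op o a b, h => by
    obtain ⟨ha, hb⟩ := Expr.small_operands h
    have h1 := a.cost_le hσ ha
    have h2 := b.cost_le hσ hb
    have h3 := Nat.size_le_size (a.eval_le hσ ha)
    have h4 := Nat.size_le_size (b.eval_le hσ hb)
    have h5 := Nat.size_le_size ((Expr.op o a b).eval_le hσ h)
    simp only [Expr.cost, Expr.nodes, Expr.eval, add_mul, one_mul] at h5 ⊢
    simp only [unitCost] at h1 h2 ⊢
    omega
  | .load a e, h => by
    have h1 := e.cost_le hσ h
    have h3 := Nat.size_le_size (e.eval_le hσ h)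
    have h5 := Nat.size_le_size (hσ.2 a (e.eval σ))
    simp only [Expr.cost, Expr.nodes, add_mul, one_mul]
    simp only [unitCost] at h1 ⊢
    omega

theorem Bounded.setReg (hσ : Bounded X σ) {r v : ℕ} (hv : v ≤ X) : Bounded X (σ.setReg r v) := by
  refine ⟨fun r' => ?_, hσ.2⟩
  rw [State.reg_setReg]
  split_ifs
  exacts [hv, hσ.1 r']

theorem Bounded.setArr (hσ : Bounded X σ) {a i v : ℕ} (hv : v ≤ X) :
    Bounded X (σ.setArr a i v) := by
  refine ⟨hσ.1, fun a' i' => ?_⟩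
  rw [State.arr_setArr]
  split_ifs
  exacts [hv, hσ.2 a' i']

/-- The program `c`, started in `σ`, halts after time at most `t * unitCost X` in a state that is
bounded by `X` and satisfies `Q`. -/
def Runs (X : ℕ) (c : Program) (σ : State) (t : ℕ) (Q : State → Prop) : Prop :=
  ∃ (σ' : State) (t' : ℕ), Exec c σ σ' t' ∧ t' ≤ t * unitCost X ∧ Bounded X σ' ∧ Q σ'

variable {c c₁ c₂ : Program} {t t₁ t₂ : ℕ} {Q Q₁ : State → Prop}

theorem Runs.mono (h : Runs X c σ t₁ Q₁) (ht : t₁ ≤ t) (hQ : ∀ σ', Q₁ σ' → Q σ') :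
    Runs X c σ t Q := by
  obtain ⟨σ', t', he, ht', hb, hq⟩ := h
  exact ⟨σ', t', he, ht'.trans (Nat.mul_le_mul_right _ ht), hb, hQ σ' hq⟩

theorem Runs.seq (h₁ : Runs X c₁ σ t₁ Q₁)
    (h₂ : ∀ σ₁, Bounded X σ₁ → Q₁ σ₁ → Runs X c₂ σ₁ t₂ Q) :
    Runs X (.seq c₁ c₂) σ (t₁ + t₂) Q := by
  obtain ⟨σ₁, s₁, he₁, ht₁, hb₁, hq₁⟩ := h₁
  obtain ⟨σ₂, s₂, he₂, ht₂, hb₂, hq₂⟩ := h₂ σ₁ hb₁ hq₁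
  exact ⟨σ₂, s₁ + s₂, .seq he₁ he₂, by rw [add_mul]; omega, hb₂, hq₂⟩

theorem Runs.skip (hσ : Bounded X σ) (hQ : Q σ) : Runs X .skip σ 1 Q :=
  ⟨σ, 1, .skip σ, by simp [unitCost], hσ, hQ⟩

theorem Runs.assign (hσ : Bounded X σ) {r : ℕ} {e : Expr} (he : e.Small X σ)
    (hQ : Q (σ.setReg r (e.eval σ))) : Runs X (.assign r e) σ (e.nodes + 1) Q := by
  have h1 := e.cost_le hσ he
  have h2 := e.eval_le hσ he
  have h3 := Nat.size_le_size h2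
  refine ⟨_, _, .assign σ r e, ?_, hσ.setReg h2, hQ⟩
  rw [add_mul, one_mul]
  simp only [unitCost] at h1 ⊢
  omega

theorem Runs.store (hσ : Bounded X σ) {a : ℕ} {e₁ e₂ : Expr} (h₁ : e₁.Small X σ)
    (h₂ : e₂.Small X σ) (hQ : Q (σ.setArr a (e₁.eval σ) (e₂.eval σ))) :
    Runs X (.store a e₁ e₂) σ (e₁.nodes + e₂.nodes + 1) Q := by
  have hc1 := e₁.cost_le hσ h₁
  have hc2 := e₂.cost_le hσ h₂
  have hv1 := Nat.size_le_size (e₁.eval_le hσ h₁)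
  have hv2 := e₂.eval_le hσ h₂
  have hv3 := Nat.size_le_size hv2
  refine ⟨_, _, .store σ a e₁ e₂, ?_, hσ.setArr hv2, hQ⟩
  rw [add_mul, add_mul, one_mul]
  simp only [unitCost] at hc1 hc2 ⊢
  omega

theorem Runs.branch (hσ : Bounded X σ) {e : Expr} (he : e.Small X σ)
    (h₁ : e.eval σ ≠ 0 → Runs X c₁ σ t Q) (h₂ : e.eval σ = 0 → Runs X c₂ σ t Q) :
    Runs X (.branch e c₁ c₂) σ (e.nodes + 1 + t) Q := by
  have hc := e.cost_le hσ he
  have hU : 1 ≤ unitCost X := Nat.le_add_left _ _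
  by_cases h : e.eval σ = 0
  · obtain ⟨σ', t', hx, ht, hb, hq⟩ := h₂ h
    exact ⟨σ', _, .branch_false h hx, by rw [add_mul, add_mul, one_mul]; omega, hb, hq⟩
  · obtain ⟨σ', t', hx, ht, hb, hq⟩ := h₁ h
    exact ⟨σ', _, .branch_true h hx, by rw [add_mul, add_mul, one_mul]; omega, hb, hq⟩

/-- A loop with an invariant that is indexed by the number of the remaining rounds. -/
theorem Runs.loop {e : Expr} (I : ℕ → State → Prop) (T : ℕ)
    (hsmall : ∀ i σ, Bounded X σ → I i σ → e.Small X σ) (hzero : ∀ σ, I 0 σ → e.eval σ = 0)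
    (hstep : ∀ i σ, Bounded X σ → I (i + 1) σ →
      e.eval σ ≠ 0 ∧ Runs X c σ t (I i)) (hσ : Bounded X σ) (hI : I T σ) :
    Runs X (.loop e c) σ ((e.nodes + 1 + t) * T + (e.nodes + 1)) (I 0) := by
  have hU : 1 ≤ unitCost X := Nat.le_add_left _ _
  induction T generalizing σ with
  | zero =>
    have hc := e.cost_le hσ (hsmall 0 σ hσ hI)
    refine ⟨σ, _, .loop_done (hzero σ hI), ?_, hσ, hI⟩
    rw [mul_zero, zero_add, add_mul, one_mul]
    omega
  | succ T ih =>
    have hc := e.cost_le hσ (hsmall _ σ hσ hI)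
    obtain ⟨hne, σ₁, s₁, he₁, ht₁, hb₁, hI₁⟩ := hstep T σ hσ hI
    obtain ⟨σ₂, s₂, he₂, ht₂, hb₂, hI₂⟩ := ih hb₁ hI₁
    refine ⟨σ₂, _, .loop_step hne he₁ he₂, ?_, hb₂, hI₂⟩
    have : ((e.nodes + 1 + t) * (T + 1) + (e.nodes + 1)) * unitCost X =
        ((e.nodes + 1 + t) * T + (e.nodes + 1)) * unitCost X +
          (e.nodes * unitCost X + unitCost X + t * unitCost X) := by ring
    omega

theorem Runs.assign_seq (hσ : Bounded X σ) {r : ℕ} {e : Expr} (he : e.Small X σ) {v : ℕ}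
    (hv : e.eval σ = v) (h : Bounded X (σ.setReg r v) → Runs X c (σ.setReg r v) t Q) :
    Runs X (.seq (.assign r e) c) σ (e.nodes + 1 + t) Q :=
  Runs.seq (Q₁ := fun σ' => σ' = σ.setReg r v) (Runs.assign hσ he (by rw [hv]))
    fun σ₁ hb hq => by
      subst hq
      exact h hb

theorem Runs.store_seq (hσ : Bounded X σ) {a : ℕ} {e₁ e₂ : Expr} (h₁ : e₁.Small X σ)
    (h₂ : e₂.Small X σ) {i v : ℕ} (hi : e₁.eval σ = i) (hv : e₂.eval σ = v)
    (h : Bounded X (σ.setArr a i v) → Runs X c (σ.setArr a i v) t Q) :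
    Runs X (.seq (.store a e₁ e₂) c) σ (e₁.nodes + e₂.nodes + 1 + t) Q :=
  Runs.seq (Q₁ := fun σ' => σ' = σ.setArr a i v) (Runs.store hσ h₁ h₂ (by rw [hi, hv]))
    fun σ₁ hb hq => by
      subst hq
      exact h hb

/-- Run `c` with the register `i` counting upwards from `0` while it is below the value of `e`; the
register `r` counts the remaining rounds. -/
def forUp (i r : ℕ) (e : Expr) (c : Program) : Program :=
  .seq (.assign i (.lit 0)) (.seq (.assign r e) (.loop (.reg r)
    (.seq (.assign r (.reg r - .lit 1)) (.seq c (.assign i (.reg i + .lit 1))))))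

/-- The condition `hset` says that the invariant ignores the two counters. Termination rests on the
downward counter r, so the limit e is evaluated only once and the body may change what e refers to.
-/
theorem Runs.forUp {i r : ℕ} {e : Expr} (hX : 1 ≤ X) (hσ : Bounded X σ) (hir : i ≠ r)
    (he : e.Small X (σ.setReg i 0)) {K : ℕ} (hK : e.eval (σ.setReg i 0) = K)
    (I : ℕ → State → Prop) (hI : I 0 σ)
    (hset : ∀ j σ x v, (x = i ∨ x = r) → I j σ → I j (σ.setReg x v))
    (hstep : ∀ j σ₁, j < K → Bounded X σ₁ → σ₁.reg i = j → I j σ₁ →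
      Runs X c σ₁ t fun σ₂ => σ₂.reg i = j ∧ σ₂.reg r = σ₁.reg r ∧ I (j + 1) σ₂) :
    Runs X (forUp i r e c) σ ((t + 10) * K + (e.nodes + 10)) (I K) := by
  have hb0 : Bounded X (σ.setReg i 0) := hσ.setReg (Nat.zero_le _)
  have hKX : K ≤ X := hK ▸ e.eval_le hb0 he
  have h := Runs.assign_seq (X := X) (r := i) hσ (e := .lit 0) (Nat.zero_le X) rfl fun hb =>
    Runs.assign_seq (r := r) hb he hK fun hb' =>
      Runs.loop (c := .seq (.assign r (.reg r - .lit 1)) (.seq c (.assign i (.reg i + .lit 1))))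
        (e := .reg r) (t := 3 + 1 + (t + 4))
        (fun j σ₁ => j ≤ K ∧ σ₁.reg r = j ∧ σ₁.reg i = K - j ∧ I (K - j) σ₁) K
        (fun _ _ _ _ => trivial) (fun _ h => h.2.1) (fun j σ₁ hb₁ ⟨hj, hr, hi, hI₁⟩ => ?_) hb' ?_
  · refine h.mono ?_ fun σ' h' => by simpa using h'.2.2.2
    simp only [Expr.nodes]
    have e1 : (1 + 1 + (3 + 1 + (t + 4))) * K = (t + 10) * K := by ring
    omega
  · refine ⟨by simp [hr], ?_⟩
    refine Runs.assign_seq hb₁ ?_ (v := j) ?_ fun hb₂ => ?_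
    · simpa using hX
    · simp [hr]
    · refine Runs.seq (hstep (K - (j + 1)) _ (by omega) hb₂ ?_ (hset _ _ _ _ (Or.inr rfl) hI₁))
        fun σ₂ hb₃ ⟨hi₂, hr₂, hI₂⟩ => ?_
      · rw [State.reg_setReg, if_neg hir, hi]
      · have hr₂' : σ₂.reg r = j := by rw [hr₂, State.reg_setReg, if_pos rfl]
        refine Runs.assign hb₃ ?_ ⟨by omega, ?_, ?_, ?_⟩
        · simp only [Expr.small_add, Expr.small_reg, Expr.small_lit, Expr.eval_reg, Expr.eval_lit]
          exact ⟨trivial, hX, by omega⟩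
        · rw [State.reg_setReg, if_neg (Ne.symm hir), hr₂']
        · simp only [State.reg_setReg, if_true, Expr.eval_add, Expr.eval_reg, Expr.eval_lit]
          omega
        · have : K - (j + 1) + 1 = K - j := by omega
          rw [this] at hI₂
          exact hset _ _ _ _ (Or.inl rfl) hI₂
  · refine ⟨le_rfl, by simp, ?_, ?_⟩
    · simp [hir]
    · rw [Nat.sub_self]
      exact hset _ _ _ _ (Or.inr rfl) (hset _ _ _ _ (Or.inl rfl) hI)

end Framework

end RAM

/-! ### Decoding a profile -/

namespace RAM

section Pow

/-- `d := b ^ e`, with counters `i` and `r`. -/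
def powProg (d b i r : ℕ) (e : Expr) : Program :=
  .seq (.assign d (.lit 1)) (forUp i r e (.assign d (.reg d * .reg b)))

theorem runs_powProg {X : ℕ} {σ : State} {d b i r : ℕ} {e : Expr} (hσ : Bounded X σ)
    (hir : i ≠ r) (hdi : d ≠ i) (hdr : d ≠ r) (hbd : b ≠ d) (hbi : b ≠ i) (hbr : b ≠ r)
    (he : e.Small X ((σ.setReg d 1).setReg i 0)) {K B : ℕ}
    (hK : e.eval ((σ.setReg d 1).setReg i 0) = K) (hB : σ.reg b = B) (hB0 : 0 < B)
    (hX : B ^ K ≤ X) :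
    Runs X (powProg d b i r e) σ (14 * K + (e.nodes + 12)) fun σ' =>
      σ'.reg d = B ^ K ∧ (∀ x, x ≠ d → x ≠ i → x ≠ r → σ'.reg x = σ.reg x) ∧
      ∀ a q, σ'.arr a q = σ.arr a q := by
  have hX1 : 1 ≤ X := (Nat.one_le_pow _ _ hB0).trans hX
  refine (Runs.assign_seq hσ (by simpa using hX1) (v := 1) rfl fun hb =>
    Runs.forUp hX1 hb hir he hK (fun j σ' => σ'.reg d = B ^ j ∧
      (∀ x, x ≠ d → x ≠ i → x ≠ r → σ'.reg x = σ.reg x) ∧ ∀ a q, σ'.arr a q = σ.arr a q)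
      ⟨by simp, fun x hx _ _ => by simp [hx], fun a q => rfl⟩ ?_
      fun j σ₁ hj hb₁ hi ⟨hd, hx, ha⟩ => Runs.assign hb₁ ?_ ⟨?_, ?_, ?_, fun x hxd hxi hxr => ?_,
        fun a q => ha a q⟩).mono ?_ fun _ h => h
  · rintro j σ₁ x v (rfl | rfl) ⟨hd, hx, ha⟩
    · exact ⟨by simp [hdi, hd], fun y h1 h2 h3 => by simp [h2, hx y h1 h2 h3], fun a q => ha a q⟩
    · exact ⟨by simp [hdr, hd], fun y h1 h2 h3 => by simp [h3, hx y h1 h2 h3], fun a q => ha a q⟩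
  · simp only [Expr.small_mul, Expr.small_reg, Expr.eval_reg, hd, hx b hbd hbi hbr, hB, true_and]
    rw [← pow_succ]
    exact (Nat.pow_le_pow_right hB0 hj).trans hX
  · simp [hi, hdi.symm]
  · simp [hdr.symm]
  · simp [hd, hx b hbd hbi hbr, hB, pow_succ]
  · simp [hxd, hx x hxd hxi hxr]
  · simp only [Expr.nodes_lit, Expr.nodes_mul, Expr.nodes_reg]
    omega

end Pow

/-! The row of strategy probabilities with a given code: its digits in base `D + 1`, cut off as soon
as their sum reaches `D`; what is missing goes to coordinate `0`. -/

def codeDigit (D c h : ℕ) : ℕ := c / (D + 1) ^ h % (D + 1)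

def rowRem (D c : ℕ) : ℕ → ℕ
  | 0 => D
  | h + 1 => rowRem D c h - min (codeDigit D c h) (rowRem D c h)

def rowEntry (D k c h : ℕ) : ℕ :=
  min (codeDigit D c h) (rowRem D c h) + if h = 0 then rowRem D c k else 0

/-- For z h = Y^(n^h) this is the generating polynomial of one player, evaluated at an integer. -/
def rowVal (D k : ℕ) (z : ℕ → ℕ) (c : ℕ) : ℕ := ∑ h ∈ Finset.range k, rowEntry D k c h * z h

theorem sum_add_rowRem (D c j : ℕ) :
    ∑ h ∈ Finset.range j, min (codeDigit D c h) (rowRem D c h) + rowRem D c j = D := by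
  induction j with
  | zero => simp [rowRem]
  | succ j ih =>
    rw [Finset.sum_range_succ, rowRem]
    have : min (codeDigit D c j) (rowRem D c j) ≤ rowRem D c j := min_le_right _ _
    omega

/-- Since the digits are cut off and the rest goes to coordinate 0, every number decodes to a
probability vector. Hence the search never has to test a code for validity. -/
theorem sum_rowEntry {D k c : ℕ} (hk : 0 < k) : ∑ h ∈ Finset.range k, rowEntry D k c h = D := by
  simp only [rowEntry, Finset.sum_add_distrib, Finset.sum_ite_eq', Finset.mem_range, hk, if_true]
  exact sum_add_rowRem D c k

theorem rowVal_eq {D k c : ℕ} (hk : 0 < k) (z : ℕ → ℕ) :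
    rowVal D k z c = ∑ h ∈ Finset.range k, min (codeDigit D c h) (rowRem D c h) * z h +
      rowRem D c k * z 0 := by
  simp only [rowVal, rowEntry, add_mul, Finset.sum_add_distrib, ite_mul, zero_mul,
    Finset.sum_ite_eq', Finset.mem_range, hk, if_true]

theorem rowVal_le {D k c Z : ℕ} {z : ℕ → ℕ} (hk : 0 < k) (hz : ∀ h < k, z h ≤ Z) :
    rowVal D k z c ≤ D * Z := by
  calc rowVal D k z c ≤ ∑ h ∈ Finset.range k, rowEntry D k c h * Z :=
        Finset.sum_le_sum fun h hh => Nat.mul_le_mul_left _ (hz h (Finset.mem_range.mp hh))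
    _ = D * Z := by rw [← Finset.sum_mul, sum_rowEntry hk]

theorem partial_rowVal_le {D k c Z : ℕ} {z : ℕ → ℕ} (hz : ∀ h < k, z h ≤ Z) {j : ℕ} (hj : j ≤ k) :
    ∑ h ∈ Finset.range j, min (codeDigit D c h) (rowRem D c h) * z h ≤ D * Z := by
  have h1 : ∀ h ∈ Finset.range j, min (codeDigit D c h) (rowRem D c h) * z h ≤
      min (codeDigit D c h) (rowRem D c h) * Z := fun h hh =>
    Nat.mul_le_mul_left _ (hz h ((Finset.mem_range.mp hh).trans_le hj))
  refine (Finset.sum_le_sum h1).trans ?_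
  rw [← Finset.sum_mul]
  have := sum_add_rowRem D c j
  exact Nat.mul_le_mul_right _ (by omega)

/-- The constants that the decoder uses. -/
structure CodeEnv (n k D N : ℕ) (z : ℕ → ℕ) (σ : State) : Prop where
  reg0 : σ.reg 0 = n
  reg1 : σ.reg 1 = k
  reg3 : σ.reg 3 = D
  reg7 : σ.reg 7 = D + 1
  reg8 : σ.reg 8 = N
  arr4 : ∀ h < k, σ.arr 4 h = z h

theorem CodeEnv.congr {n k D N : ℕ} {z : ℕ → ℕ} {σ σ' : State} (h : CodeEnv n k D N z σ)
    (hr : ∀ r < 10, σ'.reg r = σ.reg r) (ha : ∀ q, σ'.arr 4 q = σ.arr 4 q) :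
    CodeEnv n k D N z σ' where
  reg0 := by rw [hr 0 (by norm_num), h.reg0]
  reg1 := by rw [hr 1 (by norm_num), h.reg1]
  reg3 := by rw [hr 3 (by norm_num), h.reg3]
  reg7 := by rw [hr 7 (by norm_num), h.reg7]
  reg8 := by rw [hr 8 (by norm_num), h.reg8]
  arr4 := fun q hq => by rw [ha, h.arr4 q hq]

/-- One digit of a row. -/
def digitProg : Program :=
  .seq (.assign 43 (.reg 20 - .reg 20 / .reg 7 * .reg 7))
  (.seq (.assign 43 (.reg 43 - (.reg 43 - .reg 42)))
  (.seq (.store 5 (.reg 40) (.reg 43))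
  (.seq (.assign 23 (.reg 23 + .reg 43 * .load 4 (.reg 40)))
  (.seq (.assign 42 (.reg 42 - .reg 43))
  (.assign 20 (.reg 20 / .reg 7))))))

/-- Read a row from the code in register `20` into array `5`, and its value into register `23`. -/
def readRowProg : Program :=
  .seq (.assign 23 (.lit 0))
  (.seq (.assign 42 (.reg 3))
  (.seq (forUp 40 41 (.reg 1) digitProg)
  (.seq (.store 5 (.lit 0) (.load 5 (.lit 0) + .reg 42))
  (.assign 23 (.reg 23 + .reg 42 * .load 4 (.lit 0))))))

/-- Remainders are not among the machine operations and are computed in this way; likewise minima by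
the next lemma. -/
theorem sub_div_mul (a b : ℕ) : a - a / b * b = a % b := by
  rw [mul_comm, Nat.mod_eq_sub]

theorem sub_sub_eq_min (a b : ℕ) : a - (a - b) = min a b := by omega

/-- The invariant of the loop in `readRowProg`. -/
structure RowInv (D c : ℕ) (z : ℕ → ℕ) (σ₀ : State) (j : ℕ) (σ : State) : Prop where
  reg20 : σ.reg 20 = c / (D + 1) ^ j
  reg23 : σ.reg 23 = ∑ h ∈ Finset.range j, min (codeDigit D c h) (rowRem D c h) * z h
  reg42 : σ.reg 42 = rowRem D c j
  arr5 : ∀ h < j, σ.arr 5 h = min (codeDigit D c h) (rowRem D c h)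
  regs : ∀ r < 40, r ≠ 20 → r ≠ 23 → σ.reg r = σ₀.reg r
  arrs : ∀ a q, a ≠ 5 → σ.arr a q = σ₀.arr a q

theorem runs_digitProg {X n k D N Z c j : ℕ} {z : ℕ → ℕ} {σ₀ σ : State} (hX : 1 ≤ X)
    (henv : CodeEnv n k D N z σ₀) (hz : ∀ h < k, z h ≤ Z) (hDZ : D * Z ≤ X)
    (hj : j < k) (hσ : Bounded X σ) (h40 : σ.reg 40 = j) (h : RowInv D c z σ₀ j σ) :
    Runs X digitProg σ 40 fun σ' =>
      σ'.reg 40 = j ∧ σ'.reg 41 = σ.reg 41 ∧ RowInv D c z σ₀ (j + 1) σ' := by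
  have h7 : σ.reg 7 = D + 1 := by rw [h.regs 7 (by norm_num) (by norm_num) (by norm_num), henv.reg7]
  have h4 : σ.arr 4 j = z j := by rw [h.arrs 4 j (by norm_num), henv.arr4 j hj]
  have hsum := partial_rowVal_le (D := D) (c := c) hz (show j + 1 ≤ k from hj)
  rw [Finset.sum_range_succ] at hsum
  set e := min (codeDigit D c j) (rowRem D c j) with he
  have h20X : σ.reg 20 ≤ X := hσ.1 20
  refine (Runs.assign_seq hσ ?_ (v := codeDigit D c j) ?_ fun hb1 =>
    Runs.assign_seq hb1 ?_ (v := e) ?_ fun hb2 =>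
    Runs.store_seq hb2 ?_ ?_ (i := j) (v := e) ?_ ?_ fun hb3 =>
    Runs.assign_seq hb3 ?_
      (v := ∑ h ∈ Finset.range (j + 1), min (codeDigit D c h) (rowRem D c h) * z h) ?_ fun hb4 =>
    Runs.assign_seq hb4 ?_ (v := rowRem D c (j + 1)) ?_ fun hb5 =>
    Runs.assign hb5 ?_ ⟨?_, ?_, ?_⟩).mono ?_ fun _ h => h
  · simpa using (Nat.div_mul_le_self _ _).trans h20X
  · simp only [Expr.eval_sub, Expr.eval_mul, Expr.eval_div, Expr.eval_reg, h7, h.reg20, sub_div_mul,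
      codeDigit]
  · simp
  · simp [sub_sub_eq_min, h.reg42, he]
  · simp
  · simp
  · simp [h40]
  · simp
  · simp [h40, h4, h.reg23]
    constructor <;> omega
  · simp [h40, h4, h.reg23, Finset.sum_range_succ, he]
  · simp
  · simp [h.reg42, rowRem, he]
  · simp
  · norm_num
  · simp [h40]
  · simp
  · refine ⟨?_, ?_, ?_, fun h' hh' => ?_, fun r h1 h2 h3 => ?_, fun a q ha => ?_⟩
    · simp [h.reg20, h7, Nat.div_div_eq_div_mul, pow_succ]
    · simp
    · simp
    · rcases Nat.lt_succ_iff_lt_or_eq.mp hh' with h1 | h1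
      · simp [h1.ne, h.arr5 h' h1]
      · subst h1
        simp [he]
    · have : r ≠ 42 ∧ r ≠ 43 := by omega
      simp [h2, h3, this.1, this.2, h.regs r h1 h2 h3]
    · simp [ha, h.arrs a q ha]

theorem runs_readRowProg {X n k D N Z c : ℕ} {z : ℕ → ℕ} {σ : State} (hX : 1 ≤ X) (hk : 0 < k)
    (henv : CodeEnv n k D N z σ) (hz : ∀ h < k, z h ≤ Z) (hDZ : D * Z ≤ X) (hσ : Bounded X σ)
    (hc : σ.reg 20 = c) :
    Runs X readRowProg σ (50 * k + 40) fun σ' =>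
      σ'.reg 20 = c / (D + 1) ^ k ∧ σ'.reg 23 = rowVal D k z c ∧
      (∀ h < k, σ'.arr 5 h = rowEntry D k c h) ∧
      (∀ r < 40, r ≠ 20 → r ≠ 23 → σ'.reg r = σ.reg r) ∧ ∀ a q, a ≠ 5 → σ'.arr a q = σ.arr a q := by
  have hDX : D ≤ X := henv.reg3 ▸ hσ.1 3
  refine (Runs.assign_seq hσ (by simp) (v := 0) rfl fun hb1 =>
    Runs.assign_seq hb1 (by simp) (v := D) (by simp [henv.reg3]) fun hb2 =>
    Runs.seq (Runs.forUp (K := k) (t := 40) hX hb2 (by norm_num) (by simp) (by simp [henv.reg1])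
      (RowInv D c z σ) ?_ ?_ fun j σ₁ hj hb h40 hI => ?_) fun σ₂ hb3 hI =>
    Runs.store_seq hb3 ?_ ?_ (i := 0) (v := rowEntry D k c 0) ?_ ?_ fun hb4 =>
    Runs.assign hb4 ?_ ?_).mono ?_ fun _ h => h
  · exact ⟨by simp [hc], by simp, by simp [rowRem], by simp,
      fun r h1 h2 h3 => by simp [h3, (show r ≠ 42 by omega)], fun a q _ => rfl⟩
  · rintro j σ₁ x v hx ⟨h1, h2, h3, h4, h5, h6⟩
    have hx' : x = 40 ∨ x = 41 := hx
    exact ⟨by rcases hx' with rfl | rfl <;> simp [h1], by rcases hx' with rfl | rfl <;> simp [h2],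
      by rcases hx' with rfl | rfl <;> simp [h3], h4, fun r hr1 hr2 hr3 => by
        have : r ≠ x := by omega
        simp [this, h5 r hr1 hr2 hr3], h6⟩
  · exact runs_digitProg hX henv hz hDZ hj hb h40 hI
  · simp
  · simp only [Expr.small_add, Expr.small_load, Expr.small_lit, Expr.small_reg, Expr.eval_load,
      Expr.eval_lit, Expr.eval_reg, hI.reg42, hI.arr5 0 hk]
    refine ⟨Nat.zero_le _, trivial, le_trans ?_ hDX⟩
    have h1 := sum_rowEntry (D := D) (c := c) hk
    have h2 := Finset.single_le_sum (f := rowEntry D k c) (fun h _ => Nat.zero_le _)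
      (Finset.mem_range.mpr hk)
    simp only [rowEntry, if_true] at h1 h2
    omega
  · simp
  · simp [hI.arr5 0 hk, hI.reg42, rowEntry]
  · have h1 := rowVal_le (D := D) (c := c) hk hz
    rw [rowVal_eq hk] at h1
    simp [hI.reg23, hI.reg42, hI.arrs, henv.arr4 0 hk]
    constructor <;> omega
  · refine ⟨by simp [hI.reg20], ?_, fun h hh => ?_, fun r h1 h2 h3 => ?_, fun a q ha => ?_⟩
    · simp [hI.reg23, hI.reg42, hI.arrs, henv.arr4 0 hk, rowVal_eq hk]
    · by_cases h0 : h = 0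
      · simp [h0]
      · simp [h0, hI.arr5 h hh, rowEntry]
    · simp [h3, hI.regs r h1 h2 h3]
    · simp [ha, hI.arrs a q ha]
  · simp
    omega

end RAM

/-! ### Decoding a profile player by player -/

namespace RAM

section Decode

/-- The largest multiplicity of the next type, which depends on the parity of the code. -/
def slotBase (n D c : ℕ) : ℕ := c % 2 * n + (1 - c % 2) * (D + 1)

/-- One player: the state consists of the code that has not been read, of the number of further
players of the current type, and of the code of the row of the current type. -/
def decStep (n k D : ℕ) (s : ℕ × ℕ × ℕ) : ℕ × ℕ × ℕ :=
  if s.2.1 = 0 then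
    (s.1 / 2 / slotBase n D s.1 / (D + 1) ^ k, s.1 / 2 % slotBase n D s.1,
      s.1 / 2 / slotBase n D s.1)
  else (s.1, s.2.1 - 1, s.2.2)

def decState (n k D c : ℕ) : ℕ → ℕ × ℕ × ℕ
  | 0 => (c, 0, 0)
  | j + 1 => decStep n k D (decState n k D c j)

/-- The code of the row of player `j`. -/
def profCode (n k D c j : ℕ) : ℕ := (decState n k D c (j + 1)).2.2

/-- Start a new type. -/
def slotProg : Program :=
  .seq (.assign 26 (.reg 20 - .reg 20 / .lit 2 * .lit 2))
  (.seq (.assign 25 (.reg 26 * .reg 0 + (.lit 1 - .reg 26) * .reg 7))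
  (.seq (.assign 20 (.reg 20 / .lit 2))
  (.seq (.assign 21 (.reg 20 - .reg 20 / .reg 25 * .reg 25))
  (.seq (.assign 20 (.reg 20 / .reg 25)) readRowProg))))

theorem slotBase_le {n D c X : ℕ} (hn : n ≤ X) (hD : D + 1 ≤ X) : slotBase n D c ≤ X := by
  unfold slotBase
  rcases Nat.mod_two_eq_zero_or_one c with h | h <;> rw [h] <;> omega

theorem runs_slotProg {X n k D N Z c : ℕ} {z : ℕ → ℕ} {σ : State} (hX : 2 ≤ X) (hk : 0 < k)
    (henv : CodeEnv n k D N z σ) (hz : ∀ h < k, z h ≤ Z) (hDZ : D * Z ≤ X) (hσ : Bounded X σ)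
    (hc : σ.reg 20 = c) :
    Runs X slotProg σ (50 * k + 80) fun σ' =>
      σ'.reg 20 = c / 2 / slotBase n D c / (D + 1) ^ k ∧ σ'.reg 21 = c / 2 % slotBase n D c ∧
      σ'.reg 23 = rowVal D k z (c / 2 / slotBase n D c) ∧
      (∀ h < k, σ'.arr 5 h = rowEntry D k (c / 2 / slotBase n D c) h) ∧
      (∀ r < 40, r < 20 ∨ 26 < r ∨ r = 22 ∨ r = 24 → σ'.reg r = σ.reg r) ∧
      ∀ a q, a ≠ 5 → σ'.arr a q = σ.arr a q := by
  have hcX : c ≤ X := hc ▸ hσ.1 20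
  have hnX : n ≤ X := henv.reg0 ▸ hσ.1 0
  have hDX : D + 1 ≤ X := henv.reg7 ▸ hσ.1 7
  have hsl := slotBase_le (c := c) hnX hDX
  have hkind : (c % 2) * n ≤ X ∧ (1 - c % 2) * (D + 1) ≤ X := by
    unfold slotBase at hsl
    omega
  refine (Runs.assign_seq hσ ?_ (v := c % 2) ?_ fun hb1 =>
    Runs.assign_seq hb1 ?_ (v := slotBase n D c) ?_ fun hb2 =>
    Runs.assign_seq hb2 ?_ (v := c / 2) ?_ fun hb3 =>
    Runs.assign_seq hb3 ?_ (v := c / 2 % slotBase n D c) ?_ fun hb4 =>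
    Runs.assign_seq hb4 ?_ (v := c / 2 / slotBase n D c) ?_ fun hb5 =>
    runs_readRowProg (n := n) (N := N) (z := z) (by omega) hk ?_ hz hDZ hb5 rfl).mono ?_
    fun σ' ⟨h1, h2, h3, h4, h5⟩ => ⟨?_, ?_, ?_, ?_, ?_, ?_⟩
  · simp only [Expr.small_sub, Expr.small_mul, Expr.small_div, Expr.small_reg, Expr.small_lit,
      Expr.eval_div, Expr.eval_reg, Expr.eval_lit, hc, true_and]
    have := Nat.div_mul_le_self c 2
    omega
  · simp only [Expr.eval_sub, Expr.eval_mul, Expr.eval_div, Expr.eval_reg, Expr.eval_lit, hc]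
    omega
  · simp only [Expr.small_sub, Expr.small_mul, Expr.small_add, Expr.small_reg, Expr.small_lit,
      Expr.eval_mul, Expr.eval_sub, Expr.eval_reg, Expr.eval_lit, State.reg_setReg, true_and,
      if_true]
    simp only [slotBase] at hsl
    simp [henv.reg0, henv.reg7, hkind, hsl]
    omega
  · simp [henv.reg0, henv.reg7, slotBase]
  · simpa using hX
  · simp [hc]
  · simp
    exact (Nat.div_mul_le_self _ _).trans ((Nat.div_le_self _ _).trans hcX)
  · simp [sub_div_mul]
  · simp
  · simp
  · refine henv.congr (fun r hr => ?_) fun q => rfl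
    have : r ≠ 20 ∧ r ≠ 21 ∧ r ≠ 25 ∧ r ≠ 26 := by omega
    simp [this]
  · simp
    omega
  · simpa using h1
  · rw [h4 21 (by norm_num) (by norm_num) (by norm_num)]
    simp
  · simpa using h2
  · simpa using h3
  · intro r hr hr'
    have : r ≠ 20 ∧ r ≠ 21 ∧ r ≠ 23 ∧ r ≠ 25 ∧ r ≠ 26 := by omega
    rw [h4 r hr this.1 this.2.2.1]
    simp [this]
  · intro a q ha
    rw [h5 a q ha]
    rfl

/-- Write the row in array `5` to row number `reg 31` of array `2`. -/
def writeRowProg : Program :=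
  forUp 40 41 (.reg 1) (.store 2 (.reg 31 * .reg 1 + .reg 40) (.load 5 (.reg 40)))

theorem mul_add_lt {i j k h : ℕ} (hij : i < j) (hh : h < k) : i * k + h < j * k := by
  calc i * k + h < i * k + k := by omega
    _ = (i + 1) * k := by ring
    _ ≤ j * k := Nat.mul_le_mul_right _ hij

theorem runs_writeRowProg {X k w : ℕ} {σ : State} (hX : 1 ≤ X) (hσ : Bounded X σ)
    (hk : σ.reg 1 = k) (hw : σ.reg 31 = w) (hwX : (w + 1) * k ≤ X) :
    Runs X writeRowProg σ (30 * k + 20) fun σ' =>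
      (∀ h < k, σ'.arr 2 (w * k + h) = σ.arr 5 h) ∧ (∀ q < w * k, σ'.arr 2 q = σ.arr 2 q) ∧
      (∀ r < 40, σ'.reg r = σ.reg r) ∧ ∀ a q, a ≠ 2 → σ'.arr a q = σ.arr a q := by
  refine (Runs.forUp (K := k) (t := 20) hX hσ (by norm_num) (by simp) (by simp [hk])
    (fun j σ' => (∀ h < j, σ'.arr 2 (w * k + h) = σ.arr 5 h) ∧
      (∀ q < w * k, σ'.arr 2 q = σ.arr 2 q) ∧
      (∀ r < 40, σ'.reg r = σ.reg r) ∧ ∀ a q, a ≠ 2 → σ'.arr a q = σ.arr a q) ?_ ?_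
    fun j σ₁ hj hb h40 ⟨h1, h2, h3, h4⟩ => (Runs.store hb ?_ ?_ ⟨?_, ?_, ?_, ?_, ?_, ?_⟩).mono ?_
      fun _ h => h).mono ?_ fun _ h => h
  · exact ⟨by simp, by simp, by simp, by simp⟩
  · rintro j σ₁ x v hx ⟨h1, h2, h3, h4⟩
    refine ⟨h1, h2, fun r hr => ?_, h4⟩
    have : r ≠ x := by omega
    simp [this, h3 r hr]
  · have hlt : w * k + j < (w + 1) * k := mul_add_lt (Nat.lt_succ_self w) hj
    simp only [Expr.small_add, Expr.small_mul, Expr.small_reg, Expr.eval_mul, Expr.eval_reg,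
      h3 31 (by norm_num), h3 1 (by norm_num), hk, hw, h40, true_and]
    constructor <;> omega
  · simp
  · simp
  · simp [h40]
  · simp
  · intro h hh
    simp only [State.arr_setArr, Expr.eval_add, Expr.eval_mul, Expr.eval_reg, Expr.eval_load,
      h3 31 (by norm_num), h3 1 (by norm_num), hk, hw, h40, true_and]
    split_ifs with h0
    · rw [h4 5 j (by norm_num), show h = j by omega]
    · exact h1 h (by omega)
  · intro q hq
    simp only [State.arr_setArr, Expr.eval_add, Expr.eval_mul, Expr.eval_reg,
      h3 31 (by norm_num), h3 1 (by norm_num), hk, hw, true_and]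
    rw [if_neg (by omega), h2 q hq]
  · intro r hr
    exact h3 r hr
  · intro a q ha
    simp [ha, h4 a q ha]
  · simp

/-- Decode the row of one player. -/
def playerProg : Program :=
  .seq (.branch (.reg 21) (.assign 21 (.reg 21 - .lit 1)) slotProg)
  (.seq (.assign 24 (.reg 24 * .reg 23))
  (.seq writeRowProg (.assign 31 (.reg 31 + .lit 1))))

/-- Decode the code in register `19` into the rows of array `2` from row number `reg 12` on, and put
the product of the values of the rows into register `24`. -/
def decodeProg : Program :=
  .seq (.assign 20 (.reg 19))
  (.seq (.assign 21 (.lit 0))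
  (.seq (.assign 24 (.lit 1))
  (.seq (.assign 31 (.reg 12))
  (forUp 22 32 (.reg 8) playerProg))))

/-- The invariant of the loop in `decodeProg`. -/
structure DecInv (n k D : ℕ) (z : ℕ → ℕ) (c off : ℕ) (σ₀ : State) (j : ℕ) (σ : State) : Prop where
  reg20 : σ.reg 20 = (decState n k D c j).1
  reg21 : σ.reg 21 = (decState n k D c j).2.1
  -- The value and the row of the current type are needed only if a further player of that type
  -- follows; at the start no type has been read.
  cur : (decState n k D c j).2.1 ≠ 0 → σ.reg 23 = rowVal D k z (decState n k D c j).2.2 ∧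
    ∀ h < k, σ.arr 5 h = rowEntry D k (decState n k D c j).2.2 h
  reg24 : σ.reg 24 = ∏ i ∈ Finset.range j, rowVal D k z (profCode n k D c i)
  reg31 : σ.reg 31 = off + j
  regs : ∀ r < 20, σ.reg r = σ₀.reg r
  arrs : ∀ a q, a ≠ 2 → a ≠ 5 → σ.arr a q = σ₀.arr a q
  rows : ∀ i < j, ∀ h < k, σ.arr 2 ((off + i) * k + h) = rowEntry D k (profCode n k D c i) h
  old : ∀ q < off * k, σ.arr 2 q = σ₀.arr 2 q

theorem runs_playerProg {X n k D N Z c off j : ℕ} {z : ℕ → ℕ} {σ₀ σ : State} (hX : 2 ≤ X)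
    (hk : 0 < k) (henv : CodeEnv n k D N z σ₀) (hz : ∀ h < k, z h ≤ Z) (hDZ1 : 1 ≤ D * Z)
    (hDZ : (D * Z) ^ N ≤ X) (hoff : (off + N) * k ≤ X) (hj : j < N) (hσ : Bounded X σ)
    (hI : DecInv n k D z c off σ₀ j σ) :
    Runs X playerProg σ (80 * k + 130) fun σ' =>
      σ'.reg 22 = σ.reg 22 ∧ σ'.reg 32 = σ.reg 32 ∧ DecInv n k D z c off σ₀ (j + 1) σ' := by
  have henv' : CodeEnv n k D N z σ :=
    henv.congr (fun r hr => hI.regs r (by omega)) fun q => hI.arrs 4 q (by norm_num) (by norm_num)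
  have hDZX : D * Z ≤ X := (Nat.le_self_pow (by omega) _).trans hDZ
  -- Each factor is at most DZ, so every partial product is below (DZ)^N, a bound that is known to
  -- be at most X.
  have hprod : ∀ i ≤ N, ∏ i ∈ Finset.range i, rowVal D k z (profCode n k D c i) ≤ X := by
    intro i hi
    calc ∏ i ∈ Finset.range i, rowVal D k z (profCode n k D c i) ≤ (D * Z) ^ i := by
          refine (Finset.prod_le_pow_card _ _ (D * Z) fun i _ => rowVal_le hk hz).trans ?_
          rw [Finset.card_range]
      _ ≤ (D * Z) ^ N := Nat.pow_le_pow_right hDZ1 hi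
      _ ≤ X := hDZ
  have hstep : decState n k D c (j + 1) = decStep n k D (decState n k D c j) := rfl
  have hwk : (off + j + 1) * k ≤ X := le_trans (Nat.mul_le_mul_right _ (by omega)) hoff
  refine (Runs.seq (t₁ := 1 + 1 + (50 * k + 80))
    (Q₁ := fun σ' => σ'.reg 20 = (decState n k D c (j + 1)).1 ∧
      σ'.reg 21 = (decState n k D c (j + 1)).2.1 ∧
      σ'.reg 23 = rowVal D k z (profCode n k D c j) ∧
      (∀ h < k, σ'.arr 5 h = rowEntry D k (profCode n k D c j) h) ∧
      (∀ r < 40, r < 20 ∨ 26 < r ∨ r = 22 ∨ r = 24 → σ'.reg r = σ.reg r) ∧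
      ∀ a q, a ≠ 5 → σ'.arr a q = σ.arr a q)
    (Runs.branch hσ (by simp) (fun hne => ?_) fun h0 => ?_) fun σ₁ hb1 ⟨h1, h2, h3, h4, h5, h6⟩ =>
    Runs.assign_seq hb1 ?_
      (v := ∏ i ∈ Finset.range (j + 1), rowVal D k z (profCode n k D c i)) ?_ fun hb2 =>
    Runs.seq (runs_writeRowProg (k := k) (w := off + j) (by omega) hb2 ?_ ?_ hwk)
      fun σ₂ hb3 ⟨g1, g2, g3, g4⟩ => Runs.assign hb3 ?_ ⟨?_, ?_, ?_⟩).mono ?_ fun _ h => h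
  · rw [Expr.eval_reg, hI.reg21] at hne
    obtain ⟨c1, c2⟩ := hI.cur hne
    have hst : decState n k D c (j + 1) = ((decState n k D c j).1, (decState n k D c j).2.1 - 1,
        (decState n k D c j).2.2) := by rw [hstep, decStep, if_neg hne]
    refine (Runs.assign hσ (by simp; omega) ⟨?_, ?_, ?_, fun h hh => ?_, fun r _ hr => ?_,
      fun a q _ => rfl⟩).mono ?_ fun _ h => h
    · simp
    · simp [hst, hI.reg20]
    · simp [hst, hI.reg21]
    · simp [profCode, hst, c1]
    · simp [profCode, hst, c2 h hh]
    · have : r ≠ 21 := by omega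
      simp [this]
  · rw [Expr.eval_reg, hI.reg21] at h0
    refine (runs_slotProg hX hk henv' hz hDZX hσ hI.reg20).mono le_rfl
      fun σ' ⟨h1, h2, h3, h4, h5, h6⟩ => ⟨?_, ?_, ?_, fun h hh => ?_, h5, h6⟩
    · rw [h1, hstep, decStep, if_pos h0]
    · rw [h2, hstep, decStep, if_pos h0]
    · rw [h3, profCode, hstep, decStep, if_pos h0]
    · rw [h4 h hh, profCode, hstep, decStep, if_pos h0]
  · have := hprod (j + 1) hj
    rw [Finset.prod_range_succ] at this
    simpa [h3, h5 24, hI.reg24] using this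
  · simp [h3, h5 24, hI.reg24, Finset.prod_range_succ]
  · simp [h5 1, henv'.reg1]
  · simp [h5 31, hI.reg31]
  · simp
    omega
  · have hw : off + j + 1 ≤ X := (Nat.le_mul_of_pos_right _ hk).trans hwk
    simp [g3 31, h5 31, hI.reg31]
    omega
  · simp [g3 22, h5 22]
  · simp [g3 32, h5 32]
  · refine ⟨?_, ?_, fun _ => ⟨?_, fun h hh => ?_⟩, ?_, ?_, fun r hr => ?_, fun a q h2 h5' => ?_,
      fun i hi h hh => ?_, fun q hq => ?_⟩
    · simp [g3 20, h1]
    · simp [g3 21, h2]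
    · simp [g3 23, h3, profCode]
    · simp [g4 5, h4 h hh, profCode]
    · simp [g3 24]
    · simp [g3 31, h5 31, hI.reg31]
      omega
    · have : r ≠ 31 ∧ r ≠ 24 := by omega
      simp [this, g3 r (by omega), h5 r (by omega) (Or.inl hr), hI.regs r hr]
    · simp [g4 a q h2, h6 a q h5', hI.arrs a q h2 h5']
    · rcases Nat.lt_succ_iff_lt_or_eq.mp hi with hi' | rfl
      · have hlt : (off + i) * k + h < (off + j) * k := mul_add_lt (by omega) hh
        simp [g2 _ hlt, h6 2, hI.rows i hi' h hh]
      · simp [g1 h hh, h4 h hh]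
    · have hlt : q < (off + j) * k := hq.trans_le (Nat.mul_le_mul_right _ (by omega))
      simp [g2 q hlt, h6 2, hI.old q hq]

theorem runs_decodeProg {X n k D N Z c off : ℕ} {z : ℕ → ℕ} {σ : State} (hX : 2 ≤ X)
    (hk : 0 < k) (henv : CodeEnv n k D N z σ) (hz : ∀ h < k, z h ≤ Z) (hDZ1 : 1 ≤ D * Z)
    (hDZ : (D * Z) ^ N ≤ X) (hoff : (off + N) * k ≤ X) (hσ : Bounded X σ)
    (hc : σ.reg 19 = c) (ho : σ.reg 12 = off) :
    Runs X decodeProg σ ((80 * k + 140) * N + 30) fun σ' =>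
      σ'.reg 24 = ∏ i ∈ Finset.range N, rowVal D k z (profCode n k D c i) ∧
      (∀ r < 20, σ'.reg r = σ.reg r) ∧ (∀ a q, a ≠ 2 → a ≠ 5 → σ'.arr a q = σ.arr a q) ∧
      (∀ i < N, ∀ h < k, σ'.arr 2 ((off + i) * k + h) = rowEntry D k (profCode n k D c i) h) ∧
      ∀ q < off * k, σ'.arr 2 q = σ.arr 2 q := by
  refine (Runs.assign_seq hσ (by simp) (v := c) (by simp [hc]) fun hb1 =>
    Runs.assign_seq hb1 (by simp) (v := 0) (by simp) fun hb2 =>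
    Runs.assign_seq hb2 (by simp; omega) (v := 1) (by simp) fun hb3 =>
    Runs.assign_seq hb3 (by simp) (v := off) (by simp [ho]) fun hb4 =>
    Runs.forUp (K := N) (t := 80 * k + 130) (by omega) hb4 (by norm_num) (by simp)
      (by simp [henv.reg8]) (DecInv n k D z c off σ) ?_ ?_ fun j σ₁ hj hb h22 hI => ?_).mono ?_
    fun σ' h => ⟨h.reg24, h.regs, h.arrs, h.rows, h.old⟩
  · refine ⟨by simp [decState], by simp [decState], by simp [decState], by simp, by simp,
      fun r hr => ?_, fun _ _ _ _ => rfl, by simp, fun _ _ => rfl⟩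
    have : r ≠ 20 ∧ r ≠ 21 ∧ r ≠ 24 ∧ r ≠ 31 := by omega
    simp [this]
  · rintro j σ₁ x v hx hI
    have hx' : x = 22 ∨ x = 32 := hx
    refine ⟨?_, ?_, fun h => ⟨?_, fun i hi => ?_⟩, ?_, ?_, fun r hr => ?_, hI.arrs, hI.rows, hI.old⟩
    · rcases hx' with rfl | rfl <;> simp [hI.reg20]
    · rcases hx' with rfl | rfl <;> simp [hI.reg21]
    · rcases hx' with rfl | rfl <;> simp [(hI.cur h).1]
    · simp [(hI.cur h).2 i hi]
    · rcases hx' with rfl | rfl <;> simp [hI.reg24]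
    · rcases hx' with rfl | rfl <;> simp [hI.reg31]
    · have : r ≠ x := by omega
      simp [this, hI.regs r hr]
  · refine (runs_playerProg hX hk henv hz hDZ1 hDZ hoff hj hb hI).mono le_rfl
      fun σ₂ ⟨h1, h2, h3⟩ => ⟨by rw [h1, h22], h2, h3⟩
  · have h1 : (80 * k + 130 + 10) * N = (80 * k + 140) * N := by ring
    simp only [Expr.nodes_lit, Expr.nodes_reg]
    omega

end Decode

end RAM

/-! ### Payoffs from the digits of one integer -/

namespace RAM

section Value

/-- The mass of the sum `y` in the profile with code `c`, scaled to integers. -/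
def codeDigitMass (n k D N Y c y : ℕ) : ℕ :=
  (∏ i ∈ Finset.range N, rowVal D k (fun h => Y ^ n ^ h) (profCode n k D c i)) / Y ^ y % Y

def codePayoff (n k D N Y S : ℕ) (α : ℕ → ℕ) (i c ℓ : ℕ) : ℕ :=
  ∑ y ∈ Finset.range S, codeDigitMass n k D N Y c y * α ((i * k + ℓ) * S + y)

/-- The best payoff of player `i` against the profile with code `c`, scaled to integers. -/
def codeVal (n k D N Y S : ℕ) (α : ℕ → ℕ) (i c : ℕ) : ℕ :=
  (Finset.range k).sup (codePayoff n k D N Y S α i c)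

/-- The constants of the search. -/
structure SearchEnv (n k D N Y S : ℕ) (α : ℕ → ℕ) (σ : State) : Prop where
  code : CodeEnv n k D N (fun h => Y ^ n ^ h) σ
  reg4 : σ.reg 4 = Y
  reg5 : σ.reg 5 = S
  arr0 : ∀ q, σ.arr 0 q = α q

theorem SearchEnv.congr {n k D N Y S : ℕ} {α : ℕ → ℕ} {σ σ' : State}
    (h : SearchEnv n k D N Y S α σ) (hr : ∀ r < 10, σ'.reg r = σ.reg r)
    (ha : ∀ a q, a = 0 ∨ a = 4 → σ'.arr a q = σ.arr a q) : SearchEnv n k D N Y S α σ' where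
  code := h.code.congr hr fun q => ha 4 q (Or.inr rfl)
  reg4 := by rw [hr 4 (by norm_num), h.reg4]
  reg5 := by rw [hr 5 (by norm_num), h.reg5]
  arr0 := fun q => by rw [ha 0 q (Or.inl rfl), h.arr0]

/-- The bounds on the parameters that keep all numbers below `X`. -/
structure SearchBounds (X n k D N Y S A : ℕ) : Prop where
  two_le : 2 ≤ X
  k_pos : 0 < k
  n_pos : 0 < n
  D_pos : 0 < D
  Y_pos : 0 < Y
  code : (D * Y ^ n ^ (k - 1)) ^ N ≤ X
  rows : n * n * k ≤ X
  index : n * k * S ≤ X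
  power : Y ^ S ≤ X
  sum : S * (Y * A) ≤ X

variable {X n k D N Y S A : ℕ} {α : ℕ → ℕ} {σ₀ σ : State}

/-- Add the next term to the payoff. -/
def termProg : Program :=
  .seq (.assign 33 (.reg 33 + (.reg 24 / .reg 18 - .reg 24 / .reg 18 / .reg 4 * .reg 4) *
      .load 0 ((.reg 13 * .reg 1 + .reg 16) * .reg 5 + .reg 17)))
    (.assign 18 (.reg 18 * .reg 4))

/-- Put the payoff of player `reg 13` for strategy `reg 16` into register `33`. -/
def payoffProg : Program :=
  .seq (.assign 33 (.lit 0)) (.seq (.assign 18 (.lit 1)) (forUp 17 36 (.reg 5) termProg))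

/-- Put the best payoff of player `reg 13` into register `15`. -/
def valueProg : Program :=
  .seq (.assign 15 (.lit 0)) (forUp 16 35 (.reg 1)
    -- With truncated subtraction, x + (y - x) is the maximum of x and y.
    (.seq payoffProg (.assign 15 (.reg 15 + (.reg 33 - .reg 15)))))

theorem partial_codePayoff_le (hα : ∀ q, α q ≤ A) (hY : 0 < Y) (i c ℓ : ℕ) {j : ℕ} (hj : j ≤ S) :
    ∑ y ∈ Finset.range j, codeDigitMass n k D N Y c y * α ((i * k + ℓ) * S + y) ≤ S * (Y * A) := by
  calc _ ≤ ∑ _y ∈ Finset.range j, Y * A :=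
        Finset.sum_le_sum fun y _ => Nat.mul_le_mul (Nat.mod_lt _ hY).le (hα _)
    _ = j * (Y * A) := by simp
    _ ≤ _ := Nat.mul_le_mul_right _ hj

theorem runs_payoffProg (hB : SearchBounds X n k D N Y S A) (hα : ∀ q, α q ≤ A)
    (henv : SearchEnv n k D N Y S α σ) (hσ : Bounded X σ) {c i ℓ : ℕ}
    (hP : σ.reg 24 = ∏ i ∈ Finset.range N, rowVal D k (fun h => Y ^ n ^ h) (profCode n k D c i))
    (hi : σ.reg 13 = i) (hℓ : σ.reg 16 = ℓ) (hin : i < n) (hℓk : ℓ < k) :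
    Runs X payoffProg σ (50 * S + 20) fun σ' => σ'.reg 33 = codePayoff n k D N Y S α i c ℓ ∧
      (∀ r, r ≠ 33 → r ≠ 17 → r ≠ 18 → r ≠ 36 → σ'.reg r = σ.reg r) ∧
      ∀ a q, σ'.arr a q = σ.arr a q := by
  have hX : 1 ≤ X := by have := hB.two_le; omega
  refine (Runs.assign_seq hσ (by simp) (v := 0) rfl fun hb1 =>
    Runs.assign_seq hb1 (by simpa using hX) (v := 1) rfl fun hb2 =>
    Runs.forUp (K := S) (t := 40) hX hb2 (by norm_num) (by simp) (by simp [henv.reg5])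
      (fun j σ' => σ'.reg 33 = ∑ y ∈ Finset.range j, codeDigitMass n k D N Y c y *
          α ((i * k + ℓ) * S + y) ∧ σ'.reg 18 = Y ^ j ∧
        (∀ r, r ≠ 33 → r ≠ 17 → r ≠ 18 → r ≠ 36 → σ'.reg r = σ.reg r) ∧
        ∀ a q, σ'.arr a q = σ.arr a q) ?_ ?_ ?_).mono ?_ ?_
  · exact ⟨by simp, by simp, fun r h1 h2 h3 h4 => by simp [h1, h3], fun _ _ => rfl⟩
  · rintro j σ₁ x v (rfl | rfl) ⟨h1, h2, h3, h4⟩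
    · exact ⟨by simp [h1], by simp [h2], fun r g1 g2 g3 g4 => by simp [g2, h3 r g1 g2 g3 g4], h4⟩
    · exact ⟨by simp [h1], by simp [h2], fun r g1 g2 g3 g4 => by simp [g4, h3 r g1 g2 g3 g4], h4⟩
  · intro j σ₁ hj hb h17 ⟨h1, h2, h3, h4⟩
    have hpart := partial_codePayoff_le (n := n) (k := k) (D := D) (N := N) hα hB.Y_pos i c ℓ
      (show j + 1 ≤ S from hj)
    have hsum := hpart.trans hB.sum
    rw [Finset.sum_range_succ] at hsum
    have hidx : (i * k + ℓ) * S + j < n * k * S := mul_add_lt (mul_add_lt hin hℓk) hj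
    have hidx' := hB.index
    -- The base-Y digit in place j: register 18 holds Y^j, and the remainder modulo Y is expressed
    -- by subtraction.
    have hdig : codeDigitMass n k D N Y c j = σ₁.reg 24 / Y ^ j - σ₁.reg 24 / Y ^ j / Y * Y := by
      rw [sub_div_mul, h3 24 (by norm_num) (by norm_num) (by norm_num) (by norm_num), hP,
        codeDigitMass]
    have h24 := hb.1 24
    have e4 : σ₁.reg 4 = Y := by
      rw [h3 4 (by norm_num) (by norm_num) (by norm_num) (by norm_num), henv.reg4]
    have e5 : σ₁.reg 5 = S := by
      rw [h3 5 (by norm_num) (by norm_num) (by norm_num) (by norm_num), henv.reg5]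
    have e1 : σ₁.reg 1 = k := by
      rw [h3 1 (by norm_num) (by norm_num) (by norm_num) (by norm_num), henv.code.reg1]
    have e13 : σ₁.reg 13 = i := by
      rw [h3 13 (by norm_num) (by norm_num) (by norm_num) (by norm_num), hi]
    have e16 : σ₁.reg 16 = ℓ := by
      rw [h3 16 (by norm_num) (by norm_num) (by norm_num) (by norm_num), hℓ]
    have ea : ∀ q, σ₁.arr 0 q = α q := fun q => by rw [h4, henv.arr0]
    have hSpos : 0 < S := by omega
    have hik : i * k + ℓ ≤ X := (Nat.le_mul_of_pos_right _ hSpos).trans (by omega)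
    have hcur : σ₁.reg 24 / Y ^ j / Y * Y ≤ X :=
      (Nat.div_mul_le_self _ _).trans ((Nat.div_le_self _ _).trans h24)
    have hpow : Y ^ (j + 1) ≤ X := (Nat.pow_le_pow_right hB.Y_pos hj).trans hB.power
    have e0 : ∀ v, (σ₁.setReg 33 v).reg 17 = j := fun v => by simp [h17]
    refine (Runs.assign_seq hb ?_ (v := ∑ y ∈ Finset.range (j + 1), codeDigitMass n k D N Y c y *
      α ((i * k + ℓ) * S + y)) ?_ fun hb3 => Runs.assign hb3 ?_ ⟨?_, ?_, ?_, ?_, ?_, ?_⟩).mono ?_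
      fun _ h => h
    · simp only [Expr.small_add, Expr.small_sub, Expr.small_mul, Expr.small_div, Expr.small_reg,
        Expr.small_load, Expr.eval_add, Expr.eval_sub, Expr.eval_mul, Expr.eval_div, Expr.eval_reg,
        Expr.eval_load, h1, h2, h17, e4, e5, e1, e13, e16, ea, true_and, ← hdig]
      repeat' apply And.intro
      all_goals first | assumption | omega
    · simp only [Expr.eval_add, Expr.eval_sub, Expr.eval_mul, Expr.eval_div, Expr.eval_reg,
        Expr.eval_load, h1, h2, h17, e4, e5, e1, e13, e16, ea, ← hdig, Finset.sum_range_succ]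
    · simpa [h2, e4, ← pow_succ] using hpow
    · simp
    · simp [h17]
    · simp
    · simp
    · simp [h2, e4, pow_succ]
    · intro r g1 g2 g3 g4
      simp [g1, g3, h3 r g1 g2 g3 g4]
    · exact fun a q => h4 a q
  · simp
    omega
  · exact fun σ' ⟨h1, _, h3, h4⟩ => ⟨h1, h3, h4⟩

theorem runs_valueProg (hB : SearchBounds X n k D N Y S A) (hα : ∀ q, α q ≤ A)
    (henv : SearchEnv n k D N Y S α σ) (hσ : Bounded X σ) {c i : ℕ}
    (hP : σ.reg 24 = ∏ i ∈ Finset.range N, rowVal D k (fun h => Y ^ n ^ h) (profCode n k D c i))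
    (hi : σ.reg 13 = i) (hin : i < n) :
    Runs X valueProg σ ((50 * S + 50) * k + 20) fun σ' =>
      σ'.reg 15 = codeVal n k D N Y S α i c ∧ (∀ r < 15, σ'.reg r = σ.reg r) ∧
      ∀ a q, σ'.arr a q = σ.arr a q := by
  have hX : 1 ≤ X := by have := hB.two_le; omega
  refine (Runs.assign_seq hσ (by simp) (v := 0) rfl fun hb1 =>
    Runs.forUp (K := k) (t := 50 * S + 40) hX hb1 (by norm_num) (by simp) (by simp [henv.code.reg1])
      (fun j σ' => σ'.reg 15 = (Finset.range j).sup (codePayoff n k D N Y S α i c) ∧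
        (∀ r, r < 15 ∨ r = 24 → σ'.reg r = σ.reg r) ∧
        ∀ a q, σ'.arr a q = σ.arr a q) ?_ ?_ ?_).mono ?_ ?_
  · refine ⟨by simp, fun r hr => ?_, fun _ _ => rfl⟩
    have : r ≠ 15 := by omega
    simp [this]
  · rintro j σ₁ x v hx ⟨h1, h2, h3⟩
    have hx' : x = 16 ∨ x = 35 := hx
    refine ⟨by rcases hx' with rfl | rfl <;> simp [h1], fun r hr => ?_, h3⟩
    have : r ≠ x := by omega
    simp [this, h2 r hr]
  · intro j σ₁ hj hb h16 ⟨h1, h2, h3⟩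
    have henv₁ : SearchEnv n k D N Y S α σ₁ :=
      henv.congr (fun r hr => h2 r (Or.inl (by omega))) fun a q _ => h3 a q
    have hsup : (Finset.range (j + 1)).sup (codePayoff n k D N Y S α i c) =
        (Finset.range j).sup (codePayoff n k D N Y S α i c) +
          (codePayoff n k D N Y S α i c j -
            (Finset.range j).sup (codePayoff n k D N Y S α i c)) := by
      rw [Finset.range_add_one, Finset.sup_insert]
      omega
    have hle : (Finset.range (j + 1)).sup (codePayoff n k D N Y S α i c) ≤ X :=
      Finset.sup_le fun ℓ _ => (partial_codePayoff_le hα hB.Y_pos i c ℓ le_rfl).trans hB.sum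
    refine (Runs.seq (runs_payoffProg hB hα henv₁ hb (c := c) (by rw [h2 24 (Or.inr rfl), hP])
      (by rw [h2 13 (Or.inl (by norm_num)), hi]) h16 hin hj) fun σ₂ hb2 hq =>
      Runs.assign hb2 ?_ ⟨?_, ?_, ?_, ?_, ?_⟩).mono ?_ fun _ h => h
    · simp [hq.1, hq.2.1, h1, ← hsup, hle]
    · simp
    · simp [hq.2.1, h16]
    · simp [hq.2.1]
    · simp [hq.1, hq.2.1, h1, ← hsup]
    · intro r hr
      have : r ≠ 15 := by omega
      rw [State.reg_setReg, if_neg this, hq.2.1 r (by omega) (by omega) (by omega) (by omega),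
        h2 r hr]
    · intro a q
      rw [State.arr_setReg, hq.2.2, h3]
  · have e1 : (50 * S + 40 + 10) * k = (50 * S + 50) * k := by ring
    simp only [Expr.nodes_lit, Expr.nodes_reg]
    omega
  · exact fun σ' h => ⟨h.1, fun r hr => h.2.1 r (Or.inl hr), h.2.2⟩

end Value

end RAM

/-! ### Exhaustive search over the codes -/

namespace RAM

section Search

/-- The best value `b` among the first `j` codes and a code `c` for it, where `b₀` is the initial
value. -/
def IsBest (v : ℕ → ℕ) (b₀ j b c : ℕ) : Prop :=
  (∀ c' < j, b ≤ v c') ∧ ((b = b₀ ∧ c = 0) ∨ (c < j ∧ b = v c))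

theorem IsBest.succ_of_lt {v : ℕ → ℕ} {b₀ j b c : ℕ} (h : IsBest v b₀ j b c) (hlt : v j < b) :
    IsBest v b₀ (j + 1) (v j) j := by
  refine ⟨fun c' hc' => ?_, Or.inr ⟨Nat.lt_succ_self j, rfl⟩⟩
  rcases Nat.lt_succ_iff_lt_or_eq.mp hc' with h1 | rfl
  · exact hlt.le.trans (h.1 c' h1)
  · exact le_rfl

theorem IsBest.succ_of_le {v : ℕ → ℕ} {b₀ j b c : ℕ} (h : IsBest v b₀ j b c) (hle : b ≤ v j) :
    IsBest v b₀ (j + 1) b c := by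
  refine ⟨fun c' hc' => ?_, h.2.imp id fun h2 => ⟨h2.1.trans (Nat.lt_succ_self j), h2.2⟩⟩
  rcases Nat.lt_succ_iff_lt_or_eq.mp hc' with h1 | rfl
  · exact h.1 c' h1
  · exact hle

/-- Compare the profile with code `reg 11` with the best one for player `reg 13`. -/
def candidateProg : Program :=
  .seq (.assign 19 (.reg 11)) (.seq decodeProg (.seq valueProg
    -- The truncated difference is nonzero exactly if the new value is strictly smaller than the
    -- best one so far.
    (.branch (.load 1 (.reg 13) - .reg 15)
      (.seq (.store 1 (.reg 13) (.reg 15)) (.store 3 (.reg 13) (.reg 11))) .skip)))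

/-- Find the best profiles: the values go to array `1`, the codes to array `3`. -/
def searchProg : Program :=
  .seq (.assign 12 (.lit 0)) (forUp 13 10 (.reg 0)
    (.seq (.store 1 (.reg 13) (.reg 9)) (.seq (.store 3 (.reg 13) (.lit 0))
      (forUp 11 14 (.reg 6) candidateProg))))

variable {X n k D N Y S A : ℕ} {α : ℕ → ℕ} {σ₀ σ : State}

theorem SearchBounds.decode (hB : SearchBounds X n k D N Y S A) :
    (∀ h < k, Y ^ n ^ h ≤ Y ^ n ^ (k - 1)) ∧ 1 ≤ D * Y ^ n ^ (k - 1) :=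
  ⟨fun _ hh => Nat.pow_le_pow_right hB.Y_pos (Nat.pow_le_pow_right hB.n_pos (by omega)),
    Nat.mul_pos hB.D_pos (Nat.pow_pos hB.Y_pos)⟩

/-- The invariant of the loop over the codes for player `i`. -/
structure CodeInv (n k D N Y S : ℕ) (α : ℕ → ℕ) (i b₀ : ℕ) (σ₀ : State) (j : ℕ) (σ : State) :
    Prop where
  best : IsBest (codeVal n k D N Y S α i) b₀ j (σ.arr 1 i) (σ.arr 3 i)
  regs : ∀ r, r < 11 ∨ r = 12 ∨ r = 13 → σ.reg r = σ₀.reg r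
  arrs : ∀ a q, a ≠ 2 → a ≠ 5 → (a ≠ 1 ∧ a ≠ 3 ∨ q ≠ i) → σ.arr a q = σ₀.arr a q

theorem runs_candidateProg (hB : SearchBounds X n k D N Y S A) (hα : ∀ q, α q ≤ A) (hN : N ≤ n)
    (henv : SearchEnv n k D N Y S α σ₀) (h12 : σ₀.reg 12 = 0) {i b₀ j : ℕ}
    (hi : σ₀.reg 13 = i) (hin : i < n) (hσ : Bounded X σ) (hj : σ.reg 11 = j)
    (hI : CodeInv n k D N Y S α i b₀ σ₀ j σ) :
    Runs X candidateProg σ ((80 * k + 140) * N + (50 * S + 50) * k + 80) fun σ' =>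
      σ'.reg 11 = j ∧ σ'.reg 14 = σ.reg 14 ∧ CodeInv n k D N Y S α i b₀ σ₀ (j + 1) σ' := by
  have hrows := hB.rows
  have hkX : (0 + N) * k ≤ X := by
    refine le_trans ?_ hrows
    rw [zero_add]
    exact Nat.mul_le_mul_right _ (hN.trans (Nat.le_mul_of_pos_right _ hB.n_pos))
  have henv₁ : SearchEnv n k D N Y S α (σ.setReg 19 j) := by
    refine henv.congr (fun r hr => ?_) fun a q ha =>
      hI.arrs a q (by omega) (by omega) (Or.inl (by omega))
    rw [State.reg_setReg, if_neg (by omega), hI.regs r (Or.inl (by omega))]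
  refine (Runs.assign_seq hσ (by simp) (v := j) (by simp [hj]) fun hb1 =>
    Runs.seq (runs_decodeProg (n := n) (N := N) (c := j) (off := 0) hB.two_le hB.k_pos henv₁.code
      hB.decode.1 hB.decode.2 hB.code hkX hb1 (by simp) (by simp [hI.regs 12, h12]))
      fun σ₁ hb2 hq => Runs.seq (t₂ := 20)
        (runs_valueProg (n := n) (N := N) (i := i) (c := j) hB hα ?_ hb2 hq.1 ?_ hin)
        fun σ₂ hb3 hv => ?_).mono ?_ fun _ h => h
  · exact henv₁.congr (fun r hr => hq.2.1 r (by omega)) fun a q ha =>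
      hq.2.2.1 a q (by omega) (by omega)
  · simp [hq.2.1 13, hI.regs 13, hi]
  rotate_left
  · simp only [Expr.nodes_reg]
    omega
  have harr : ∀ a q, a ≠ 2 → a ≠ 5 → σ₂.arr a q = σ.arr a q := fun a q h2 h5 => by
    rw [hv.2.2, hq.2.2.1 a q h2 h5, State.arr_setReg]
  have hreg : ∀ r < 15, σ₂.reg r = σ.reg r := fun r hr => by
    rw [hv.2.1 r hr, hq.2.1 r (by omega), State.reg_setReg, if_neg (by omega)]
  have h13 : σ₂.reg 13 = i := by rw [hreg 13 (by norm_num), hI.regs 13 (by simp), hi]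
  have h11 : σ₂.reg 11 = j := by rw [hreg 11 (by norm_num), hj]
  have hb1' : σ₂.arr 1 i = σ.arr 1 i := harr 1 i (by norm_num) (by norm_num)
  have hb3' : σ₂.arr 3 i = σ.arr 3 i := harr 3 i (by norm_num) (by norm_num)
  refine (Runs.branch (t := 10) hb3 (by simp) (fun hne => ?_) fun h0 => ?_).mono (by simp)
    fun _ h => h
  · have hlt : codeVal n k D N Y S α i j < σ.arr 1 i := by
      simp only [Expr.eval_sub, Expr.eval_load, Expr.eval_reg, h13, hv.1, hb1'] at hne
      omega
    refine (Runs.store_seq hb3 (by simp) (by simp) (i := i) (v := codeVal n k D N Y S α i j)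
      (by simp [h13]) (by simp [hv.1]) fun hb4 => Runs.store hb4 (by simp) (by simp)
        ⟨?_, ?_, ?_, ?_, ?_⟩).mono ?_ fun _ h => h
    · simp
    · simp [h11]
    · simp [hreg 14]
    · simpa [h13, h11] using hI.best.succ_of_lt hlt
    · intro r hr
      simp [hreg r (by omega), hI.regs r hr]
    · intro a q h2 h5 hq'
      have e1 : ¬ (a = 3 ∧ q = i) := by omega
      have e2 : ¬ (a = 1 ∧ q = i) := by omega
      simp [h13, e1, e2, harr a q h2 h5, hI.arrs a q h2 h5 hq']
  · have hle : σ.arr 1 i ≤ codeVal n k D N Y S α i j := by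
      simp only [Expr.eval_sub, Expr.eval_load, Expr.eval_reg, h13, hv.1, hb1'] at h0
      omega
    refine (Runs.skip hb3 ⟨h11, hreg 14 (by norm_num), ?_, fun r hr => ?_,
      fun a q h2 h5 hq' => ?_⟩).mono (by norm_num) fun _ h => h
    · rw [hb1', hb3']
      exact hI.best.succ_of_le hle
    · rw [hreg r (by omega), hI.regs r hr]
    · rw [harr a q h2 h5, hI.arrs a q h2 h5 hq']

/-- The invariant of the loop over the players. -/
structure SearchInv (n k D N Y S : ℕ) (α : ℕ → ℕ) (b₀ T : ℕ) (σ₀ : State) (j : ℕ) (σ : State) :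
    Prop where
  best : ∀ i < j, IsBest (codeVal n k D N Y S α i) b₀ T (σ.arr 1 i) (σ.arr 3 i)
  reg12 : σ.reg 12 = 0
  regs : ∀ r < 10, σ.reg r = σ₀.reg r
  arrs : ∀ a q, a = 0 ∨ a = 4 → σ.arr a q = σ₀.arr a q

theorem runs_searchProg (hB : SearchBounds X n k D N Y S A) (hα : ∀ q, α q ≤ A) (hN : N ≤ n)
    (henv : SearchEnv n k D N Y S α σ) (hσ : Bounded X σ) {b₀ T : ℕ} (h9 : σ.reg 9 = b₀)
    (h6 : σ.reg 6 = T) :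
    Runs X searchProg σ
      ((((80 * k + 140) * N + (50 * S + 50) * k + 90) * T + 40) * n + 20) fun σ' =>
      (∀ i < n, IsBest (codeVal n k D N Y S α i) b₀ T (σ'.arr 1 i) (σ'.arr 3 i)) ∧
      (∀ r < 10, σ'.reg r = σ.reg r) ∧ ∀ a q, a = 0 ∨ a = 4 → σ'.arr a q = σ.arr a q := by
  have hX : 1 ≤ X := by have := hB.two_le; omega
  refine (Runs.assign_seq hσ (by simp) (v := 0) rfl fun hb1 =>
    Runs.forUp (K := n) (t := ((80 * k + 140) * N + (50 * S + 50) * k + 90) * T + 30) hX hb1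
      (by norm_num) (by simp) (by simp [henv.code.reg0])
      (SearchInv n k D N Y S α b₀ T σ) ?_ ?_ ?_).mono ?_ ?_
  · refine ⟨by simp, by simp, fun r hr => ?_, fun _ _ _ => rfl⟩
    have : r ≠ 12 := by omega
    simp [this]
  · rintro j σ₁ x v hx ⟨h1, h2, h3, h4⟩
    have hx' : x = 13 ∨ x = 10 := hx
    refine ⟨h1, by rcases hx' with rfl | rfl <;> simp [h2], fun r hr => ?_, h4⟩
    have : r ≠ x := by omega
    simp [this, h3 r hr]
  · intro i σ₁ hin hb h13 hI
    have h9' : σ₁.reg 9 = b₀ := by rw [hI.regs 9 (by norm_num), h9]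
    refine (Runs.store_seq hb (by simp) (by simp) (i := i) (v := b₀) (by simp [h13])
      (by simp [h9']) fun hb2 => Runs.store_seq hb2 (by simp) (by simp) (i := i) (v := 0)
      (by simp [h13]) (by simp) fun hb3 => Runs.forUp (K := T)
        (t := (80 * k + 140) * N + (50 * S + 50) * k + 80) hX hb3 (by norm_num) (by simp) ?_
        (CodeInv n k D N Y S α i b₀ ((σ₁.setArr 1 i b₀).setArr 3 i 0)) ?_ ?_ ?_).mono ?_ ?_
    · simp [hI.regs 6, h6]
    · exact ⟨⟨by simp, Or.inl (by simp)⟩, fun _ _ => rfl, fun _ _ _ _ _ => rfl⟩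
    · rintro j σ₂ x v hx ⟨h1, h2, h3⟩
      have hx' : x = 11 ∨ x = 14 := hx
      refine ⟨h1, fun r hr => ?_, h3⟩
      have : r ≠ x := by omega
      rw [State.reg_setReg, if_neg this, h2 r hr]
    · intro j σ₂ hj hb4 h11 hI₂
      refine runs_candidateProg (σ₀ := (σ₁.setArr 1 i b₀).setArr 3 i 0) hB hα hN
        (henv.congr (fun r hr => hI.regs r hr) fun a q ha => ?_)
        hI.reg12 h13 hin hb4 h11 hI₂
      have : a ≠ 1 ∧ a ≠ 3 := by omega
      simp [this, hI.arrs a q ha]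
    · have : ((80 * k + 140) * N + (50 * S + 50) * k + 80 + 10) * T =
        ((80 * k + 140) * N + (50 * S + 50) * k + 90) * T := by ring
      simp only [Expr.nodes_reg, Expr.nodes_lit]
      omega
    · intro σ₂ h
      refine ⟨?_, ?_, fun i' hi' => ?_, ?_, fun r hr => ?_, fun a q ha => ?_⟩
      · rw [h.regs 13 (by simp)]
        exact h13
      · rw [h.regs 10 (by simp)]
        rfl
      · rcases Nat.lt_succ_iff_lt_or_eq.mp hi' with h1 | rfl
        · rw [h.arrs 1 i' (by norm_num) (by norm_num) (Or.inr h1.ne),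
            h.arrs 3 i' (by norm_num) (by norm_num) (Or.inr h1.ne)]
          simpa [h1.ne] using hI.best i' h1
        · exact h.best
      · rw [h.regs 12 (by simp)]
        exact hI.reg12
      · rw [h.regs r (Or.inl (by omega))]
        exact hI.regs r hr
      · rw [h.arrs a q (by omega) (by omega) (Or.inl (by omega))]
        have : a ≠ 1 ∧ a ≠ 3 := by omega
        simp [this, hI.arrs a q ha]
  · simp only [Expr.nodes_reg, Expr.nodes_lit]
    have : (((80 * k + 140) * N + (50 * S + 50) * k + 90) * T + 30 + 10) * n =
      (((80 * k + 140) * N + (50 * S + 50) * k + 90) * T + 40) * n := by ring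
    omega
  · exact fun σ' h => ⟨h.best, h.regs, h.arrs⟩

/-- Copy row number `reg 12 + reg 13` of array `2` to row number `reg 12 + reg 8`. -/
def copyRowProg : Program :=
  forUp 40 41 (.reg 1) (.store 2 ((.reg 12 + .reg 8) * .reg 1 + .reg 40)
    (.load 2 ((.reg 12 + .reg 13) * .reg 1 + .reg 40)))

theorem runs_copyRowProg {w w' : ℕ} (hX : 1 ≤ X) (hσ : Bounded X σ) (hk : σ.reg 1 = k) (hk0 : 0 < k)
    (hw : σ.reg 12 + σ.reg 8 = w) (hw' : σ.reg 12 + σ.reg 13 = w') (hwX : (w + 1) * k ≤ X)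
    (hle : w' ≤ w) :
    Runs X copyRowProg σ (40 * k + 20) fun σ' =>
      (∀ h < k, σ'.arr 2 (w * k + h) = σ.arr 2 (w' * k + h)) ∧
      (∀ q < w * k, σ'.arr 2 q = σ.arr 2 q) ∧
      (∀ r < 40, σ'.reg r = σ.reg r) ∧ ∀ a q, a ≠ 2 → σ'.arr a q = σ.arr a q := by
  refine (Runs.forUp (K := k) (t := 30) hX hσ (by norm_num) (by simp) (by simp [hk])
    (fun j σ' => (∀ h < j, σ'.arr 2 (w * k + h) = σ.arr 2 (w' * k + h)) ∧
      (∀ h, j ≤ h → h < k → σ'.arr 2 (w * k + h) = σ.arr 2 (w * k + h)) ∧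
      (∀ q < w * k, σ'.arr 2 q = σ.arr 2 q) ∧
      (∀ r < 40, σ'.reg r = σ.reg r) ∧ ∀ a q, a ≠ 2 → σ'.arr a q = σ.arr a q) ?_ ?_ ?_).mono ?_ ?_
  · exact ⟨by simp, fun _ _ _ => rfl, by simp, by simp, by simp⟩
  · rintro j σ₁ x v hx ⟨h1, h2, h3, h4, h5⟩
    refine ⟨h1, h2, h3, fun r hr => ?_, h5⟩
    have : r ≠ x := by omega
    simp [this, h4 r hr]
  · intro j σ₁ hj hb h40 ⟨h1, h2, h3, h4, h5⟩
    have hlt : w * k + j < (w + 1) * k := mul_add_lt (Nat.lt_succ_self w) hj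
    have hlt' : w' * k + j < (w + 1) * k := mul_add_lt (by omega) hj
    have hwle : w ≤ X := (Nat.le_mul_of_pos_right _ hk0).trans (by omega)
    have e : σ₁.reg 12 + σ₁.reg 8 = w := by rw [h4 12 (by norm_num), h4 8 (by norm_num), hw]
    have e' : σ₁.reg 12 + σ₁.reg 13 = w' := by rw [h4 12 (by norm_num), h4 13 (by norm_num), hw']
    have e1 : σ₁.reg 1 = k := by rw [h4 1 (by norm_num), hk]
    -- The source row lies below the target row and is untouched, or the two coincide. They coincide
    -- when player i is the last player, and then the cell has not been overwritten yet.
    have hsrc : σ₁.arr 2 (w' * k + j) = σ.arr 2 (w' * k + j) := by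
      rcases hle.lt_or_eq with h | rfl
      · exact h3 _ (mul_add_lt h hj)
      · exact h2 j le_rfl hj
    refine (Runs.store hb ?_ ?_ ⟨?_, ?_, ?_, ?_, ?_, ?_, ?_⟩).mono ?_ fun _ h => h
    · simp only [Expr.small_add, Expr.small_mul, Expr.small_reg, Expr.eval_mul, Expr.eval_reg,
        Expr.eval_add, e, e1, h40, true_and]
      refine ⟨⟨?_, ?_⟩, ?_⟩ <;> omega
    · simp only [Expr.small_add, Expr.small_mul, Expr.small_reg, Expr.small_load, Expr.eval_mul,
        Expr.eval_reg, Expr.eval_add, e', e1, h40, true_and]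
      refine ⟨⟨?_, ?_⟩, ?_⟩ <;> omega
    · simp
    · simp [h40]
    · simp
    · intro h hh
      simp only [State.arr_setArr, Expr.eval_add, Expr.eval_mul, Expr.eval_reg, Expr.eval_load,
        e, e', e1, h40, true_and, hsrc]
      split_ifs with h0
      · rw [show h = j by omega]
      · exact h1 h (by omega)
    · intro h hh hhk
      simp only [State.arr_setArr, Expr.eval_add, Expr.eval_mul, Expr.eval_reg, e, e1, h40,
        true_and]
      rw [if_neg (by omega), h2 h (by omega) hhk]
    · intro q hq
      simp only [State.arr_setArr, Expr.eval_add, Expr.eval_mul, Expr.eval_reg, e, e1, h40,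
        true_and]
      rw [if_neg (by omega), h3 q hq]
    · exact fun r hr => h4 r hr
    · intro a q ha
      simp [ha, h5 a q ha]
  · simp
  · exact fun σ' ⟨h1, _, h3, h4, h5⟩ => ⟨h1, h3, h4, h5⟩

/-- Write the strategies of the others against each player into array `2`. -/
def strategyProg : Program :=
  forUp 13 10 (.reg 0) (.seq (.assign 12 (.reg 13 * .reg 0))
    (.seq (.assign 19 (.load 3 (.reg 13))) (.seq decodeProg copyRowProg)))

/-- The number of player `j` among the opponents of player `i`: the last player takes the place of
player `i`. -/
def opponentIndex (N i j : ℕ) : ℕ := if j < N then j else i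

/-- The invariant of the loop in `strategyProg`. -/
structure StrategyInv (n k D N : ℕ) (σ₀ : State) (i : ℕ) (σ : State) : Prop where
  rows : ∀ i' < i, ∀ j < n, j ≠ i' → ∀ h < k, σ.arr 2 ((i' * n + j) * k + h) =
    rowEntry D k (profCode n k D (σ₀.arr 3 i') (opponentIndex N i' j)) h
  regs : ∀ r < 10, σ.reg r = σ₀.reg r
  arrs : ∀ a q, a ≠ 2 → a ≠ 5 → σ.arr a q = σ₀.arr a q

theorem runs_strategyProg (hB : SearchBounds X n k D N Y S A) (hN : N + 1 = n)
    (henv : SearchEnv n k D N Y S α σ) (hσ : Bounded X σ) :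
    Runs X strategyProg σ (((80 * k + 140) * N + 40 * k + 100) * n + 20) fun σ' =>
      (∀ i < n, ∀ j < n, j ≠ i → ∀ h < k, σ'.arr 2 ((i * n + j) * k + h) =
        rowEntry D k (profCode n k D (σ.arr 3 i) (opponentIndex N i j)) h) ∧
      (∀ r < 10, σ'.reg r = σ.reg r) ∧ ∀ a q, a ≠ 2 → a ≠ 5 → σ'.arr a q = σ.arr a q := by
  have hX : 1 ≤ X := by have := hB.two_le; omega
  refine (Runs.forUp (K := n) (t := (80 * k + 140) * N + 40 * k + 90) hX hσ
      (by norm_num) (by simp) (by simp [henv.code.reg0])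
      (StrategyInv n k D N σ) ?_ ?_ ?_).mono ?_ ?_
  · exact ⟨by simp, fun _ _ => rfl, fun _ _ _ _ => rfl⟩
  · rintro j σ₁ x v hx ⟨h1, h2, h3⟩
    have hx' : x = 13 ∨ x = 10 := hx
    refine ⟨h1, fun r hr => ?_, h3⟩
    have : r ≠ x := by omega
    simp [this, h2 r hr]
  · intro i σ₁ hin hb h13 hI
    have hrows := hB.rows
    have hlast : (i * n + N + 1) * k ≤ n * n * k := by
      refine Nat.mul_le_mul_right _ ?_
      calc i * n + N + 1 = (i + 1) * n := by rw [add_assoc, hN]; ring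
        _ ≤ n * n := Nat.mul_le_mul_right _ hin
    have hlast' : (i * n + N) * k ≤ (i * n + N + 1) * k := Nat.mul_le_mul_right _ (by omega)
    have hinX : i * n ≤ X :=
      (Nat.le_add_right _ (N + 1)).trans ((Nat.le_mul_of_pos_right _ hB.k_pos).trans
        (hlast.trans hrows))
    have e0 : σ₁.reg 0 = n := by rw [hI.regs 0 (by norm_num), henv.code.reg0]
    have e3 : σ₁.arr 3 i = σ.arr 3 i := hI.arrs 3 i (by norm_num) (by norm_num)
    have henv₁ : SearchEnv n k D N Y S α ((σ₁.setReg 12 (i * n)).setReg 19 (σ.arr 3 i)) := by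
      refine henv.congr (fun r hr => ?_) fun a q ha => hI.arrs a q (by omega) (by omega)
      rw [State.reg_setReg, if_neg (by omega), State.reg_setReg, if_neg (by omega), hI.regs r hr]
    refine (Runs.assign_seq hb ?_ (v := i * n) ?_ fun hb1 => Runs.assign_seq hb1 (by simp)
      (v := σ.arr 3 i) ?_ fun hb2 => Runs.seq
        (runs_decodeProg (n := n) (N := N) (c := σ.arr 3 i) (off := i * n) hB.two_le hB.k_pos henv₁.code
          hB.decode.1 hB.decode.2 hB.code (hlast'.trans (hlast.trans hrows)) hb2 ?_ ?_)
        fun σ₂ hb3 hq => (runs_copyRowProg (k := k) (w := i * n + N) (w' := i * n + i) hX hb3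
          ?_ hB.k_pos ?_ ?_ (hlast.trans hrows) (by omega)).mono le_rfl
            fun σ₃ hc => ⟨?_, ?_, ?_, ?_, ?_⟩).mono ?_ fun _ h => h
    · simpa [h13, e0] using hinX
    · simp [h13, e0]
    · simp [h13, e3]
    · simp
    · simp
    · simp [hq.2.1 1, hI.regs 1, henv.code.reg1]
    · simp [hq.2.1 12, hq.2.1 8, hI.regs 8, henv.code.reg8]
    · simp [hq.2.1 12, hq.2.1 13, h13]
    · simp only [Expr.nodes_reg, Expr.nodes_mul, Expr.nodes_load]
      omega
    · rw [hc.2.2.1 13 (by norm_num), hq.2.1 13 (by norm_num)]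
      simp [h13]
    · rw [hc.2.2.1 10 (by norm_num), hq.2.1 10 (by norm_num)]
      simp
    · intro i' hi' j hjn hji h hh
      -- The blocks of earlier players survive since the decoder writes only from row i·n on. In the
      -- block of player i the N decoded rows leave no row for the last player; the row at position
      -- i, which is not needed for i itself, is copied there.
      rcases Nat.lt_succ_iff_lt_or_eq.mp hi' with h1 | rfl
      · have hlt : (i' * n + j) * k + h < i * n * k := mul_add_lt (mul_add_lt h1 hjn) hh
        have hlt' : i * n * k ≤ (i * n + N) * k := Nat.mul_le_mul_right _ (by omega)
        rw [hc.2.1 _ (by omega), hq.2.2.2.2 _ hlt]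
        simpa using hI.rows i' h1 j hjn hji h hh
      · by_cases hjN : j < N
        · have hlt : (i' * n + j) * k + h < (i' * n + N) * k := mul_add_lt (by omega) hh
          rw [hc.2.1 _ hlt, hq.2.2.2.1 j hjN h hh, opponentIndex, if_pos hjN]
        · have hj : j = N := by omega
          subst hj
          rw [hc.1 h hh, hq.2.2.2.1 i' (by omega) h hh, opponentIndex, if_neg hjN]
    · intro r hr
      have : r ≠ 12 ∧ r ≠ 19 := by omega
      rw [hc.2.2.1 r (by omega), hq.2.1 r (by omega)]
      simp [this, hI.regs r hr]
    · intro a q h2 h5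
      rw [hc.2.2.2 a q h2, hq.2.2.1 a q h2 h5]
      simpa using hI.arrs a q h2 h5
  · simp only [Expr.nodes_reg]
    have : ((80 * k + 140) * N + 40 * k + 90 + 10) * n = ((80 * k + 140) * N + 40 * k + 100) * n := by
      ring
    omega
  · exact fun σ' h => ⟨h.rows, h.regs, h.arrs⟩

end Search

end RAM

/-! ### Computing the numbers of types and the denominator -/

namespace RAM

section Parameters

/-- Sums and products of positive numbers. -/
def Expr.Pos (σ : State) : Expr → Prop
  | .lit c => 0 < c
  | .reg r => 0 < σ.reg r
  | .op .add a b => a.Pos σ ∧ b.Pos σ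
  | .op .mul a b => a.Pos σ ∧ b.Pos σ
  | _ => False

@[simp] theorem Expr.pos_lit {σ : State} (c : ℕ) : (Expr.lit c).Pos σ ↔ 0 < c := Iff.rfl
@[simp] theorem Expr.pos_reg {σ : State} (r : ℕ) : (Expr.reg r).Pos σ ↔ 0 < σ.reg r := Iff.rfl
@[simp] theorem Expr.pos_add {σ : State} (a b : Expr) :
    (a + b).Pos σ ↔ a.Pos σ ∧ b.Pos σ := Iff.rfl
@[simp] theorem Expr.pos_mul {σ : State} (a b : Expr) :
    (a * b).Pos σ ↔ a.Pos σ ∧ b.Pos σ := Iff.rfl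

theorem Expr.Pos.eval_pos {σ : State} : ∀ {e : Expr}, e.Pos σ → 0 < e.eval σ
  | .lit _, h => h
  | .reg _, h => h
  | .op .add _ _, h => Nat.add_pos_left h.1.eval_pos _
  | .op .mul _ _, h => Nat.mul_pos h.1.eval_pos h.2.eval_pos

/-- Sums and products of positive numbers dominate their operands, so one bound for the final value
covers all intermediate values. -/
theorem Expr.Pos.small {X : ℕ} {σ : State} : ∀ {e : Expr}, e.Pos σ → e.eval σ ≤ X → e.Small X σ
  | .lit _, _, hX => hX
  | .reg _, _, _ => trivial
  | .op .add _ _, h, hX => ⟨h.1.small ((Nat.le_add_right _ _).trans hX),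
      h.2.small ((Nat.le_add_left _ _).trans hX), hX⟩
  | .op .mul _ _, h, hX => ⟨h.1.small ((Nat.le_mul_of_pos_right _ h.2.eval_pos).trans hX),
      h.2.small ((Nat.le_mul_of_pos_left _ h.1.eval_pos).trans hX), hX⟩

theorem Runs.assign_seq_of_pos {X : ℕ} {σ : State} {c : Program} {t : ℕ} {Q : State → Prop}
    (hσ : Bounded X σ) {r : ℕ} {e : Expr} {v : ℕ} (hv : e.eval σ = v) (he : e.Pos σ) (hX : v ≤ X)
    (h : Bounded X (σ.setReg r v) → Runs X c (σ.setReg r v) t Q) :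
    Runs X (.seq (.assign r e) c) σ (e.nodes + 1 + t) Q :=
  Runs.assign_seq hσ (he.small (hv.trans_le hX)) hv h

/-- `d := size (reg s)`. -/
def sizeProg (d s : ℕ) : Program :=
  .seq (.assign d (.lit 0)) (.loop (.reg s)
    (.seq (.assign s (.reg s / .lit 2)) (.assign d (.reg d + .lit 1))))

theorem size_div_two {v : ℕ} (hv : v ≠ 0) : v.size = (v / 2).size + 1 := by
  have h := Nat.size_bit (b := v.bodd) (n := v.div2) (by rwa [Nat.bit_bodd_div2])
  rwa [Nat.bit_bodd_div2, Nat.div2_val] at h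

theorem size_le_self (v : ℕ) : v.size ≤ v := Nat.size_le.mpr Nat.lt_two_pow_self

theorem runs_sizeProg {X : ℕ} {σ : State} {d s v : ℕ} (hσ : Bounded X σ) (hX : 2 ≤ X)
    (hds : d ≠ s) (hv : σ.reg s = v) :
    Runs X (sizeProg d s) σ (15 * v.size + 5) fun σ' => σ'.reg d = v.size ∧
      (∀ x, x ≠ d → x ≠ s → σ'.reg x = σ.reg x) ∧ ∀ a q, σ'.arr a q = σ.arr a q := by
  have hvX : v ≤ X := hv ▸ hσ.1 s
  have hsize := size_le_self v
  refine (Runs.assign_seq hσ (by simp) (v := 0) rfl fun hb1 => Runs.loop (t := 8)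
    (fun j σ' => (σ'.reg s).size = j ∧ σ'.reg d + j = v.size ∧
      (∀ x, x ≠ d → x ≠ s → σ'.reg x = σ.reg x) ∧ ∀ a q, σ'.arr a q = σ.arr a q) v.size
      ?_ ?_ ?_ hb1 ?_).mono ?_ ?_
  · simp
  · rintro σ' ⟨h, -⟩
    simpa [Nat.size_eq_zero] using h
  · rintro j σ' hb ⟨h1, h2, h3, h4⟩
    have hne : σ'.reg s ≠ 0 := by
      intro h0
      simp [h0] at h1
    refine ⟨hne, (Runs.assign_seq hb (by simpa using hX) (v := σ'.reg s / 2) (by simp) fun hb2 =>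
      Runs.assign hb2 ?_ ⟨?_, ?_, fun x hxd hxs => ?_, fun a q => ?_⟩).mono ?_ fun _ h => h⟩
    · simp [hds]
      omega
    · simp
    · rw [size_div_two hne] at h1
      simpa [hds.symm] using Nat.succ_injective h1
    · simp [hds]
      omega
    · simp [hxd, hxs, h3 x hxd hxs]
    · simp [h4]
  · refine ⟨by simp [hds.symm, hv], by simp, fun x hxd _ => by simp [hxd], fun _ _ => rfl⟩
  · simp only [Expr.nodes_reg, Expr.nodes_lit]
    omega
  · exact fun σ' ⟨_, h2, h3, h4⟩ => ⟨by simpa using h2, h3, h4⟩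

/-- Compute `lightTypes`, `heavyTypes` and `gridDenom` into the registers `58`, `59` and `3`. -/
def typesProg : Program :=
  .seq (.assign 50 (.reg 1 * .reg 2))
  (.seq (sizeProg 51 50)
  (.seq (.assign 50 (.reg 51))
  (.seq (sizeProg 52 50)
  (.seq (.assign 53 (.lit 2))
  (.seq (powProg 54 53 75 76 (.reg 52 / .lit 8 + .lit 3))
  (.seq (.assign 55 (.reg 1 * (.lit 64 * (.reg 1 * .reg 1) * .reg 51) * (.reg 54 * .reg 54)))
  (.seq (.assign 60 (.reg 51 / .reg 52))
  (.seq (.assign 60 (.reg 60 + .lit 1))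
  (.seq (.assign 56 ((.lit 4 * (.reg 1 * .reg 1) + .lit 2) *
    (.lit 64 * .reg 1 * .reg 60 + .lit 1 + .lit 2)))
  (.seq (powProg 57 56 75 76 (.reg 1 - .lit 1))
  (.seq (.assign 58 (.reg 1 * (.lit 2 * .reg 1 * .reg 55 + (.reg 57 + .lit 1))))
  (.seq (.assign 59 (.reg 1 * (.reg 1 + .reg 1 * .reg 1 + .lit 1 + .lit 1)))
  (.seq (.assign 60 (.lit 8))
  (.seq (powProg 61 60 75 76 (.reg 1 + .lit 5))
  (powProg 3 53 75 76 (.reg 1 * .reg 51 * .reg 61))))))))))))))))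

theorem runs_typesProg {X k m : ℕ} {σ : State} (hσ : Bounded X σ) (hk : 3 ≤ k) (hm : 1 ≤ m)
    (h1 : σ.reg 1 = k) (h2 : σ.reg 2 = m) (hkm : k * m ≤ X) (hX8 : 8 ^ (k + 5) ≤ X)
    (hXl : lightTypes k m ≤ X) (hXh : heavyTypes k ≤ X) (hXD : gridDenom k m ≤ X) :
    Runs X typesProg σ (100 * (k * paramSize k m * 8 ^ (k + 5)) + 300) fun σ' =>
      σ'.reg 58 = lightTypes k m ∧ σ'.reg 59 = heavyTypes k ∧ σ'.reg 3 = gridDenom k m ∧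
      (∀ r < 50, r ≠ 3 → σ'.reg r = σ.reg r) ∧ ∀ a q, σ'.arr a q = σ.arr a q := by
  have h3l : 1 ≤ paramSize k m := Nat.size_pos.mpr (Nat.mul_pos (by omega) hm)
  set l := paramSize k m with hl
  set b := l.size with hb
  have hbl : b ≤ l := size_le_self l
  have hb0 : 0 < b := Nat.size_pos.mpr (by omega)
  have hk8 : k + 5 ≤ 8 ^ (k + 5) := (Nat.lt_pow_self (by norm_num)).le
  have h80 : 0 < 8 ^ (k + 5) := by positivity
  have hE : k * l * 8 ^ (k + 5) ≤ X :=
    (Nat.lt_two_pow_self (n := k * l * 8 ^ (k + 5))).le.trans hXD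
  have hlE : l ≤ k * l * 8 ^ (k + 5) :=
    (Nat.le_mul_of_pos_left _ (by omega)).trans (Nat.le_mul_of_pos_right _ h80)
  have h8E : 8 ^ (k + 5) ≤ k * l * 8 ^ (k + 5) := Nat.le_mul_of_pos_left _ (by positivity)
  have hX8' : 8 ^ 5 ≤ X := (Nat.pow_le_pow_right (by norm_num) (by omega)).trans hX8
  have hK0 : 0 < spreadFactor k m := by
    unfold spreadFactor
    have : 0 < paramSize k m := by omega
    positivity
  set K := spreadFactor k m with hKdef
  set R := ((4 * k ^ 2 + 2) * (momentOrder k m + 2)) with hR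
  have hM : lightTypes k m = k * (2 * k * K + (R ^ (k - 1) + 1)) := rfl
  have hR0 : 0 < R := by positivity
  have hRp : R ≤ R ^ (k - 1) := Nat.le_self_pow (by omega) _
  have hin : 2 * k * K + (R ^ (k - 1) + 1) ≤ X :=
    (Nat.le_mul_of_pos_left _ (by omega)).trans (hM ▸ hXl)
  have hKX : K ≤ X := (Nat.le_mul_of_pos_left _ (by omega : 0 < 2 * k)).trans (by omega)
  have hq : 2 ^ (b / 8 + 3) ≤ K := by
    rw [hKdef, spreadFactor, ← hl, ← hb]
    exact (Nat.le_self_pow (by norm_num) _).trans (Nat.le_mul_of_pos_left _ (by positivity))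
  have hq0 : 0 < 2 ^ (b / 8 + 3) := by positivity
  have hmo : momentOrder k m = 64 * k * (l / b + 1) + 1 := rfl
  have hlb : l / b ≤ l := Nat.div_le_self _ _
  refine (Runs.assign_seq_of_pos hσ (v := k * m) (by simp [h1, h2]) (by simp [h1, h2]; omega) hkm
    fun hb1 => Runs.seq (runs_sizeProg (v := k * m) hb1 (by omega) (by norm_num) (by simp))
    fun σ₁ hb2 ⟨e51, er, ea⟩ => Runs.assign_seq hb2 (by simp) (v := l) (by simp [e51, hl, paramSize])
    fun hb3 => Runs.seq (runs_sizeProg (v := l) hb3 (by omega) (by norm_num) (by simp))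
    fun σ₂ hb4 ⟨e52, er2, ea2⟩ => ?_).mono (t₁ := 4 + (15 * l + 5 + (2 + (15 * b + 5 +
      (14 * (b / 8 + 3) + 14 * (k - 1) + 14 * (k + 5) + 14 * (k * l * 8 ^ (k + 5)) + 150)))))
      ?_ fun _ h => h
  · omega
  · have e51' : σ₂.reg 51 = l := by
      rw [er2 51 (by norm_num) (by norm_num), State.reg_setReg, if_neg (by norm_num), e51]
      rfl
    have er' : ∀ r < 50, σ₂.reg r = σ.reg r := fun r hr => by
      have : r ≠ 50 ∧ r ≠ 51 ∧ r ≠ 52 := by omega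
      rw [er2 r this.2.2 this.1, State.reg_setReg, if_neg this.1, er r this.2.1 this.1,
        State.reg_setReg, if_neg this.1]
    have ea' : ∀ a q, σ₂.arr a q = σ.arr a q := fun a q => by
      rw [ea2, State.arr_setReg, ea, State.arr_setReg]
    have e1 : σ₂.reg 1 = k := by rw [er' 1 (by norm_num), h1]
    clear er2 ea2 er ea
    refine (Runs.assign_seq hb4 (by simp; omega) (v := 2) rfl fun hb5 =>
      Runs.seq (runs_powProg (K := b / 8 + 3) (B := 2) hb5 (by norm_num) (by norm_num)
        (by norm_num) (by norm_num) (by norm_num) (by norm_num) ?_ (by simp [e52, hb]) (by simp)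
        (by norm_num) (hq.trans hKX))
      fun σ₃ hb6 ⟨f54, fr, fa⟩ => Runs.assign_seq_of_pos hb6 (v := K) ?_ ?_ hKX
      fun hb7 => Runs.assign_seq hb7 (by simp) (v := l / b) ?_ fun hb8 =>
      Runs.assign_seq hb8 ?_ (v := l / b + 1) (by simp) fun hb9 =>
      Runs.assign_seq_of_pos hb9 (v := R) ?_ ?_ (by omega) fun hb10 =>
      Runs.seq (runs_powProg (K := k - 1) (B := R) hb10 (by norm_num) (by norm_num) (by norm_num)
        (by norm_num) (by norm_num) (by norm_num) (by simp; omega) ?_ (by simp) hR0 (by omega))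
      fun σ₄ hb11 ⟨g57, gr, ga⟩ => ?_).mono (t₁ := 2 + (14 * (b / 8 + 3) + 17 + (14 + (4 + (4 + (18 +
        (14 * (k - 1) + 15 + (14 * (k + 5) + 14 * (k * l * 8 ^ (k + 5)) + 70))))))))
        (by omega) fun _ h => h
    · simp
      omega
    · simp [fr, e1, e51', f54, hKdef, spreadFactor, ← hl, ← hb]
      ring
    · simp [fr, e1, e51', f54]
      omega
    · simp [fr, e51', e52, hb]
    · have hE1 : k * l * 8 ^ (k + 5) < X :=
        (Nat.lt_two_pow_self (n := k * l * 8 ^ (k + 5))).trans_le hXD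
      simp
      omega
    · simp [fr, e1, hR, hmo]
      ring
    · simp [fr, e1]
      omega
    · simp [fr, e1]
    have gr1 : σ₄.reg 1 = k := by
      rw [gr 1 (by norm_num) (by norm_num) (by norm_num)]
      simp [fr, e1]
    have gr51 : σ₄.reg 51 = l := by
      rw [gr 51 (by norm_num) (by norm_num) (by norm_num)]
      simp [fr, e51']
    have gr53 : σ₄.reg 53 = 2 := by
      rw [gr 53 (by norm_num) (by norm_num) (by norm_num)]
      simp [fr]
    have gr55 : σ₄.reg 55 = K := by
      rw [gr 55 (by norm_num) (by norm_num) (by norm_num)]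
      simp
    have gr' : ∀ r < 50, σ₄.reg r = σ.reg r := fun r hr => by
      have : r ≠ 57 ∧ r ≠ 75 ∧ r ≠ 76 ∧ r ≠ 56 ∧ r ≠ 60 ∧ r ≠ 55 ∧ r ≠ 54 ∧ r ≠ 53 := by omega
      rw [gr r this.1 this.2.1 this.2.2.1]
      simp [this, fr, er' r hr]
    have ga' : ∀ a q, σ₄.arr a q = σ.arr a q := fun a q => by
      rw [ga]
      simp [fa, ea']
    refine (Runs.assign_seq_of_pos hb11 (v := lightTypes k m) ?_ ?_ hXl fun hb12 =>
      Runs.assign_seq_of_pos hb12 (v := heavyTypes k) ?_ ?_ hXh fun hb13 =>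
      Runs.assign_seq hb13 ?_ (v := 8) rfl fun hb14 =>
      Runs.seq (runs_powProg (K := k + 5) (B := 8) hb14 (by norm_num) (by norm_num) (by norm_num)
        (by norm_num) (by norm_num) (by norm_num) ?_ ?_ (by simp) (by norm_num) hX8)
      fun σ₅ hb15 ⟨i61, ir, ia⟩ => (runs_powProg (K := k * l * 8 ^ (k + 5)) (B := 2) hb15
        (by norm_num) (by norm_num) (by norm_num) (by norm_num) (by norm_num) (by norm_num)
        ?_ ?_ ?_ (by norm_num) hXD).mono le_rfl fun σ₆ ⟨j3, jr, ja⟩ =>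
          ⟨?_, ?_, j3, fun r hr hr3 => ?_, fun a q => ?_⟩).mono ?_ fun _ h => h
    · simp [gr1, gr55, g57, hM]
    · simp [gr1, gr55, g57, hR0, hK0]
      omega
    · simp [gr1, heavyTypes, gridTypeCount]
      left
      ring
    · simp [gr1]
      omega
    · simp
      omega
    · simp [gr1]
      omega
    · simp [gr1]
    · simp
      omega
    · simp [ir, gr1, gr51, i61]
      refine ⟨?_, hE⟩
      exact (Nat.le_mul_of_pos_right _ h80).trans hE
    · simp [ir, gr1, gr51, i61]
    · simp [ir, gr53]
    · simp [jr, ir]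
    · simp [jr, ir]
    · have : r ≠ 61 ∧ r ≠ 75 ∧ r ≠ 76 ∧ r ≠ 60 ∧ r ≠ 59 ∧ r ≠ 58 := by omega
      rw [jr r hr3 this.2.1 this.2.2.1, ir r this.1 this.2.1 this.2.2.1]
      simp [this, gr' r hr]
    · rw [ja, ia]
      simp [ga']

end Parameters

end RAM

/-! ### The constants of the search -/

namespace RAM

section Constants

/-- The number of codes of profiles. -/
def codeCount (n k D M₁ M₂ : ℕ) : ℕ :=
  (2 * n * (D + 1) ^ k) ^ M₁ * (2 * ((D + 1) ^ k * (D + 1))) ^ M₂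

/-- Put the powers `Y ^ n ^ h` into array `4`. -/
def tableProg : Program :=
  .seq (.assign 69 (.lit 1)) (forUp 70 71 (.reg 1)
    (.seq (powProg 72 4 73 74 (.reg 69))
    (.seq (.store 4 (.reg 70) (.reg 72)) (.assign 69 (.reg 69 * .reg 0)))))

variable {X n k : ℕ} {σ : State}

theorem runs_tableProg {Y : ℕ} (hσ : Bounded X σ) (hn : 0 < n) (h0 : σ.reg 0 = n) (h1 : σ.reg 1 = k)
    (h4 : σ.reg 4 = Y) (hY : 0 < Y) (hX : n ^ k ≤ X) (hXY : Y ^ n ^ (k - 1) ≤ X) :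
    Runs X tableProg σ ((14 * n ^ k + 50) * k + 20) fun σ' =>
      (∀ h < k, σ'.arr 4 h = Y ^ n ^ h) ∧ (∀ r < 50, σ'.reg r = σ.reg r) ∧
      ∀ a q, a ≠ 4 → σ'.arr a q = σ.arr a q := by
  have hX1 : 1 ≤ X := (Nat.one_le_pow _ _ hn).trans hX
  refine (Runs.assign_seq hσ (by simpa using hX1) (v := 1) rfl fun hb1 =>
    Runs.forUp (K := k) (t := 14 * n ^ k + 40) hX1 hb1 (by norm_num) (by simp) (by simp [h1])
      (fun j σ' => (∀ h < j, σ'.arr 4 h = Y ^ n ^ h) ∧ σ'.reg 69 = n ^ j ∧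
        (∀ r < 50, σ'.reg r = σ.reg r) ∧ ∀ a q, a ≠ 4 → σ'.arr a q = σ.arr a q)
      ?_ ?_ ?_).mono ?_ ?_
  · refine ⟨by simp, by simp, fun r hr => ?_, fun _ _ _ => rfl⟩
    have : r ≠ 69 := by omega
    simp [this]
  · rintro j σ₁ x v hx ⟨g1, g2, g3, g4⟩
    have hx' : x = 70 ∨ x = 71 := hx
    refine ⟨g1, by rcases hx' with rfl | rfl <;> simp [g2], fun r hr => ?_, g4⟩
    have : r ≠ x := by omega
    simp [this, g3 r hr]
  · rintro j σ₁ hj hb h70 ⟨g1, g2, g3, g4⟩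
    have hpow : n ^ j ≤ n ^ k := Nat.pow_le_pow_right hn hj.le
    have hpow' : n ^ j * n ≤ n ^ k := by
      rw [← pow_succ]
      exact Nat.pow_le_pow_right hn hj
    have hYj : Y ^ n ^ j ≤ X :=
      (Nat.pow_le_pow_right hY (Nat.pow_le_pow_right hn (by omega))).trans hXY
    refine (Runs.seq (runs_powProg (K := n ^ j) (B := Y) hb (by norm_num) (by norm_num)
      (by norm_num) (by norm_num) (by norm_num) (by norm_num) (by simp) (by simp [g2])
      (by rw [g3 4 (by norm_num), h4]) hY hYj) fun σ₂ hb2 ⟨e1, e2, e3⟩ =>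
      Runs.store_seq hb2 (by simp) (by simp) (i := j) (v := Y ^ n ^ j) (by simp [e2, h70])
        (by simp [e1]) fun hb3 => Runs.assign hb3 ?_ ⟨?_, ?_, ?_, ?_, ?_, ?_⟩).mono ?_ fun _ h => h
    · simp
      omega
    · simp [e2, g2, g3, h0]
      omega
    · simp [e2, h70]
    · simp [e2]
    · intro h hh
      rcases Nat.lt_succ_iff_lt_or_eq.mp hh with h1 | rfl
      · simp [h1.ne, e3, g1 h h1]
      · simp
    · simp [e2, g2, g3, h0, pow_succ]
    · intro r hr
      have : r ≠ 69 ∧ r ≠ 72 ∧ r ≠ 73 ∧ r ≠ 74 := by omega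
      simp [this, e2, g3 r hr]
    · intro a q ha
      simp [ha, e3, g4 a q ha]
  · have : (14 * n ^ k + 40 + 10) * k = (14 * n ^ k + 50) * k := by ring
    simp only [Expr.nodes_reg, Expr.nodes_lit]
    omega
  · exact fun σ' ⟨g1, _, g3, g4⟩ => ⟨g1, g3, g4⟩

/-- The constants of the search, apart from those in array `4`. -/
def constantsProg : Program :=
  .seq (.assign 7 (.reg 3 + .lit 1))
  (.seq (.assign 8 (.reg 0 - .lit 1))
  (.seq (powProg 62 3 75 76 (.reg 8))
  (.seq (.assign 4 (.reg 62 + .lit 1))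
  (.seq (powProg 5 0 75 76 (.reg 1))
  -- A switch: for m ≥ 1 this is 0 if m = 1 and 1 if m ≥ 2. It turns off the search when ε ≥ 1.
  (.seq (.assign 63 (.lit 1 - (.lit 2 - .reg 2)))
  (.seq (.assign 64 ((.lit 4 * .reg 2 + .lit 1) * .reg 62 + .lit 1))
  -- The initial best value. For m ≥ 2 it exceeds by one the bound (4m + 1) D^(n-1) for all computed
  -- values, so some code is certain to replace it.
  (.seq (.assign 9 (.reg 63 * .reg 64))
  (.seq (powProg 64 7 75 76 (.reg 1))
  (.seq (.assign 65 (.lit 2 * .reg 0 * .reg 64))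
  (.seq (powProg 66 65 75 76 (.reg 59))
  (.seq (.assign 67 (.lit 2 * (.reg 64 * .reg 7)))
  (.seq (powProg 68 67 75 76 (.reg 58))
  (.seq (.assign 65 (.reg 66 * .reg 68))
  (.assign 6 (.reg 63 * .reg 65)))))))))))))))

theorem runs_constantsProg {m D M₁ M₂ : ℕ} (hσ : Bounded X σ) (hX : 2 ≤ X) (hn : 0 < n) (hk : 0 < k)
    (hm : 0 < m) (hD : 0 < D) (hM₁ : 0 < M₁) (hM₂ : 0 < M₂) (h0 : σ.reg 0 = n) (h1 : σ.reg 1 = k)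
    (h2 : σ.reg 2 = m) (h3 : σ.reg 3 = D) (h58 : σ.reg 58 = M₂) (h59 : σ.reg 59 = M₁)
    (hXT : codeCount n k D M₁ M₂ ≤ X) (hXS : n ^ k ≤ X)
    (hXm : (4 * m + 1) * D ^ (n - 1) + 1 ≤ X) :
    Runs X constantsProg σ (14 * (n + 2 * k + M₁ + M₂) + 250) fun σ' =>
      σ'.reg 7 = D + 1 ∧ σ'.reg 8 = n - 1 ∧ σ'.reg 4 = D ^ (n - 1) + 1 ∧ σ'.reg 5 = n ^ k ∧
      σ'.reg 9 = (1 - (2 - m)) * ((4 * m + 1) * D ^ (n - 1) + 1) ∧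
      σ'.reg 6 = (1 - (2 - m)) * codeCount n k D M₁ M₂ ∧
      (∀ r < 4, σ'.reg r = σ.reg r) ∧ ∀ a q, σ'.arr a q = σ.arr a q := by
  have hDk : 0 < (D + 1) ^ k := by positivity
  have hA0 : 0 < 2 * n * (D + 1) ^ k := by positivity
  have hB0 : 0 < 2 * ((D + 1) ^ k * (D + 1)) := by positivity
  have hAT : (2 * n * (D + 1) ^ k) ^ M₁ ≤ X :=
    (Nat.le_mul_of_pos_right _ (Nat.pow_pos hB0)).trans hXT
  have hBT : (2 * ((D + 1) ^ k * (D + 1))) ^ M₂ ≤ X :=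
    (Nat.le_mul_of_pos_left _ (Nat.pow_pos hA0)).trans hXT
  have hA : 2 * n * (D + 1) ^ k ≤ X := (Nat.le_self_pow (by omega) _).trans hAT
  have hB : 2 * ((D + 1) ^ k * (D + 1)) ≤ X := (Nat.le_self_pow (by omega) _).trans hBT
  have hDkX : (D + 1) ^ k ≤ X := (Nat.le_mul_of_pos_left _ (by positivity)).trans hA
  have hDX : D + 1 ≤ X := (Nat.le_self_pow (by omega) _).trans hDkX
  have hN0 : 0 < D ^ (n - 1) := by positivity
  have hNX : D ^ (n - 1) + 1 ≤ X := by
    have : D ^ (n - 1) ≤ (4 * m + 1) * D ^ (n - 1) := Nat.le_mul_of_pos_left _ (by omega)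
    omega
  have hf : 1 - (2 - m) = 0 ∨ 1 - (2 - m) = 1 := by omega
  set f := 1 - (2 - m) with hfdef
  refine (Runs.assign_seq hσ (by simp [h3]; omega) (v := D + 1) (by simp [h3]) fun hb1 =>
    Runs.assign_seq hb1 (by simp; omega) (v := n - 1) (by simp [h0]) fun hb2 =>
    Runs.seq (runs_powProg (K := n - 1) (B := D) hb2 (by norm_num) (by norm_num) (by norm_num)
      (by norm_num) (by norm_num) (by norm_num) (by simp) (by simp) (by simp [h3]) hD (by omega))
    fun σ₁ hb3 ⟨e62, er, ea⟩ => Runs.assign_seq hb3 (by simp [e62]; omega) (v := D ^ (n - 1) + 1)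
      (by simp [e62]) fun hb4 =>
    Runs.seq (runs_powProg (K := k) (B := n) hb4 (by norm_num) (by norm_num) (by norm_num)
      (by norm_num) (by norm_num) (by norm_num) (by simp) (by simp [er, h1]) (by simp [er, h0]) hn
      hXS) fun σ₂ hb5 ⟨e5, er2, ea2⟩ => ?_).mono (t₁ := 4 + (4 + (14 * (n - 1) + 13 + (4 + (14 * k +
        13 + (14 * k + 14 * M₁ + 14 * M₂ + 150)))))) (by omega) fun _ h => h
  have c0 : σ₂.reg 0 = n := by simp [er2, er, h0]
  have c1 : σ₂.reg 1 = k := by simp [er2, er, h1]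
  have c2 : σ₂.reg 2 = m := by simp [er2, er, h2]
  have c3 : σ₂.reg 3 = D := by simp [er2, er, h3]
  have c4 : σ₂.reg 4 = D ^ (n - 1) + 1 := by simp [er2]
  have c7 : σ₂.reg 7 = D + 1 := by simp [er2, er]
  have c8 : σ₂.reg 8 = n - 1 := by simp [er2, er]
  have c62 : σ₂.reg 62 = D ^ (n - 1) := by simp [er2, e62]
  have c58 : σ₂.reg 58 = M₂ := by simp [er2, er, h58]
  have c59 : σ₂.reg 59 = M₁ := by simp [er2, er, h59]
  have ca : ∀ a q, σ₂.arr a q = σ.arr a q := fun a q => by simp [ea2, ea]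
  have cr : ∀ r < 4, σ₂.reg r = σ.reg r := fun r hr => by
    have : r ≠ 4 ∧ r ≠ 5 ∧ r ≠ 7 ∧ r ≠ 8 ∧ r ≠ 62 ∧ r ≠ 75 ∧ r ≠ 76 := by omega
    simp [er2, er, this]
  clear er2 ea2 er ea e62
  refine (Runs.assign_seq hb5 (by simp; omega) (v := f) (by simp [c2, hfdef]) fun hb6 =>
    Runs.assign_seq_of_pos hb6 (v := (4 * m + 1) * D ^ (n - 1) + 1) (by simp [c2, c62])
      (by simp [c2, c62, hm, hN0]) hXm fun hb7 =>
    Runs.assign_seq hb7 ?_ (v := f * ((4 * m + 1) * D ^ (n - 1) + 1)) (by simp) fun hb8 =>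
    Runs.seq (runs_powProg (K := k) (B := D + 1) hb8 (by norm_num) (by norm_num) (by norm_num)
      (by norm_num) (by norm_num) (by norm_num) (by simp) (by simp [c1]) (by simp [c7]) (by omega)
      hDkX) fun σ₃ hb9 ⟨f64, fr, fa⟩ => Runs.assign_seq_of_pos hb9 (v := 2 * n * (D + 1) ^ k)
      (by simp [fr, c0, f64]) (by simp [fr, c0, f64, hn]) hA fun hb10 =>
    Runs.seq (runs_powProg (K := M₁) (B := 2 * n * (D + 1) ^ k) hb10 (by norm_num) (by norm_num)
      (by norm_num) (by norm_num) (by norm_num) (by norm_num) (by simp) (by simp [fr, c59])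
      (by simp) hA0 hAT) fun σ₄ hb11 ⟨g66, gr, ga⟩ =>
    Runs.assign_seq_of_pos hb11 (v := 2 * ((D + 1) ^ k * (D + 1))) (by simp [gr, fr, c7, f64])
      (by simp [gr, fr, c7, f64]) hB fun hb12 =>
    Runs.seq (runs_powProg (K := M₂) (B := 2 * ((D + 1) ^ k * (D + 1))) hb12 (by norm_num)
      (by norm_num) (by norm_num) (by norm_num) (by norm_num) (by norm_num) (by simp)
      (by simp [gr, fr, c58]) (by simp) hB0 hBT) fun σ₅ hb13 ⟨i68, ir, ia⟩ =>
    Runs.assign_seq hb13 ?_ (v := codeCount n k D M₁ M₂) ?_ fun hb14 =>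
    Runs.assign hb14 ?_ ⟨?_, ?_, ?_, ?_, ?_, ?_, fun r hr => ?_, fun a q => ?_⟩).mono ?_ fun _ h => h
  · rcases hf with h | h <;> simp [h, hXm]
  · simp
    omega
  · simpa [ir, gr, g66, i68, codeCount] using hXT
  · simp [ir, gr, g66, i68, codeCount]
  · rcases hf with h | h <;> simp [ir, gr, fr, h, hXT]
  · simp [ir, gr, fr, c7]
  · simp [ir, gr, fr, c8]
  · simp [ir, gr, fr, c4]
  · simp [ir, gr, fr, e5]
  · simp [ir, gr, fr]
  · simp [ir, gr, fr]
  · have : r ≠ 6 ∧ r ≠ 9 ∧ r ≠ 63 ∧ r ≠ 64 ∧ r ≠ 65 ∧ r ≠ 66 ∧ r ≠ 67 ∧ r ≠ 68 ∧ r ≠ 75 ∧ r ≠ 76 := by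
      omega
    simp [ir, gr, fr, cr r hr, this]
  · simp [ia, ga, fa, ca]

end Constants

end RAM

/-! ### The complete program -/

namespace RAM

section Threat

/-- Compute the threat point and the strategies that enforce it. -/
def threatProg : Program :=
  .seq typesProg (.seq constantsProg (.seq tableProg (.seq searchProg (.seq strategyProg
    -- Register 4 holds Y = D^(n-1) + 1, so the denominator of the values is 4m·D^(n-1): the factor
    -- 4m comes from the payoff table and D^(n-1) from the rows.
    (.seq (.assign 0 (.lit 4 * .reg 2 * (.reg 4 - .lit 1))) (.assign 1 (.reg 3)))))))

/-- A bound for all numbers that occur in `threatProg`. -/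
def memoryBound (n k m : ℕ) : ℕ :=
  let D := gridDenom k m
  let Y := D ^ (n - 1) + 1
  [2, (D * Y ^ n ^ (k - 1)) ^ (n - 1), n * n * k, n * k * n ^ k, Y ^ n ^ k,
    n ^ k * (Y * (4 * m + 1)), k * m, 8 ^ (k + 5), lightTypes k m, heavyTypes k, D,
    codeCount n k D (heavyTypes k) (lightTypes k m), n ^ k, (4 * m + 1) * D ^ (n - 1) + 1,
    Y ^ n ^ (k - 1)].sum

/-- The number of codes that are searched: none if `m = 1`. -/
def searchCount (n k m : ℕ) : ℕ :=
  (1 - (2 - m)) * codeCount n k (gridDenom k m) (heavyTypes k) (lightTypes k m)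

/-- A bound for the number of steps of `threatProg`. -/
def stepBound (n k m : ℕ) : ℕ :=
  100 * (k * paramSize k m * 8 ^ (k + 5)) + 300 +
    (14 * (n + 2 * k + heavyTypes k + lightTypes k m) + 250 + ((14 * n ^ k + 50) * k + 20 +
    (((((80 * k + 140) * (n - 1) + (50 * n ^ k + 50) * k + 90) * searchCount n k m + 40) * n + 20) +
    (((80 * k + 140) * (n - 1) + 40 * k + 100) * n + 20 + 20))))

/-- What the output means, in terms of the codes `c i` that were found. -/
structure IsOutput (n k m : ℕ) (α : ℕ → ℕ) (σ : State) (c : ℕ → ℕ) : Prop where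
  reg0 : σ.reg 0 = 4 * m * gridDenom k m ^ (n - 1)
  reg1 : σ.reg 1 = gridDenom k m
  best : ∀ i < n, IsBest
    (codeVal n k (gridDenom k m) (n - 1) (gridDenom k m ^ (n - 1) + 1) (n ^ k) α i)
    ((1 - (2 - m)) * ((4 * m + 1) * gridDenom k m ^ (n - 1) + 1)) (searchCount n k m)
    (σ.arr 1 i) (c i)
  rows : ∀ i < n, ∀ j < n, j ≠ i → ∀ h < k, σ.arr 2 ((i * n + j) * k + h) =
    rowEntry (gridDenom k m) k (profCode n k (gridDenom k m) (c i) (opponentIndex (n - 1) i j)) h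

theorem runs_threatProg {n k m : ℕ} {σ : State} {α : ℕ → ℕ} (hn : 2 ≤ n) (hk : 3 ≤ k) (hm : 1 ≤ m)
    (h0 : σ.reg 0 = n) (h1 : σ.reg 1 = k) (h2 : σ.reg 2 = m) (hα : ∀ q, σ.arr 0 q = α q)
    (hA : ∀ q, α q ≤ 4 * m + 1) (hσ : Bounded (memoryBound n k m) σ) :
    Runs (memoryBound n k m) threatProg σ (stepBound n k m) fun σ' =>
      ∃ c, IsOutput n k m α σ' c := by
  obtain ⟨X, hX⟩ : ∃ X, X = memoryBound n k m := ⟨_, rfl⟩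
  rw [← hX] at hσ ⊢
  obtain ⟨D, hD⟩ : ∃ D, D = gridDenom k m := ⟨_, rfl⟩
  have hD0 : 0 < D := by simp [hD, gridDenom]
  have hM₁ : 0 < heavyTypes k := Nat.mul_pos (by omega) (by omega)
  have hM₂ : 0 < lightTypes k m := Nat.mul_pos (by omega) (by omega)
  unfold memoryBound at hX
  simp only [← hD] at hX
  -- The memory bound is a sum of all quantities to be controlled, hence an upper bound for each of
  -- them.
  have hmem := fun x hx => (List.le_sum_of_mem (x := x) hx).trans_eq hX.symm
  simp only [List.forall_mem_cons, List.not_mem_nil, false_imp_iff, implies_true, and_true] at hmem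
  obtain ⟨x1, x2, x3, x4, x5, x6, x7, x8, x9, x10, x11, x12, x13, x14, x15⟩ := hmem
  have hB : SearchBounds X n k D (n - 1) (D ^ (n - 1) + 1) (n ^ k) (4 * m + 1) :=
    ⟨x1, by omega, by omega, hD0, by omega, x2, x3, x4, x5, x6⟩
  refine (Runs.seq (runs_typesProg (k := k) (m := m) hσ hk hm h1 h2 x7 x8 x9 x10
      (hD ▸ x11)) fun σ₁ hb1 ⟨e58, e59, e3, er, ea⟩ =>
    Runs.seq (runs_constantsProg (n := n) (k := k) (m := m) (D := D) (M₁ := heavyTypes k)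
      (M₂ := lightTypes k m) hb1 x1 (by omega) (by omega) hm hD0 hM₁ hM₂ (by simp [er, h0])
      (by simp [er, h1]) (by simp [er, h2]) (by rw [e3, hD]) e58 e59 x12 x13 x14)
      fun σ₂ hb2 ⟨f7, f8, f4, f5, f9, f6, fr, fa⟩ =>
    Runs.seq (runs_tableProg (n := n) (k := k) (Y := D ^ (n - 1) + 1) hb2 (by omega)
      (by simp [fr, er, h0]) (by simp [fr, er, h1]) f4 (by omega) x13 x15)
      fun σ₃ hb3 ⟨g4, gr, ga⟩ => ?_).mono le_rfl fun _ h => h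
  have henv : SearchEnv n k D (n - 1) (D ^ (n - 1) + 1) (n ^ k) α σ₃ := by
    refine ⟨⟨?_, ?_, ?_, ?_, ?_, g4⟩, ?_, ?_, fun q => ?_⟩
    · simp [gr, fr, er, h0]
    · simp [gr, fr, er, h1]
    · simp [gr, fr, e3, hD]
    · simp [gr, f7]
    · simp [gr, f8]
    · simp [gr, f4]
    · simp [gr, f5]
    · simp [ga, fa, ea, hα]
  refine Runs.seq (runs_searchProg hB hA (by omega) henv hb3 (gr 9 (by norm_num)) (T := searchCount n k m)
    (by rw [gr 6 (by norm_num), f6, searchCount, hD])) fun σ₄ hb4 ⟨i1, ir, ia⟩ => ?_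
  have henv' : SearchEnv n k D (n - 1) (D ^ (n - 1) + 1) (n ^ k) α σ₄ := henv.congr ir ia
  refine Runs.seq (runs_strategyProg hB (by omega) henv' hb4) fun σ₅ hb5 ⟨j2, jr, ja⟩ => ?_
  have k2 : σ₅.reg 2 = m := by simp [jr, ir, gr, fr, er, h2]
  have k3 : σ₅.reg 3 = D := by rw [jr 3 (by norm_num), henv'.code.reg3]
  have k4 : σ₅.reg 4 = D ^ (n - 1) + 1 := by rw [jr 4 (by norm_num), henv'.reg4]
  have hout : 4 * m * D ^ (n - 1) ≤ X := by
    have : 4 * m * D ^ (n - 1) ≤ (4 * m + 1) * D ^ (n - 1) := Nat.mul_le_mul_right _ (by omega)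
    omega
  have h4m : 4 * m ≤ X := (Nat.le_mul_of_pos_right _ (Nat.pow_pos hD0)).trans hout
  refine (Runs.assign_seq hb5 ?_ (v := 4 * m * D ^ (n - 1)) ?_ fun hb6 => Runs.assign hb6 (by simp)
    ⟨fun i => σ₄.arr 3 i, ?_, ?_, ?_, ?_⟩).mono ?_ fun _ h => h
  · simp only [Expr.small_mul, Expr.small_sub, Expr.small_lit, Expr.small_reg, Expr.eval_mul,
      Expr.eval_sub, Expr.eval_lit, Expr.eval_reg, k2, k4, true_and, and_true, Nat.add_sub_cancel]
    have hm4 : 4 ≤ 4 * m := by omega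
    have hX1 : 1 ≤ X := by omega
    exact ⟨⟨hm4.trans h4m, h4m⟩, hX1, hout⟩
  · simp [k2, k4]
  · simp
  · simp [hD]
  · simp [k3, hD]
  · intro i hi
    simpa [ja, gr, f9, hD] using i1 i hi
  · intro i hi j hj hji h hh
    simpa [← hD] using j2 i hi j hj hji h hh

end Threat

end RAM

/-! ### The meaning of the computed values -/

section Semantics

theorem sum_partitions_eq_pmdExp {ι : Type} [Fintype ι] [DecidableEq ι] {N k : ℕ}
    (p : ι → Fin k → ℝ) (g : Partitions N k → ℝ) :
    ∑ x : Partitions N k, pmdMass p x * g x =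
      pmdExp p fun x => if hx : x ∈ Partitions N k then g ⟨x, hx⟩ else 0 := by
  simp only [pmdMass, pmdExp, Finset.sum_filter, Finset.sum_mul]
  rw [Finset.sum_comm]
  refine Finset.sum_congr rfl fun s _ => ?_
  by_cases hx : (∑ i, (Pi.single (s i) 1 : Fin k → ℕ)) ∈ Partitions N k
  · rw [dif_pos hx, Finset.sum_eq_single ⟨_, hx⟩]
    · rw [if_pos rfl]
    · intro x _ hne
      rw [if_neg fun h => hne (Subtype.ext h.symm), zero_mul]
    · simp
  · rw [dif_neg hx, mul_zero]
    refine Finset.sum_eq_zero fun x _ => ?_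
    rw [if_neg (by rintro h; exact hx (h ▸ x.2)), zero_mul]

/-- Anonymity: the law depends only on the multiset of rows. It justifies sorting the players by
type in a code, and the renumbering of the opponents in the output. -/
theorem pmdMass_comp_equiv {ι κ : Type} [Fintype ι] [DecidableEq ι] [Fintype κ] [DecidableEq κ]
    {k : ℕ} (e : ι ≃ κ) (p : κ → Fin k → ℝ) : pmdMass (fun i => p (e i)) = pmdMass p := by
  funext x
  simp only [pmdMass, Finset.sum_filter]
  refine Fintype.sum_equiv (e.arrowCongr (Equiv.refl _)) _ _ fun s => ?_
  have h1 : ∑ i, (Pi.single (s i) 1 : Fin k → ℕ) =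
      ∑ j, Pi.single ((e.arrowCongr (Equiv.refl (Fin k))) s j) 1 :=
    Fintype.sum_equiv e _ _ fun i => by simp
  have h2 : ∏ i, p (e i) (s i) = ∏ j, p j ((e.arrowCongr (Equiv.refl (Fin k))) s j) :=
    Fintype.prod_equiv e _ _ fun i => by simp
  rw [h1, h2]

theorem abs_ciSup_sub_ciSup_le {κ : Type*} [Finite κ] [Nonempty κ] {f g : κ → ℝ} {ε : ℝ}
    (h : ∀ i, |f i - g i| ≤ ε) : |(⨆ i, f i) - ⨆ i, g i| ≤ ε := by
  have key : ∀ f g : κ → ℝ, (∀ i, |f i - g i| ≤ ε) → (⨆ i, f i) - ⨆ i, g i ≤ ε := by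
    intro f g h
    have : ⨆ i, f i ≤ (⨆ i, g i) + ε := ciSup_le fun i => by
      have h1 := le_ciSup (Set.finite_range g).bddAbove i
      have h2 := (abs_le.mp (h i)).2
      linarith
    linarith
  refine abs_le.mpr ⟨?_, key f g h⟩
  have := key g f fun i => by rw [abs_sub_comm]; exact h i
  linarith

namespace AnonymousGame

variable {n k : ℕ} (G : AnonymousGame n k)

theorem abs_bestPayoff_sub_le {ι : Type} [Fintype ι] [DecidableEq ι] (hk : 0 < k) (i : Fin n)
    {p q : ι → Fin k → ℝ} {ε : ℝ} (h : PMDClose p q ε) :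
    |G.bestPayoff i (pmdMass p) - G.bestPayoff i (pmdMass q)| ≤ ε := by
  have : Nonempty (Fin k) := ⟨⟨0, hk⟩⟩
  refine abs_ciSup_sub_ciSup_le fun ℓ => ?_
  rw [sum_partitions_eq_pmdExp, sum_partitions_eq_pmdExp]
  refine h _ fun x => ?_
  split_ifs with hx
  · have := G.payoff_mem i ℓ ⟨x, hx⟩
    rw [abs_of_nonneg this.1]
    exact this.2
  · simp

end AnonymousGame

/-- Kronecker substitution: the total weight is below Y, so there are no carries, and a base-Y digit
is the total weight with that exponent. Smaller exponents together stay below Y^y, larger ones are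
multiples of Y^(y+1). -/
theorem sum_mul_pow_div_mod {κ : Type*} (s : Finset κ) (w e : κ → ℕ) {Y : ℕ}
    (hw : ∑ c ∈ s, w c < Y) (y : ℕ) :
    (∑ c ∈ s, w c * Y ^ e c) / Y ^ y % Y = ∑ c ∈ s with e c = y, w c := by
  classical
  have hY : 0 < Y := by omega
  have hsplit : ∑ c ∈ s, w c * Y ^ e c = ∑ c ∈ s with e c < y, w c * Y ^ e c +
      Y ^ y * (∑ c ∈ s with e c = y, w c + Y * ∑ c ∈ s with y < e c, w c * Y ^ (e c - y - 1)) := by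
    rw [mul_add, Finset.mul_sum, Finset.mul_sum, Finset.mul_sum, Finset.sum_filter,
      Finset.sum_filter, Finset.sum_filter, ← Finset.sum_add_distrib, ← Finset.sum_add_distrib]
    refine Finset.sum_congr rfl fun c _ => ?_
    rcases lt_trichotomy (e c) y with h | h | h
    · simp [h, h.ne, h.not_gt]
    · simp [h, mul_comm]
    · simp only [h.not_gt, if_false, h.ne', h, if_true, zero_add]
      rw [show Y ^ y * (Y * (w c * Y ^ (e c - y - 1))) = w c * Y ^ (y + 1 + (e c - y - 1)) by ring]
      congr 2
      omega
  have hsmall : ∑ c ∈ s with e c < y, w c * Y ^ e c < Y ^ y := by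
    rcases Nat.eq_zero_or_pos y with rfl | hy
    · simp
    · calc ∑ c ∈ s with e c < y, w c * Y ^ e c ≤ ∑ c ∈ s with e c < y, w c * Y ^ (y - 1) :=
            Finset.sum_le_sum fun c hc => Nat.mul_le_mul_left _ (Nat.pow_le_pow_right hY (by
              have := (Finset.mem_filter.mp hc).2
              omega))
        _ = (∑ c ∈ s with e c < y, w c) * Y ^ (y - 1) := by rw [Finset.sum_mul]
        _ ≤ (∑ c ∈ s, w c) * Y ^ (y - 1) :=
            Nat.mul_le_mul_right _ (Finset.sum_le_sum_of_subset (Finset.filter_subset _ _))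
        _ < Y * Y ^ (y - 1) := Nat.mul_lt_mul_of_pos_right hw (Nat.pow_pos hY)
        _ = Y ^ y := by rw [← pow_succ', Nat.sub_add_cancel hy]
  have hmid : ∑ c ∈ s with e c = y, w c < Y :=
    (Finset.sum_le_sum_of_subset (Finset.filter_subset _ _)).trans_lt hw
  rw [hsplit, Nat.add_mul_div_left _ _ (Nat.pow_pos hY), Nat.div_eq_of_lt hsmall, zero_add,
    Nat.add_mul_mod_self_left, Nat.mod_eq_of_lt hmid]

variable {n k D N : ℕ}

/-- The strategies with code `c`, as integers with sum `D`. -/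
def codeRow (n k D N c : ℕ) (j : Fin N) (h : Fin k) : ℕ :=
  RAM.rowEntry D k (RAM.profCode n k D c j) h

theorem sum_codeRow (hk : 0 < k) (c : ℕ) (j : Fin N) : ∑ h, codeRow n k D N c j h = D := by
  simp only [codeRow]
  rw [Fin.sum_univ_eq_sum_range (fun h => RAM.rowEntry D k (RAM.profCode n k D c j) h) k]
  exact RAM.sum_rowEntry hk

theorem sum_prod_codeRow (hk : 0 < k) (c : ℕ) :
    ∑ s : Fin N → Fin k, ∏ j, codeRow n k D N c j (s j) = D ^ N := by
  rw [← Fintype.piFinset_univ, ← Finset.prod_univ_sum]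
  simp [sum_codeRow hk]

theorem prod_rowVal_eq (Y c : ℕ) :
    ∏ i ∈ Finset.range N, RAM.rowVal D k (fun h => Y ^ n ^ h) (RAM.profCode n k D c i) =
      ∑ s : Fin N → Fin k, (∏ j, codeRow n k D N c j (s j)) * Y ^ ∑ j, n ^ (s j : ℕ) := by
  rw [← Fin.prod_univ_eq_prod_range
    (fun i => RAM.rowVal D k (fun h => Y ^ n ^ h) (RAM.profCode n k D c i)) N]
  have h1 : ∀ j : Fin N, RAM.rowVal D k (fun h => Y ^ n ^ h) (RAM.profCode n k D c j) =
      ∑ h : Fin k, codeRow n k D N c j h * Y ^ n ^ (h : ℕ) := fun j => by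
    rw [RAM.rowVal, ← Fin.sum_univ_eq_sum_range
      (fun h => RAM.rowEntry D k (RAM.profCode n k D c j) h * Y ^ n ^ h) k]
    rfl
  simp_rw [h1]
  rw [Finset.prod_univ_sum, Fintype.piFinset_univ]
  refine Finset.sum_congr rfl fun s _ => ?_
  rw [Finset.prod_mul_distrib, Finset.prod_pow_eq_pow_sum]

theorem sum_pow_lt (hn : N < n) (hk : 0 < k) (s : Fin N → Fin k) : ∑ j, n ^ (s j : ℕ) < n ^ k := by
  calc ∑ j, n ^ (s j : ℕ) ≤ ∑ _j : Fin N, n ^ (k - 1) :=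
        Finset.sum_le_sum fun j _ => Nat.pow_le_pow_right (by omega) (by have := (s j).2; omega)
    _ = N * n ^ (k - 1) := by simp
    _ < n * n ^ (k - 1) := Nat.mul_lt_mul_of_pos_right hn (Nat.pow_pos (by omega))
    _ = n ^ k := by rw [← pow_succ', Nat.sub_add_cancel hk]

/-- The total scaled mass is D^N < Y, so the digits are the exact masses. The digit place ∑_j
n^(s_j) is the base-n reading of the count vector that also addresses the payoff table. -/
theorem codePayoff_eq (hn : N < n) (hk : 0 < k) (α : ℕ → ℕ) (i c ℓ : ℕ) :
    RAM.codePayoff n k D N (D ^ N + 1) (n ^ k) α i c ℓ =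
      ∑ s : Fin N → Fin k, (∏ j, codeRow n k D N c j (s j)) *
        α ((i * k + ℓ) * n ^ k + ∑ j, n ^ (s j : ℕ)) := by
  have hmass : ∀ y, RAM.codeDigitMass n k D N (D ^ N + 1) c y =
      ∑ s : Fin N → Fin k with ∑ j, n ^ (s j : ℕ) = y, ∏ j, codeRow n k D N c j (s j) := fun y => by
    rw [RAM.codeDigitMass, prod_rowVal_eq]
    exact sum_mul_pow_div_mod _ _ _ (by rw [sum_prod_codeRow hk]; omega) y
  simp only [RAM.codePayoff, hmass]
  have hmap : ∀ s ∈ (Finset.univ : Finset (Fin N → Fin k)),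
      ∑ j, n ^ (s j : ℕ) ∈ Finset.range (n ^ k) :=
    fun s _ => Finset.mem_range.mpr (sum_pow_lt hn hk s)
  rw [← Finset.sum_fiberwise_of_maps_to hmap]
  refine Finset.sum_congr rfl fun y _ => ?_
  rw [Finset.sum_mul]
  refine Finset.sum_congr rfl fun s hs => ?_
  rw [(Finset.mem_filter.mp hs).2]

theorem payoffIndex_sum_single (i : Fin n) (ℓ : Fin k) (s : Fin N → Fin k) :
    payoffIndex n k i ℓ (∑ j, Pi.single (s j) 1) =
      ((i : ℕ) * k + ℓ) * n ^ k + ∑ j, n ^ (s j : ℕ) := by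
  rw [payoffIndex]
  congr 1
  simp only [Finset.sum_apply, Finset.sum_mul]
  rw [Finset.sum_comm]
  refine Finset.sum_congr rfl fun j _ => ?_
  rw [Finset.sum_eq_single (s j)]
  · simp
  · intro h _ hne
    simp [hne]
  · simp

theorem sum_single_mem_partitions (s : Fin N → Fin k) :
    (∑ j, (Pi.single (s j) 1 : Fin k → ℕ)) ∈ Partitions N k := by
  rw [Finset.mem_piAntidiag]
  refine ⟨?_, by simp⟩
  simp only [Finset.sum_apply]
  rw [Finset.sum_comm]
  simp

/-- The strategies with code `c`. -/
noncomputable def codeProfile (n k D N c : ℕ) (j : Fin N) (h : Fin k) : ℝ :=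
  (codeRow n k D N c j h : ℝ) / D

theorem codeProfile_mem_stdSimplex (hk : 0 < k) (hD : 0 < D) (c : ℕ) (j : Fin N) :
    codeProfile n k D N c j ∈ stdSimplex ℝ (Fin k) := by
  refine ⟨fun h => by unfold codeProfile; positivity, ?_⟩
  simp only [codeProfile, ← Finset.sum_div, ← Nat.cast_sum, sum_codeRow hk]
  exact div_self (by positivity)

theorem codeVal_le {A Y S : ℕ} {α : ℕ → ℕ} (hn : N < n) (hk : 0 < k) (hα : ∀ q, α q ≤ A)
    (hY : Y = D ^ N + 1) (hS : S = n ^ k) (i c : ℕ) :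
    RAM.codeVal n k D N Y S α i c ≤ D ^ N * A := by
  subst hY hS
  refine Finset.sup_le fun ℓ _ => ?_
  rw [codePayoff_eq hn hk, ← sum_prod_codeRow (n := n) (D := D) hk c, Finset.sum_mul]
  exact Finset.sum_le_sum fun s _ => Nat.mul_le_mul_left _ (hα _)

theorem cast_codeVal_eq {Y S : ℕ} (hk : 0 < k) (α : ℕ → ℕ) (i c : ℕ) :
    (RAM.codeVal n k D N Y S α i c : ℝ) =
      ⨆ ℓ : Fin k, (RAM.codePayoff n k D N Y S α i c ℓ : ℝ) := by
  have : Nonempty (Fin k) := ⟨⟨0, hk⟩⟩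
  have hbdd := (Set.finite_range
    fun ℓ : Fin k => (RAM.codePayoff n k D N Y S α i c ℓ : ℝ)).bddAbove
  refine le_antisymm ?_ (ciSup_le fun ℓ => ?_)
  · obtain ⟨ℓ, hℓ, h⟩ := Finset.exists_mem_eq_sup (Finset.range k) ⟨0, Finset.mem_range.mpr hk⟩
      (RAM.codePayoff n k D N Y S α i c)
    rw [RAM.codeVal, h]
    exact le_ciSup hbdd ⟨ℓ, Finset.mem_range.mp hℓ⟩
  · exact_mod_cast Finset.le_sup (f := RAM.codePayoff n k D N Y S α i c)
      (Finset.mem_range.mpr ℓ.2)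

/-- The computed values are close to the payoffs. -/
theorem abs_codeVal_sub_bestPayoff_le {n k D m : ℕ} (hn : 2 ≤ n) (hk : 0 < k) (hD : 0 < D)
    (hm : 0 < m) (G : AnonymousGame n k) (a : Fin n → Fin k → Partitions (n - 1) k → ℕ) {α : ℕ → ℕ}
    (ha : ∀ i ℓ x, |G.payoff i ℓ x - (a i ℓ x : ℝ) / (4 * m)| ≤ 1 / (4 * m))
    (hα : ∀ i ℓ (x : Partitions (n - 1) k), α (payoffIndex n k i ℓ x) = a i ℓ x)
    (i : Fin n) (c : ℕ) :
    |(RAM.codeVal n k D (n - 1) (D ^ (n - 1) + 1) (n ^ k) α i c : ℝ) / (4 * m * D ^ (n - 1)) -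
      G.bestPayoff i (pmdMass (codeProfile n k D (n - 1) c))| ≤ 1 / (4 * m) := by
  have : Nonempty (Fin k) := ⟨⟨0, hk⟩⟩
  have hDR : (0 : ℝ) < D := by exact_mod_cast hD
  have hmR : (0 : ℝ) < m := by exact_mod_cast hm
  have hden : (0 : ℝ) < 4 * m * (D : ℝ) ^ (n - 1) := by positivity
  have hsup : (⨆ ℓ : Fin k, (RAM.codePayoff n k D (n - 1) (D ^ (n - 1) + 1) (n ^ k) α i c ℓ : ℝ)) /
      (4 * m * D ^ (n - 1)) =
      ⨆ ℓ : Fin k, (RAM.codePayoff n k D (n - 1) (D ^ (n - 1) + 1) (n ^ k) α i c ℓ : ℝ) /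
        (4 * m * D ^ (n - 1)) := by
    simp only [div_eq_mul_inv]
    exact Real.iSup_mul_of_nonneg (by positivity) _
  rw [cast_codeVal_eq hk, hsup]
  refine abs_ciSup_sub_ciSup_le fun ℓ => ?_
  rw [sum_partitions_eq_pmdExp, codePayoff_eq (by omega) hk, pmdExp]
  push_cast
  rw [Finset.sum_div, ← Finset.sum_sub_distrib]
  have hsum : ∑ s : Fin (n - 1) → Fin k, ∏ j, codeProfile n k D (n - 1) c j (s j) = 1 :=
    sum_prod_eq_one _ fun j => (codeProfile_mem_stdSimplex hk hD c j).2
  calc _ ≤ ∑ s : Fin (n - 1) → Fin k,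
        (∏ j, codeProfile n k D (n - 1) c j (s j)) * (1 / (4 * m)) := by
        refine (Finset.abs_sum_le_sum_abs _ _).trans (Finset.sum_le_sum fun s _ => ?_)
        have hmem := sum_single_mem_partitions s
        have hprod : ∏ j, codeProfile n k D (n - 1) c j (s j) =
            (∏ j, (codeRow n k D (n - 1) c j (s j) : ℝ)) / (D : ℝ) ^ (n - 1) := by
          simp [codeProfile, Finset.prod_div_distrib]
        have h0 : 0 ≤ ∏ j, codeProfile n k D (n - 1) c j (s j) :=
          Finset.prod_nonneg fun j _ => (codeProfile_mem_stdSimplex hk hD c j).1 _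
        rw [dif_pos hmem, ← payoffIndex_sum_single i ℓ s, hα i ℓ ⟨_, hmem⟩]
        have e : (∏ j, (codeRow n k D (n - 1) c j (s j) : ℝ)) * (a i ℓ ⟨_, hmem⟩ : ℝ) /
            (4 * m * D ^ (n - 1)) = (∏ j, codeProfile n k D (n - 1) c j (s j)) *
              ((a i ℓ ⟨_, hmem⟩ : ℝ) / (4 * m)) := by
          rw [hprod]
          field_simp
        rw [e, ← mul_sub, abs_mul, abs_of_nonneg h0, abs_sub_comm]
        exact mul_le_mul_of_nonneg_left (ha i ℓ _) h0
    _ = 1 / (4 * m) := by rw [← Finset.sum_mul, hsum, one_mul]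

end Semantics

/-! ### Encoding a profile -/

section Encoding

variable {n k D N : ℕ}

/-- The code of a row. -/
def rowCode (D : ℕ) (d : Fin k → ℕ) : ℕ := ∑ h, d h * (D + 1) ^ (h : ℕ)

theorem rowCode_lt {d : Fin k → ℕ} (hk : 0 < k) (hd : ∑ h, d h = D) :
    rowCode D d < (D + 1) ^ k := by
  calc rowCode D d ≤ ∑ h, d h * (D + 1) ^ (k - 1) :=
        Finset.sum_le_sum fun h _ =>
          Nat.mul_le_mul_left _ (Nat.pow_le_pow_right (by omega) (by have := h.2; omega))
    _ = D * (D + 1) ^ (k - 1) := by rw [← Finset.sum_mul, hd]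
    _ < (D + 1) * (D + 1) ^ (k - 1) := Nat.mul_lt_mul_of_pos_right (by omega) (Nat.pow_pos (by omega))
    _ = (D + 1) ^ k := by rw [← pow_succ', Nat.sub_add_cancel hk]

theorem codeDigit_rowCode {d : Fin k → ℕ} (hd : ∑ h, d h = D) (h : Fin k) :
    RAM.codeDigit D (rowCode D d) h = d h := by
  rw [RAM.codeDigit, rowCode,
    sum_mul_pow_div_mod Finset.univ d (fun h => (h : ℕ)) (by rw [hd]; omega)]
  rw [Finset.sum_eq_single h]
  · intro b hb hne
    exact absurd (Fin.ext (Finset.mem_filter.mp hb).2) hne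
  · simp

theorem sum_filter_lt_succ (d : Fin k → ℕ) {j : ℕ} (hj : j < k) :
    ∑ h ∈ Finset.univ.filter (fun h : Fin k => (h : ℕ) < j + 1), d h =
      d ⟨j, hj⟩ + ∑ h ∈ Finset.univ.filter (fun h : Fin k => (h : ℕ) < j), d h := by
  rw [← Finset.sum_insert (by simp)]
  refine Finset.sum_congr (Finset.ext fun h => ?_) fun _ _ => rfl
  simp only [Finset.mem_filter, Finset.mem_univ, true_and, Finset.mem_insert, Fin.ext_iff]
  omega

theorem rowRem_rowCode {d : Fin k → ℕ} (hd : ∑ h, d h = D) :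
    ∀ j ≤ k, RAM.rowRem D (rowCode D d) j + ∑ h ∈ Finset.univ.filter (fun h : Fin k => (h : ℕ) < j), d h = D
  | 0, _ => by simp [RAM.rowRem]
  | j + 1, hj => by
    have ih := rowRem_rowCode hd j (by omega)
    have hsplit := sum_filter_lt_succ d hj
    have hle : ∑ h ∈ Finset.univ.filter (fun h : Fin k => (h : ℕ) < j + 1), d h ≤ D :=
      (Finset.sum_le_sum_of_subset (Finset.filter_subset _ _)).trans_eq hd
    rw [RAM.rowRem, codeDigit_rowCode hd ⟨j, hj⟩]
    omega

theorem codeDigit_add_mul {r x h : ℕ} (hh : h < k) :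
    RAM.codeDigit D (r + (D + 1) ^ k * x) h = RAM.codeDigit D r h := by
  have e : (D + 1) ^ k * x = (D + 1) ^ h * ((D + 1) * ((D + 1) ^ (k - h - 1) * x)) := by
    rw [← mul_assoc, ← mul_assoc, ← pow_succ, ← pow_add]
    congr 2
    omega
  rw [RAM.codeDigit, RAM.codeDigit, e, Nat.add_mul_div_left _ _ (by positivity),
    Nat.add_mul_mod_self_left]

theorem rowRem_add_mul {r x : ℕ} : ∀ j ≤ k,
    RAM.rowRem D (r + (D + 1) ^ k * x) j = RAM.rowRem D r j
  | 0, _ => rfl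
  | j + 1, hj => by
    rw [RAM.rowRem, RAM.rowRem, codeDigit_add_mul hj, rowRem_add_mul j (by omega)]

/-- Only the k lowest digits are read. This is why the decoder need not separate the row code from
the codes of later types, which sit above it as a multiple of (D + 1)^k. -/
theorem rowEntry_rowCode {d : Fin k → ℕ} (hd : ∑ h, d h = D) (x : ℕ) (h : Fin k) :
    RAM.rowEntry D k (rowCode D d + (D + 1) ^ k * x) h = d h := by
  have h1 := rowRem_rowCode hd h h.2.le
  have h2 := rowRem_rowCode hd (h + 1) h.2
  have h3 := rowRem_rowCode hd k le_rfl
  have hall : ∑ h ∈ Finset.univ.filter (fun h : Fin k => (h : ℕ) < k), d h = D := by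
    rw [Finset.filter_true_of_mem fun h _ => h.2, hd]
  rw [RAM.rowRem, codeDigit_rowCode hd h] at h2
  have hsplit := sum_filter_lt_succ d h.2
  rw [RAM.rowEntry, rowRem_add_mul _ le_rfl, rowRem_add_mul _ h.2.le, codeDigit_add_mul h.2,
    codeDigit_rowCode hd h]
  have : RAM.rowRem D (rowCode D d) k = 0 := by omega
  rw [this, Fin.eta] at *
  split_ifs <;> omega

/-- The rows that a list of slots (kind, multiplicity, row) describes. -/
def slotRows (L : List (ℕ × ℕ × (Fin k → ℕ))) : List (Fin k → ℕ) :=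
  L.flatMap fun s => List.replicate s.2.1 s.2.2

/-- The largest multiplicity of a slot. -/
def kindBase (n D κ : ℕ) : ℕ := κ * n + (1 - κ) * (D + 1)

/-- A mixed-radix code read from the lowest digit: the kind, the multiplicity minus one, the row,
the other slots. The kind comes first because it determines the radix for the multiplicity. -/
def slotCode (n D : ℕ) : List (ℕ × ℕ × (Fin k → ℕ)) → ℕ
  | [] => 0
  | s :: L => s.1 + 2 * (s.2.1 - 1 + kindBase n D s.1 *
      (rowCode D s.2.2 + (D + 1) ^ k * slotCode n D L))

structure SlotValid (n D : ℕ) (s : ℕ × ℕ × (Fin k → ℕ)) : Prop where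
  kind : s.1 < 2
  pos : 0 < s.2.1
  lt : s.2.1 - 1 < kindBase n D s.1
  sum : ∑ h, s.2.2 h = D

theorem decStep_slotCode {s : ℕ × ℕ × (Fin k → ℕ)} (hk : 0 < k) (hs : SlotValid n D s)
    (L : List (ℕ × ℕ × (Fin k → ℕ))) (r : ℕ) :
    RAM.decStep n k D (slotCode n D (s :: L), 0, r) =
      (slotCode n D L, s.2.1 - 1, rowCode D s.2.2 + (D + 1) ^ k * slotCode n D L) := by
  obtain ⟨h1, h2, h3, h4⟩ := hs
  have h5 := rowCode_lt hk h4
  have hb : RAM.slotBase n D (slotCode n D (s :: L)) = kindBase n D s.1 := by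
    rw [RAM.slotBase, slotCode, Nat.add_mul_mod_self_left, Nat.mod_eq_of_lt h1, kindBase]
  have hhalf : slotCode n D (s :: L) / 2 =
      s.2.1 - 1 + kindBase n D s.1 * (rowCode D s.2.2 + (D + 1) ^ k * slotCode n D L) := by
    rw [slotCode]
    omega
  rw [RAM.decStep, if_pos rfl]
  simp only
  rw [hb, hhalf, Nat.add_mul_mod_self_left, Nat.mod_eq_of_lt h3,
    Nat.add_mul_div_left _ _ (by omega), Nat.div_eq_of_lt h3, zero_add,
    Nat.add_mul_div_left _ _ (by positivity), Nat.div_eq_of_lt h5, zero_add]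

theorem iterate_decStep_of_le (c r : ℕ) : ∀ j μ, j ≤ μ →
    (RAM.decStep n k D)^[j] (c, μ, r) = (c, μ - j, r)
  | 0, μ, _ => rfl
  | j + 1, μ, hj => by
    rw [Function.iterate_succ_apply', iterate_decStep_of_le c r j μ (by omega), RAM.decStep,
      if_neg (by simp only; omega)]
    simp only [Prod.mk.injEq, and_true, true_and]
    omega

theorem decState_eq_iterate (c j : ℕ) :
    RAM.decState n k D c j = (RAM.decStep n k D)^[j] (c, 0, 0) := by
  induction j with
  | zero => rfl
  | succ j ih => rw [Function.iterate_succ_apply', ← ih, RAM.decState]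

theorem rowEntry_iterate_slotCode (hk : 0 < k) : ∀ (L : List (ℕ × ℕ × (Fin k → ℕ))) (r j : ℕ),
    (∀ s ∈ L, SlotValid n D s) → ∀ hj : j < (slotRows L).length, ∀ h : Fin k,
      RAM.rowEntry D k ((RAM.decStep n k D)^[j + 1] (slotCode n D L, 0, r)).2.2 h =
        (slotRows L)[j] h
  | [], _, _, _, hj, _ => by simp [slotRows] at hj
  | s :: L, r, j, hL, hj, h => by
    have hs := hL s (by simp)
    have hrows : slotRows (s :: L) = List.replicate s.2.1 s.2.2 ++ slotRows L := by
      simp [slotRows]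
    have hj' : j < (List.replicate s.2.1 s.2.2 ++ slotRows L).length := by rwa [← hrows]
    have hget : (slotRows (s :: L))[j] = (List.replicate s.2.1 s.2.2 ++ slotRows L)[j] := by
      simp only [hrows]
    refine Eq.trans ?_ (congrFun hget h).symm
    rw [List.length_append, List.length_replicate] at hj'
    clear hget
    by_cases hlt : j < s.2.1
    · rw [Function.iterate_succ_apply, decStep_slotCode hk hs,
        iterate_decStep_of_le _ _ j _ (by omega), rowEntry_rowCode hs.sum,
        List.getElem_append_left (by simpa using hlt), List.getElem_replicate]
    · obtain ⟨i, rfl⟩ := Nat.exists_eq_add_of_le (not_lt.mp hlt)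
      have hμ : s.2.1 = s.2.1 - 1 + 1 := by have := hs.pos; omega
      -- A slot of multiplicity μ takes μ steps: one opens it and μ - 1 count down. Then the counter
      -- is 0 and the rest of the code is read; the stale row code is irrelevant, which is why r is
      -- arbitrary.
      have h1 : (RAM.decStep n k D)^[s.2.1 + i + 1] (slotCode n D (s :: L), 0, r) =
          (RAM.decStep n k D)^[i + 1] (slotCode n D L, 0,
            rowCode D s.2.2 + (D + 1) ^ k * slotCode n D L) := by
        rw [show s.2.1 + i + 1 = i + 1 + s.2.1 by ring, Function.iterate_add_apply]
        congr 1
        rw [hμ, Function.iterate_succ_apply, decStep_slotCode hk hs,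
          iterate_decStep_of_le _ _ _ _ le_rfl, Nat.sub_self]
      rw [h1, rowEntry_iterate_slotCode hk L _ i (fun s' hs' => hL s' (by simp [hs'])) (by omega)]
      rw [List.getElem_append_right (by simp)]
      have hidx : ∀ (a b : ℕ) (ha : a < (slotRows L).length) (hb : b < (slotRows L).length),
          a = b → (slotRows L)[a] h = (slotRows L)[b] h := by
        rintro a _ ha hb rfl
        rfl
      exact hidx _ _ _ _ (by simp)

theorem slotCode_lt (hk : 0 < k) : ∀ L : List (ℕ × ℕ × (Fin k → ℕ)),
    (∀ s ∈ L, SlotValid n D s) →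
      slotCode n D L < (L.map fun s => 2 * kindBase n D s.1 * (D + 1) ^ k).prod
  | [], _ => by simp [slotCode]
  | s :: L, hL => by
    have hs := hL s (by simp)
    have ih := slotCode_lt hk L fun s' hs' => hL s' (by simp [hs'])
    have h5 := rowCode_lt hk hs.sum
    rw [List.map_cons, List.prod_cons, slotCode]
    set P := (L.map fun s => 2 * kindBase n D s.1 * (D + 1) ^ k).prod
    have h1 : rowCode D s.2.2 + (D + 1) ^ k * slotCode n D L + 1 ≤ (D + 1) ^ k * P := by
      calc _ ≤ (D + 1) ^ k + (D + 1) ^ k * slotCode n D L := by omega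
        _ = (D + 1) ^ k * (slotCode n D L + 1) := by ring
        _ ≤ _ := Nat.mul_le_mul_left _ ih
    have h2 := Nat.mul_le_mul_left (kindBase n D s.1) h1
    have h3 := hs.lt
    have h4 := hs.kind
    rw [mul_add, mul_one] at h2
    have e : 2 * kindBase n D s.1 * (D + 1) ^ k * P =
      2 * (kindBase n D s.1 * ((D + 1) ^ k * P)) := by ring
    rw [e]
    omega

theorem coe_slotRows (L : List (ℕ × ℕ × (Fin k → ℕ))) :
    (slotRows L : Multiset (Fin k → ℕ)) = (L.map fun s => s.2.1 • ({s.2.2} : Multiset _)).sum := by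
  induction L with
  | nil => rfl
  | cons s L ih =>
    rw [List.map_cons, List.sum_cons, ← ih, Multiset.nsmul_singleton, ← Multiset.coe_replicate,
      Multiset.coe_add, slotRows, List.flatMap_cons]
    rfl

/-- One slot of kind `κ` for each type in `S`. -/
noncomputable def typeSlots {ι : Type} [DecidableEq ι] (κ : ℕ) (S : Finset ι) (d : ι → Fin k → ℕ) :
    List (ℕ × ℕ × (Fin k → ℕ)) :=
  (S.image d).toList.map fun t => (κ, (S.filter fun i => d i = t).card, t)

section TypeSlots

variable {ι : Type} [DecidableEq ι] (κ : ℕ) (S : Finset ι) (d : ι → Fin k → ℕ)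

theorem sum_typeSlots :
    ((typeSlots κ S d).map fun s => s.2.1 • ({s.2.2} : Multiset (Fin k → ℕ))).sum =
      S.val.map d := by
  rw [typeSlots, List.map_map]
  simp only [Function.comp_def]
  rw [Finset.sum_map_toList (S.image d)
    fun t => (S.filter fun i => d i = t).card • ({t} : Multiset (Fin k → ℕ))]
  have h : S.val.map d = ∑ i ∈ S, ({d i} : Multiset (Fin k → ℕ)) := by
    rw [Finset.sum, ← Multiset.sum_map_singleton (S.val.map d), Multiset.map_map]
    rfl
  rw [h, ← Finset.sum_fiberwise_of_maps_to fun i hi => Finset.mem_image_of_mem d hi]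
  refine Finset.sum_congr rfl fun t _ => ?_
  rw [Finset.sum_congr rfl fun i hi => by rw [(Finset.mem_filter.mp hi).2], Finset.sum_const]

theorem typeSlots_valid (hκ : κ < 2) (hd : ∀ i, ∑ h, d i h = D)
    (hS : S.card ≤ kindBase n D κ) : ∀ s ∈ typeSlots κ S d, SlotValid n D s := by
  intro s hs
  obtain ⟨t, ht, rfl⟩ := List.mem_map.mp hs
  rw [Finset.mem_toList] at ht
  obtain ⟨i, hi, rfl⟩ := Finset.mem_image.mp ht
  have hpos : 0 < (S.filter fun j => d j = d i).card :=
    Finset.card_pos.mpr ⟨i, Finset.mem_filter.mpr ⟨hi, rfl⟩⟩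
  have hle : (S.filter fun j => d j = d i).card ≤ S.card := Finset.card_filter_le _ _
  exact ⟨hκ, hpos, by simp only; omega, hd i⟩

theorem prod_typeSlots {M : ℕ} (hM : (S.image d).card ≤ M)
    (hb : 0 < 2 * kindBase n D κ * (D + 1) ^ k) :
    ((typeSlots κ S d).map fun s => 2 * kindBase n D s.1 * (D + 1) ^ k).prod ≤
      (2 * kindBase n D κ * (D + 1) ^ k) ^ M := by
  rw [typeSlots, List.map_map]
  simp only [Function.comp_def, List.map_const', List.prod_replicate, Finset.length_toList]
  exact Nat.pow_le_pow_right hb hM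

end TypeSlots

/-- Equal multisets of values mean fibres of equal size, and bijections of the fibres glue together.
-/
theorem exists_equiv_of_map_eq {ι β : Type} [Fintype ι] [DecidableEq β] (f g : ι → β)
    (h : Finset.univ.val.map f = Finset.univ.val.map g) : ∃ e : ι ≃ ι, ∀ i, f i = g (e i) := by
  have hcard : ∀ b, Fintype.card {i // f i = b} = Fintype.card {i // g i = b} := by
    intro b
    have := congrArg (Multiset.count b) h
    rw [Multiset.count_map, Multiset.count_map] at this
    rw [Fintype.card_subtype, Fintype.card_subtype, Finset.card_def, Finset.card_def]
    simpa [Finset.filter_val, eq_comm] using this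
  refine ⟨Equiv.ofFiberEquiv fun b => Fintype.equivOfCardEq (hcard b), fun i =>
    (Equiv.ofFiberEquiv_map _ i).symm⟩

/-- Every profile with few types is, up to a permutation of the players, given by a code. -/
theorem exists_code_of_few_types {M₁ M₂ : ℕ} (hN : N ≤ n) (hn : 0 < n) (hk : 0 < k)
    (d : Fin N → Fin k → ℕ) (hd : ∀ i, ∑ h, d i h = D) (E : Finset (Fin N))
    (hE₁ : (d '' (E : Set (Fin N))ᶜ).ncard ≤ M₁) (hE₂ : (d '' (E : Set (Fin N))).ncard ≤ M₂)
    (hE : E.card ≤ D) :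
    ∃ c < RAM.codeCount n k D M₁ M₂, ∃ e : Fin N ≃ Fin N, ∀ j, codeRow n k D N c j = d (e j) := by
  rw [← Finset.coe_compl, ← Finset.coe_image, Set.ncard_coe_finset] at hE₁
  rw [← Finset.coe_image, Set.ncard_coe_finset] at hE₂
  have hb₁ : kindBase n D 1 = n := by simp [kindBase]
  have hb₀ : kindBase n D 0 = D + 1 := by simp [kindBase]
  -- Kind 1 allows multiplicities up to n, for the types outside E; kind 0 allows D + 1, enough
  -- inside E. Codes with fewer slots than M₁ and M₂ stay below the count as well, because the
  -- radices are positive.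
  set L := typeSlots 1 Eᶜ d ++ typeSlots 0 E d with hL
  have hvalid : ∀ s ∈ L, SlotValid n D s := by
    intro s hs
    rcases List.mem_append.mp hs with h | h
    · refine typeSlots_valid _ _ _ (by norm_num) hd ?_ s h
      rw [hb₁]
      exact (Finset.card_le_univ _).trans (by simpa using hN)
    · refine typeSlots_valid _ _ _ (by norm_num) hd ?_ s h
      rw [hb₀]
      omega
  have hrows : (slotRows L : Multiset (Fin k → ℕ)) = Finset.univ.val.map d := by
    rw [coe_slotRows, hL, List.map_append, List.sum_append, sum_typeSlots, sum_typeSlots,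
      ← Multiset.map_add, ← Finset.disjUnion_val _ _ disjoint_compl_left,
      Finset.disjUnion_eq_union, ← Finset.sup_eq_union, compl_sup_eq_top, Finset.top_eq_univ]
  have hlen : (slotRows L).length = N := by
    have := congrArg Multiset.card hrows
    simpa using this
  refine ⟨slotCode n D L, (slotCode_lt hk L hvalid).trans_le ?_, ?_⟩
  · rw [hL, List.map_append, List.prod_append, RAM.codeCount]
    refine Nat.mul_le_mul ((prod_typeSlots 1 _ d hE₁ ?_).trans_eq ?_)
      ((prod_typeSlots 0 _ d hE₂ ?_).trans_eq ?_)
    · rw [hb₁]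
      positivity
    · rw [hb₁]
    · rw [hb₀]
      positivity
    · rw [hb₀]
      congr 1
      ring
  · have hrow : ∀ j : Fin N, codeRow n k D N (slotCode n D L) j =
        (slotRows L)[(j : ℕ)]'(by rw [hlen]; exact j.2) := fun j => funext fun h => by
      rw [codeRow, RAM.profCode, decState_eq_iterate]
      exact rowEntry_iterate_slotCode hk L 0 j hvalid (by rw [hlen]; exact j.2) h
    refine exists_equiv_of_map_eq _ _ ?_
    rw [← hrows, Fin.univ_val_map]
    congr 1
    refine List.ext_getElem (by simp [hlen]) fun j h1 h2 => ?_
    rw [List.getElem_ofFn, hrow]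

end Encoding

/-! ### The running time -/

section RunningTime

variable {n k m : ℕ}

/-- The exponent that governs the number of codes. -/
def workSize (k m : ℕ) : ℕ := k * paramSize k m * 8 ^ (k + 5) * k * (heavyTypes k + lightTypes k m)

def momentRatio (k m : ℕ) : ℕ := paramSize k m / (paramSize k m).size + 1

theorem paramSize_pos (hk : 3 ≤ k) (hm : 1 ≤ m) : 0 < paramSize k m :=
  Nat.size_pos.mpr (Nat.mul_pos (by omega) hm)

/-- With b the bit length of l, the factor 4^(b/8) is about l^(1/4), so b²·4^(b/8) ≤ 128·l. Hence
l·4^(b/8) is of order at most (l/b)². The exponent 1/8 in the choice of q leaves ample room for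
this. -/
theorem spreadFactor_le (hk : 3 ≤ k) (hm : 1 ≤ m) :
    spreadFactor k m ≤ 2 ^ 19 * k ^ 3 * momentRatio k m ^ 2 := by
  have hl := paramSize_pos hk hm
  rw [momentRatio, spreadFactor]
  set l := paramSize k m
  set b := l.size with hb
  have hb0 : 0 < b := Nat.size_pos.mpr hl
  set w := l / b + 1 with hw
  have hlw : l ≤ b * w := by
    have := Nat.lt_mul_div_succ l hb0
    exact this.le
  set q := b / 8 with hq
  have hq1 : q + 1 ≤ 2 ^ q := Nat.lt_two_pow_self
  have hbq : b ≤ 8 * (q + 1) := by omega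
  have h2l : 16 ^ q ≤ 2 * l := by
    have h1 : 2 ^ (b - 1) ≤ l := Nat.lt_size.mp (by omega)
    calc 16 ^ q = 2 ^ (4 * q) := by rw [pow_mul]; norm_num
      _ ≤ 2 ^ b := Nat.pow_le_pow_right (by norm_num) (by omega)
      _ = 2 * 2 ^ (b - 1) := by rw [← pow_succ', Nat.sub_add_cancel hb0]
      _ ≤ 2 * l := by omega
  have h1 : b ^ 2 * 4 ^ q ≤ 128 * l := by
    calc b ^ 2 * 4 ^ q ≤ (8 * 2 ^ q) ^ 2 * 4 ^ q :=
          Nat.mul_le_mul_right _ (Nat.pow_le_pow_left (hbq.trans (Nat.mul_le_mul_left _ hq1)) 2)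
      _ = 64 * 16 ^ q := by
          rw [mul_pow, ← pow_mul, mul_comm q 2, pow_mul, mul_assoc, ← mul_pow]
          norm_num
      _ ≤ 128 * l := by omega
  have h2 : l * 4 ^ q ≤ 128 * w ^ 2 := by
    refine Nat.le_of_mul_le_mul_left (a := l * 4 ^ q) (b := 128 * w ^ 2) (c := b ^ 2) ?_ (by positivity)
    calc b ^ 2 * (l * 4 ^ q) = l * (b ^ 2 * 4 ^ q) := by ring
      _ ≤ l * (128 * l) := Nat.mul_le_mul_left _ h1
      _ = 128 * l ^ 2 := by ring
      _ ≤ 128 * (b * w) ^ 2 := Nat.mul_le_mul_left _ (Nat.pow_le_pow_left hlw 2)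
      _ = b ^ 2 * (128 * w ^ 2) := by ring
  calc k * (64 * k ^ 2 * l) * (2 ^ (q + 3)) ^ 2 = 4096 * k ^ 3 * (l * 4 ^ q) := by
        rw [pow_add, mul_pow, ← pow_mul 2 q, mul_comm q 2, pow_mul]
        ring
    _ ≤ 4096 * k ^ 3 * (128 * w ^ 2) := Nat.mul_le_mul_left _ h2
    _ = 2 ^ 19 * k ^ 3 * w ^ 2 := by ring

theorem heavyTypes_le (hk : 3 ≤ k) : heavyTypes k ≤ 2 * k ^ 3 := by
  unfold heavyTypes gridTypeCount
  have h : k + 2 ≤ k ^ 2 := by nlinarith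
  calc k * (k + k ^ 2 + 1 + 1) ≤ k * (2 * k ^ 2) := Nat.mul_le_mul_left _ (by omega)
    _ = 2 * k ^ 3 := by ring

/-- Each contribution is at most Z^(k-1) with Z = 2^10 k³w. The removed players contribute about Z²,
which is where k ≥ 3 enters. The factor k for the groups is absorbed by k ≤ 2^(k-1). -/
theorem heavyTypes_add_lightTypes_le (hk : 3 ≤ k) (hm : 1 ≤ m) :
    heavyTypes k + lightTypes k m ≤ (2 ^ 11 * k ^ 3 * momentRatio k m) ^ (k - 1) := by
  have hK := spreadFactor_le hk hm
  have hH := heavyTypes_le hk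
  have hbase : (4 * k ^ 2 + 2) * (momentOrder k m + 2) ≤ 330 * k ^ 3 * momentRatio k m := by
    have h1 : 4 * k ^ 2 + 2 ≤ 5 * k ^ 2 := by nlinarith
    have h2 : momentOrder k m + 2 ≤ 66 * (k * momentRatio k m) := by
      have e : momentOrder k m = 64 * (k * momentRatio k m) + 1 := by
        rw [momentOrder, momentRatio]
        ring
      have : 3 * 1 ≤ k * momentRatio k m := Nat.mul_le_mul hk (Nat.succ_pos _)
      omega
    calc _ ≤ 5 * k ^ 2 * (66 * (k * momentRatio k m)) := Nat.mul_le_mul h1 h2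
      _ = _ := by ring
  have hw : 1 ≤ momentRatio k m := Nat.succ_pos _
  rw [lightTypes]
  set w := momentRatio k m
  set K := spreadFactor k m
  have hk0 : 0 < k := by omega
  set Z := 2 ^ 10 * k ^ 3 * w with hZ
  have hZ1 : 1 ≤ Z := Nat.mul_pos (by positivity) hw
  have hk2 : k ≤ 2 ^ (k - 1) := by
    have := Nat.lt_two_pow_self (n := k - 1)
    omega
  have hZ2 : Z ^ 2 ≤ Z ^ (k - 1) := Nat.pow_le_pow_right hZ1 (by omega)
  have t1 : k * (2 * k * K) ≤ Z ^ (k - 1) := by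
    refine le_trans ?_ hZ2
    calc k * (2 * k * K) ≤ k * (2 * k * (2 ^ 19 * k ^ 3 * w ^ 2)) := by gcongr
      _ = 2 ^ 20 * k ^ 5 * w ^ 2 := by ring
      _ ≤ 2 ^ 20 * k ^ 6 * w ^ 2 := by
          gcongr
          · omega
      _ = Z ^ 2 := by rw [hZ]; ring
  have t2 : k * ((4 * k ^ 2 + 2) * (momentOrder k m + 2)) ^ (k - 1) ≤ Z ^ (k - 1) := by
    calc _ ≤ 2 ^ (k - 1) * (330 * k ^ 3 * w) ^ (k - 1) :=
          Nat.mul_le_mul hk2 (Nat.pow_le_pow_left hbase _)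
      _ = (660 * k ^ 3 * w) ^ (k - 1) := by rw [← mul_pow]; ring
      _ ≤ Z ^ (k - 1) := Nat.pow_le_pow_left (by rw [hZ]; gcongr; norm_num) _
  have t3 : heavyTypes k + k ≤ Z ^ (k - 1) := by
    refine le_trans ?_ hZ2
    have h1 : k ≤ k ^ 3 := Nat.le_self_pow (by norm_num) _
    have h2 : 3 * k ^ 3 ≤ Z := by
      calc 3 * k ^ 3 ≤ 2 ^ 10 * k ^ 3 := Nat.mul_le_mul_right _ (by norm_num)
        _ ≤ Z := Nat.le_mul_of_pos_right _ hw
    have h3 : Z ≤ Z ^ 2 := Nat.le_self_pow (by norm_num) _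
    omega
  have h4 : 4 ≤ 2 ^ (k - 1) := by
    calc 4 = 2 ^ 2 := by norm_num
      _ ≤ 2 ^ (k - 1) := Nat.pow_le_pow_right (by norm_num) (by omega)
  calc heavyTypes k + k * (2 * k * K + (((4 * k ^ 2 + 2) * (momentOrder k m + 2)) ^ (k - 1) + 1))
      = (heavyTypes k + k) + k * (2 * k * K) +
        k * ((4 * k ^ 2 + 2) * (momentOrder k m + 2)) ^ (k - 1) := by ring
    _ ≤ 4 * Z ^ (k - 1) := by omega
    _ ≤ 2 ^ (k - 1) * Z ^ (k - 1) := Nat.mul_le_mul_right _ h4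
    _ = (2 ^ 11 * k ^ 3 * w) ^ (k - 1) := by rw [← mul_pow, hZ]; ring

/-- All factors exponential in k, among them the exponent 8^(k+5) of the denominator, go into the
base of the power k - 1. Only one factor l remains outside. -/
theorem workSize_le (hk : 3 ≤ k) (hm : 1 ≤ m) :
    workSize k m ≤ paramSize k m * (2 ^ 25 * k ^ 3 * momentRatio k m) ^ (k - 1) := by
  have h1 := heavyTypes_add_lightTypes_le hk hm
  have hk2 : k ≤ 2 ^ (k - 1) := by
    have := Nat.lt_two_pow_self (n := k - 1)
    omega
  have h8 : 8 ^ (k + 5) ≤ (2 ^ 12) ^ (k - 1) := by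
    calc 8 ^ (k + 5) = 2 ^ (3 * (k + 5)) := by rw [pow_mul]; norm_num
      _ ≤ 2 ^ (12 * (k - 1)) := Nat.pow_le_pow_right (by norm_num) (by omega)
      _ = _ := by rw [pow_mul]
  rw [workSize]
  set w := momentRatio k m
  set l := paramSize k m
  calc k * l * 8 ^ (k + 5) * k * (heavyTypes k + lightTypes k m)
      ≤ 2 ^ (k - 1) * l * (2 ^ 12) ^ (k - 1) * 2 ^ (k - 1) * (2 ^ 11 * k ^ 3 * w) ^ (k - 1) := by
        gcongr
    _ = l * (2 * 2 ^ 12 * 2 * (2 ^ 11 * k ^ 3 * w)) ^ (k - 1) := by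
        have e : 2 * 2 ^ 12 * 2 * (2 ^ 11 * k ^ 3 * w) = 2 * (2 ^ 12 * (2 * (2 ^ 11 * k ^ 3 * w))) := by
          ring
        rw [e, mul_pow 2, mul_pow (2 ^ 12), mul_pow 2]
        generalize (2 : ℕ) ^ (k - 1) = a
        generalize ((2 : ℕ) ^ 12) ^ (k - 1) = b
        ring
    _ = _ := by
        congr 2
        ring

/-- Only the slots of heavy types have a multiplicity of size n; everything else is a power of D,
whose exponent `workSize` collects. -/
theorem codeCount_le (hk : 3 ≤ k) (hm : 1 ≤ m) :
    RAM.codeCount n k (gridDenom k m) (heavyTypes k) (lightTypes k m) ≤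
      n ^ heavyTypes k * 2 ^ (4 * workSize k m) := by
  have hl := paramSize_pos hk hm
  rw [RAM.codeCount, workSize, gridDenom]
  set E := k * paramSize k m * 8 ^ (k + 5) with hE
  have hE0 : 0 < E := by positivity
  have hD : 2 ^ E + 1 ≤ 2 ^ (2 * E) := by
    have h1 : 2 ^ (E + 1) ≤ 2 ^ (2 * E) := Nat.pow_le_pow_right (by norm_num) (by omega)
    have h2 : 1 ≤ 2 ^ E := Nat.one_le_two_pow
    rw [pow_succ] at h1
    omega
  have hDk : (2 ^ E + 1) ^ k ≤ 2 ^ (2 * E * k) := by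
    rw [pow_mul 2 (2 * E)]
    exact Nat.pow_le_pow_left hD k
  have hEk : 3 ≤ E * k := by nlinarith
  have hEk' : E * 3 ≤ E * k := Nat.mul_le_mul_left _ hk
  have h1 : 2 * n * (2 ^ E + 1) ^ k ≤ n * 2 ^ (4 * (E * k)) := by
    calc 2 * n * (2 ^ E + 1) ^ k ≤ 2 * n * 2 ^ (2 * E * k) := Nat.mul_le_mul_left _ hDk
      _ = n * 2 ^ (2 * (E * k) + 1) := by ring
      _ ≤ _ := Nat.mul_le_mul_left _ (Nat.pow_le_pow_right (by norm_num) (by omega))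
  have h2 : 2 * ((2 ^ E + 1) ^ k * (2 ^ E + 1)) ≤ 2 ^ (4 * (E * k)) := by
    calc _ ≤ 2 * (2 ^ (2 * E * k) * 2 ^ (2 * E)) :=
          Nat.mul_le_mul_left _ (Nat.mul_le_mul hDk hD)
      _ = 2 ^ (2 * (E * k) + 2 * E + 1) := by ring
      _ ≤ _ := Nat.pow_le_pow_right (by norm_num) (by omega)
  calc _ ≤ (n * 2 ^ (4 * (E * k))) ^ heavyTypes k * (2 ^ (4 * (E * k))) ^ lightTypes k m :=
        Nat.mul_le_mul (Nat.pow_le_pow_left h1 _) (Nat.pow_le_pow_left h2 _)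
    _ = _ := by
        rw [mul_pow, mul_assoc, ← pow_add, ← pow_mul]
        congr 2
        ring

/-- Every entry is a power of two with exponent at most 8·W·n^(k+1). So a number has O(W n^(k+1))
bits, and the bit cost of an operation is negligible beside the number of codes. -/
theorem memoryBound_le (hn : 2 ≤ n) (hk : 3 ≤ k) (hm : 1 ≤ m) :
    RAM.memoryBound n k m ≤ 15 * 2 ^ (8 * workSize k m * n ^ (k + 1)) := by
  have hl := paramSize_pos hk hm
  have hT := codeCount_le (n := n) hk hm
  have hW : workSize k m = k * paramSize k m * 8 ^ (k + 5) * k *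
    (heavyTypes k + lightTypes k m) := rfl
  have hlm : k * m < 2 ^ paramSize k m := Nat.lt_size_self _
  unfold RAM.memoryBound
  rw [gridDenom] at hT ⊢
  set E := k * paramSize k m * 8 ^ (k + 5) with hE
  have hH0 : 0 < heavyTypes k := Nat.mul_pos (by omega) (by omega)
  have hH := heavyTypes_le hk
  set M₁ := heavyTypes k
  set M₂ := lightTypes k m
  set W := workSize k m
  have h8 : 8 ^ (k + 5) ≤ E := Nat.le_mul_of_pos_left _ (by positivity)
  have hlE : paramSize k m ≤ E :=
    (Nat.le_mul_of_pos_left _ (by omega)).trans (Nat.le_mul_of_pos_right _ (by positivity))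
  have h85 : 8 ^ 5 ≤ E := (Nat.pow_le_pow_right (by norm_num) (by omega)).trans h8
  have hk8 : k + 5 < 8 ^ (k + 5) := Nat.lt_pow_self (by norm_num)
  have hEW : E ≤ W := by
    rw [hW, mul_assoc]
    exact Nat.le_mul_of_pos_right _ (Nat.mul_pos (by omega) (by omega))
  have hMW : M₁ + M₂ ≤ W := by
    rw [hW]
    exact Nat.le_mul_of_pos_left _ (by positivity)
  set Q := n ^ (k + 1) with hQ
  have hnQ : n ≤ Q := Nat.le_self_pow (by omega) _
  have hnkQ : n * n ^ k = Q := by rw [hQ, pow_succ']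
  have hnkQ' : n ^ k ≤ Q := Nat.pow_le_pow_right (by omega) (by omega)
  have hWQ : W ≤ W * Q := Nat.le_mul_of_pos_right _ (by positivity)
  have hQW : Q ≤ W * Q := Nat.le_mul_of_pos_left _ (by omega)
  have hnW : E * n ≤ W * Q := Nat.mul_le_mul hEW hnQ
  have hEQ : E * Q ≤ W * Q := Nat.mul_le_mul_right _ hEW
  have key : ∀ x y, x ≤ 2 ^ y → y ≤ 8 * (W * Q) → x ≤ 2 ^ (8 * W * Q) := fun x y h1 h2 =>
    h1.trans (Nat.pow_le_pow_right (by norm_num) (by rw [mul_assoc]; exact h2))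
  have key' : ∀ x, x ≤ 8 * (W * Q) → x ≤ 2 ^ (8 * W * Q) := fun x h =>
    key x x Nat.lt_two_pow_self.le h
  have hY : (2 ^ E) ^ (n - 1) + 1 ≤ 2 ^ (E * n) := by
    have e : (2 ^ E) ^ (n - 1) * 2 ^ E = 2 ^ (E * n) := by
      rw [← pow_succ, Nat.sub_add_cancel (by omega), pow_mul 2 E]
    have h1 : 1 ≤ (2 ^ E) ^ (n - 1) := Nat.one_le_pow _ _ (by positivity)
    have h2 : 2 ≤ 2 ^ E := Nat.le_self_pow (by omega) _
    calc (2 ^ E) ^ (n - 1) + 1 ≤ (2 ^ E) ^ (n - 1) * 2 := by omega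
      _ ≤ (2 ^ E) ^ (n - 1) * 2 ^ E := Nat.mul_le_mul_left _ h2
      _ = _ := e
  have hYp : ∀ x, ((2 ^ E) ^ (n - 1) + 1) ^ x ≤ 2 ^ (E * n * x) := fun x => by
    rw [pow_mul 2 (E * n)]
    exact Nat.pow_le_pow_left hY x
  have hkm : 4 * m + 1 ≤ 2 ^ (E + 3) := by
    have h1 : m ≤ k * m := Nat.le_mul_of_pos_left _ (by omega)
    have h2 : 2 ^ paramSize k m ≤ 2 ^ E := Nat.pow_le_pow_right (by norm_num) hlE
    rw [pow_add]
    omega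
  have hprev : n ^ (k - 1) * n = n ^ k := by rw [← pow_succ, Nat.sub_add_cancel (by omega)]
  have hall : ∀ x ∈ [2, (2 ^ E * ((2 ^ E) ^ (n - 1) + 1) ^ n ^ (k - 1)) ^ (n - 1), n * n * k,
      n * k * n ^ k, ((2 ^ E) ^ (n - 1) + 1) ^ n ^ k,
      n ^ k * (((2 ^ E) ^ (n - 1) + 1) * (4 * m + 1)), k * m, 8 ^ (k + 5), M₂, M₁, 2 ^ E,
      RAM.codeCount n k (2 ^ E) M₁ M₂, n ^ k, (4 * m + 1) * (2 ^ E) ^ (n - 1) + 1,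
      ((2 ^ E) ^ (n - 1) + 1) ^ n ^ (k - 1)], x ≤ 2 ^ (8 * W * Q) := by
    simp only [List.forall_mem_cons, List.not_mem_nil, false_imp_iff, implies_true, and_true]
    refine ⟨?_, ?_, ?_, ?_, ?_, ?_, ?_, ?_, ?_, ?_, ?_, ?_, ?_, ?_, ?_⟩
    · exact key' _ (by omega)
    · refine key _ ((E + E * n * n ^ (k - 1)) * n) ?_ ?_
      · calc _ ≤ (2 ^ E * 2 ^ (E * n * n ^ (k - 1))) ^ (n - 1) :=
              Nat.pow_le_pow_left (Nat.mul_le_mul_left _ (hYp _)) _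
          _ = 2 ^ ((E + E * n * n ^ (k - 1)) * (n - 1)) := by rw [← pow_add, ← pow_mul]
          _ ≤ _ := Nat.pow_le_pow_right (by norm_num) (Nat.mul_le_mul_left _ (by omega))
      · have e : (E + E * n * n ^ (k - 1)) * n = E * n + E * (n * (n ^ (k - 1) * n)) := by ring
        rw [e, hprev, hnkQ]
        omega
    · refine key' _ ?_
      calc n * n * k ≤ n * n ^ k * k := Nat.mul_le_mul_right _
            (Nat.mul_le_mul_left _ (Nat.le_self_pow (by omega) _))
        _ = k * Q := by rw [hnkQ, mul_comm]
        _ ≤ W * Q := Nat.mul_le_mul_right _ (by omega)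
        _ ≤ _ := by omega
    · refine key' _ ?_
      calc n * k * n ^ k = k * (n * n ^ k) := by ring
        _ = k * Q := by rw [hnkQ]
        _ ≤ W * Q := Nat.mul_le_mul_right _ (by omega)
        _ ≤ _ := by omega
    · refine key _ _ (hYp _) ?_
      rw [mul_assoc, hnkQ]
      omega
    · refine key _ (Q + (E * n + (E + 3))) ?_ (by omega)
      calc _ ≤ 2 ^ Q * (2 ^ (E * n) * 2 ^ (E + 3)) :=
            Nat.mul_le_mul (hnkQ'.trans Nat.lt_two_pow_self.le) (Nat.mul_le_mul hY hkm)
        _ = _ := by rw [← pow_add, ← pow_add]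
    · exact key _ _ hlm.le (by omega)
    · exact key' _ (by omega)
    · exact key' _ (by omega)
    · exact key' _ (by omega)
    · exact key _ _ le_rfl (by omega)
    · refine key _ (n * M₁ + 4 * W) ?_ ?_
      · refine hT.trans ?_
        rw [pow_add, pow_mul 2 n]
        exact Nat.mul_le_mul_right _ (Nat.pow_le_pow_left Nat.lt_two_pow_self.le _)
      · have : n * M₁ ≤ Q * W := Nat.mul_le_mul hnQ (by omega)
        rw [mul_comm Q W] at this
        omega
    · exact key' _ (by omega)
    · refine key _ (E * n + (E + 3) + 1) ?_ (by omega)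
      have h1 : (4 * m + 1) * (2 ^ E) ^ (n - 1) ≤ 2 ^ (E + 3) * 2 ^ (E * n) :=
        Nat.mul_le_mul hkm (by omega)
      have h2 : 1 ≤ 2 ^ (E + 3) * 2 ^ (E * n) := Nat.mul_pos (by positivity) (by positivity)
      calc _ ≤ 2 ^ (E + 3) * 2 ^ (E * n) * 2 := by omega
        _ = _ := by ring
    · refine key _ _ (hYp _) ?_
      have e : E * n * n ^ (k - 1) = E * (n ^ (k - 1) * n) := by ring
      rw [e, hprev]
      have : E * n ^ k ≤ W * Q := Nat.mul_le_mul hEW hnkQ'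
      omega
  exact (List.sum_le_card_nsmul _ _ hall).trans_eq (by simp)

end RunningTime

/-! ### Comparison with the stated time bound -/

section TimeBound

variable {n k m : ℕ}

theorem le_workSize (hk : 3 ≤ k) (hm : 1 ≤ m) :
    k * paramSize k m * 8 ^ (k + 5) ≤ workSize k m ∧ heavyTypes k + lightTypes k m ≤ workSize k m ∧
      k ≤ workSize k m := by
  have hl := paramSize_pos hk hm
  have hH0 : 0 < heavyTypes k := Nat.mul_pos (by omega) (by omega)
  have h1 : k * paramSize k m * 8 ^ (k + 5) ≤ workSize k m := by
    rw [workSize, mul_assoc (k * paramSize k m * 8 ^ (k + 5))]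
    exact Nat.le_mul_of_pos_right _ (Nat.mul_pos (by omega) (by omega))
  refine ⟨h1, Nat.le_mul_of_pos_left _ (by positivity), le_trans ?_ h1⟩
  rw [mul_assoc]
  exact Nat.le_mul_of_pos_right _ (by positivity)

theorem unitCost_memoryBound_le (hn : 2 ≤ n) (hk : 3 ≤ k) (hm : 1 ≤ m) :
    RAM.unitCost (RAM.memoryBound n k m) ≤ 37 * (workSize k m * n ^ (k + 1)) := by
  have hB := memoryBound_le hn hk hm
  have hW := (le_workSize hk hm).2.2
  have hQ : 0 < n ^ (k + 1) := by positivity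
  have hWQ : 1 ≤ workSize k m * n ^ (k + 1) := Nat.mul_pos (by omega) hQ
  have hsize : (RAM.memoryBound n k m).size ≤ 8 * workSize k m * n ^ (k + 1) + 4 := by
    refine Nat.size_le.mpr (hB.trans_lt ?_)
    rw [pow_add _ _ 4, mul_comm]
    exact Nat.mul_lt_mul_of_pos_left (show 15 < 2 ^ 4 by norm_num) (by positivity)
  rw [mul_assoc] at hsize
  rw [RAM.unitCost]
  omega

theorem stepBound_le (hn : 2 ≤ n) (hk : 3 ≤ k) (hm : 1 ≤ m) :
    RAM.stepBound n k m ≤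
      1500 * (workSize k m * (k * n ^ (k + 1)) * (RAM.searchCount n k m + 1)) := by
  obtain ⟨hE, hM, hkW⟩ := le_workSize hk hm
  rw [RAM.stepBound]
  set T := RAM.searchCount n k m
  set W := workSize k m
  have hnS : n ≤ n ^ k := Nat.le_self_pow (by omega) _
  rw [pow_succ' n k]
  set S := n ^ k
  have hS1 : 1 ≤ S := by omega
  set P := W * (k * (n * S)) * (T + 1) with hP
  have hV : k * (n * S) * (T + 1) ≤ P := by
    rw [hP, mul_assoc W]
    exact Nat.le_mul_of_pos_left _ (by omega)
  have hV1 : k * (n * S) ≤ k * (n * S) * (T + 1) := Nat.le_mul_of_pos_right _ (Nat.succ_pos _)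
  have hkS : k * S ≤ k * (n * S) := Nat.mul_le_mul_left _ (Nat.le_mul_of_pos_left _ (by omega))
  have hnV : n * S ≤ k * (n * S) := Nat.le_mul_of_pos_left _ (by omega)
  have hnS' : n ≤ n * S := Nat.le_mul_of_pos_right _ hS1
  have hkk : k ≤ k * S := Nat.le_mul_of_pos_right _ hS1
  have hWP : W ≤ P := by
    rw [hP, mul_assoc]
    exact Nat.le_mul_of_pos_right _ (by positivity)
  have hsub : n - 1 ≤ S := by omega
  have hI : (80 * k + 140) * (n - 1) + (50 * S + 50) * k + 90 ≤ 260 * (k * S) := by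
    have h1 : (80 * k + 140) * (n - 1) ≤ (80 * k + 47 * k) * S := Nat.mul_le_mul (by omega) hsub
    have h2 : (80 * k + 47 * k) * S = 127 * (k * S) := by ring
    have h3 : (50 * S + 50) * k = 50 * (k * S) + 50 * k := by ring
    omega
  have h1 : (((80 * k + 140) * (n - 1) + (50 * S + 50) * k + 90) * T + 40) * n ≤
      260 * (k * (n * S) * (T + 1)) + 40 * n := by
    calc _ ≤ (260 * (k * S) * T + 40) * n := by gcongr
      _ = 260 * (k * (n * S) * T) + 40 * n := by ring
      _ ≤ _ := by
        have : k * (n * S) * T ≤ k * (n * S) * (T + 1) := Nat.mul_le_mul_left _ (Nat.le_succ _)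
        omega
  have h2 : ((80 * k + 140) * (n - 1) + 40 * k + 100) * n ≤ 250 * (k * (n * S)) := by
    have h1 : (80 * k + 140) * (n - 1) ≤ (80 * k + 47 * k) * S := Nat.mul_le_mul (by omega) hsub
    calc _ ≤ (250 * (k * S)) * n := by
          refine Nat.mul_le_mul_right _ ?_
          have h2 : (80 * k + 47 * k) * S = 127 * (k * S) := by ring
          omega
      _ = _ := by ring
  have h3 : (14 * S + 50) * k = 14 * (k * S) + 50 * k := by ring
  omega

theorem stepBound_mul_unitCost_le (hn : 2 ≤ n) (hk : 3 ≤ k) (hm : 1 ≤ m) :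
    RAM.stepBound n k m * RAM.unitCost (RAM.memoryBound n k m) ≤
      2 ^ 16 * workSize k m ^ 3 * n ^ (2 * k + 2) * (RAM.searchCount n k m + 1) := by
  have hkW := (le_workSize hk hm).2.2
  refine (Nat.mul_le_mul (stepBound_le hn hk hm) (unitCost_memoryBound_le hn hk hm)).trans ?_
  set W := workSize k m
  set T := RAM.searchCount n k m
  calc 1500 * (W * (k * n ^ (k + 1)) * (T + 1)) * (37 * (W * n ^ (k + 1)))
      = 55500 * (W * k * W) * n ^ (2 * k + 2) * (T + 1) := by ring
    _ ≤ 2 ^ 16 * (W * W * W) * n ^ (2 * k + 2) * (T + 1) := by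
        gcongr
        norm_num
    _ = _ := by ring

theorem stepBound_mul_unitCost_le_of_two_le (hn : 2 ≤ n) (hk : 3 ≤ k) (hm : 2 ≤ m) :
    RAM.stepBound n k m * RAM.unitCost (RAM.memoryBound n k m) ≤
      n ^ (5 * k ^ 3) * 2 ^ (7 * workSize k m) := by
  refine (stepBound_mul_unitCost_le hn hk (by omega)).trans ?_
  have hT := codeCount_le (n := n) (m := m) hk (by omega)
  have hcount : RAM.searchCount n k m + 1 ≤ 2 * (n ^ heavyTypes k * 2 ^ (4 * workSize k m)) := by
    have h1 : 1 ≤ n ^ heavyTypes k * 2 ^ (4 * workSize k m) :=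
      Nat.mul_pos (by positivity) (by positivity)
    rw [RAM.searchCount, show 1 - (2 - m) = 1 by omega, one_mul]
    omega
  set W := workSize k m
  have hW : W ^ 3 ≤ 2 ^ (3 * W) := by
    rw [mul_comm, pow_mul]
    exact Nat.pow_le_pow_left Nat.lt_two_pow_self.le 3
  have hk3 : 9 * k ≤ k ^ 3 := by
    rw [pow_succ]
    exact Nat.mul_le_mul_right _ (Nat.pow_le_pow_left hk 2)
  have hH := heavyTypes_le hk
  calc 2 ^ 16 * W ^ 3 * n ^ (2 * k + 2) * (RAM.searchCount n k m + 1)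
      ≤ 2 ^ 16 * 2 ^ (3 * W) * n ^ (2 * k + 2) * (2 * (n ^ heavyTypes k * 2 ^ (4 * W))) := by gcongr
    _ = 2 ^ 17 * n ^ (2 * k + 2 + heavyTypes k) * 2 ^ (7 * W) := by ring
    _ ≤ n ^ 17 * n ^ (2 * k + 2 + heavyTypes k) * 2 ^ (7 * W) := by gcongr
    _ = n ^ (17 + (2 * k + 2 + heavyTypes k)) * 2 ^ (7 * W) := by rw [← pow_add]
    _ ≤ n ^ (5 * k ^ 3) * 2 ^ (7 * W) :=
        Nat.mul_le_mul_right _ (Nat.pow_le_pow_right (by omega) (by omega))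

/-- Without a search only the preparation and the output remain. Their cost involves W³ with W ≤
2^(13k³), and powers of 2 are bounded by powers of n. -/
theorem stepBound_mul_unitCost_le_of_one (hn : 2 ≤ n) (hk : 3 ≤ k) :
    RAM.stepBound n k 1 * RAM.unitCost (RAM.memoryBound n k 1) ≤ n ^ (50 * k ^ 3) := by
  refine (stepBound_mul_unitCost_le hn hk le_rfl).trans ?_
  have hW := workSize_le (m := 1) hk le_rfl
  have hl : paramSize k 1 ≤ k := by
    rw [paramSize, mul_one]
    exact RAM.size_le_self k
  have hw : momentRatio k 1 ≤ 2 * k := by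
    rw [momentRatio]
    have := Nat.div_le_self (paramSize k 1) (paramSize k 1).size
    omega
  have hk2 : k ≤ 2 ^ (k - 1) := by
    have := Nat.lt_two_pow_self (n := k - 1)
    omega
  have hk3 : 9 * k ≤ k ^ 3 := by
    rw [pow_succ]
    exact Nat.mul_le_mul_right _ (Nat.pow_le_pow_left hk 2)
  have hk32 : 3 * k ^ 2 ≤ k ^ 3 := by nlinarith [sq_nonneg k]
  have hWle : workSize k 1 ≤ 2 ^ (13 * k ^ 3) := by
    calc workSize k 1 ≤ 2 ^ (k - 1) * (2 ^ 25 * k ^ 3 * (2 * k)) ^ (k - 1) := by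
          refine hW.trans (Nat.mul_le_mul (hl.trans hk2) (Nat.pow_le_pow_left ?_ _))
          exact Nat.mul_le_mul_left _ hw
      _ = (2 ^ 27 * k ^ 4) ^ (k - 1) := by
          rw [← mul_pow]
          ring
      _ ≤ (2 ^ 27 * (2 ^ k) ^ 4) ^ (k - 1) := by
          gcongr
          exact Nat.lt_two_pow_self.le
      _ = 2 ^ ((27 + k * 4) * (k - 1)) := by rw [← pow_mul, ← pow_add, ← pow_mul]
      _ ≤ 2 ^ (13 * k ^ 3) := by
          refine Nat.pow_le_pow_right (by norm_num) ?_
          calc (27 + k * 4) * (k - 1) ≤ (13 * k) * k := Nat.mul_le_mul (by omega) (by omega)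
            _ = 13 * k ^ 2 := by ring
            _ ≤ 13 * k ^ 3 := by omega
  have hT : RAM.searchCount n k 1 = 0 := by simp [RAM.searchCount]
  calc 2 ^ 16 * workSize k 1 ^ 3 * n ^ (2 * k + 2) * (RAM.searchCount n k 1 + 1)
      ≤ n ^ 16 * (n ^ (13 * k ^ 3)) ^ 3 * n ^ (2 * k + 2) * (0 + 1) := by
        rw [hT]
        gcongr
        exact hWle.trans (Nat.pow_le_pow_left hn _)
    _ = n ^ (16 + 13 * k ^ 3 * 3 + (2 * k + 2)) := by
        rw [zero_add, mul_one, ← pow_mul, ← pow_add, ← pow_add]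
    _ ≤ n ^ (50 * k ^ 3) := Nat.pow_le_pow_right (by omega) (by omega)

/-- With L = log(k/ε), the bit length l of km lies between L and 5L, and the bit length of l is at
least log L. So l divided by its bit length is at most 5L/log L, and the single factor l turns into
the factor log(k/ε) that raises k/ε to a power. -/
theorem workSize_le_log {ε : ℝ} (hk : 3 ≤ k) (hε : 0 < ε) (hε1 : ε < 1)
    (hkε : Real.exp 1 * ε < k) :
    7 * Real.log 2 * workSize k ⌈1 / ε⌉₊ ≤ Real.log (k / ε) *
      ((2 ^ 32 : ℕ) * (k : ℝ) ^ 3 * Real.log (k / ε) / Real.log (Real.log (k / ε))) ^ (k - 1) := by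
  set m := ⌈1 / ε⌉₊ with hmdef
  have hkR : (3 : ℝ) ≤ k := by exact_mod_cast hk
  have hm1 : 1 / ε ≤ m := Nat.le_ceil _
  have h1ε : 1 ≤ 1 / ε := by rw [le_div_iff₀ hε]; linarith
  have hm2 : (m : ℝ) ≤ 2 * (1 / ε) := by
    have := Nat.ceil_lt_add_one (a := 1 / ε) (by positivity)
    linarith
  have hm : 1 ≤ m := by exact_mod_cast h1ε.trans hm1
  have hl := paramSize_pos (m := m) hk hm
  have hW := workSize_le (m := m) hk hm
  set L := Real.log (k / ε) with hL
  have hkε0 : 0 < (k : ℝ) / ε := by positivity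
  have hL1 : 1 < L := by
    rw [hL, Real.lt_log_iff_exp_lt hkε0, lt_div_iff₀ hε]
    exact hkε
  set l := paramSize k m with hldef
  set b := l.size with hb
  have hlogL : 0 < Real.log L := Real.log_pos hL1
  have hlog2 : Real.log 2 < 0.7 := by linarith [Real.log_two_lt_d9]
  have hlog2' : 0.6 < Real.log 2 := by linarith [Real.log_two_gt_d9]
  have hupper : (l : ℝ) ≤ 5 * L := by
    have h1 : 2 ^ (l - 1) ≤ k * m := Nat.lt_size.mp (show l - 1 < l by omega)
    have h2 : (2 : ℝ) ^ (l - 1) ≤ 2 * (k / ε) := by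
      calc (2 : ℝ) ^ (l - 1) ≤ (k : ℝ) * m := by exact_mod_cast h1
        _ ≤ k * (2 * (1 / ε)) := by gcongr
        _ = 2 * (k / ε) := by ring
    have h3 := Real.log_le_log (by positivity) h2
    rw [Real.log_pow, Real.log_mul (by norm_num) hkε0.ne', ← hL, Nat.cast_sub hl] at h3
    push_cast at h3
    nlinarith
  have hlower : L < l := by
    have h1 : k * m < 2 ^ l := Nat.lt_size_self _
    have h2 : (k : ℝ) / ε < 2 ^ l := by
      calc (k : ℝ) / ε = k * (1 / ε) := by ring
        _ ≤ k * m := by gcongr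
        _ < 2 ^ l := by exact_mod_cast h1
    have h3 := Real.log_lt_log hkε0 h2
    rw [Real.log_pow, ← hL] at h3
    have : (0 : ℝ) < l := by exact_mod_cast hl
    nlinarith
  have hb1 : Real.log L ≤ b := by
    have h1 : l < 2 ^ b := Nat.lt_size_self _
    have h2 : L < 2 ^ b := hlower.trans (by exact_mod_cast h1)
    have h3 := Real.log_lt_log (by linarith) h2
    rw [Real.log_pow] at h3
    have : (0 : ℝ) ≤ b := Nat.cast_nonneg _
    nlinarith
  have hw : (momentRatio k m : ℝ) ≤ 6 * (L / Real.log L) := by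
    have h1 : ((l / b : ℕ) : ℝ) ≤ 5 * (L / Real.log L) := by
      refine Nat.cast_div_le.trans ?_
      calc (l : ℝ) / b ≤ 5 * L / Real.log L := div_le_div₀ (by linarith) hupper hlogL hb1
        _ = _ := by ring
    have h2 : 1 ≤ L / Real.log L := by
      rw [le_div_iff₀ hlogL]
      linarith [Real.log_le_sub_one_of_pos (show 0 < L by linarith)]
    rw [momentRatio]
    push_cast
    linarith
  have hWR : (workSize k m : ℝ) ≤ 5 * L * (2 ^ 25 * k ^ 3 * (6 * (L / Real.log L))) ^ (k - 1) := by
    calc (workSize k m : ℝ) ≤ l * (2 ^ 25 * k ^ 3 * momentRatio k m) ^ (k - 1) := by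
          exact_mod_cast hW
      _ ≤ _ := by gcongr
  -- The constants 7·log 2 ≤ 5 and 5 from the bound l ≤ 5L are moved into the power k - 1.
  have h16 : (25 : ℝ) ≤ 5 ^ (k - 1) := by
    calc (25 : ℝ) = 5 ^ 2 := by norm_num
      _ ≤ 5 ^ (k - 1) := pow_le_pow_right₀ (by norm_num) (by omega)
  have hratio : 0 < L / Real.log L := by positivity
  calc 7 * Real.log 2 * workSize k m
      ≤ 5 * (5 * L * (2 ^ 25 * k ^ 3 * (6 * (L / Real.log L))) ^ (k - 1)) := by
        refine mul_le_mul (by linarith) hWR (by positivity) (by norm_num)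
    _ = L * (25 * (2 ^ 25 * k ^ 3 * (6 * (L / Real.log L))) ^ (k - 1)) := by ring
    _ ≤ L * (5 ^ (k - 1) * (2 ^ 25 * k ^ 3 * (6 * (L / Real.log L))) ^ (k - 1)) := by gcongr
    _ = L * (30 * 2 ^ 25 * (k ^ 3 * (L / Real.log L))) ^ (k - 1) := by
        rw [← mul_pow]
        congr 2
        ring
    _ ≤ L * ((2 ^ 32 : ℕ) * (k : ℝ) ^ 3 * L / Real.log L) ^ (k - 1) := by
        refine mul_le_mul_of_nonneg_left (pow_le_pow_left₀ (by positivity) ?_ _) (by linarith)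
        have e : ((2 ^ 32 : ℕ) * (k : ℝ) ^ 3 * L / Real.log L) =
            (2 ^ 32 : ℕ) * (k ^ 3 * (L / Real.log L)) := by ring
        rw [e]
        refine mul_le_mul_of_nonneg_right ?_ (mul_nonneg (by positivity) hratio.le)
        norm_num

theorem cast_stepBound_mul_unitCost_le {ε : ℝ} (hn : 2 ≤ n) (hk : 3 ≤ k) (hε : 0 < ε)
    (hkε : Real.exp 1 * ε < k) :
    ((RAM.stepBound n k ⌈1 / ε⌉₊ * RAM.unitCost (RAM.memoryBound n k ⌈1 / ε⌉₊) : ℕ) : ℝ) ≤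
      timeBound (2 ^ 32) n k ε := by
  have hkR : (3 : ℝ) ≤ k := by exact_mod_cast hk
  have hkε0 : 0 < (k : ℝ) / ε := by positivity
  have hkε1 : Real.exp 1 < k / ε := by
    rw [lt_div_iff₀ hε]
    exact hkε
  have h1n : (1 : ℝ) ≤ n := by exact_mod_cast (by omega : 1 ≤ n)
  have hpow : ∀ c ≤ 2 ^ 32, (n : ℝ) ^ (c * k ^ 3) ≤ (n : ℝ) ^ (2 ^ 32 * k ^ 3) := fun c hc =>
    pow_le_pow_right₀ h1n (Nat.mul_le_mul_right _ hc)
  rw [timeBound]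
  by_cases hε1 : ε < 1
  · have hm : 2 ≤ ⌈1 / ε⌉₊ := by
      refine Nat.lt_ceil.mpr ?_
      rw [Nat.cast_one, lt_div_iff₀ hε]
      linarith
    have h := workSize_le_log hk hε hε1 hkε
    calc _ ≤ ((n ^ (5 * k ^ 3) * 2 ^ (7 * workSize k ⌈1 / ε⌉₊) : ℕ) : ℝ) := by
          exact_mod_cast stepBound_mul_unitCost_le_of_two_le hn hk hm
      _ = (n : ℝ) ^ (5 * k ^ 3) * 2 ^ (7 * workSize k ⌈1 / ε⌉₊) := by push_cast; rfl
      _ ≤ _ := by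
          refine mul_le_mul (hpow 5 (by norm_num)) ?_ (by positivity) (by positivity)
          rw [Real.rpow_def_of_pos hkε0, ← Real.log_le_iff_le_exp (by positivity), Real.log_pow]
          push_cast at h ⊢
          linarith
  -- For ε ≥ 1 the first factor of the time bound is already enough; the second is at least 1
  -- because k/ε > e.
  · have hm : ⌈1 / ε⌉₊ = 1 := by
      refine le_antisymm (Nat.ceil_le.mpr ?_) (Nat.ceil_pos.mpr (by positivity))
      rw [Nat.cast_one, div_le_one hε]
      linarith
    have h1 : (1 : ℝ) ≤ k / ε := by
      have := Real.add_one_le_exp (1 : ℝ)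
      linarith
    have hL : 1 < Real.log (k / ε) := (Real.lt_log_iff_exp_lt hkε0).mpr hkε1
    have hlogL := Real.log_pos hL
    rw [hm]
    calc _ ≤ ((n ^ (50 * k ^ 3) : ℕ) : ℝ) := by exact_mod_cast stepBound_mul_unitCost_le_of_one hn hk
      _ = (n : ℝ) ^ (50 * k ^ 3) := by push_cast; rfl
      _ ≤ (n : ℝ) ^ (2 ^ 32 * k ^ 3) := hpow 50 (by norm_num)
      _ ≤ _ := le_mul_of_one_le_right (by positivity) (Real.one_le_rpow h1 (by positivity))

end TimeBound

/-! ### Correctness of the output -/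

section Main

namespace AnonymousGame

variable {n k : ℕ} (G : AnonymousGame n k)

theorem bestPayoff_mem_Icc (hk : 0 < k) (i : Fin n) (p : Fin (n - 1) → Fin k → ℝ)
    (hp : ∀ j, p j ∈ stdSimplex ℝ (Fin k)) : G.bestPayoff i (pmdMass p) ∈ Set.Icc (0 : ℝ) 1 := by
  have : Nonempty (Fin k) := ⟨⟨0, hk⟩⟩
  have hterm : ∀ ℓ, ∑ x : Partitions (n - 1) k, pmdMass p x * G.payoff i ℓ x ∈
      Set.Icc (0 : ℝ) 1 := by
    intro ℓ
    rw [sum_partitions_eq_pmdExp, pmdExp]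
    have h0 : ∀ s : Fin (n - 1) → Fin k, 0 ≤ ∏ j, p j (s j) := fun s =>
      Finset.prod_nonneg fun j _ => (hp j).1 _
    have hf : ∀ s : Fin (n - 1) → Fin k, G.payoff i ℓ ⟨_, sum_single_mem_partitions s⟩ ∈
      Set.Icc (0 : ℝ) 1 := fun s => G.payoff_mem i ℓ _
    simp only [sum_single_mem_partitions, dif_pos]
    refine ⟨Finset.sum_nonneg fun s _ => mul_nonneg (h0 s) (hf s).1, ?_⟩
    rw [← sum_prod_eq_one p fun j => (hp j).2]
    exact Finset.sum_le_sum fun s _ => mul_le_of_le_one_right (h0 s) (hf s).2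
  exact ⟨Real.iSup_nonneg fun ℓ => (hterm ℓ).1, ciSup_le fun ℓ => (hterm ℓ).2⟩

theorem threatPoint_le (hk : 0 < k) (i : Fin n) (p : Fin (n - 1) → Fin k → ℝ)
    (hp : ∀ j, p j ∈ stdSimplex ℝ (Fin k)) : G.threatPoint i ≤ G.bestPayoff i (pmdMass p) :=
  (G.isLeast_threatPoint hk i).2 ⟨_, ⟨p, hp, rfl⟩, rfl⟩

theorem threatPoint_mem_Icc (hk : 0 < k) (i : Fin n) : G.threatPoint i ∈ Set.Icc (0 : ℝ) 1 := by
  obtain ⟨P, ⟨p, hp, rfl⟩, h⟩ := (G.isLeast_threatPoint hk i).1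
  rw [← h]
  exact G.bestPayoff_mem_Icc hk i p hp

/-- Some code gives an almost optimal profile. -/
theorem exists_code_bestPayoff_le {m : ℕ} (hn : 2 ≤ n) (hk : 3 ≤ k) (hm : 2 ≤ m) (i : Fin n) :
    ∃ c < RAM.searchCount n k m, G.bestPayoff i
      (pmdMass (codeProfile n k (gridDenom k m) (n - 1) c)) ≤ G.threatPoint i + 1 / (4 * m) := by
  obtain ⟨P, ⟨p, hp, rfl⟩, h⟩ := (G.isLeast_threatPoint (by omega) i).1
  obtain ⟨d, E, hd, hE₁, hE₂, hE, hclose⟩ := exists_few_types_profile hk hm p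
    (fun j => (hp j).1) fun j => (hp j).2
  obtain ⟨c, hc, e, hce⟩ := exists_code_of_few_types (n := n) (by omega) (by omega) (by omega) d hd E
    hE₁ hE₂ hE
  refine ⟨c, by rwa [RAM.searchCount, show 1 - (2 - m) = 1 by omega, one_mul], ?_⟩
  have hprof : codeProfile n k (gridDenom k m) (n - 1) c =
      fun j => (fun i h => (d i h : ℝ) / gridDenom k m) (e j) := by
    funext j h
    simp only [codeProfile, hce]
  rw [hprof, pmdMass_comp_equiv e fun i h => (d i h : ℝ) / gridDenom k m]
  have := (abs_le.mp (G.abs_bestPayoff_sub_le (by omega) i hclose)).1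
  linarith

/-- The outcome of the search. -/
theorem search_result {m : ℕ} {ε : ℝ} (hn : 2 ≤ n) (hk : 3 ≤ k) (hm : 1 ≤ m) (hmε : 1 ≤ m * ε)
    (a : Fin n → Fin k → Partitions (n - 1) k → ℕ) {α : ℕ → ℕ}
    (ha : ∀ i ℓ x, |G.payoff i ℓ x - (a i ℓ x : ℝ) / (4 * m)| ≤ 1 / (4 * m))
    (hα : ∀ i ℓ (x : Partitions (n - 1) k), α (payoffIndex n k i ℓ x) = a i ℓ x)
    (hA : ∀ q, α q ≤ 4 * m + 1) (i : Fin n) {b c : ℕ}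
    (hb : RAM.IsBest
      (RAM.codeVal n k (gridDenom k m) (n - 1) (gridDenom k m ^ (n - 1) + 1) (n ^ k) α i)
      ((1 - (2 - m)) * ((4 * m + 1) * gridDenom k m ^ (n - 1) + 1)) (RAM.searchCount n k m) b c) :
    |G.threatPoint i - (b : ℝ) / ((4 * m * gridDenom k m ^ (n - 1) : ℕ) : ℝ)| ≤ ε ∧
      G.bestPayoff i (pmdMass (codeProfile n k (gridDenom k m) (n - 1) c)) ≤
        G.threatPoint i + ε := by
  have hk0 : 0 < k := by omega
  have hD : 0 < gridDenom k m := by simp [gridDenom]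
  have hmem := G.threatPoint_mem_Icc hk0 i
  have hV := G.bestPayoff_mem_Icc hk0 i _ (codeProfile_mem_stdSimplex (n := n) hk0 hD c)
  have hmR : (0 : ℝ) < m := by exact_mod_cast hm
  rcases hm.eq_or_lt with rfl | hm2
  -- If m = 1 then ε ≥ 1. All values lie in [0, 1], so the value 0 and the profile with code 0 are
  -- good enough.
  · have hε : 1 ≤ ε := by simpa using hmε
    rcases hb.2 with ⟨h1, -⟩ | ⟨h1, -⟩
    · have hb0 : b = 0 := by simpa using h1
      rw [hb0, Nat.cast_zero, zero_div, sub_zero, abs_of_nonneg hmem.1]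
      exact ⟨hmem.2.trans hε, by linarith [hmem.1, hV.2]⟩
    · simp [RAM.searchCount] at h1
  · obtain ⟨c₀, hc₀, hle⟩ := G.exists_code_bestPayoff_le hn hk hm2 i
    have happ := abs_codeVal_sub_bestPayoff_le hn hk0 hD hm G a ha hα i
    -- The initial value is larger than every computed value, so b comes from a code that was
    -- examined.
    have hval : b = RAM.codeVal n k (gridDenom k m) (n - 1) (gridDenom k m ^ (n - 1) + 1) (n ^ k)
        α i c := by
      rcases hb.2 with ⟨h1, -⟩ | ⟨-, h1⟩
      · have h2 := codeVal_le (n := n) (D := gridDenom k m) (N := n - 1) (by omega) hk0 hA rfl rfl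
          i c₀
        have h3 := hb.1 c₀ hc₀
        rw [h1, show 1 - (2 - m) = 1 by omega, one_mul] at h3
        rw [mul_comm] at h2
        omega
      · exact h1
    set q : ℝ := 4 * m * (gridDenom k m : ℝ) ^ (n - 1) with hq
    have hq0 : 0 < q := by positivity
    have hle₀ : (b : ℝ) / q ≤ (RAM.codeVal n k (gridDenom k m) (n - 1)
        (gridDenom k m ^ (n - 1) + 1) (n ^ k) α i c₀ : ℝ) / q :=
      div_le_div_of_nonneg_right (by exact_mod_cast hb.1 c₀ hc₀) hq0.le
    have h0 := (abs_le.mp (happ c₀)).2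
    have h1 := abs_le.mp (happ c)
    rw [← hval] at h1
    have hθ := G.threatPoint_le hk0 i _ (codeProfile_mem_stdSimplex (n := n) hk0 hD c)
    -- The error budget in units of 1/(4m): one for approximating an optimal profile by a code, one
    -- for the rounded payoffs at that code, one for them at the code found. Three units are at most
    -- ε.
    have hε : 1 / (4 * (m : ℝ)) * 4 ≤ ε := by
      rw [div_mul_eq_mul_div, div_le_iff₀ (by positivity)]
      linarith
    have hm0 : 0 < 1 / (4 * (m : ℝ)) := by positivity
    push_cast
    rw [← hq]
    refine ⟨abs_le.mpr ⟨?_, ?_⟩, ?_⟩ <;> linarith [h1.1, h1.2]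

end AnonymousGame

/-- The opponents of player `i`, numbered as in the output. -/
theorem exists_opponentEquiv {n : ℕ} (i : Fin n) : ∃ e : {j : Fin n // j ≠ i} ≃ Fin (n - 1),
    ∀ j, (e j : ℕ) = RAM.opponentIndex (n - 1) i j := by
  have hlt : ∀ j : {j : Fin n // j ≠ i}, RAM.opponentIndex (n - 1) i j < n - 1 := by
    rintro ⟨j, hj⟩
    have h1 := j.2
    have h2 := i.2
    have h3 : (j : ℕ) ≠ i := fun h => hj (Fin.ext h)
    rw [RAM.opponentIndex]
    split_ifs <;> simp only at * <;> omega
  let f : {j : Fin n // j ≠ i} → Fin (n - 1) := fun j => ⟨_, hlt j⟩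
  have hinj : Function.Injective f := by
    rintro ⟨j, hj⟩ ⟨j', hj'⟩ h
    have h0 := congrArg Fin.val h
    have h1 := j.2
    have h2 := j'.2
    have h3 : (j : ℕ) ≠ i := fun h => hj (Fin.ext h)
    have h4 : (j' : ℕ) ≠ i := fun h => hj' (Fin.ext h)
    simp only [f, RAM.opponentIndex] at h0
    refine Subtype.ext (Fin.ext ?_)
    simp only
    split_ifs at h0 <;> omega
  have hcard : Fintype.card {j : Fin n // j ≠ i} = Fintype.card (Fin (n - 1)) := by
    rw [Fintype.card_subtype_compl]
    simp
  exact ⟨Equiv.ofBijective f ((Fintype.bijective_iff_injective_and_card f).mpr ⟨hinj, hcard⟩),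
    fun j => rfl⟩

theorem IsInput.bounded {n k m : ℕ} (hn : 2 ≤ n) (hk : 3 ≤ k) (hm : 1 ≤ m)
    {a : Fin n → Fin k → Partitions (n - 1) k → ℕ} {σ : RAM.State} (h : IsInput m a σ)
    (hA : ∀ q, σ.arr 0 q ≤ 4 * m + 1) : RAM.Bounded (RAM.memoryBound n k m) σ := by
  have hmem := fun x hx => List.le_sum_of_mem (x := x) (xs := [2, (gridDenom k m *
    (gridDenom k m ^ (n - 1) + 1) ^ n ^ (k - 1)) ^ (n - 1), n * n * k, n * k * n ^ k,
    (gridDenom k m ^ (n - 1) + 1) ^ n ^ k, n ^ k * ((gridDenom k m ^ (n - 1) + 1) * (4 * m + 1)),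
    k * m, 8 ^ (k + 5), lightTypes k m, heavyTypes k, gridDenom k m,
    RAM.codeCount n k (gridDenom k m) (heavyTypes k) (lightTypes k m), n ^ k,
    (4 * m + 1) * gridDenom k m ^ (n - 1) + 1, (gridDenom k m ^ (n - 1) + 1) ^ n ^ (k - 1)]) hx
  change ∀ x, _ → x ≤ RAM.memoryBound n k m at hmem
  have hD : 0 < gridDenom k m := by simp [gridDenom]
  have h1 : n * n * k ≤ RAM.memoryBound n k m := hmem _ (by simp)
  have h2 : k * m ≤ RAM.memoryBound n k m := hmem _ (by simp)
  have h3 : (4 * m + 1) * gridDenom k m ^ (n - 1) + 1 ≤ RAM.memoryBound n k m := hmem _ (by simp)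
  have hn1 : n ≤ n * n * k := by
    rw [mul_assoc]
    exact Nat.le_mul_of_pos_right _ (by positivity)
  have hk1 : k ≤ k * m := Nat.le_mul_of_pos_right _ (by omega)
  have hm1 : m ≤ k * m := Nat.le_mul_of_pos_left _ (by omega)
  have hA1 : 4 * m + 1 ≤ (4 * m + 1) * gridDenom k m ^ (n - 1) :=
    Nat.le_mul_of_pos_right _ (by positivity)
  refine ⟨fun r => ?_, fun b q => ?_⟩
  · rcases lt_or_ge r 3 with hr | hr
    · interval_cases r
      · rw [h.players]; omega
      · rw [h.strategies]; omega
      · rw [h.accuracy]; omega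
    · rw [h.reg_zero r hr]
      exact Nat.zero_le _
  · rcases Nat.eq_zero_or_pos b with rfl | hb
    · have := hA q
      omega
    · rw [h.arr_zero b q hb]
      exact Nat.zero_le _

end Main

theorem mainTheorem10 :
    ∃ (prog : RAM.Program) (C : ℕ), ∀ (n k : ℕ) (ε : ℝ), 2 ≤ n → 2 < k → 0 < ε →
      Real.exp 1 * ε < k → ∀ (G : AnonymousGame n k)
      (a : Fin n → Fin k → Partitions (n - 1) k → ℕ) (σ : RAM.State),
      (∀ i ℓ x, |G.payoff i ℓ x - (a i ℓ x : ℝ) / (4 * ⌈1 / ε⌉₊)| ≤ 1 / (4 * ⌈1 / ε⌉₊)) →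
      IsInput ⌈1 / ε⌉₊ a σ →
      ∃ (σ' : RAM.State) (t : ℕ), RAM.Exec prog σ σ' t ∧
        (t : ℝ) ≤ timeBound C n k ε ∧
        0 < σ'.reg 0 ∧ ‖G.threatPoint - outThreat n σ'‖ ≤ ε ∧
        (∀ i j, j ≠ i → outStrategy n k σ' i j ∈ stdSimplex ℝ (Fin k)) ∧
        (∀ i, G.bestPayoff i (pmdMass fun j : {j : Fin n // j ≠ i} => outStrategy n k σ' i j) ≤
          G.threatPoint i + ε) := by
  refine ⟨RAM.threatProg, 2 ^ 32, fun n k ε hn hk hε hkε G a σ ha hin => ?_⟩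
  have hceil : 1 / ε ≤ (⌈1 / ε⌉₊ : ℝ) := Nat.le_ceil _
  have hm : 1 ≤ ⌈1 / ε⌉₊ := Nat.ceil_pos.mpr (by positivity)
  have htime := cast_stepBound_mul_unitCost_le hn hk hε hkε
  set m := ⌈1 / ε⌉₊ with hmdef
  clear_value m
  have hmR : (0 : ℝ) < m := by exact_mod_cast hm
  have hmε : 1 ≤ m * ε := (div_le_iff₀ hε).mp hceil
  have hk0 : 0 < k := by omega
  have hD : 0 < gridDenom k m := by simp [gridDenom]
  -- A payoff is at most 1, so a table entry within 1/(4m) of it, in units of 1/(4m), is at most 4m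
  -- + 1; cells outside the table hold 0.
  have hA : ∀ q, σ.arr 0 q ≤ 4 * m + 1 := by
    intro q
    by_cases hq : ∃ i ℓ, ∃ x : Partitions (n - 1) k, q = payoffIndex n k i ℓ x
    · obtain ⟨i, ℓ, x, rfl⟩ := hq
      rw [hin.table]
      have h1 := (abs_le.mp (ha i ℓ x)).1
      have h2 := (G.payoff_mem i ℓ x).2
      have h3 : (a i ℓ x : ℝ) / (4 * m) ≤ 1 + 1 / (4 * m) := by linarith
      rw [div_le_iff₀ (by positivity), add_mul, one_mul, div_mul_cancel₀ _ (by positivity)] at h3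
      exact_mod_cast h3
    · push Not at hq
      rw [hin.table_zero q hq]
      exact Nat.zero_le _
  obtain ⟨σ', t, hexec, ht, -, c, hout⟩ := RAM.runs_threatProg (α := σ.arr 0) hn hk hm hin.players
    hin.strategies hin.accuracy (fun _ => rfl) hA (hin.bounded hn hk hm hA)
  have hres := fun i : Fin n => G.search_result hn hk hm hmε a ha hin.table hA i (hout.best i i.2)
  have hstrat : ∀ i j : Fin n, j ≠ i → ∀ j' : Fin (n - 1), (j' : ℕ) = RAM.opponentIndex (n - 1) i j →
      outStrategy n k σ' i j = codeProfile n k (gridDenom k m) (n - 1) (c i) j' := by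
    intro i j hji j' hj'
    funext h
    rw [outStrategy, hout.reg1, hout.rows i i.2 j j.2 (fun h => hji (Fin.ext h)) h h.2, codeProfile,
      codeRow, hj']
  refine ⟨σ', t, hexec, (Nat.cast_le.mpr ht).trans htime, ?_, ?_, fun i j hji => ?_, fun i => ?_⟩
  · rw [hout.reg0]
    positivity
  · refine (pi_norm_le_iff_of_nonneg hε.le).mpr fun i => ?_
    rw [Pi.sub_apply, Real.norm_eq_abs, outThreat, hout.reg0]
    exact (hres i).1
  · obtain ⟨e, he⟩ := exists_opponentEquiv i
    rw [hstrat i j hji (e ⟨j, hji⟩) (he _)]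
    exact codeProfile_mem_stdSimplex hk0 hD _ _
  · obtain ⟨e, he⟩ := exists_opponentEquiv i
    have hprof : (fun j : {j : Fin n // j ≠ i} => outStrategy n k σ' i j) =
        fun j => codeProfile n k (gridDenom k m) (n - 1) (c i) (e j) :=
      funext fun j => hstrat i j j.2 (e j) (he j)
    rw [hprof, pmdMass_comp_equiv e]
    exact (hres i).2
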